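/- **Setting.** Let $\Delta\subset\mathbb R^2$ be a convex quadrilateral with edges $F_1,\dots,F_4$, labeled by vectors $u=(u_1,\dots,u_4)$, where $u_i$ is inward normal to $F_i$. Let $dv=d\mu_1\wedge d\mu_2$, and let $d\nu$ be the measure on $\partial\Delta$ with $u_i\wedge d\nu=-dv$ on $F_i$. The *extremal affine function* $\zeta=\zeta_{(\Delta,u)}$ is the unique affine function with $\int_\Delta f\zeta\,dv=2\int_{\partial\Delta}f\,d\nu$ for all affine $f$. It is *equipoised* if $\sum_{i=1}^4(-1)^i\zeta(s_i)=0$, where $s_1,\dots,s_4$ are the vertices of $\Delta$ in cyclic order. For a function $\mathbf H=(H_{ij})$ with values in the symmetric $2\times2$ matrices, smooth on $\Delta$, consider $$(1)\quad \mathbf H_p(u_i,\cdot)=0,\quad d\mathbf H_p(u_i,u_i)=2u_i\quad\text{for } p \text{ in the interior of } F_i,\ i=1,\dots,4,$$ $$(3)\quad S(\mathbf H):=-\sum_{i,j}\frac{\partial^2H_{ij}}{\partial\mu_i\partial\mu_j}=\zeta .$$ Let $\mathcal S(\Delta,u)$ be the set of smooth strictly convex functions $G$ on the interior $\mathring\Delta$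 whose inverse Hessian extends to a function $\mathbf H$ smooth on $\Delta$, positive definite on the interior of every face $F$ (as a form on $\mathbb R^2$ modulo the span of the $u_i$ with $F\subset F_i$), and satisfying (1). Such a $G$ solves (3) if $\mathbf H$ does. Finally, $(\Delta,u)$ is *analytically relatively K-stable with respect to toric degenerations* if $\mathcal L(f)=\int_{\partial\Delta}f\,d\nu-\frac12\int_\Delta f\zeta\,dv$ is non-negative for every convex continuous piecewise affine function $f$ on $\Delta$, and zero for such an $f$ if and only if $f$ is affine on $\Delta$. **Theorem.** Let $(\Delta,u)$ be a labeled convex quadrilateral whose extremal affine function $\zeta$ is equipoised. Then there is an affine isomorphism $\varphi$ of $\mathbb R^2$ with $\varphi(\Delta)=\sigma([\alpha_1,\alpha_2]\times[\beta_1,\beta_2])$, where $\alpha_1<\alpha_2$, $\beta_1<\beta_2$, and $\sigma$ is one of the following maps: $\sigma(x,y)=(x,y)$; $\sigma(x,y)=(x,xy)$ with $\alpha_1>0$, $\beta_1\ge0$; $\sigma(x,y)=(x+y,xy)$ with $\beta_2<\alpha_1$. For every such $\varphi$, $\sigma$ and rectangle there are real polynomials $A(x)$, $B(y)$ of degree at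 most $4$ with the following properties. Let $\mathbf H_{A,B}$ be the function on $\Delta$ whose value at $\varphi^{-1}(\sigma(x,y))$ is $L^{-1}\mathbf M\,(L^{-1})^{T}$, where $L$ is the linear part of $\varphi$ and $\mathbf M$ is, in the three cases respectively, $$\begin{pmatrix}A(x)&0\\0&B(y)\end{pmatrix},\quad \frac1x\begin{pmatrix}A(x)&yA(x)\\yA(x)&x^2B(y)+y^2A(x)\end{pmatrix},\quad \frac1{x-y}\begin{pmatrix}A(x)+B(y)&yA(x)+xB(y)\\yA(x)+xB(y)&y^2A(x)+x^2B(y)\end{pmatrix}.$$ Then $\mathbf H_{A,B}$ is smooth on $\Delta$ and satisfies the boundary conditions (1) and the equation (3). Moreover, the following are equivalent: - $(\Delta,u)$ is analytically relatively K-stable with respect to toric degenerations; - $\mathbf H_{A,B}$ is the inverse Hessian of a solution $G_{A,B}\in\mathcal S(\Delta,u)$ of (3); - $\mathbf H_{A,B}$ is positive definite on $\mathring\Delta$; - $A>0$ on $(\alpha_1,\alpha_2)$ and $B>0$ on $(\beta_1,\beta_2)$. If $G\in\mathcal S(\Delta,u)$ is any solution of (3), then its inverse Hessian is $\mathbf H_{A,B}$,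 and the solutions of (3) in $\mathcal S(\Delta,u)$ are exactly the functions $G+a$ with $a$ affine. -/

import Mathlib

open scoped ContDiff Matrix
open MeasureTheory

noncomputable section

namespace ToricQuad

/-- The plane in which the moment polytope lives. -/
abbrev Plane := EuclideanSpace ℝ (Fin 2)

/-- The partial derivative of `f` with respect to the `i`-th coordinate. -/
def pd (i : Fin 2) (f : Plane → ℝ) (p : Plane) : ℝ :=
  fderiv ℝ f p (EuclideanSpace.single i 1)

/-- The value `H(v, w)` of the bilinear form with matrix `H`. -/
def form (H : Matrix (Fin 2) (Fin 2) ℝ) (v w : Plane) : ℝ :=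
  v.ofLp ⬝ᵥ (H *ᵥ w.ofLp)

/-- The Hessian matrix of `G`. -/
def hess (G : Plane → ℝ) (p : Plane) : Matrix (Fin 2) (Fin 2) ℝ :=
  Matrix.of fun i j => pd i (pd j G) p

/-- Abreu's expression `S(H) = - ∑ ∂²H_{ij} / ∂μ_i ∂μ_j`. -/
def abreu (H : Plane → Matrix (Fin 2) (Fin 2) ℝ) (p : Plane) : ℝ :=
  -∑ i, ∑ j, pd i (pd j fun q => H q i j) p

/-- A labeled convex quadrilateral: the vertices in cyclic order (indices are taken mod 4), and, for
each edge `[vertex i, vertex (i + 1)]`, a normal vector pointing inwards: it is orthogonal to the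
edge, and the two remaining vertices lie strictly on its positive side. -/
structure LabeledQuadrilateral where
  vertex : Fin 4 → Plane
  normal : Fin 4 → Plane
  normal_orthogonal : ∀ i, inner ℝ (normal i) (vertex (i + 1) - vertex i) = 0
  normal_inward : ∀ i j, j ≠ i → j ≠ i + 1 → 0 < inner ℝ (normal i) (vertex j - vertex i)

namespace LabeledQuadrilateral

variable (Q : LabeledQuadrilateral)

/-- The closed quadrilateral `Δ`. -/
def polytope : Set Plane := convexHull ℝ (Set.range Q.vertex)

/-- The relative interior of the `i`-th facet. -/
def openFacet (i : Fin 4) : Set Plane := openSegment ℝ (Q.vertex i) (Q.vertex (i + 1))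

/-- The integral over `∂Δ` against the measure `dν`, where `u_i ∧ dν = -dv` on the `i`-th facet:
`dν` is there the length measure divided by the length of `u_i`. -/
def boundaryIntegral (f : Plane → ℝ) : ℝ :=
  ∑ i, ‖Q.vertex (i + 1) - Q.vertex i‖ / ‖Q.normal i‖ *
    ∫ t in (0 : ℝ)..1, f (Q.vertex i + t • (Q.vertex (i + 1) - Q.vertex i))

/-- The basis `1, μ_1, μ_2` of the space of affine functions on the plane. -/
def affineBasisFun (i : Fin 3) (p : Plane) : ℝ := ![1, p 0, p 1] i

/-- `W_{ij} = ∫_Δ μ_i μ_j dv`. -/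
def momentMatrix : Matrix (Fin 3) (Fin 3) ℝ :=
  Matrix.of fun i j => ∫ p in Q.polytope, affineBasisFun i p * affineBasisFun j p

/-- `Z_i = 2 ∫_{∂Δ} μ_i dν`. -/
def momentVector (i : Fin 3) : ℝ := 2 * Q.boundaryIntegral (affineBasisFun i)

/-- The coefficients of the extremal affine function: the solution of `W ζ = Z`. -/
def extremalCoeff : Fin 3 → ℝ := Q.momentMatrix⁻¹ *ᵥ Q.momentVector

/-- The extremal affine function `ζ_{(Δ,u)}`. -/
def extremalAffine (p : Plane) : ℝ := ∑ i, Q.extremalCoeff i * affineBasisFun i p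

theorem interior_polytope_nonempty :
    (interior Q.polytope).Nonempty := by
  unfold LabeledQuadrilateral.polytope
  rw [interior_convexHull_nonempty_iff_affineSpan_eq_top]
  set v := Q.vertex
  have hli : LinearIndependent ℝ ![v 1 - v 0, v 3 - v 0] := by
    rw [LinearIndependent.pair_iff]
    intro a b h
    have o0 := Q.normal_orthogonal 0
    have o3 := Q.normal_orthogonal 3
    have i0 := Q.normal_inward 0 3 (by decide) (by decide)
    have i3 := Q.normal_inward 3 1 (by decide) (by decide)
    have e0 : inner ℝ (Q.normal 0) (a • (v 1 - v 0) + b • (v 3 - v 0)) = 0 := by rw [h]; simp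
    have e3 : inner ℝ (Q.normal 3) (a • (v 1 - v 0) + b • (v 3 - v 0)) = 0 := by rw [h]; simp
    simp only [inner_add_right, inner_smul_right, inner_sub_right, show (3:Fin 4) + 1 = 0 from rfl,
      show (0:Fin 4) + 1 = 1 from rfl] at o0 o3 i0 i3 e0 e3
    change _ = _ at o0
    have hb : b = 0 := by
      have : b * (inner ℝ (Q.normal 0) (v 3) - inner ℝ (Q.normal 0) (v 0)) = 0 := by
        simp only [v] at *; linear_combination e0 - a * o0
      rcases mul_eq_zero.1 this with h | h
      · exact h
      · simp only [v] at *; linarith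
    have ha : a = 0 := by
      have : a * (inner ℝ (Q.normal 3) (v 1) - inner ℝ (Q.normal 3) (v 3)) = 0 := by
        simp only [v] at *; subst hb; linear_combination e3 + a * o3
      rcases mul_eq_zero.1 this with h | h
      · exact h
      · simp only [v] at *; linarith
    exact ⟨ha, hb⟩
  have hai : AffineIndependent ℝ ![v 0, v 1, v 3] := by
    rw [affineIndependent_iff_linearIndependent_vsub ℝ _ (0 : Fin 3)]
    have e : (fun i : { x : Fin 3 // x ≠ 0 } => (![v 0, v 1, v 3] i -ᵥ ![v 0, v 1, v 3] 0)) =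
      ![v 1 - v 0, v 3 - v 0] ∘ (finSuccAboveEquiv (0 : Fin 3)).symm := by
      funext ⟨i, hi⟩
      obtain ⟨j, hj⟩ := (finSuccAboveEquiv (0 : Fin 3)).surjective ⟨i, hi⟩
      rw [← hj]
      fin_cases j <;> simp [finSuccAboveEquiv]
    rw [e]
    exact hli.comp _ (Equiv.injective _)
  have ht : affineSpan ℝ (Set.range ![v 0, v 1, v 3]) = ⊤ :=
    hai.affineSpan_eq_top_iff_card_eq_finrank_add_one.2 (by simp)
  rw [eq_top_iff, ← ht]
  apply affineSpan_mono
  rintro _ ⟨i, rfl⟩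
  fin_cases i <;> simp

/-- The linear system `W ζ = Z` is nondegenerate, and `extremalCoeff` is its solution. -/
theorem momentMatrix_mulVec_extremalCoeff :
    IsUnit Q.momentMatrix.det ∧ Q.momentMatrix *ᵥ Q.extremalCoeff = Q.momentVector := by
  have hc : IsCompact Q.polytope := (Set.finite_range _).isCompact_convexHull (𝕜 := ℝ)
  have hcont : ∀ i, Continuous (affineBasisFun i) := by
    intro i; unfold affineBasisFun
    fin_cases i <;> simp <;> fun_prop
  have hint : ∀ i j, IntegrableOn (fun p => affineBasisFun i p * affineBasisFun j p) Q.polytope :=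
    fun i j => ((hcont i).mul (hcont j)).continuousOn.integrableOn_compact hc
  have hdet : IsUnit Q.momentMatrix.det := by
    rw [isUnit_iff_ne_zero]
    intro h0
    obtain ⟨c, hc0, hcW⟩ := Matrix.exists_mulVec_eq_zero_iff.2 h0
    set g : Plane → ℝ := fun p => ∑ i, c i * affineBasisFun i p with hg
    have hgc : Continuous g := by fun_prop
    have hq : ∫ p in Q.polytope, g p ^ 2 = 0 := by
      have : c ⬝ᵥ (Q.momentMatrix *ᵥ c) = ∫ p in Q.polytope, g p ^ 2 := by
        have e : ∀ p, g p ^ 2 = ∑ i, ∑ j, c i * c j * (affineBasisFun i p * affineBasisFun j p) := by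
          intro p
          simp only [hg, sq, Finset.sum_mul_sum]
          exact Finset.sum_congr rfl fun i _ => Finset.sum_congr rfl fun j _ => by ring
        simp only [e]
        rw [integral_finsetSum _ fun i _ => integrable_finsetSum _ fun j _ => (hint i j).const_mul _]
        simp only [dotProduct, Matrix.mulVec, Finset.mul_sum]
        refine Finset.sum_congr rfl fun i _ => ?_
        rw [integral_finsetSum _ fun j _ => (hint i j).const_mul _]
        refine Finset.sum_congr rfl fun j _ => ?_
        rw [integral_const_mul]; simp [momentMatrix]; ring
      rw [← this, hcW]; simp
    have hz : ∀ p ∈ interior Q.polytope, g p = 0 := by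
      rw [setIntegral_eq_zero_iff_of_nonneg_ae (Filter.Eventually.of_forall fun p => sq_nonneg _)
        ((hgc.pow 2).continuousOn.integrableOn_compact hc)] at hq
      have h2 := ae_restrict_of_ae_restrict_of_subset interior_subset hq
      have := Measure.eqOn_open_of_ae_eq h2 isOpen_interior (hgc.pow 2).continuousOn
        continuousOn_const
      intro p hp
      simpa using this hp
    obtain ⟨p, hp⟩ := Q.interior_polytope_nonempty
    have hloc : ∀ i : Fin 2, c i.succ = 0 := by
      intro i
      have hev : ∀ᶠ t in nhds (0:ℝ), p + t • EuclideanSpace.single i 1 ∈ interior Q.polytope := by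
        have : Continuous fun t : ℝ => p + t • (EuclideanSpace.single i 1 : Plane) := by fun_prop
        exact this.continuousAt.eventually_mem (isOpen_interior.mem_nhds (by simpa using hp))
      obtain ⟨t, ht, ht0⟩ := ((hev.filter_mono nhdsWithin_le_nhds).and
        (self_mem_nhdsWithin : {(0:ℝ)}ᶜ ∈ nhdsWithin (0:ℝ) {0}ᶜ)).exists
      have h1 := hz _ ht
      have h2 := hz _ hp
      have ht0 : t ≠ 0 := ht0
      simp only [hg, affineBasisFun, Fin.sum_univ_three] at h1 h2
      fin_cases i
      · simp at h1 h2 ⊢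
        exact (mul_eq_zero.1 (by linear_combination h1 - h2 : c 1 * t = 0)).resolve_right ht0
      · simp at h1 h2 ⊢
        exact (mul_eq_zero.1 (by linear_combination h1 - h2 : c 2 * t = 0)).resolve_right ht0
    apply hc0
    have h2 := hz _ hp
    have a1 : c 1 = 0 := hloc 0
    have a2 : c 2 = 0 := hloc 1
    simp [hg, affineBasisFun, Fin.sum_univ_three, a1, a2] at h2
    funext i
    fin_cases i <;> simp [*]
  refine ⟨hdet, ?_⟩
  unfold extremalCoeff
  rw [Matrix.mulVec_mulVec, Matrix.mul_nonsing_inv _ hdet, Matrix.one_mulVec]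

/-- The affine function `f` is equipoised: its alternating sum over the vertices is zero. -/
def IsEquipoised (f : Plane → ℝ) : Prop := ∑ i : Fin 4, (-1) ^ (i : ℕ) * f (Q.vertex i) = 0

/-- The relative Futaki functional. -/
def futaki (f : Plane → ℝ) : ℝ :=
  Q.boundaryIntegral f - 1 / 2 * ∫ p in Q.polytope, f p * Q.extremalAffine p

/-- `f` is a convex continuous piecewise affine-linear function on `Δ`. -/
def IsConvexPL (f : Plane → ℝ) : Prop :=
  ConvexOn ℝ Q.polytope f ∧ ContinuousOn f Q.polytope ∧
    ∃ s : Finset (Plane →ᵃ[ℝ] ℝ), ∀ p ∈ Q.polytope, ∃ a ∈ s, f p = a p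

/-- `f` is affine-linear on `Δ`. -/
def IsAffineOn (f : Plane → ℝ) : Prop :=
  ∃ a : Plane →ᵃ[ℝ] ℝ, ∀ p ∈ Q.polytope, f p = a p

/-- Analytic relative K-stability with respect to toric degenerations. -/
def IsRelativelyKStable : Prop :=
  ∀ f : Plane → ℝ, Q.IsConvexPL f → 0 ≤ Q.futaki f ∧ (Q.futaki f = 0 ↔ Q.IsAffineOn f)

/-- `H` is a smooth function on `Δ` with values in the symmetric matrices. -/
def IsSmoothSymm (H : Plane → Matrix (Fin 2) (Fin 2) ℝ) : Prop :=
  (∀ i j, ContDiffOn ℝ ∞ (fun p => H p i j) Q.polytope) ∧ ∀ p ∈ Q.polytope, (H p).IsSymm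

/-- The boundary conditions `H_y(u_i, ·) = 0` and `dH_y(u_i, u_i) = 2 u_i` at every point `y` in
the interior of a facet. -/
def BoundaryConditions (H : Plane → Matrix (Fin 2) (Fin 2) ℝ) : Prop :=
  ∀ i, ∀ y ∈ Q.openFacet i,
    (∀ v, form (H y) (Q.normal i) v = 0) ∧
    ∀ v, fderivWithin ℝ (fun z => form (H z) (Q.normal i) (Q.normal i)) Q.polytope y v =
      2 * inner ℝ (Q.normal i) v

/-- `H` is positive definite on the interior of `Δ`. -/
def IsPosDef (H : Plane → Matrix (Fin 2) (Fin 2) ℝ) : Prop :=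
  ∀ p ∈ interior Q.polytope, (H p).PosDef

/-- On the interior of each facet, `H` is positive definite on the quotient of the space of normals
by the line of `u_i`. (At a vertex this quotient is zero and there is no condition.) -/
def IsPosDefOnFacets (H : Plane → Matrix (Fin 2) (Fin 2) ℝ) : Prop :=
  ∀ i, ∀ y ∈ Q.openFacet i, ∀ v, v ∉ Submodule.span ℝ {Q.normal i} → 0 < form (H y) v v

/-- `H` is on the interior of `Δ` the inverse of the Hessian of `G`. -/
def IsInverseHessian (H : Plane → Matrix (Fin 2) (Fin 2) ℝ) (G : Plane → ℝ) : Prop :=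
  ∀ p ∈ interior Q.polytope, H p * hess G p = 1

/-- `H` satisfies the extremal equation `S(H) = ζ_{(Δ,u)}`. -/
def ExtremalEquation (H : Plane → Matrix (Fin 2) (Fin 2) ℝ) : Prop :=
  ∀ p ∈ interior Q.polytope, abreu H p = Q.extremalAffine p

/-- `G` belongs to the set `𝒮(Δ, u)` of symplectic potentials. (Only the values of `G` on the
interior of `Δ` matter.) -/
def IsSymplecticPotential (G : Plane → ℝ) : Prop :=
  ContDiffOn ℝ ∞ G (interior Q.polytope) ∧ StrictConvexOn ℝ (interior Q.polytope) G ∧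
    ∃ H : Plane → Matrix (Fin 2) (Fin 2) ℝ,
      Q.IsInverseHessian H G ∧ Q.IsSmoothSymm H ∧ Q.IsPosDef H ∧ Q.IsPosDefOnFacets H ∧
        Q.BoundaryConditions H

/-- `G` is a symplectic potential which solves the extremal equation `S(G) = ζ_{(Δ,u)}`. -/
def IsExtremalPotential (G : Plane → ℝ) : Prop :=
  Q.IsSymplecticPotential G ∧ Q.ExtremalEquation fun p => (hess G p)⁻¹

end LabeledQuadrilateral

/-- The three kinds of coordinates `(x, y)` that are used to separate variables. -/
inductive Shape
  | product
  | calabi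
  | orthotoric

namespace Shape

/-- The map `σ` from the `(x, y)`-plane to the moment plane. -/
def sigma : Shape → ℝ → ℝ → Plane
  | product, x, y => !₂[x, y]
  | calabi, x, y => !₂[x, x * y]
  | orthotoric, x, y => !₂[x + y, x * y]

/-- The coordinate `x` as a function on the moment plane. -/
def xCoord : Shape → Plane → ℝ
  | product, p => p 0
  | calabi, p => p 0
  | orthotoric, p => (p 0 + √(p 0 ^ 2 - 4 * p 1)) / 2

/-- The coordinate `y` as a function on the moment plane. -/
def yCoord : Shape → Plane → ℝ
  | product, p => p 1
  | calabi, p => p 1 / p 0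
  | orthotoric, p => (p 0 - √(p 0 ^ 2 - 4 * p 1)) / 2

/-- The condition on the rectangle `[α₁, α₂] × [β₁, β₂]`. -/
def Admissible (α₁ α₂ β₁ β₂ : ℝ) : Shape → Prop
  | product => α₁ < α₂ ∧ β₁ < β₂
  | calabi => α₁ < α₂ ∧ β₁ < β₂ ∧ 0 < α₁ ∧ 0 ≤ β₁
  | orthotoric => α₁ < α₂ ∧ β₁ < β₂ ∧ β₂ < α₁

/-- The matrix determined by the values `a = A(x)` and `b = B(y)` at the point `(x, y)`. -/
def matrix (a b x y : ℝ) : Shape → Matrix (Fin 2) (Fin 2) ℝ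
  | product => !![a, 0; 0, b]
  | calabi => (1 / x) • !![a, y * a; y * a, x ^ 2 * b + y ^ 2 * a]
  | orthotoric =>
      (1 / (x - y)) • !![a + b, y * a + x * b; y * a + x * b, y ^ 2 * a + x ^ 2 * b]

/-- `xCoord` and `yCoord` invert `σ` on an admissible rectangle. -/
theorem coord_sigma (s : Shape) (a b c d x y : ℝ) (h : s.Admissible a b c d) (hx : x ∈ Set.Icc a b)
    (hy : y ∈ Set.Icc c d) : s.xCoord (s.sigma x y) = x ∧ s.yCoord (s.sigma x y) = y := by
  obtain ⟨h1, h2⟩ := hx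
  obtain ⟨h3, h4⟩ := hy
  cases s
  · simp [Shape.xCoord, Shape.yCoord, Shape.sigma]
  · have : 0 < a := h.2.2.1
    have : x ≠ 0 := by linarith
    simp [Shape.xCoord, Shape.yCoord, Shape.sigma, this]
  · have : d < a := h.2.2
    have e : √((x + y) ^ 2 - 4 * (x * y)) = x - y := by
      rw [show (x + y) ^ 2 - 4 * (x * y) = (x - y) ^ 2 by ring, Real.sqrt_sq (by linarith)]
    simp [Shape.xCoord, Shape.yCoord, Shape.sigma, e]

end Shape

/-- A rectangle `[α₁, α₂] × [β₁, β₂]` that is admissible for a shape, with an affine isomorphism of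
the plane. -/
structure SeparatingChart where
  shape : Shape
  α₁ : ℝ
  α₂ : ℝ
  β₁ : ℝ
  β₂ : ℝ
  admissible : shape.Admissible α₁ α₂ β₁ β₂
  toAffine : Plane ≃ᵃ[ℝ] Plane

namespace SeparatingChart

variable (N : SeparatingChart)

/-- The chart maps the quadrilateral `Δ` onto the image of the rectangle under `σ`. -/
def Represents (Q : LabeledQuadrilateral) : Prop :=
  N.toAffine '' Q.polytope =
    {p | ∃ x ∈ Set.Icc N.α₁ N.α₂, ∃ y ∈ Set.Icc N.β₁ N.β₂, p = N.shape.sigma x y}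

/-- The matrix of the linear part of the inverse of the affine isomorphism. -/
def invLinear : Matrix (Fin 2) (Fin 2) ℝ :=
  Matrix.of fun i j => (N.toAffine.linear.symm (EuclideanSpace.single j 1)) i

/-- The function `H_{A,B}` on `Δ`: the explicit matrix in the variables `x, y`, transported by the
affine isomorphism as a section of the symmetric square of the plane. -/
def matrixH (A B : Polynomial ℝ) (p : Plane) : Matrix (Fin 2) (Fin 2) ℝ :=
  N.invLinear *
    N.shape.matrix (A.eval (N.shape.xCoord (N.toAffine p))) (B.eval (N.shape.yCoord (N.toAffine p)))
      (N.shape.xCoord (N.toAffine p)) (N.shape.yCoord (N.toAffine p)) *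
    N.invLinearᵀ

end SeparatingChart

end ToricQuad

end

/-! The three normal forms are one picture. In each of them Δ is the image of a rectangle under a
map c₀ + x c₁ + y c₂ + xy c₃ that is affine in each variable separately (`BilinearChart`). With the
velocities X = c₁ + y c₃ and Y = c₂ + x c₃ and the Jacobian det(X, Y) = κρ, the matrix function is H
= (A XXᵀ + B YYᵀ)/ρ. Coordinate lines are straight segments, ρ is affine in (x, y), and a divergence
can be computed from the fluxes across coordinate lines. Doing so twice gives S(H) = -(A'' + B'')/ρ
(`abreu_matH`), so the extremal equation reads A''(x) + B''(y) = -ρζ.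

An affine function has alternating sum zero over the corners exactly when it has no xy-term in the
chart. For such ζ the xy-term of ρζ vanishes as well, so -ρζ splits into a quadratic in x plus a
quadratic in y. The boundary conditions ask that A and B vanish at the end points with prescribed
slopes. These are eight conditions on five free constants, and the other three are the moment
equations that define ζ (`exists_solves`).

The same integration by parts computes the Futaki functional: twice its value at f is |κ| times the
sum of the integrals over y of the pairing of A'' with f along x-lines and over x of the pairing of
B'' with f along y-lines (`two_mul_futaki_eq`). Formally the one-dimensional pairing is the integral
of A against the second derivative of f, hence nonnegative for convex f if A > 0. It vanishes only
if f is affine along the lines. A crease along the line x = x₀ yields a positive multiple of A(x₀)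
(`two_mul_futaki_crease`). So K-stability means A, B > 0, which is also positive definiteness of H,
since the conormals of the coordinate lines isolate A and B (`posDef_matH_iff`).

If A, B > 0, the inverse of H is ρ(dx²/A + dy²/B). Its columns are one-forms with separated
variables, so a potential can be written down by integration (`isExtremalPotential_potential`).

Conversely, let G be any solution with inverse Hessian H', and let D = H' - H. Then D has zero
double divergence and vanishes at the boundary to such an order that the field D∇f - f div D has
flux O(distance to the boundary), provided f is bounded with derivatives O(1/distance)
(`exists_bound_fluxX`). Testing against the crease along a line where A ≤ 0 gives a contradiction
(`not_form_pos_of_abreu_eq_zero`), so A and B are positive and the explicit potential exists.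
Testing against the difference f of the two potentials gives vanishing of the integral of tr(D Hess
f), whose integrand is nonpositive and zero only where D = 0 (`trace_sub_mul_sub_nonpos`,
`eq_of_bounded`). The growth condition follows from convexity once the potentials are bounded.
Boundedness comes from the behaviour of the inverse Hessian at the vertices
(`exists_bound_of_isSymplecticPotential`).

Separating coordinates exist because the affine type of a quadrilateral is given by the two
coordinates of a vertex in the frame at the opposite vertex. After renumbering, these are matched by
one of the three maps σ (`exists_represents`). -/

noncomputable section

namespace ToricQuad

/-! ### Linear algebra of the plane -/

section PlaneAlgebra

/-- The determinant of two vectors in the plane. -/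
def det2 (v w : Plane) : ℝ := v 0 * w 1 - v 1 * w 0

/-- The vector `v` rotated by a right angle. -/
def perp (v : Plane) : Plane := !₂[v 1, -v 0]

@[simp] theorem perp_zero_apply (v : Plane) : perp v 0 = v 1 := rfl
@[simp] theorem perp_one_apply (v : Plane) : perp v 1 = -v 0 := rfl

theorem inner_eq (v w : Plane) : inner ℝ v w = v 0 * w 0 + v 1 * w 1 := by
  simp [PiLp.inner_apply, Fin.sum_univ_two, mul_comm]

theorem inner_perp (v w : Plane) : inner ℝ (perp v) w = det2 w v := by
  simp [inner_eq, det2]; ring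

theorem plane_ext {v w : Plane} (h0 : v 0 = w 0) (h1 : v 1 = w 1) : v = w := by
  ext i; fin_cases i <;> assumption

theorem det2_self (v : Plane) : det2 v v = 0 := by simp [det2]; ring

theorem form_eq (H : Matrix (Fin 2) (Fin 2) ℝ) (v w : Plane) :
    form H v w = v 0 * (H 0 0 * w 0 + H 0 1 * w 1) + v 1 * (H 1 0 * w 0 + H 1 1 * w 1) := by
  simp [form, dotProduct, Matrix.mulVec, Fin.sum_univ_two]

theorem norm_perp (v : Plane) : ‖perp v‖ = ‖v‖ := by
  simp [EuclideanSpace.norm_eq, Fin.sum_univ_two, add_comm]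

/-- Vectors with nonzero determinant span the plane. -/
theorem exists_combination {v w : Plane} (h : det2 v w ≠ 0) (u : Plane) :
    u = (det2 u w / det2 v w) • v + (det2 v u / det2 v w) • w := by
  have h' : v 0 * w 1 - v 1 * w 0 ≠ 0 := h
  apply plane_ext <;> simp only [det2, PiLp.add_apply, PiLp.smul_apply, smul_eq_mul] <;>
    rw [div_mul_eq_mul_div, div_mul_eq_mul_div, ← add_div, eq_div_iff h'] <;> ring

/-- A vector orthogonal to `w ≠ 0` is a multiple of `perp w`. -/
theorem eq_smul_perp {n w v : Plane} (h : inner ℝ n w = 0) (hd : det2 v w ≠ 0) :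
    n = (inner ℝ n v / det2 v w) • perp w := by
  rw [inner_eq] at h
  apply plane_ext <;> simp [inner_eq, det2] at hd ⊢ <;> field_simp
  · linear_combination (-v 1) * h
  · linear_combination (v 0) * h

end PlaneAlgebra

/-! ### Labeled quadrilaterals and their renumbering -/

theorem fin4_add_right_comm : ∀ i k : Fin 4, i + k + 1 = i + 1 + k := by decide

theorem fin4_neg_sub_add : ∀ i : Fin 4, -i - 1 + 1 = -i := by decide

theorem fin4_neg_add : ∀ i : Fin 4, -(i + 1) = -i - 1 := by decide

theorem fin4_neg_sub_neg_sub : ∀ i : Fin 4, -(-i - 1) - 1 = i := by decide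

theorem fin4_neg_eq_iff : ∀ i j : Fin 4, -j = -i - 1 ↔ j = i + 1 := by decide

namespace LabeledQuadrilateral

variable (Q : LabeledQuadrilateral)

theorem mem_polytope_iff {p : Plane} :
    p ∈ Q.polytope ↔ ∃ w : Fin 4 → ℝ, (∀ i, 0 ≤ w i) ∧ ∑ i, w i = 1 ∧ ∑ i, w i • Q.vertex i = p := by
  rw [polytope, convexHull_range_eq_exists_affineCombination]
  constructor
  · rintro ⟨s, w, h0, h1, rfl⟩
    refine ⟨fun i => if i ∈ s then w i else 0, fun i => ?_, ?_, ?_⟩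
    · dsimp; split_ifs with h
      exacts [h0 i h, le_rfl]
    · simpa [Finset.sum_ite_mem] using h1
    · rw [Finset.affineCombination_eq_linear_combination _ _ _ h1]
      simp [ite_smul, Finset.sum_ite_mem]
  · rintro ⟨w, h0, h1, rfl⟩
    exact ⟨Finset.univ, w, fun i _ => h0 i, h1,
      Finset.affineCombination_eq_linear_combination _ _ _ h1⟩

theorem vertex_mem (i : Fin 4) : Q.vertex i ∈ Q.polytope := subset_convexHull _ _ ⟨i, rfl⟩

theorem convex_polytope : Convex ℝ Q.polytope := convex_convexHull _ _

theorem isCompact_polytope : IsCompact Q.polytope :=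
  (Set.finite_range _).isCompact_convexHull (𝕜 := ℝ)

theorem uniqueDiffOn_polytope : UniqueDiffOn ℝ Q.polytope :=
  uniqueDiffOn_convex Q.convex_polytope Q.interior_polytope_nonempty

theorem normal_vertex_nonneg (i j : Fin 4) : 0 ≤ inner ℝ (Q.normal i) (Q.vertex j - Q.vertex i) := by
  by_cases h1 : j = i
  · simp [h1]
  by_cases h2 : j = i + 1
  · rw [h2, Q.normal_orthogonal]
  · exact (Q.normal_inward i j h1 h2).le

theorem normal_nonneg (i : Fin 4) {p : Plane} (hp : p ∈ Q.polytope) :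
    0 ≤ inner ℝ (Q.normal i) (p - Q.vertex i) := by
  obtain ⟨w, h0, h1, rfl⟩ := Q.mem_polytope_iff.1 hp
  have : ∑ j, w j • Q.vertex j - Q.vertex i = ∑ j, w j • (Q.vertex j - Q.vertex i) := by
    simp [smul_sub, Finset.sum_sub_distrib, ← Finset.sum_smul, h1]
  rw [this, inner_sum]
  exact Finset.sum_nonneg fun j _ => by
    rw [inner_smul_right]; exact mul_nonneg (h0 j) (Q.normal_vertex_nonneg i j)

theorem normal_ne_zero (i : Fin 4) : Q.normal i ≠ 0 := by
  intro h
  have := Q.normal_inward i (i + 2) (by fin_cases i <;> decide) (by fin_cases i <;> decide)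
  simp [h] at this

/-- If the value were zero, a small step against the normal would stay in Δ and make it negative. -/
theorem normal_pos_of_mem_interior (i : Fin 4) {p : Plane} (hp : p ∈ interior Q.polytope) :
    0 < inner ℝ (Q.normal i) (p - Q.vertex i) := by
  have hcont : Continuous fun t : ℝ => p - t • Q.normal i := by fun_prop
  have hev : ∀ᶠ t in nhds (0 : ℝ), p - t • Q.normal i ∈ interior Q.polytope :=
    hcont.continuousAt.eventually_mem (isOpen_interior.mem_nhds (by simpa using hp))
  obtain ⟨t, ht, ht0⟩ := ((hev.filter_mono nhdsWithin_le_nhds).and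
    (self_mem_nhdsWithin : Set.Ioi (0 : ℝ) ∈ nhdsWithin (0 : ℝ) (Set.Ioi 0))).exists
  have h1 := Q.normal_nonneg i (interior_subset ht)
  have ht0 : 0 < t := ht0
  have h2 : 0 < inner ℝ (Q.normal i) (Q.normal i) := by
    rw [real_inner_self_eq_norm_sq]; have := norm_pos_iff.2 (Q.normal_ne_zero i); positivity
  rw [show p - t • Q.normal i - Q.vertex i = (p - Q.vertex i) - t • Q.normal i by abel,
    inner_sub_right, inner_smul_right] at h1
  nlinarith

theorem openFacet_subset (i : Fin 4) : Q.openFacet i ⊆ Q.polytope :=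
  Q.convex_polytope.openSegment_subset (Q.vertex_mem _) (Q.vertex_mem _)

/-- The vertices are renumbered by a rotation. -/
def rotate (k : Fin 4) : LabeledQuadrilateral where
  vertex i := Q.vertex (i + k)
  normal i := Q.normal (i + k)
  normal_orthogonal i := by
    have := Q.normal_orthogonal (i + k)
    rwa [fin4_add_right_comm] at this
  normal_inward i j h1 h2 := Q.normal_inward _ _ (by simpa using h1) (by
    rw [fin4_add_right_comm]; simpa using h2)

/-- The vertices are renumbered in the opposite direction. -/
def reflect : LabeledQuadrilateral where
  vertex i := Q.vertex (-i)
  normal i := Q.normal (-i - 1)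
  normal_orthogonal i := by
    have := Q.normal_orthogonal (-i - 1)
    rw [fin4_neg_sub_add] at this
    rw [fin4_neg_add, ← neg_sub (Q.vertex _), inner_neg_right, this, neg_zero]
  normal_inward i j h1 h2 := by
    have o := Q.normal_orthogonal (-i - 1)
    have := Q.normal_inward (-i - 1) (-j) (by
      rwa [Ne, fin4_neg_eq_iff]) (by
      rw [fin4_neg_sub_add]; simpa using h1)
    rw [fin4_neg_sub_add] at o
    simp only [inner_sub_right] at *
    linarith

/-- Two labeled quadrilaterals differ only by the numbering of the vertices, as far as the
notions in the theorem are concerned. -/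
structure SameAs (Q Q' : LabeledQuadrilateral) : Prop where
  polytope_eq : Q'.polytope = Q.polytope
  boundaryIntegral_eq : ∀ f, Q'.boundaryIntegral f = Q.boundaryIntegral f
  equipoised_iff : ∀ f, Q'.IsEquipoised f ↔ Q.IsEquipoised f
  boundaryConditions_iff : ∀ H, Q'.BoundaryConditions H ↔ Q.BoundaryConditions H
  posDefOnFacets_iff : ∀ H, Q'.IsPosDefOnFacets H ↔ Q.IsPosDefOnFacets H

theorem SameAs.trans {Q Q' Q'' : LabeledQuadrilateral} (h : SameAs Q Q') (h' : SameAs Q' Q'') :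
    SameAs Q Q'' where
  polytope_eq := h'.polytope_eq.trans h.polytope_eq
  boundaryIntegral_eq f := (h'.boundaryIntegral_eq f).trans (h.boundaryIntegral_eq f)
  equipoised_iff f := (h'.equipoised_iff f).trans (h.equipoised_iff f)
  boundaryConditions_iff f := (h'.boundaryConditions_iff f).trans (h.boundaryConditions_iff f)
  posDefOnFacets_iff f := (h'.posDefOnFacets_iff f).trans (h.posDefOnFacets_iff f)

theorem polytope_rotate (k : Fin 4) : (Q.rotate k).polytope = Q.polytope := by
  unfold polytope
  congr 1
  exact (Equiv.addRight k).surjective.range_comp Q.vertex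

theorem polytope_reflect : Q.reflect.polytope = Q.polytope := by
  unfold polytope
  congr 1
  exact (Equiv.neg (Fin 4)).surjective.range_comp Q.vertex

theorem openFacet_rotate (k i : Fin 4) : (Q.rotate k).openFacet i = Q.openFacet (i + k) := by
  simp [openFacet, rotate, fin4_add_right_comm]

theorem openFacet_reflect (i : Fin 4) : Q.reflect.openFacet i = Q.openFacet (-i - 1) := by
  simp only [openFacet, reflect]
  rw [fin4_neg_sub_add, fin4_neg_add, openSegment_symm]

theorem sameAs_rotate (k : Fin 4) : SameAs Q (Q.rotate k) where
  polytope_eq := Q.polytope_rotate k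
  boundaryIntegral_eq f := by
    unfold boundaryIntegral
    rw [← Equiv.sum_comp (Equiv.addRight k) (fun i => ‖Q.vertex (i + 1) - Q.vertex i‖ / ‖Q.normal i‖ *
      ∫ t in (0 : ℝ)..1, f (Q.vertex i + t • (Q.vertex (i + 1) - Q.vertex i)))]
    refine Finset.sum_congr rfl fun i _ => ?_
    simp [rotate, fin4_add_right_comm]
  equipoised_iff f := by
    unfold IsEquipoised
    fin_cases k <;> simp [Fin.sum_univ_four, rotate] <;> constructor <;> intro h <;> linarith
  boundaryConditions_iff H := by
    unfold BoundaryConditions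
    simp only [openFacet_rotate, polytope_rotate]
    exact (Equiv.addRight k).forall_congr_right (q := fun i => ∀ y ∈ Q.openFacet i,
      (∀ v, form (H y) (Q.normal i) v = 0) ∧
      ∀ v, fderivWithin ℝ (fun z => form (H z) (Q.normal i) (Q.normal i)) Q.polytope y v =
        2 * inner ℝ (Q.normal i) v)
  posDefOnFacets_iff H := by
    unfold IsPosDefOnFacets
    simp only [openFacet_rotate]
    exact (Equiv.addRight k).forall_congr_right (q := fun i => ∀ y ∈ Q.openFacet i, ∀ v,
      v ∉ Submodule.span ℝ {Q.normal i} → 0 < form (H y) v v)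

/-- The involution of the edges that belongs to a reflection. -/
def edgeReflection : Fin 4 ≃ Fin 4 where
  toFun i := -i - 1
  invFun i := -i - 1
  left_inv := fin4_neg_sub_neg_sub
  right_inv := fin4_neg_sub_neg_sub

theorem sameAs_reflect : SameAs Q Q.reflect where
  polytope_eq := Q.polytope_reflect
  boundaryIntegral_eq f := by
    unfold boundaryIntegral
    rw [← Equiv.sum_comp edgeReflection (fun i => ‖Q.vertex (i + 1) - Q.vertex i‖ / ‖Q.normal i‖ *
      ∫ t in (0 : ℝ)..1, f (Q.vertex i + t • (Q.vertex (i + 1) - Q.vertex i)))]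
    refine Finset.sum_congr rfl fun i _ => ?_
    simp only [reflect, edgeReflection, Equiv.coe_fn_mk]
    rw [fin4_neg_sub_add, fin4_neg_add]
    rw [norm_sub_rev]
    congr 1
    have := intervalIntegral.integral_comp_sub_left (a := 0) (b := 1)
      (fun t : ℝ => f (Q.vertex (-i - 1) + t • (Q.vertex (-i) - Q.vertex (-i - 1)))) 1
    simp only [sub_self, sub_zero] at this
    rw [← this]
    congr 1
    funext t
    congr 1
    module
  equipoised_iff f := by
    unfold IsEquipoised
    simp [Fin.sum_univ_four, reflect, show (-1 : Fin 4) = 3 from rfl, show (-2 : Fin 4) = 2 from rfl,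
      show (-3 : Fin 4) = 1 from rfl]
    constructor <;> intro h <;> linarith
  boundaryConditions_iff H := by
    unfold BoundaryConditions
    simp only [openFacet_reflect, polytope_reflect]
    exact edgeReflection.forall_congr_right (q := fun i => ∀ y ∈ Q.openFacet i,
      (∀ v, form (H y) (Q.normal i) v = 0) ∧
      ∀ v, fderivWithin ℝ (fun z => form (H z) (Q.normal i) (Q.normal i)) Q.polytope y v =
        2 * inner ℝ (Q.normal i) v)
  posDefOnFacets_iff H := by
    unfold IsPosDefOnFacets
    simp only [openFacet_reflect]
    exact edgeReflection.forall_congr_right (q := fun i => ∀ y ∈ Q.openFacet i, ∀ v,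
      v ∉ Submodule.span ℝ {Q.normal i} → 0 < form (H y) v v)

theorem SameAs.extremalAffine_eq {Q Q' : LabeledQuadrilateral} (h : SameAs Q Q') :
    Q'.extremalAffine = Q.extremalAffine := by
  have e1 : Q'.momentMatrix = Q.momentMatrix := by unfold momentMatrix; rw [h.polytope_eq]
  have e2 : Q'.momentVector = Q.momentVector := by
    funext i; unfold momentVector; rw [h.boundaryIntegral_eq]
  funext p
  unfold extremalAffine extremalCoeff
  rw [e1, e2]

theorem SameAs.kStable_iff {Q Q' : LabeledQuadrilateral} (h : SameAs Q Q') :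
    Q'.IsRelativelyKStable ↔ Q.IsRelativelyKStable := by
  unfold IsRelativelyKStable IsConvexPL IsAffineOn futaki
  simp only [h.polytope_eq, h.boundaryIntegral_eq, h.extremalAffine_eq]

theorem SameAs.extremalPotential_iff {Q Q' : LabeledQuadrilateral} (h : SameAs Q Q')
    (G : Plane → ℝ) : Q'.IsExtremalPotential G ↔ Q.IsExtremalPotential G := by
  unfold IsExtremalPotential IsSymplecticPotential ExtremalEquation IsInverseHessian IsSmoothSymm
    IsPosDef
  simp only [h.polytope_eq, h.boundaryConditions_iff, h.posDefOnFacets_iff, h.extremalAffine_eq]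

end LabeledQuadrilateral

/-! ### Matching the corners -/

/-- This recognises a bijection of the corners that preserves adjacency as one of the eight dihedral
symmetries; only non-oppositeness of successive images has to be checked. -/
theorem fin4_dihedral : ∀ a b c d : Fin 4, (a ≠ b ∧ a ≠ c ∧ a ≠ d ∧ b ≠ c ∧ b ≠ d ∧ c ≠ d) ∧
    (b ≠ a + 2 ∧ c ≠ b + 2 ∧ d ≠ c + 2 ∧ a ≠ d + 2) →
    (b = 1 + a ∧ c = 2 + a ∧ d = 3 + a) ∨ (b = a - 1 ∧ c = a - 2 ∧ d = a - 3) := by decide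

theorem fin4_add_one_ne_sub : ∀ i : Fin 4, i + 1 ≠ i - 1 := by decide

theorem fin4_add_one_ne_sub_add : ∀ i : Fin 4, i + 1 ≠ i - 1 + 1 := by decide

namespace LabeledQuadrilateral

theorem vertex_injective (Q : LabeledQuadrilateral) : Function.Injective Q.vertex := by
  intro i j hij
  by_contra hne
  have o1 := Q.normal_orthogonal i
  have o2 := Q.normal_orthogonal (i - 1)
  rw [sub_add_cancel] at o2
  by_cases h : j = i + 1
  · have := Q.normal_inward (i - 1) j (h ▸ fin4_add_one_ne_sub i)
      (h ▸ fin4_add_one_ne_sub_add i)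
    rw [← hij, o2] at this
    exact this.false
  · have := Q.normal_inward i j (fun h => hne h.symm) h
    rw [hij] at this; simp at this

/-- The functionals of the two edges at a vertex are nonnegative on all vertices, and each of the
other three vertices is strictly positive on at least one of them. Two zero values therefore force
all weight onto the given vertex. -/
theorem vertex_eq_of_mem (Q : LabeledQuadrilateral) (i : Fin 4) {p : Plane} (hp : p ∈ Q.polytope)
    (h1 : inner ℝ (Q.normal i) (p - Q.vertex i) = 0)
    (h2 : inner ℝ (Q.normal (i - 1)) (p - Q.vertex i) = 0) : p = Q.vertex i := by
  obtain ⟨w, w0, w1, rfl⟩ := Q.mem_polytope_iff.1 hp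
  have e : ∑ j, w j • Q.vertex j - Q.vertex i = ∑ j, w j • (Q.vertex j - Q.vertex i) := by
    simp [smul_sub, Finset.sum_sub_distrib, ← Finset.sum_smul, w1]
  have o2 := Q.normal_orthogonal (i - 1)
  rw [sub_add_cancel] at o2
  have n2 : ∀ j, inner ℝ (Q.normal (i - 1)) (Q.vertex j - Q.vertex i) =
      inner ℝ (Q.normal (i - 1)) (Q.vertex j - Q.vertex (i - 1)) := by
    intro j
    simp only [inner_sub_right] at o2 ⊢
    linarith
  rw [e, inner_sum] at h1 h2
  simp only [inner_smul_right] at h1 h2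
  rw [Finset.sum_eq_zero_iff_of_nonneg fun j _ => mul_nonneg (w0 j) (Q.normal_vertex_nonneg i j)]
    at h1
  rw [Finset.sum_eq_zero_iff_of_nonneg fun j _ => mul_nonneg (w0 j) (by
    rw [n2]; exact Q.normal_vertex_nonneg _ j)] at h2
  have hz : ∀ j, j ≠ i → w j = 0 := by
    intro j hj
    by_cases hj1 : j = i + 1
    · refine (mul_eq_zero.1 (h2 j (Finset.mem_univ _))).resolve_right ?_
      rw [n2]
      exact (Q.normal_inward _ _ (hj1 ▸ fin4_add_one_ne_sub i)
        (hj1 ▸ fin4_add_one_ne_sub_add i)).ne'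
    · exact (mul_eq_zero.1 (h1 j (Finset.mem_univ _))).resolve_right
        (Q.normal_inward _ _ hj hj1).ne'
  rw [Finset.sum_eq_single i (fun j _ hj => hz j hj) (by simp)] at w1
  rw [Finset.sum_eq_single i (fun j _ hj => by rw [hz j hj, zero_smul]) (by simp), w1, one_smul]

/-- If `Δ` is the convex hull of four points which satisfy the affine relation of the vertices of
a convex quadrilateral, then these are the vertices, up to the numbering. -/
theorem exists_sameAs_vertex_eq (Q : LabeledQuadrilateral) (w : Fin 4 → Plane) (r : Fin 4 → ℝ)
    (hw : Q.polytope = convexHull ℝ (Set.range w)) (hr : ∀ i, 0 < r i)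
    (hrel : r 2 • w 0 + r 0 • w 2 = r 3 • w 1 + r 1 • w 3) (hsum : r 2 + r 0 = r 3 + r 1) :
    ∃ Q', SameAs Q Q' ∧ ∀ i, Q'.vertex i = w i := by
  have hmem : ∀ j, w j ∈ Q.polytope := fun j => by rw [hw]; exact subset_convexHull _ _ ⟨j, rfl⟩
  -- A vertex is the only common zero in Δ of its two edge functionals, hence an extreme point, and
  -- extreme points of a convex hull are among the generating points.
  have hex : ∀ i, ∃ j, w j = Q.vertex i := by
    intro i
    have hv : Q.vertex i ∈ Q.polytope.extremePoints ℝ := by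
      rw [mem_extremePoints_iff_left]
      refine ⟨Q.vertex_mem i, ?_⟩
      rintro p hp q hq ⟨a, b, ha, hb, hab, h⟩
      have o2 := Q.normal_orthogonal (i - 1)
      rw [sub_add_cancel] at o2
      have key : ∀ k, inner ℝ (Q.normal k) (Q.vertex i - Q.vertex k) = 0 →
          inner ℝ (Q.normal k) (p - Q.vertex i) = 0 := by
        intro k hk
        have hp' := Q.normal_nonneg k hp
        have hq' := Q.normal_nonneg k hq
        rw [← h] at hk
        have : inner ℝ (Q.normal k) (a • p + b • q - Q.vertex k) =
            a * inner ℝ (Q.normal k) (p - Q.vertex k) +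
              b * inner ℝ (Q.normal k) (q - Q.vertex k) := by
          rw [show a • p + b • q - Q.vertex k = a • (p - Q.vertex k) + b • (q - Q.vertex k) by
            rw [show b = 1 - a by linarith]; module]
          rw [inner_add_right, inner_smul_right, inner_smul_right]
        have hz : inner ℝ (Q.normal k) (p - Q.vertex k) = 0 := by
          rw [this] at hk
          have h1 := mul_nonneg ha.le hp'
          have h2 := mul_nonneg hb.le hq'
          have : a * inner ℝ (Q.normal k) (p - Q.vertex k) = 0 := by linarith
          exact (mul_eq_zero.1 this).resolve_left ha.ne'
        rw [h] at hk
        simp only [inner_sub_right] at *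
        linarith
      exact Q.vertex_eq_of_mem i hp (key i (by simp)) (key (i - 1) o2)
    rw [hw] at hv
    obtain ⟨j, hj⟩ := extremePoints_convexHull_subset hv
    exact ⟨j, hj⟩
  choose e he using hex
  have hinj : Function.Injective e := fun i j h => Q.vertex_injective (by rw [← he, ← he, h])
  have hsurj : Function.Surjective e := Finite.injective_iff_surjective.1 hinj
  -- If an edge joined two opposite points of `w`, its functional would vanish on one side of the
  -- affine relation and be positive on the other.
  have hadj : ∀ i, e (i + 1) ≠ e i + 2 := by
    intro i h
    have h0 : inner ℝ (Q.normal i) (w (e i) - Q.vertex i) = 0 := by rw [he]; simp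
    have h1 : inner ℝ (Q.normal i) (w (e i + 2) - Q.vertex i) = 0 := by
      rw [← h, he]; exact Q.normal_orthogonal i
    have h2 : ∀ j, j ≠ e i → j ≠ e i + 2 → 0 < inner ℝ (Q.normal i) (w j - Q.vertex i) := by
      intro j hj hj'
      obtain ⟨k, rfl⟩ := hsurj j
      rw [he]
      exact Q.normal_inward _ _ (fun h => hj (by rw [h])) (fun h' => hj' (by rw [h', h]))
    have hm : r 2 * inner ℝ (Q.normal i) (w 0 - Q.vertex i) +
        r 0 * inner ℝ (Q.normal i) (w 2 - Q.vertex i) =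
        r 3 * inner ℝ (Q.normal i) (w 1 - Q.vertex i) +
        r 1 * inner ℝ (Q.normal i) (w 3 - Q.vertex i) := by
      have := congrArg (inner ℝ (Q.normal i)) hrel
      simp only [inner_add_right, inner_smul_right, inner_sub_right] at this ⊢
      linear_combination this - hsum * inner ℝ (Q.normal i) (Q.vertex i)
    generalize e i = a at h0 h1 h2
    have p0 := hr 0
    have p1 := hr 1
    have p2 := hr 2
    have p3 := hr 3
    fin_cases a
    · have q1 := h2 1 (by decide) (by decide)
      have q3 := h2 3 (by decide) (by decide)
      simp at h0 h1
      rw [h0, h1] at hm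
      nlinarith [mul_pos p3 q1, mul_pos p1 q3]
    · have q1 := h2 0 (by decide) (by decide)
      have q3 := h2 2 (by decide) (by decide)
      simp at h0 h1
      rw [h0, h1] at hm
      nlinarith [mul_pos p2 q1, mul_pos p0 q3]
    · have q1 := h2 1 (by decide) (by decide)
      have q3 := h2 3 (by decide) (by decide)
      simp at h0 h1
      rw [h0, h1] at hm
      nlinarith [mul_pos p3 q1, mul_pos p1 q3]
    · have q1 := h2 0 (by decide) (by decide)
      have q3 := h2 2 (by decide) (by decide)
      simp at h0
      have h1 : inner ℝ (Q.normal i) (w 1 - Q.vertex i) = 0 := h1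
      rw [h0, h1] at hm
      nlinarith [mul_pos p2 q1, mul_pos p0 q3]
  have hd := fin4_dihedral (e 0) (e 1) (e 2) (e 3) ⟨⟨hinj.ne (by decide), hinj.ne (by decide),
    hinj.ne (by decide), hinj.ne (by decide), hinj.ne (by decide), hinj.ne (by decide)⟩,
    hadj 0, hadj 1, hadj 2, hadj 3⟩
  rcases hd with ⟨h1, h2, h3⟩ | ⟨h1, h2, h3⟩
  · have hi : ∀ i, e i = i + e 0 := by
      intro i; fin_cases i
      exacts [by simp, h1, h2, h3]
    refine ⟨Q.rotate (-e 0), Q.sameAs_rotate _, fun i => ?_⟩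
    change Q.vertex (i + -e 0) = w i
    rw [← he, hi (i + -e 0)]
    simp
  · have hi : ∀ i, e i = e 0 - i := by
      intro i; fin_cases i
      exacts [by simp, h1, h2, h3]
    refine ⟨(Q.rotate (e 0)).reflect, (Q.sameAs_rotate _).trans (sameAs_reflect _), fun i => ?_⟩
    change Q.vertex (-i + e 0) = w i
    rw [← he, hi (-i + e 0)]
    simp

end LabeledQuadrilateral

/-! ### Bilinear charts -/

/-- A bilinear map from a rectangle to the plane. -/
structure Grid where
  α₁ : ℝ
  α₂ : ℝ
  β₁ : ℝ
  β₂ : ℝ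
  c₀ : Plane
  c₁ : Plane
  c₂ : Plane
  c₃ : Plane
  κ : ℝ
  hα : α₁ < α₂
  hβ : β₁ < β₂
  hκ : κ ≠ 0

namespace Grid

variable (C : Grid)

/-- The bilinear map. -/
def map (x y : ℝ) : Plane := C.c₀ + x • C.c₁ + y • C.c₂ + (x * y) • C.c₃

/-- The derivative of the bilinear map in the direction of `x`. -/
def X (y : ℝ) : Plane := C.c₁ + y • C.c₃

/-- The derivative of the bilinear map in the direction of `y`. -/
def Y (x : ℝ) : Plane := C.c₂ + x • C.c₃

/-- The normalized Jacobian determinant. -/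
def ρ (x y : ℝ) : ℝ := det2 (C.X y) (C.Y x) / C.κ

theorem det_eq (x y : ℝ) : det2 (C.X y) (C.Y x) = C.κ * C.ρ x y := by
  have := C.hκ
  unfold ρ; field_simp

theorem map_sub_map_left (x x' y : ℝ) : C.map x y - C.map x' y = (x - x') • C.X y := by
  unfold map X; module

theorem map_sub_map_right (x y y' : ℝ) : C.map x y - C.map x y' = (y - y') • C.Y x := by
  unfold map Y; module

/-- The corners of the rectangle in cyclic order. -/
def corner : Fin 4 → Plane :=
  ![C.map C.α₁ C.β₁, C.map C.α₂ C.β₁, C.map C.α₂ C.β₂, C.map C.α₁ C.β₂]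

/-- The map is affine in each variable: first combine corners along the two horizontal sides, then
combine the two resulting points along a vertical line. -/
theorem map_mem_convexHull {x y : ℝ} (hx : x ∈ Set.Icc C.α₁ C.α₂) (hy : y ∈ Set.Icc C.β₁ C.β₂) :
    C.map x y ∈ convexHull ℝ (Set.range C.corner) := by
  have h1 : ∀ y', C.map C.α₁ y' ∈ convexHull ℝ (Set.range C.corner) →
      C.map C.α₂ y' ∈ convexHull ℝ (Set.range C.corner) →
      C.map x y' ∈ convexHull ℝ (Set.range C.corner) := by
    intro y' ha hb
    have hα := sub_pos.2 C.hα
    have := (convex_convexHull ℝ (Set.range C.corner)) ha hb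
      (div_nonneg (sub_nonneg.2 hx.2) hα.le) (div_nonneg (sub_nonneg.2 hx.1) hα.le)
      (by field_simp; ring)
    convert this using 1
    have e : x = (C.α₂ - x) / (C.α₂ - C.α₁) * C.α₁ + (x - C.α₁) / (C.α₂ - C.α₁) * C.α₂ := by
      field_simp; ring
    have e1 : (C.α₂ - x) / (C.α₂ - C.α₁) + (x - C.α₁) / (C.α₂ - C.α₁) = 1 := by
      field_simp; ring
    set a := (C.α₂ - x) / (C.α₂ - C.α₁)
    set b := (x - C.α₁) / (C.α₂ - C.α₁)
    have hb : b = 1 - a := by linarith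
    rw [hb] at e ⊢
    rw [e]
    unfold map; module
  have hc : ∀ i, C.corner i ∈ convexHull ℝ (Set.range C.corner) :=
    fun i => subset_convexHull _ _ ⟨i, rfl⟩
  have ha := h1 C.β₁ (hc 0) (hc 1)
  have hb := h1 C.β₂ (hc 3) (hc 2)
  have hβ := sub_pos.2 C.hβ
  have := (convex_convexHull ℝ (Set.range C.corner)) ha hb
    (div_nonneg (sub_nonneg.2 hy.2) hβ.le) (div_nonneg (sub_nonneg.2 hy.1) hβ.le)
    (by field_simp; ring)
  convert this using 1
  have e : y = (C.β₂ - y) / (C.β₂ - C.β₁) * C.β₁ + (y - C.β₁) / (C.β₂ - C.β₁) * C.β₂ := by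
    field_simp; ring
  have e1 : (C.β₂ - y) / (C.β₂ - C.β₁) + (y - C.β₁) / (C.β₂ - C.β₁) = 1 := by
    field_simp; ring
  set a := (C.β₂ - y) / (C.β₂ - C.β₁)
  set b := (y - C.β₁) / (C.β₂ - C.β₁)
  have hb : b = 1 - a := by linarith
  rw [hb] at e ⊢
  rw [e]
  unfold map; module

/-- The weight of each corner is the Jacobian at the opposite corner. This is the relation by which
`exists_sameAs_vertex_eq` tells adjacent corners from opposite ones. -/
theorem corner_relation : C.ρ C.α₂ C.β₂ • C.corner 0 + C.ρ C.α₁ C.β₁ • C.corner 2 =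
    C.ρ C.α₁ C.β₂ • C.corner 1 + C.ρ C.α₂ C.β₁ • C.corner 3 := by
  apply plane_ext <;> simp [corner, map, ρ, X, Y, det2] <;> ring

theorem corner_relation_sum : C.ρ C.α₂ C.β₂ + C.ρ C.α₁ C.β₁ =
    C.ρ C.α₁ C.β₂ + C.ρ C.α₂ C.β₁ := by
  simp [ρ, X, Y, det2]; ring

/-- The matrix `v vᵀ`. -/
def sq (v : Plane) : Matrix (Fin 2) (Fin 2) ℝ := Matrix.of fun i j => v i * v j

/-- The matrix with the values `a`, `b` of the functions `A`, `B` at `(x, y)`. -/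
def mat (a b x y : ℝ) : Matrix (Fin 2) (Fin 2) ℝ :=
  (1 / C.ρ x y) • (a • sq (C.X y) + b • sq (C.Y x))

end Grid

/-- A bilinear parametrization of `Δ` by a rectangle, with smooth inverse on a neighbourhood. -/
structure BilinearChart (Q : LabeledQuadrilateral) extends Grid where
  x : Plane → ℝ
  y : Plane → ℝ
  U : Set Plane
  isOpen_U : IsOpen U
  contDiffOn_x : ContDiffOn ℝ ∞ x U
  contDiffOn_y : ContDiffOn ℝ ∞ y U
  ρ_pos : ∀ s ∈ Set.Icc α₁ α₂, ∀ t ∈ Set.Icc β₁ β₂, 0 < toGrid.ρ s t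
  map_mem_U : ∀ s t, 0 < toGrid.ρ s t → toGrid.map s t ∈ U
  x_map : ∀ s t, 0 < toGrid.ρ s t → x (toGrid.map s t) = s
  y_map : ∀ s t, 0 < toGrid.ρ s t → y (toGrid.map s t) = t
  map_coord : ∀ p ∈ U, toGrid.map (x p) (y p) = p
  ρ_coord_pos : ∀ p ∈ U, 0 < toGrid.ρ (x p) (y p)
  mem_polytope_iff : ∀ p, p ∈ Q.polytope ↔ ∃ s ∈ Set.Icc α₁ α₂, ∃ t ∈ Set.Icc β₁ β₂,
    toGrid.map s t = p
  vertex_eq : ∀ i, Q.vertex i = toGrid.corner i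

namespace BilinearChart

variable {Q : LabeledQuadrilateral} (C : BilinearChart Q)

/-- The matrix function `H_{A,B}`. -/
def matH (A B : Polynomial ℝ) (p : Plane) : Matrix (Fin 2) (Fin 2) ℝ :=
  C.mat (A.eval (C.x p)) (B.eval (C.y p)) (C.x p) (C.y p)

end BilinearChart

/-! ### The bilinear chart of a separating chart -/

namespace Shape

/-- The coefficients of the bilinear map `σ`. -/
def lin : Shape → Fin 3 → Plane
  | product => ![!₂[1, 0], !₂[0, 1], 0]
  | calabi => ![!₂[1, 0], 0, !₂[0, 1]]
  | orthotoric => ![!₂[1, 0], !₂[1, 0], !₂[0, 1]]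

theorem sigma_eq (s : Shape) (x y : ℝ) :
    s.sigma x y = x • s.lin 0 + y • s.lin 1 + (x * y) • s.lin 2 := by
  cases s <;> apply plane_ext <;> simp [sigma, lin]

/-- The Jacobian determinant of `σ`. -/
def density : Shape → ℝ → ℝ → ℝ
  | product, _, _ => 1
  | calabi, x, _ => x
  | orthotoric, x, y => x - y

/-- The domain of the inverse of `σ`. -/
def domain : Shape → Set Plane
  | product => Set.univ
  | calabi => {p | 0 < p 0}
  | orthotoric => {p | 0 < p 0 ^ 2 - 4 * p 1}

theorem isOpen_domain (s : Shape) : IsOpen s.domain := by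
  cases s
  · exact isOpen_univ
  · exact isOpen_lt continuous_const (by fun_prop)
  · exact isOpen_lt continuous_const (by fun_prop)

theorem contDiff_coord (i : Fin 2) : ContDiff ℝ ∞ fun p : Plane => p i := by fun_prop

theorem contDiffOn_xCoord (s : Shape) : ContDiffOn ℝ ∞ s.xCoord s.domain := by
  cases s
  · exact (contDiff_coord 0).contDiffOn
  · exact (contDiff_coord 0).contDiffOn
  · intro p hp
    apply ContDiffAt.contDiffWithinAt
    have hp : 0 < p 0 ^ 2 - 4 * p 1 := hp
    have h0 := (contDiff_coord 0).contDiffAt (x := p)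
    have h1 := (contDiff_coord 1).contDiffAt (x := p)
    exact (h0.add (((h0.pow 2).sub (contDiffAt_const.mul h1)).sqrt hp.ne')).div_const 2

theorem contDiffOn_yCoord (s : Shape) : ContDiffOn ℝ ∞ s.yCoord s.domain := by
  cases s
  · exact (contDiff_coord 1).contDiffOn
  · exact (contDiff_coord 1).contDiffOn.div (contDiff_coord 0).contDiffOn
      fun p (hp : 0 < p 0) => hp.ne'
  · intro p hp
    apply ContDiffAt.contDiffWithinAt
    have hp : 0 < p 0 ^ 2 - 4 * p 1 := hp
    have h0 := (contDiff_coord 0).contDiffAt (x := p)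
    have h1 := (contDiff_coord 1).contDiffAt (x := p)
    exact (h0.sub (((h0.pow 2).sub (contDiffAt_const.mul h1)).sqrt hp.ne')).div_const 2

theorem density_pos (s : Shape) {a b c d x y : ℝ} (h : s.Admissible a b c d)
    (hx : x ∈ Set.Icc a b) (hy : y ∈ Set.Icc c d) : 0 < s.density x y := by
  cases s
  · exact one_pos
  · exact lt_of_lt_of_le h.2.2.1 hx.1
  · have := h.2.2
    have := hx.1
    have := hy.2
    show 0 < x - y
    linarith

theorem sigma_mem_domain (s : Shape) {x y : ℝ} (h : 0 < s.density x y) :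
    s.sigma x y ∈ s.domain ∧ s.xCoord (s.sigma x y) = x ∧ s.yCoord (s.sigma x y) = y := by
  cases s
  · simp [domain, sigma, xCoord, yCoord]
  · have h : 0 < x := h
    simp [domain, sigma, xCoord, yCoord, h, h.ne']
  · have h : 0 < x - y := h
    have e : (x + y) ^ 2 - 4 * (x * y) = (x - y) ^ 2 := by ring
    simp [domain, sigma, xCoord, yCoord, e, Real.sqrt_sq h.le]
    nlinarith [pow_pos h 2]

theorem sigma_coord (s : Shape) {p : Plane} (h : p ∈ s.domain) :
    s.sigma (s.xCoord p) (s.yCoord p) = p ∧ 0 < s.density (s.xCoord p) (s.yCoord p) := by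
  cases s
  · exact ⟨plane_ext rfl rfl, one_pos⟩
  · have h : 0 < p 0 := h
    refine ⟨plane_ext rfl ?_, h⟩
    simp [sigma, xCoord, yCoord]; field_simp
  · have h : 0 < p 0 ^ 2 - 4 * p 1 := h
    have e := Real.sq_sqrt h.le
    refine ⟨plane_ext ?_ ?_, ?_⟩
    · simp [sigma, xCoord, yCoord]; ring
    · simp [sigma, xCoord, yCoord]; linear_combination -e / 4
    · simp [density, xCoord, yCoord]
      have := Real.sqrt_pos.2 h
      linarith

/-- The three matrices are a single expression in the velocities of σ and its Jacobian. This is what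
allows the analysis to proceed without distinguishing cases. -/
theorem matrix_eq (s : Shape) (a b x y : ℝ) :
    s.matrix a b x y = (1 / s.density x y) • (a • Grid.sq (s.lin 0 + y • s.lin 2) +
      b • Grid.sq (s.lin 1 + x • s.lin 2)) := by
  cases s <;> ext i j <;> fin_cases i <;> fin_cases j <;>
    simp [matrix, density, lin, Grid.sq] <;> grind

theorem det2_lin (s : Shape) (x y : ℝ) :
    det2 (s.lin 0 + y • s.lin 2) (s.lin 1 + x • s.lin 2) = s.density x y := by
  cases s <;> simp [det2, density, lin]

theorem Admissible.lt {s : Shape} {a b c d : ℝ} (h : s.Admissible a b c d) : a < b ∧ c < d := by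
  cases s
  exacts [h, ⟨h.1, h.2.1⟩, ⟨h.1, h.2.1⟩]

end Shape

namespace SeparatingChart

variable (N : SeparatingChart)

/-- The inverse of the linear part of the affine isomorphism. -/
def M : Plane ≃ₗ[ℝ] Plane := N.toAffine.linear.symm

theorem M_apply (v : Plane) (i : Fin 2) : N.M v i = ∑ j, N.invLinear i j * v j := by
  have : v = ∑ j, v j • (EuclideanSpace.single j 1 : Plane) := by
    apply plane_ext <;> simp [Fin.sum_univ_two]
  conv_lhs => rw [this]
  simp [Fin.sum_univ_two, invLinear, M, mul_comm]

theorem det2_M (v w : Plane) : det2 (N.M v) (N.M w) = N.invLinear.det * det2 v w := by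
  simp only [det2, M_apply, Matrix.det_fin_two, Fin.sum_univ_two]; ring

theorem det_invLinear_ne_zero : N.invLinear.det ≠ 0 := by
  intro h
  have e := N.det2_M (N.M.symm !₂[1, 0]) (N.M.symm !₂[0, 1])
  rw [h] at e
  simp [det2] at e

theorem symm_apply (p : Plane) : N.toAffine.symm p = N.toAffine.symm 0 + N.M p := by
  have := N.toAffine.symm.map_vadd 0 p
  simp only [vadd_eq_add, add_zero] at this
  rw [this, add_comm]
  rfl

/-- The bilinear map `φ⁻¹ ∘ σ`. -/
def grid : Grid where
  α₁ := N.α₁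
  α₂ := N.α₂
  β₁ := N.β₁
  β₂ := N.β₂
  c₀ := N.toAffine.symm 0
  c₁ := N.M (N.shape.lin 0)
  c₂ := N.M (N.shape.lin 1)
  c₃ := N.M (N.shape.lin 2)
  κ := N.invLinear.det
  hα := N.admissible.lt.1
  hβ := N.admissible.lt.2
  hκ := N.det_invLinear_ne_zero

theorem grid_map (x y : ℝ) : N.grid.map x y = N.toAffine.symm (N.shape.sigma x y) := by
  rw [symm_apply, Shape.sigma_eq]
  simp [Grid.map, grid, add_assoc]

theorem grid_X (y : ℝ) : N.grid.X y = N.M (N.shape.lin 0 + y • N.shape.lin 2) := by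
  simp [Grid.X, grid]

theorem grid_Y (x : ℝ) : N.grid.Y x = N.M (N.shape.lin 1 + x • N.shape.lin 2) := by
  simp [Grid.Y, grid]

/-- Because κ is the determinant of the linear part of φ⁻¹, it absorbs scale and orientation. The
function ρ is the Jacobian of σ alone, positive on the rectangle whether or not φ preserves
orientation. -/
theorem grid_ρ (x y : ℝ) : N.grid.ρ x y = N.shape.density x y := by
  rw [Grid.ρ, grid_X, grid_Y, det2_M, Shape.det2_lin]
  exact mul_div_cancel_left₀ _ N.det_invLinear_ne_zero

/-- The corners of the rectangle agree with the vertices of Δ only up to a rotation or reflection of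
the numbering, so the chart is attached to a renumbered copy of the quadrilateral. -/
theorem exists_bilinearChart {Q : LabeledQuadrilateral} (h : N.Represents Q) :
    ∃ Q', LabeledQuadrilateral.SameAs Q Q' ∧ ∃ C : BilinearChart Q',
      C.α₁ = N.α₁ ∧ C.α₂ = N.α₂ ∧ C.β₁ = N.β₁ ∧ C.β₂ = N.β₂ ∧
      ∀ A B, N.matrixH A B = C.matH A B := by
  have hmem : ∀ p, p ∈ Q.polytope ↔ ∃ s ∈ Set.Icc N.α₁ N.α₂, ∃ t ∈ Set.Icc N.β₁ N.β₂,
      N.grid.map s t = p := by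
    intro p
    have : p ∈ Q.polytope ↔ N.toAffine p ∈ N.toAffine '' Q.polytope := by
      rw [N.toAffine.injective.mem_set_image]
    rw [this, h]
    simp only [Set.mem_ofPred_eq, grid_map]
    constructor <;> rintro ⟨s, hs, t, ht, e⟩ <;> refine ⟨s, hs, t, ht, ?_⟩
    · rw [← e]; simp
    · rw [← e]; simp
  have hρ : ∀ s ∈ Set.Icc N.α₁ N.α₂, ∀ t ∈ Set.Icc N.β₁ N.β₂, 0 < N.grid.ρ s t := by
    intro s hs t ht
    rw [grid_ρ]
    exact N.shape.density_pos N.admissible hs ht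
  have la : N.α₁ ∈ Set.Icc N.α₁ N.α₂ := ⟨le_rfl, N.admissible.lt.1.le⟩
  have lb : N.α₂ ∈ Set.Icc N.α₁ N.α₂ := ⟨N.admissible.lt.1.le, le_rfl⟩
  have lc : N.β₁ ∈ Set.Icc N.β₁ N.β₂ := ⟨le_rfl, N.admissible.lt.2.le⟩
  have ld : N.β₂ ∈ Set.Icc N.β₁ N.β₂ := ⟨N.admissible.lt.2.le, le_rfl⟩
  obtain ⟨Q', hQ', hv⟩ := Q.exists_sameAs_vertex_eq N.grid.corner
    ![N.grid.ρ N.α₁ N.β₁, N.grid.ρ N.α₂ N.β₁, N.grid.ρ N.α₂ N.β₂, N.grid.ρ N.α₁ N.β₂]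
    (by
      apply Set.Subset.antisymm
      · intro p hp
        obtain ⟨s, hs, t, ht, rfl⟩ := (hmem p).1 hp
        exact N.grid.map_mem_convexHull hs ht
      · refine convexHull_min ?_ Q.convex_polytope
        rintro _ ⟨i, rfl⟩
        rw [hmem]
        fin_cases i
        exacts [⟨_, la, _, lc, rfl⟩, ⟨_, lb, _, lc, rfl⟩, ⟨_, lb, _, ld, rfl⟩, ⟨_, la, _, ld, rfl⟩])
    (by
      intro i
      fin_cases i
      exacts [hρ _ la _ lc, hρ _ lb _ lc, hρ _ lb _ ld, hρ _ la _ ld])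
    N.grid.corner_relation N.grid.corner_relation_sum
  have hφ : ContDiff ℝ ∞ N.toAffine := by
    have : ∀ p, N.toAffine p = N.toAffine.linear p + N.toAffine 0 := by
      intro p
      have := N.toAffine.map_vadd 0 p
      simpa using this
    rw [show (N.toAffine : Plane → Plane) = fun p =>
      (LinearMap.toContinuousLinearMap (N.toAffine.linear : Plane →ₗ[ℝ] Plane)) p + N.toAffine 0
      from funext this]
    exact (ContinuousLinearMap.contDiff _).add contDiff_const
  refine ⟨Q', hQ',
    { N.grid with
      x := fun p => N.shape.xCoord (N.toAffine p)
      y := fun p => N.shape.yCoord (N.toAffine p)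
      U := N.toAffine ⁻¹' N.shape.domain
      isOpen_U := N.shape.isOpen_domain.preimage hφ.continuous
      contDiffOn_x := N.shape.contDiffOn_xCoord.comp hφ.contDiffOn (Set.mapsTo_preimage _ _)
      contDiffOn_y := N.shape.contDiffOn_yCoord.comp hφ.contDiffOn (Set.mapsTo_preimage _ _)
      ρ_pos := hρ
      map_mem_U := ?_
      x_map := ?_
      y_map := ?_
      map_coord := ?_
      ρ_coord_pos := ?_
      mem_polytope_iff := ?_
      vertex_eq := hv }, rfl, rfl, rfl, rfl, ?_⟩
  · intro s t hst
    change 0 < N.grid.ρ s t at hst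
    change N.toAffine (N.grid.map s t) ∈ N.shape.domain
    rw [grid_ρ] at hst
    rw [grid_map, AffineEquiv.apply_symm_apply]
    exact (N.shape.sigma_mem_domain hst).1
  · intro s t hst
    change 0 < N.grid.ρ s t at hst
    rw [grid_ρ] at hst
    rw [grid_map, AffineEquiv.apply_symm_apply]
    exact (N.shape.sigma_mem_domain hst).2.1
  · intro s t hst
    change 0 < N.grid.ρ s t at hst
    rw [grid_ρ] at hst
    rw [grid_map, AffineEquiv.apply_symm_apply]
    exact (N.shape.sigma_mem_domain hst).2.2
  · intro p hp
    rw [grid_map, (N.shape.sigma_coord hp).1, AffineEquiv.symm_apply_apply]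
  · intro p hp
    rw [grid_ρ]
    exact (N.shape.sigma_coord hp).2
  · rw [hQ'.polytope_eq]
    exact hmem
  · intro A B
    funext p
    change _ = N.grid.mat _ _ _ _
    unfold matrixH Grid.mat
    rw [Shape.matrix_eq, grid_ρ, grid_X, grid_Y]
    ext i j
    simp [Matrix.mul_apply, Fin.sum_univ_two, Grid.sq, M_apply]
    ring

end SeparatingChart

/-! ### Edges, normals and interior in the chart -/

namespace Grid

variable (C : Grid)

theorem inner_perp_Y_X (s t : ℝ) : inner ℝ (perp (C.Y s)) (C.X t) = C.κ * C.ρ s t := by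
  rw [inner_perp, det_eq]

theorem inner_perp_Y_Y (s : ℝ) : inner ℝ (perp (C.Y s)) (C.Y s) = 0 := by
  rw [inner_perp, det2_self]

theorem inner_perp_X_X (t : ℝ) : inner ℝ (perp (C.X t)) (C.X t) = 0 := by
  rw [inner_perp, det2_self]

theorem inner_perp_X_Y (s t : ℝ) : inner ℝ (perp (C.X t)) (C.Y s) = -(C.κ * C.ρ s t) := by
  rw [inner_perp, ← det_eq]; simp only [det2]; ring

theorem hasDerivAt_map_left (s t : ℝ) : HasDerivAt (fun s => C.map s t) (C.X t) s := by
  have : (fun s => C.map s t) = fun s => (C.c₀ + t • C.c₂) + s • C.X t := by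
    funext s; unfold map X; module
  rw [this]
  simpa using ((hasDerivAt_id s).smul_const (C.X t)).const_add (C.c₀ + t • C.c₂)

theorem hasDerivAt_map_right (s t : ℝ) : HasDerivAt (fun t => C.map s t) (C.Y s) t := by
  have : (fun t => C.map s t) = fun t => (C.c₀ + s • C.c₁) + t • C.Y s := by
    funext t; unfold map Y; module
  rw [this]
  simpa using ((hasDerivAt_id t).smul_const (C.Y s)).const_add (C.c₀ + s • C.c₁)

theorem continuous_map : Continuous fun q : ℝ × ℝ => C.map q.1 q.2 := by
  unfold map; fun_prop

theorem contDiff_map : ContDiff ℝ ∞ fun q : ℝ × ℝ => C.map q.1 q.2 := by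
  unfold map; fun_prop

theorem continuous_ρ : Continuous fun q : ℝ × ℝ => C.ρ q.1 q.2 := by
  unfold ρ det2 X Y; fun_prop

/-- The derivative of the bilinear map. -/
def mapDeriv (s t : ℝ) : ℝ × ℝ →L[ℝ] Plane :=
  (ContinuousLinearMap.fst ℝ ℝ ℝ).smulRight (C.X t) +
    (ContinuousLinearMap.snd ℝ ℝ ℝ).smulRight (C.Y s)

theorem hasFDerivAt_map (q : ℝ × ℝ) :
    HasFDerivAt (fun q : ℝ × ℝ => C.map q.1 q.2) (C.mapDeriv q.1 q.2) q := by
  have hd : DifferentiableAt ℝ (fun q : ℝ × ℝ => C.map q.1 q.2) q :=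
    (C.contDiff_map.differentiable (by simp)).differentiableAt
  convert hd.hasFDerivAt using 1
  apply ContinuousLinearMap.ext
  rintro ⟨a, b⟩
  have h1 : fderiv ℝ (fun q : ℝ × ℝ => C.map q.1 q.2) q (1, 0) = C.X q.2 := by
    have hc : HasDerivAt (fun s : ℝ => (s, q.2)) ((1 : ℝ), (0 : ℝ)) q.1 :=
      (hasDerivAt_id q.1).prodMk (hasDerivAt_const _ _)
    exact (HasFDerivAt.comp_hasDerivAt (l := fun q : ℝ × ℝ => C.map q.1 q.2) q.1
      hd.hasFDerivAt hc).unique (C.hasDerivAt_map_left q.1 q.2)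
  have h2 : fderiv ℝ (fun q : ℝ × ℝ => C.map q.1 q.2) q (0, 1) = C.Y q.1 := by
    have hc : HasDerivAt (fun s : ℝ => (q.1, s)) ((0 : ℝ), (1 : ℝ)) q.2 :=
      (hasDerivAt_const _ _).prodMk (hasDerivAt_id q.2)
    exact (HasFDerivAt.comp_hasDerivAt (l := fun q : ℝ × ℝ => C.map q.1 q.2) q.2
      hd.hasFDerivAt hc).unique (C.hasDerivAt_map_right q.1 q.2)
  have : ((a, b) : ℝ × ℝ) = a • ((1 : ℝ), (0 : ℝ)) + b • ((0 : ℝ), (1 : ℝ)) := by simp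
  rw [this, map_add, map_add, map_smul, map_smul, map_smul, map_smul, h1, h2]
  simp [mapDeriv]

theorem left_mem : C.α₁ ∈ Set.Icc C.α₁ C.α₂ := ⟨le_rfl, C.hα.le⟩
theorem right_mem : C.α₂ ∈ Set.Icc C.α₁ C.α₂ := ⟨C.hα.le, le_rfl⟩
theorem bot_mem : C.β₁ ∈ Set.Icc C.β₁ C.β₂ := ⟨le_rfl, C.hβ.le⟩
theorem top_mem : C.β₂ ∈ Set.Icc C.β₁ C.β₂ := ⟨C.hβ.le, le_rfl⟩

end Grid

namespace BilinearChart

variable {Q : LabeledQuadrilateral} (C : BilinearChart Q)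

theorem map_mem_polytope {s t : ℝ} (hs : s ∈ Set.Icc C.α₁ C.α₂) (ht : t ∈ Set.Icc C.β₁ C.β₂) :
    C.map s t ∈ Q.polytope := (C.mem_polytope_iff _).2 ⟨s, hs, t, ht, rfl⟩

theorem polytope_subset : Q.polytope ⊆ C.U := by
  intro p hp
  obtain ⟨s, hs, t, ht, rfl⟩ := (C.mem_polytope_iff p).1 hp
  exact C.map_mem_U _ _ (C.ρ_pos s hs t ht)

theorem vertex_zero : Q.vertex 0 = C.map C.α₁ C.β₁ := C.vertex_eq 0
theorem vertex_one : Q.vertex 1 = C.map C.α₂ C.β₁ := C.vertex_eq 1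
theorem vertex_two : Q.vertex 2 = C.map C.α₂ C.β₂ := C.vertex_eq 2
theorem vertex_three : Q.vertex 3 = C.map C.α₁ C.β₂ := C.vertex_eq 3

/-- The normals are positive multiples of the inward conormals of the edges of the rectangle. -/
theorem exists_normal_eq : ∃ ν : Fin 4 → ℝ, (∀ i, 0 < ν i) ∧
    Q.normal 0 = (-(ν 0) / C.κ) • perp (C.X C.β₁) ∧ Q.normal 1 = (-(ν 1) / C.κ) • perp (C.Y C.α₂) ∧
    Q.normal 2 = (ν 2 / C.κ) • perp (C.X C.β₂) ∧ Q.normal 3 = (ν 3 / C.κ) • perp (C.Y C.α₁) := by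
  have hκ := C.hκ
  have r0 := C.ρ_pos _ C.left_mem _ C.bot_mem
  have r2 := C.ρ_pos _ C.right_mem _ C.top_mem
  have hα := sub_pos.2 C.hα
  have hβ := sub_pos.2 C.hβ
  have o := Q.normal_orthogonal
  have o0 : inner ℝ (Q.normal 0) (C.X C.β₁) = 0 := by
    have := o 0
    rw [show (0 : Fin 4) + 1 = 1 from rfl, C.vertex_one, C.vertex_zero, Grid.map_sub_map_left,
      inner_smul_right] at this
    exact (mul_eq_zero.1 this).resolve_left hα.ne'
  have o1 : inner ℝ (Q.normal 1) (C.Y C.α₂) = 0 := by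
    have := o 1
    rw [show (1 : Fin 4) + 1 = 2 from rfl, C.vertex_one, C.vertex_two, Grid.map_sub_map_right,
      inner_smul_right] at this
    exact (mul_eq_zero.1 this).resolve_left hβ.ne'
  have o2 : inner ℝ (Q.normal 2) (C.X C.β₂) = 0 := by
    have := o 2
    rw [show (2 : Fin 4) + 1 = 3 from rfl, C.vertex_three, C.vertex_two, Grid.map_sub_map_left,
      inner_smul_right] at this
    exact (mul_eq_zero.1 this).resolve_left (by linarith)
  have o3 : inner ℝ (Q.normal 3) (C.Y C.α₁) = 0 := by
    have := o 3
    rw [show (3 : Fin 4) + 1 = 0 from rfl, C.vertex_three, C.vertex_zero, Grid.map_sub_map_right,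
      inner_smul_right] at this
    exact (mul_eq_zero.1 this).resolve_left (by linarith)
  have i0 : 0 < inner ℝ (Q.normal 0) (C.Y C.α₁) := by
    have := Q.normal_inward 0 3 (by decide) (by decide)
    rw [C.vertex_three, C.vertex_zero, Grid.map_sub_map_right, inner_smul_right] at this
    exact (mul_pos_iff_of_pos_left hβ).1 this
  have i1 : inner ℝ (Q.normal 1) (C.X C.β₂) < 0 := by
    have h := Q.normal_inward 1 3 (by decide) (by decide)
    have := o 1
    rw [show (1 : Fin 4) + 1 = 2 from rfl] at this
    rw [← sub_add_sub_cancel _ (Q.vertex 2), inner_add_right, this, C.vertex_three, C.vertex_two,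
      Grid.map_sub_map_left, inner_smul_right] at h
    nlinarith
  have i2 : inner ℝ (Q.normal 2) (C.Y C.α₂) < 0 := by
    have h := Q.normal_inward 2 1 (by decide) (by decide)
    rw [C.vertex_one, C.vertex_two, Grid.map_sub_map_right, inner_smul_right] at h
    nlinarith
  have i3 : 0 < inner ℝ (Q.normal 3) (C.X C.β₁) := by
    have h := Q.normal_inward 3 1 (by decide) (by decide)
    have := o 3
    rw [show (3 : Fin 4) + 1 = 0 from rfl] at this
    rw [← sub_add_sub_cancel _ (Q.vertex 0), inner_add_right, this, C.vertex_one, C.vertex_zero,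
      Grid.map_sub_map_left, inner_smul_right] at h
    nlinarith
  have d : ∀ s t, det2 (C.Y s) (C.X t) = -(C.κ * C.ρ s t) := by
    intro s t; rw [← Grid.det_eq]; simp only [det2]; ring
  -- A conormal of an edge is unique up to scale. The factor is found by pairing the normal with the
  -- transverse velocity at one end of the edge, and inwardness fixes its sign.
  refine ⟨![inner ℝ (Q.normal 0) (C.Y C.α₁) / C.ρ C.α₁ C.β₁,
    -inner ℝ (Q.normal 1) (C.X C.β₂) / C.ρ C.α₂ C.β₂,
    -inner ℝ (Q.normal 2) (C.Y C.α₂) / C.ρ C.α₂ C.β₂,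
    inner ℝ (Q.normal 3) (C.X C.β₁) / C.ρ C.α₁ C.β₁], ?_, ?_, ?_, ?_, ?_⟩
  · intro i
    fin_cases i
    exacts [div_pos i0 r0, div_pos (by linarith) r2, div_pos (by linarith) r2, div_pos i3 r0]
  · refine (eq_smul_perp o0 (v := C.Y C.α₁) ?_).trans ?_
    · rw [d]; exact neg_ne_zero.2 (mul_ne_zero hκ r0.ne')
    · rw [d]; congr 1; simp; field_simp
  · refine (eq_smul_perp o1 (v := C.X C.β₂) ?_).trans ?_
    · rw [Grid.det_eq]; exact (mul_ne_zero hκ r2.ne')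
    · rw [Grid.det_eq]; congr 1; simp; field_simp
  · refine (eq_smul_perp o2 (v := C.Y C.α₂) ?_).trans ?_
    · rw [d]; exact neg_ne_zero.2 (mul_ne_zero hκ r2.ne')
    · rw [d]; congr 1; simp; field_simp
  · refine (eq_smul_perp o3 (v := C.X C.β₁) ?_).trans ?_
    · rw [Grid.det_eq]; exact (mul_ne_zero hκ r0.ne')
    · rw [Grid.det_eq]; congr 1; simp; field_simp

/-- The lengths of the normals relative to the coordinates. -/
def ν : Fin 4 → ℝ := C.exists_normal_eq.choose

theorem ν_pos (i : Fin 4) : 0 < C.ν i := C.exists_normal_eq.choose_spec.1 i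
theorem normal_zero : Q.normal 0 = (-(C.ν 0) / C.κ) • perp (C.X C.β₁) :=
  C.exists_normal_eq.choose_spec.2.1
theorem normal_one : Q.normal 1 = (-(C.ν 1) / C.κ) • perp (C.Y C.α₂) :=
  C.exists_normal_eq.choose_spec.2.2.1
theorem normal_two : Q.normal 2 = (C.ν 2 / C.κ) • perp (C.X C.β₂) :=
  C.exists_normal_eq.choose_spec.2.2.2.1
theorem normal_three : Q.normal 3 = (C.ν 3 / C.κ) • perp (C.Y C.α₁) :=
  C.exists_normal_eq.choose_spec.2.2.2.2

/-- The inverse coordinates are continuous on the open set `U`, so the points of `U` whose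
coordinates lie in the open intervals form an open subset of Δ. -/
theorem map_mem_interior {s t : ℝ} (hs : s ∈ Set.Ioo C.α₁ C.α₂) (ht : t ∈ Set.Ioo C.β₁ C.β₂) :
    C.map s t ∈ interior Q.polytope := by
  have hρ := C.ρ_pos s (Set.Ioo_subset_Icc_self hs) t (Set.Ioo_subset_Icc_self ht)
  rw [mem_interior]
  refine ⟨(C.U ∩ C.x ⁻¹' Set.Ioo C.α₁ C.α₂) ∩ (C.U ∩ C.y ⁻¹' Set.Ioo C.β₁ C.β₂), ?_, ?_, ?_⟩
  · rintro p ⟨⟨hU, hx⟩, -, hy⟩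
    rw [← C.map_coord p hU]
    exact C.map_mem_polytope (Set.Ioo_subset_Icc_self hx) (Set.Ioo_subset_Icc_self hy)
  · exact (C.contDiffOn_x.continuousOn.isOpen_inter_preimage C.isOpen_U isOpen_Ioo).inter
      (C.contDiffOn_y.continuousOn.isOpen_inter_preimage C.isOpen_U isOpen_Ioo)
  · have := C.map_mem_U s t hρ
    refine ⟨⟨this, ?_⟩, this, ?_⟩
    · rw [Set.mem_preimage, C.x_map _ _ hρ]; exact hs
    · rw [Set.mem_preimage, C.y_map _ _ hρ]; exact ht

theorem mem_interior_iff {p : Plane} : p ∈ interior Q.polytope ↔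
    ∃ s ∈ Set.Ioo C.α₁ C.α₂, ∃ t ∈ Set.Ioo C.β₁ C.β₂, C.map s t = p := by
  constructor
  · intro hp
    obtain ⟨s, hs, t, ht, rfl⟩ := (C.mem_polytope_iff p).1 (interior_subset hp)
    have h := fun i => Q.normal_pos_of_mem_interior i hp
    refine ⟨s, ⟨lt_of_le_of_ne hs.1 ?_, lt_of_le_of_ne hs.2 ?_⟩, t,
      ⟨lt_of_le_of_ne ht.1 ?_, lt_of_le_of_ne ht.2 ?_⟩, rfl⟩
    · rintro rfl
      have := h 3
      rw [C.vertex_three, Grid.map_sub_map_right, C.normal_three, inner_smul_left,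
        inner_smul_right, Grid.inner_perp_Y_Y] at this
      simp at this
    · rintro rfl
      have := h 1
      rw [C.vertex_one, Grid.map_sub_map_right, C.normal_one, inner_smul_left,
        inner_smul_right, Grid.inner_perp_Y_Y] at this
      simp at this
    · rintro rfl
      have := h 0
      rw [C.vertex_zero, Grid.map_sub_map_left, C.normal_zero, inner_smul_left,
        inner_smul_right, Grid.inner_perp_X_X] at this
      simp at this
    · rintro rfl
      have := h 2
      rw [C.vertex_two, Grid.map_sub_map_left, C.normal_two, inner_smul_left,
        inner_smul_right, Grid.inner_perp_X_X] at this
      simp at this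
  · rintro ⟨s, hs, t, ht, rfl⟩
    exact C.map_mem_interior hs ht

theorem mem_openFacet_of_segment {a b : ℝ} (f : ℝ → Plane) (v : Plane)
    (hf : ∀ s s', f s - f s' = (s - s') • v) (p : Plane) :
    p ∈ openSegment ℝ (f a) (f b) ↔ ∃ s ∈ openSegment ℝ a b, f s = p := by
  have hline : ∀ c : ℝ, f a + c • (f b - f a) = f (a + c * (b - a)) := by
    intro c
    have h := hf (a + c * (b - a)) a
    rw [sub_eq_iff_eq_add] at h
    rw [h, hf b a]; module
  rw [openSegment_eq_image', openSegment_eq_image']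
  constructor
  · rintro ⟨c, hc, rfl⟩
    exact ⟨_, ⟨c, hc, rfl⟩, (hline c).symm⟩
  · rintro ⟨_, ⟨c, hc, rfl⟩, rfl⟩
    exact ⟨c, hc, hline c⟩

theorem mem_openFacet_zero {p : Plane} :
    p ∈ Q.openFacet 0 ↔ ∃ s ∈ Set.Ioo C.α₁ C.α₂, C.map s C.β₁ = p := by
  rw [← openSegment_eq_Ioo C.hα]
  rw [← mem_openFacet_of_segment _ (C.X C.β₁) fun s s' => C.map_sub_map_left s s' C.β₁,
    ← C.vertex_zero, ← C.vertex_one]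
  rfl

theorem mem_openFacet_one {p : Plane} :
    p ∈ Q.openFacet 1 ↔ ∃ t ∈ Set.Ioo C.β₁ C.β₂, C.map C.α₂ t = p := by
  rw [← openSegment_eq_Ioo C.hβ]
  rw [← mem_openFacet_of_segment _ (C.Y C.α₂) fun s s' => C.map_sub_map_right C.α₂ s s',
    ← C.vertex_one, ← C.vertex_two]
  rfl

theorem mem_openFacet_two {p : Plane} :
    p ∈ Q.openFacet 2 ↔ ∃ s ∈ Set.Ioo C.α₁ C.α₂, C.map s C.β₂ = p := by
  rw [← openSegment_eq_Ioo C.hα, openSegment_symm]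
  rw [← mem_openFacet_of_segment _ (C.X C.β₂) fun s s' => C.map_sub_map_left s s' C.β₂,
    ← C.vertex_two, ← C.vertex_three]
  rfl

theorem mem_openFacet_three {p : Plane} :
    p ∈ Q.openFacet 3 ↔ ∃ t ∈ Set.Ioo C.β₁ C.β₂, C.map C.α₁ t = p := by
  rw [← openSegment_eq_Ioo C.hβ, openSegment_symm]
  rw [← mem_openFacet_of_segment _ (C.Y C.α₁) fun s s' => C.map_sub_map_right C.α₁ s s',
    ← C.vertex_three, ← C.vertex_zero]
  rfl

/-! ### Integrals in the chart -/

/-- The bilinear map as a map of the plane. -/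
def planeMap (q : Plane) : Plane := C.map (q 0) (q 1)

/-- The derivative of `planeMap`. -/
def planeMapDeriv (q : Plane) : Plane →L[ℝ] Plane :=
  (EuclideanSpace.proj (𝕜 := ℝ) (0 : Fin 2)).smulRight (C.X (q 1)) +
    (EuclideanSpace.proj (𝕜 := ℝ) (1 : Fin 2)).smulRight (C.Y (q 0))

theorem hasFDerivAt_planeMap (q : Plane) : HasFDerivAt C.planeMap (C.planeMapDeriv q) q := by
  have h := (C.hasFDerivAt_map (q 0, q 1)).comp q
    (((EuclideanSpace.proj (𝕜 := ℝ) (0 : Fin 2)).hasFDerivAt (x := q)).prodMk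
      ((EuclideanSpace.proj (𝕜 := ℝ) (1 : Fin 2)).hasFDerivAt (x := q)))
  exact h

theorem det_planeMapDeriv (q : Plane) : (C.planeMapDeriv q).det = C.κ * C.ρ (q 0) (q 1) := by
  rw [ContinuousLinearMap.det, ← LinearMap.det_toMatrix (EuclideanSpace.basisFun (Fin 2) ℝ).toBasis,
    Matrix.det_fin_two, ← Grid.det_eq]
  simp [LinearMap.toMatrix_apply, planeMapDeriv, det2, mul_comm]

/-- The rectangle as a subset of the plane. -/
def rect : Set Plane := {q | q 0 ∈ Set.Icc C.α₁ C.α₂ ∧ q 1 ∈ Set.Icc C.β₁ C.β₂}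

theorem integral_plane_eq (f : ℝ × ℝ → ℝ) (S : Set (ℝ × ℝ)) :
    ∫ q in {q : Plane | (q 0, q 1) ∈ S}, f (q 0, q 1) = ∫ z in S, f z := by
  have h1 := EuclideanSpace.volume_preserving_symm_measurableEquiv_toLp (Fin 2)
  have h2 := volume_preserving_finTwoArrow ℝ
  have h := h1.trans h2
  have he : MeasurableEmbedding
      ⇑((MeasurableEquiv.toLp 2 (Fin 2 → ℝ)).symm.trans (MeasurableEquiv.finTwoArrow (α := ℝ))) :=
    MeasurableEquiv.measurableEmbedding _
  exact h.setIntegral_preimage_emb he f S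

/-- Integrals over `Δ` in the coordinates of the chart. -/
theorem integral_polytope_eq (f : Plane → ℝ) (hf : ContinuousOn f Q.polytope) :
    ∫ p in Q.polytope, f p = ∫ s in C.α₁..C.α₂, ∫ t in C.β₁..C.β₂,
      |C.κ| * (C.ρ s t * f (C.map s t)) := by
  have himg : Q.polytope = C.planeMap '' C.rect := by
    ext p
    rw [C.mem_polytope_iff]
    constructor
    · rintro ⟨s, hs, t, ht, rfl⟩
      exact ⟨!₂[s, t], ⟨hs, ht⟩, rfl⟩
    · rintro ⟨q, ⟨hs, ht⟩, rfl⟩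
      exact ⟨_, hs, _, ht, rfl⟩
  have hmeas : MeasurableSet C.rect := by
    apply IsClosed.measurableSet
    apply IsClosed.inter
    · exact isClosed_Icc.preimage (EuclideanSpace.proj (𝕜 := ℝ) (0 : Fin 2)).continuous
    · exact isClosed_Icc.preimage (EuclideanSpace.proj (𝕜 := ℝ) (1 : Fin 2)).continuous
  have hinj : Set.InjOn C.planeMap C.rect := by
    intro q hq q' hq' h
    have r := C.ρ_pos _ hq.1 _ hq.2
    have r' := C.ρ_pos _ hq'.1 _ hq'.2
    unfold planeMap at h
    apply plane_ext
    · rw [← C.x_map _ _ r, h, C.x_map _ _ r']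
    · rw [← C.y_map _ _ r, h, C.y_map _ _ r']
  have key := integral_image_eq_integral_abs_det_fderiv_smul volume hmeas
    (fun q _ => (C.hasFDerivAt_planeMap q).hasFDerivWithinAt) hinj f
  rw [himg, key]
  have e1 : ∫ q in C.rect, |(C.planeMapDeriv q).det| • f (C.planeMap q) =
      ∫ q in C.rect, (fun z : ℝ × ℝ => |C.κ| * (C.ρ z.1 z.2 * f (C.map z.1 z.2))) (q 0, q 1) := by
    apply setIntegral_congr_fun hmeas
    intro q hq
    have r := C.ρ_pos _ hq.1 _ hq.2
    simp only [det_planeMapDeriv, abs_mul, abs_of_pos r, smul_eq_mul, planeMap]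
    ring
  rw [e1]
  have e2 := integral_plane_eq (fun z : ℝ × ℝ => |C.κ| * (C.ρ z.1 z.2 * f (C.map z.1 z.2)))
    (Set.Icc C.α₁ C.α₂ ×ˢ Set.Icc C.β₁ C.β₂)
  refine e2.trans ?_
  have hc : ContinuousOn (fun z : ℝ × ℝ => |C.κ| * (C.ρ z.1 z.2 * f (C.map z.1 z.2)))
      (Set.Icc C.α₁ C.α₂ ×ˢ Set.Icc C.β₁ C.β₂) := by
    refine continuousOn_const.mul (C.continuous_ρ.continuousOn.mul ?_)
    exact hf.comp C.continuous_map.continuousOn fun z hz => C.map_mem_polytope hz.1 hz.2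
  rw [Measure.volume_eq_prod, setIntegral_prod _
    (hc.integrableOn_compact (isCompact_Icc.prod isCompact_Icc))]
  rw [integral_Icc_eq_integral_Ioc, ← intervalIntegral.integral_of_le C.hα.le]
  congr 1
  funext s
  rw [integral_Icc_eq_integral_Ioc, ← intervalIntegral.integral_of_le C.hβ.le]

/-- The edge has length |b - a|‖v‖ and its normal has length |k|‖v‖, so ‖v‖ cancels and dν is |k|⁻¹
times the coordinate measure. The sign takes care of edges that are traversed against the
coordinate. -/
theorem edge_integral_eq {a b : ℝ} (hab : a ≠ b) (g : ℝ → Plane) (v n : Plane) (k : ℝ)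
    (hg : ∀ s s', g s - g s' = (s - s') • v) (hn : n = k • perp v) (hv : v ≠ 0) (f : Plane → ℝ) :
    ‖g b - g a‖ / ‖n‖ * ∫ t in (0 : ℝ)..1, f (g a + t • (g b - g a)) =
      SignType.sign (b - a) * |k|⁻¹ * ∫ s in a..b, f (g s) := by
  have hline : ∀ c : ℝ, g a + c • (g b - g a) = g (a + (b - a) * c) := by
    intro c
    have h := hg (a + (b - a) * c) a
    rw [sub_eq_iff_eq_add] at h
    rw [h, hg b a]; module
  have hba : b - a ≠ 0 := sub_ne_zero.2 hab.symm
  simp only [hline]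
  rw [intervalIntegral.integral_comp_add_mul (fun s => f (g s)) hba a, hg, hn, norm_smul, norm_smul,
    norm_perp]
  have : ‖v‖ ≠ 0 := norm_ne_zero_iff.2 hv
  simp only [mul_zero, add_zero, mul_one, add_sub_cancel, smul_eq_mul, Real.norm_eq_abs]
  rw [← mul_assoc]
  congr 1
  rw [mul_div_mul_right _ _ this, div_mul_eq_mul_div, mul_comm |b - a|, ← div_eq_mul_inv]
  congr 1
  rw [inv_mul_eq_div, div_eq_iff hba, sign_mul_self]

theorem X_ne_zero {t : ℝ} (ht : t ∈ Set.Icc C.β₁ C.β₂) : C.X t ≠ 0 := by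
  intro h
  have := C.ρ_pos _ C.left_mem t ht
  simp [Grid.ρ, h, det2] at this

theorem Y_ne_zero {s : ℝ} (hs : s ∈ Set.Icc C.α₁ C.α₂) : C.Y s ≠ 0 := by
  intro h
  have := C.ρ_pos s hs _ C.bot_mem
  simp [Grid.ρ, h, det2] at this

/-- The boundary integral in the coordinates of the chart. -/
theorem boundaryIntegral_eq (f : Plane → ℝ) : Q.boundaryIntegral f = |C.κ| * (
    (C.ν 3)⁻¹ * (∫ t in C.β₁..C.β₂, f (C.map C.α₁ t)) +
    (C.ν 1)⁻¹ * (∫ t in C.β₁..C.β₂, f (C.map C.α₂ t)) +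
    (C.ν 0)⁻¹ * (∫ s in C.α₁..C.α₂, f (C.map s C.β₁)) +
    (C.ν 2)⁻¹ * ∫ s in C.α₁..C.α₂, f (C.map s C.β₂)) := by
  have hα := sub_pos.2 C.hα
  have hβ := sub_pos.2 C.hβ
  have hα' : C.α₁ - C.α₂ < 0 := by linarith
  have hβ' : C.β₁ - C.β₂ < 0 := by linarith
  have h0 := edge_integral_eq C.hα.ne _ _ _ _ (fun s s' => C.map_sub_map_left s s' C.β₁)
    C.normal_zero (C.X_ne_zero C.bot_mem) f
  have h1 := edge_integral_eq C.hβ.ne _ _ _ _ (fun s s' => C.map_sub_map_right C.α₂ s s')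
    C.normal_one (C.Y_ne_zero C.right_mem) f
  have h2 := edge_integral_eq C.hα.ne' _ _ _ _ (fun s s' => C.map_sub_map_left s s' C.β₂)
    C.normal_two (C.X_ne_zero C.top_mem) f
  have h3 := edge_integral_eq C.hβ.ne' _ _ _ _ (fun s s' => C.map_sub_map_right C.α₁ s s')
    C.normal_three (C.Y_ne_zero C.left_mem) f
  have e : ∀ i, |C.ν i / C.κ|⁻¹ = |C.κ| * (C.ν i)⁻¹ := by
    intro i; rw [abs_div, abs_of_pos (C.ν_pos i), inv_div, div_eq_mul_inv]
  have e' : ∀ i, |-C.ν i / C.κ|⁻¹ = |C.κ| * (C.ν i)⁻¹ := by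
    intro i; rw [neg_div, abs_neg, e]
  rw [sign_pos hα, e'] at h0
  rw [sign_pos hβ, e'] at h1
  rw [sign_neg hα', e, intervalIntegral.integral_symm C.α₁ C.α₂] at h2
  rw [sign_neg hβ', e, intervalIntegral.integral_symm C.β₁ C.β₂] at h3
  unfold LabeledQuadrilateral.boundaryIntegral
  rw [Fin.sum_univ_four]
  simp only [show (0 : Fin 4) + 1 = 1 from rfl, show (1 : Fin 4) + 1 = 2 from rfl,
    show (2 : Fin 4) + 1 = 3 from rfl, show (3 : Fin 4) + 1 = 0 from rfl,
    C.vertex_zero, C.vertex_one, C.vertex_two, C.vertex_three]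
  rw [h0, h1, h2, h3]
  simp
  ring

end BilinearChart

/-! ### Construction of A and B from the moment equations -/

open Polynomial in
-- Integrating a quadratic twice from `a`, with initial value 0 and initial slope `k`, explains both
-- the degree bound and the explicit witness.
theorem exists_polynomial_of_deriv2 (q₀ q₁ q₂ a k : ℝ) : ∃ A : Polynomial ℝ, A.natDegree ≤ 4 ∧
    (∀ x, A.derivative.derivative.eval x = q₀ + q₁ * x + q₂ * x ^ 2) ∧ A.eval a = 0 ∧
    ∀ x, A.derivative.eval x =
      k + q₀ * (x - a) + q₁ / 2 * (x ^ 2 - a ^ 2) + q₂ / 3 * (x ^ 3 - a ^ 3) := by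
  refine ⟨C (q₂ / 12) * (X ^ 4 - C (a ^ 4)) + C (q₁ / 6) * (X ^ 3 - C (a ^ 3)) +
    C (q₀ / 2) * (X ^ 2 - C (a ^ 2)) +
    C (k - q₀ * a - q₁ / 2 * a ^ 2 - q₂ / 3 * a ^ 3) * (X - C a), ?_, ?_, ?_, ?_⟩
  · compute_degree
  · intro x
    simp [-map_pow]; ring
  · simp
  · intro x
    simp [-map_pow]; ring

theorem integral_linear (a b p q : ℝ) :
    ∫ t in a..b, (p + q * t) = (b - a) * (p + q * ((a + b) / 2)) := by
  rw [intervalIntegral.integral_add (by simp) ((Continuous.intervalIntegrable (by fun_prop) _ _))]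
  rw [intervalIntegral.integral_const_mul, integral_id, intervalIntegral.integral_const,
    smul_eq_mul]
  ring

/-- After two integrations by parts only boundary terms are left, because the linear factor has no
second derivative. -/
theorem integral_deriv2_mul_linear (A : Polynomial ℝ) (a b p q : ℝ) :
    ∫ s in a..b, A.derivative.derivative.eval s * (p + q * s) =
      ((p + q * b) * A.derivative.eval b - q * A.eval b) -
        ((p + q * a) * A.derivative.eval a - q * A.eval a) := by
  have hd : ∀ s, HasDerivAt (fun s => (p + q * s) * A.derivative.eval s - q * A.eval s)
      (A.derivative.derivative.eval s * (p + q * s)) s := by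
    intro s
    have h1 := A.hasDerivAt s
    have h2 := A.derivative.hasDerivAt s
    have h3 : HasDerivAt (fun s => p + q * s) q s := by
      simpa using ((hasDerivAt_id s).const_mul q).const_add p
    refine ((h3.mul h2).sub (h1.const_mul q)).congr_deriv ?_
    ring
  exact intervalIntegral.integral_eq_sub_of_hasDerivAt (fun s _ => hd s)
    (Continuous.intervalIntegrable (by fun_prop) _ _)

namespace LabeledQuadrilateral

variable (Q : LabeledQuadrilateral)

theorem continuous_affineBasisFun (i : Fin 3) : Continuous (affineBasisFun i) := by
  unfold affineBasisFun
  fin_cases i <;> simp <;> fun_prop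

theorem continuous_extremalAffine : Continuous Q.extremalAffine := by
  unfold extremalAffine
  exact continuous_finsetSum _ fun i _ => continuous_const.mul (continuous_affineBasisFun i)

/-- The defining property of the extremal affine function. -/
theorem integral_affineBasisFun_mul_extremalAffine (i : Fin 3) :
    ∫ p in Q.polytope, affineBasisFun i p * Q.extremalAffine p =
      2 * Q.boundaryIntegral (affineBasisFun i) := by
  have h := congrFun Q.momentMatrix_mulVec_extremalCoeff.2 i
  rw [momentVector] at h
  rw [← h]
  simp only [extremalAffine, Finset.mul_sum, Matrix.mulVec, dotProduct, momentMatrix,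
    Matrix.of_apply]
  rw [integral_finsetSum]
  · refine Finset.sum_congr rfl fun j _ => ?_
    rw [← integral_mul_const]
    congr 1; funext p; ring
  · intro j _
    refine ContinuousOn.integrableOn_compact Q.isCompact_polytope ?_
    exact ((continuous_affineBasisFun i).mul
      (continuous_const.mul (continuous_affineBasisFun j))).continuousOn

end LabeledQuadrilateral

namespace BilinearChart

variable {Q : LabeledQuadrilateral} (C : BilinearChart Q)

/-- The polynomials `A`, `B` solve the extremal equation with the boundary conditions. -/
structure Solves (A B : Polynomial ℝ) : Prop where
  A_left : A.eval C.α₁ = 0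
  A_right : A.eval C.α₂ = 0
  B_left : B.eval C.β₁ = 0
  B_right : B.eval C.β₂ = 0
  A'_left : A.derivative.eval C.α₁ = 2 * (C.ν 3)⁻¹
  A'_right : A.derivative.eval C.α₂ = -(2 * (C.ν 1)⁻¹)
  B'_left : B.derivative.eval C.β₁ = 2 * (C.ν 0)⁻¹
  B'_right : B.derivative.eval C.β₂ = -(2 * (C.ν 2)⁻¹)
  eq : ∀ s t, A.derivative.derivative.eval s + B.derivative.derivative.eval t =
    -(C.ρ s t * Q.extremalAffine (C.map s t))

/-- The moment equation for one affine function, after integration by parts. -/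
theorem moment_identity {A B : Polynomial ℝ} (hA : A.eval C.α₁ = 0) (hB : B.eval C.β₁ = 0)
    (hA1 : A.derivative.eval C.α₁ = 2 * (C.ν 3)⁻¹)
    (hA2 : A.derivative.eval C.α₂ = -(2 * (C.ν 1)⁻¹))
    (hB1 : B.derivative.eval C.β₁ = 2 * (C.ν 0)⁻¹)
    (heq : ∀ s t, A.derivative.derivative.eval s + B.derivative.derivative.eval t =
      -(C.ρ s t * Q.extremalAffine (C.map s t)))
    (i : Fin 3) (f₀ f₁ f₂ f₃ : ℝ)
    (hf : ∀ s t, LabeledQuadrilateral.affineBasisFun i (C.map s t) =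
      f₀ + f₁ * s + f₂ * t + f₃ * (s * t)) :
    (C.β₂ - C.β₁) * ((f₁ + f₃ * ((C.β₁ + C.β₂) / 2)) * A.eval C.α₂) +
      (C.α₂ - C.α₁) * ((f₂ + f₃ * ((C.α₁ + C.α₂) / 2)) * B.eval C.β₂) =
    (C.α₂ - C.α₁) * ((f₀ + f₂ * C.β₂ + (f₁ + f₃ * C.β₂) * ((C.α₁ + C.α₂) / 2)) *
      (B.derivative.eval C.β₂ + 2 * (C.ν 2)⁻¹)) := by
  have h := Q.integral_affineBasisFun_mul_extremalAffine i
  rw [C.integral_polytope_eq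
    (fun p => LabeledQuadrilateral.affineBasisFun i p * Q.extremalAffine p) ((LabeledQuadrilateral.continuous_affineBasisFun i).mul
    Q.continuous_extremalAffine).continuousOn, C.boundaryIntegral_eq] at h
  have e1 : ∀ s, ∫ t in C.β₁..C.β₂, |C.κ| * (C.ρ s t *
      (LabeledQuadrilateral.affineBasisFun i (C.map s t) * Q.extremalAffine (C.map s t))) =
      -|C.κ| * ((C.β₂ - C.β₁) * (A.derivative.derivative.eval s *
        ((f₀ + f₂ * ((C.β₁ + C.β₂) / 2)) + (f₁ + f₃ * ((C.β₁ + C.β₂) / 2)) * s)) +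
        ((f₀ + f₂ * C.β₂) * B.derivative.eval C.β₂ - f₂ * B.eval C.β₂
          - (f₀ + f₂ * C.β₁) * B.derivative.eval C.β₁ +
        (((f₁ + f₃ * C.β₂) * B.derivative.eval C.β₂ - f₃ * B.eval C.β₂
          - (f₁ + f₃ * C.β₁) * B.derivative.eval C.β₁)) * s)) := by
    intro s
    have : ∀ t, |C.κ| * (C.ρ s t *
      (LabeledQuadrilateral.affineBasisFun i (C.map s t) * Q.extremalAffine (C.map s t))) =
      -|C.κ| * (A.derivative.derivative.eval s * ((f₀ + f₁ * s) + (f₂ + f₃ * s) * t) +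
        B.derivative.derivative.eval t * ((f₀ + f₁ * s) + (f₂ + f₃ * s) * t)) := by
      intro t
      rw [hf]
      linear_combination (|C.κ| * (f₀ + f₁ * s + f₂ * t + f₃ * (s * t))) * heq s t
    simp only [this]
    rw [intervalIntegral.integral_const_mul, intervalIntegral.integral_add
      (Continuous.intervalIntegrable (by fun_prop) _ _)
      (Continuous.intervalIntegrable (by fun_prop) _ _), intervalIntegral.integral_const_mul,
      integral_linear, integral_deriv2_mul_linear, hB]
    ring
  simp only [e1] at h
  rw [intervalIntegral.integral_const_mul, intervalIntegral.integral_add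
      (Continuous.intervalIntegrable (by fun_prop) _ _)
      (Continuous.intervalIntegrable (by fun_prop) _ _), intervalIntegral.integral_const_mul,
      integral_linear, integral_deriv2_mul_linear, hA] at h
  have e2 : ∀ s, ∫ t in C.β₁..C.β₂, LabeledQuadrilateral.affineBasisFun i (C.map s t) =
      (C.β₂ - C.β₁) * ((f₀ + f₁ * s) + (f₂ + f₃ * s) * ((C.β₁ + C.β₂) / 2)) := by
    intro s
    rw [← integral_linear]
    congr 1; funext t; rw [hf]; ring
  have e3 : ∀ t, ∫ s in C.α₁..C.α₂, LabeledQuadrilateral.affineBasisFun i (C.map s t) =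
      (C.α₂ - C.α₁) * ((f₀ + f₂ * t) + (f₁ + f₃ * t) * ((C.α₁ + C.α₂) / 2)) := by
    intro t
    rw [← integral_linear]
    congr 1; funext s; rw [hf]; ring
  rw [e2, e2, e3, e3] at h
  have hκ : |C.κ| ≠ 0 := abs_ne_zero.2 C.hκ
  apply mul_left_cancel₀ hκ
  rw [hA1, hA2, hB1] at h
  linear_combination h

/-- The polynomials `A` and `B` exist if the extremal affine function is equipoised. -/
theorem exists_solves (hQ : Q.IsEquipoised Q.extremalAffine) :
    ∃ A B : Polynomial ℝ, A.natDegree ≤ 4 ∧ B.natDegree ≤ 4 ∧ C.Solves A B := by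
  set e := Q.extremalCoeff with he
  have hζ : ∀ p, Q.extremalAffine p = e 0 + e 1 * p 0 + e 2 * p 1 := by
    intro p
    simp [LabeledQuadrilateral.extremalAffine, Fin.sum_univ_three,
      LabeledQuadrilateral.affineBasisFun, he]
  have hα := sub_pos.2 C.hα
  have hβ := sub_pos.2 C.hβ
  have hκ := C.hκ
  -- The alternating sum of a bilinear function over the corners is its xy-coefficient times the
  -- area of the rectangle, so equipoised means that ζ has no xy-term.
  have z3 : e 1 * C.c₃ 0 + e 2 * C.c₃ 1 = 0 := by
    unfold LabeledQuadrilateral.IsEquipoised at hQ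
    rw [Fin.sum_univ_four, C.vertex_zero, C.vertex_one, C.vertex_two, C.vertex_three] at hQ
    simp only [hζ, Grid.map, PiLp.add_apply, PiLp.smul_apply, smul_eq_mul] at hQ
    norm_num at hQ
    have : (e 1 * C.c₃ 0 + e 2 * C.c₃ 1) * ((C.α₂ - C.α₁) * (C.β₂ - C.β₁)) = 0 := by
      linear_combination hQ
    exact (mul_eq_zero.1 this).resolve_right (by positivity)
  set z0 := e 0 + e 1 * C.c₀ 0 + e 2 * C.c₀ 1 with hz0
  set z1 := e 1 * C.c₁ 0 + e 2 * C.c₁ 1 with hz1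
  set z2 := e 1 * C.c₂ 0 + e 2 * C.c₂ 1 with hz2
  set r0 := det2 C.c₁ C.c₂ / C.κ with hr0
  set r1 := det2 C.c₁ C.c₃ / C.κ with hr1
  set r2 := det2 C.c₃ C.c₂ / C.κ with hr2
  have hρ : ∀ s t, C.ρ s t = r0 + r1 * s + r2 * t := by
    intro s t
    rw [hr0, hr1, hr2]
    unfold Grid.ρ
    field_simp
    simp [det2, Grid.X, Grid.Y]; ring
  have hζ' : ∀ s t, Q.extremalAffine (C.map s t) = z0 + z1 * s + z2 * t := by
    intro s t
    rw [hζ]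
    simp only [Grid.map, PiLp.add_apply, PiLp.smul_apply, smul_eq_mul]
    linear_combination (s * t) * z3
  -- By Cramer's rule the xy-coefficient of ρζ is a multiple of that of ζ. Hence ρζ is a function of
  -- x plus a function of y.
  have hcross : z1 * r2 + z2 * r1 = 0 := by
    rw [hz1, hz2, hr1, hr2]
    field_simp
    simp only [det2]
    linear_combination (C.c₁ 0 * C.c₂ 1 - C.c₁ 1 * C.c₂ 0) * z3
  -- The splitting of -ρζ into A'' and B'' is unique up to a constant moved from one to the other.
  -- This constant is chosen so that A has the prescribed slope at α₂.
  set k := (-(2 * (C.ν 1)⁻¹) - 2 * (C.ν 3)⁻¹ + z0 * r0 * (C.α₂ - C.α₁) +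
    (z0 * r1 + z1 * r0) / 2 * (C.α₂ ^ 2 - C.α₁ ^ 2) + z1 * r1 / 3 * (C.α₂ ^ 3 - C.α₁ ^ 3)) /
    (C.α₂ - C.α₁) with hk
  obtain ⟨A, dA, A2, A0, A1⟩ := exists_polynomial_of_deriv2 (-(z0 * r0) + k)
    (-(z0 * r1 + z1 * r0)) (-(z1 * r1)) C.α₁ (2 * (C.ν 3)⁻¹)
  obtain ⟨B, dB, B2, B0, B1⟩ := exists_polynomial_of_deriv2 (-k)
    (-(z0 * r2 + z2 * r0)) (-(z2 * r2)) C.β₁ (2 * (C.ν 0)⁻¹)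
  have hA1 : A.derivative.eval C.α₁ = 2 * (C.ν 3)⁻¹ := by rw [A1]; ring
  have hB1 : B.derivative.eval C.β₁ = 2 * (C.ν 0)⁻¹ := by rw [B1]; ring
  have hA2 : A.derivative.eval C.α₂ = -(2 * (C.ν 1)⁻¹) := by
    have : k * (C.α₂ - C.α₁) = _ := div_mul_cancel₀ _ hα.ne'
    rw [A1]; linear_combination this
  have heq : ∀ s t, A.derivative.derivative.eval s + B.derivative.derivative.eval t =
      -(C.ρ s t * Q.extremalAffine (C.map s t)) := by
    intro s t
    rw [A2, B2, hρ, hζ']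
    linear_combination (s * t) * hcross
  -- Still open are the slope of B at β₂ and the values of A and B at their right ends. The moment
  -- equation of the constant 1 gives the slope; those of the two coordinates give a linear system
  -- for the values, whose determinant is a nonzero multiple of the Jacobian at the centre of the
  -- rectangle.
  have m := C.moment_identity A0 B0 hA1 hA2 hB1 heq
  have m0 := m 0 1 0 0 0 (by intro s t; simp [LabeledQuadrilateral.affineBasisFun])
  have m1 := m 1 (C.c₀ 0) (C.c₁ 0) (C.c₂ 0) (C.c₃ 0) (by
    intro s t; simp [LabeledQuadrilateral.affineBasisFun, Grid.map]; ring)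
  have m2 := m 2 (C.c₀ 1) (C.c₁ 1) (C.c₂ 1) (C.c₃ 1) (by
    intro s t; simp [LabeledQuadrilateral.affineBasisFun, Grid.map]; ring)
  have hB2 : B.derivative.eval C.β₂ + 2 * (C.ν 2)⁻¹ = 0 := by
    have : (C.α₂ - C.α₁) * (B.derivative.eval C.β₂ + 2 * (C.ν 2)⁻¹) = 0 := by
      linear_combination -m0
    exact (mul_eq_zero.1 this).resolve_left hα.ne'
  rw [hB2] at m1 m2
  have hmid := C.ρ_pos ((C.α₁ + C.α₂) / 2) ⟨by linarith, by linarith⟩ ((C.β₁ + C.β₂) / 2)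
    ⟨by linarith, by linarith⟩
  have hdet := C.det_eq ((C.α₁ + C.α₂) / 2) ((C.β₁ + C.β₂) / 2)
  have hne : det2 (C.X ((C.β₁ + C.β₂) / 2)) (C.Y ((C.α₁ + C.α₂) / 2)) ≠ 0 := by
    rw [hdet]; exact mul_ne_zero hκ hmid.ne'
  have hA3 : A.eval C.α₂ = 0 := by
    have : (C.β₂ - C.β₁) * det2 (C.X ((C.β₁ + C.β₂) / 2)) (C.Y ((C.α₁ + C.α₂) / 2)) *
        A.eval C.α₂ = 0 := by
      simp only [det2, Grid.X, Grid.Y, PiLp.add_apply, PiLp.smul_apply, smul_eq_mul]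
      linear_combination (C.c₂ 1 + (C.α₁ + C.α₂) / 2 * C.c₃ 1) * m1 -
        (C.c₂ 0 + (C.α₁ + C.α₂) / 2 * C.c₃ 0) * m2
    exact (mul_eq_zero.1 this).resolve_left (mul_ne_zero hβ.ne' hne)
  have hB3 : B.eval C.β₂ = 0 := by
    have : (C.α₂ - C.α₁) * det2 (C.X ((C.β₁ + C.β₂) / 2)) (C.Y ((C.α₁ + C.α₂) / 2)) *
        B.eval C.β₂ = 0 := by
      simp only [det2, Grid.X, Grid.Y, PiLp.add_apply, PiLp.smul_apply, smul_eq_mul]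
      linear_combination (C.c₁ 0 + (C.β₁ + C.β₂) / 2 * C.c₃ 0) * m2 -
        (C.c₁ 1 + (C.β₁ + C.β₂) / 2 * C.c₃ 1) * m1
    exact (mul_eq_zero.1 this).resolve_left (mul_ne_zero hα.ne' hne)
  exact ⟨A, B, dA, dB, A0, hA3, B0, hB3, hA1, hA2, hB1, by linarith, heq⟩

end BilinearChart

/-! ### Partial derivatives and the divergence in the chart -/

theorem fderiv_apply_eq_pd (f : Plane → ℝ) (p v : Plane) :
    fderiv ℝ f p v = pd 0 f p * v 0 + pd 1 f p * v 1 := by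
  have : v = v 0 • (EuclideanSpace.single 0 1 : Plane) + v 1 • EuclideanSpace.single 1 1 := by
    apply plane_ext <;> simp
  conv_lhs => rw [this]
  rw [map_add, map_smul, map_smul]
  simp [pd, mul_comm]

theorem pd_congr {f g : Plane → ℝ} {p : Plane} (h : f =ᶠ[nhds p] g) (i : Fin 2) :
    pd i f p = pd i g p := by
  unfold pd; rw [h.fderiv_eq]

theorem contDiffOn_pd {f : Plane → ℝ} {U : Set Plane} (hU : IsOpen U) (hf : ContDiffOn ℝ ∞ f U)
    (i : Fin 2) : ContDiffOn ℝ ∞ (pd i f) U := by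
  have := hf.fderiv_of_isOpen hU (m := ∞) (by simp)
  exact this.clm_apply contDiffOn_const

theorem differentiableAt_of_contDiffOn {f : Plane → ℝ} {U : Set Plane} (hU : IsOpen U)
    (hf : ContDiffOn ℝ ∞ f U) {p : Plane} (hp : p ∈ U) : DifferentiableAt ℝ f p :=
  (hf.contDiffAt (hU.mem_nhds hp)).differentiableAt (by simp)

theorem pd_add {f g : Plane → ℝ} {p : Plane} (hf : DifferentiableAt ℝ f p)
    (hg : DifferentiableAt ℝ g p) (i : Fin 2) :
    pd i (fun q => f q + g q) p = pd i f p + pd i g p := by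
  unfold pd; rw [fderiv_fun_add hf hg]; rfl

theorem pd_sub {f g : Plane → ℝ} {p : Plane} (hf : DifferentiableAt ℝ f p)
    (hg : DifferentiableAt ℝ g p) (i : Fin 2) :
    pd i (fun q => f q - g q) p = pd i f p - pd i g p := by
  unfold pd; rw [fderiv_fun_sub hf hg]; rfl

theorem pd_mul {f g : Plane → ℝ} {p : Plane} (hf : DifferentiableAt ℝ f p)
    (hg : DifferentiableAt ℝ g p) (i : Fin 2) :
    pd i (fun q => f q * g q) p = pd i f p * g p + f p * pd i g p := by
  unfold pd; rw [fderiv_fun_mul hf hg]; simp; ring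

/-- Abreu's expression as the divergence of the divergence of the rows. -/
theorem abreu_eq {H : Plane → Matrix (Fin 2) (Fin 2) ℝ} {U : Set Plane} (hU : IsOpen U)
    (hH : ∀ i j, ContDiffOn ℝ ∞ (fun q => H q i j) U) {p : Plane} (hp : p ∈ U) :
    abreu H p = -(pd 0 (fun q => pd 0 (fun q => H q 0 0) q + pd 1 (fun q => H q 0 1) q) p +
      pd 1 (fun q => pd 0 (fun q => H q 1 0) q + pd 1 (fun q => H q 1 1) q) p) := by
  have h : ∀ i j k, DifferentiableAt ℝ (pd k fun q => H q i j) p := fun i j k =>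
    differentiableAt_of_contDiffOn hU (contDiffOn_pd hU (hH i j) k) hp
  rw [pd_add (h _ _ _) (h _ _ _), pd_add (h _ _ _) (h _ _ _)]
  simp [abreu, Fin.sum_univ_two]

theorem contDiff_polynomial (A : Polynomial ℝ) : ContDiff ℝ ∞ fun x => A.eval x := by
  simpa [Polynomial.coe_aeval_eq_eval] using A.contDiff_aeval (𝕜 := ℝ) (n := ∞)

namespace Grid

variable (C : Grid)

theorem hasDerivAt_comp_map_left {f : Plane → ℝ} {s t : ℝ}
    (hf : DifferentiableAt ℝ f (C.map s t)) :
    HasDerivAt (fun s => f (C.map s t)) (fderiv ℝ f (C.map s t) (C.X t)) s :=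
  hf.hasFDerivAt.comp_hasDerivAt s (C.hasDerivAt_map_left s t)

theorem hasDerivAt_comp_map_right {f : Plane → ℝ} {s t : ℝ}
    (hf : DifferentiableAt ℝ f (C.map s t)) :
    HasDerivAt (fun t => f (C.map s t)) (fderiv ℝ f (C.map s t) (C.Y s)) t :=
  hf.hasFDerivAt.comp_hasDerivAt t (C.hasDerivAt_map_right s t)

/-- The flux of the vector field `(u, w)` through the curves on which `x` is constant. -/
def fluxX (u w : Plane → ℝ) (s t : ℝ) : ℝ :=
  C.Y s 1 * u (C.map s t) - C.Y s 0 * w (C.map s t)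

/-- The flux of the vector field `(u, w)` through the curves on which `y` is constant. -/
def fluxY (u w : Plane → ℝ) (s t : ℝ) : ℝ :=
  C.X t 0 * w (C.map s t) - C.X t 1 * u (C.map s t)

theorem Y_apply (s : ℝ) (i : Fin 2) : C.Y s i = C.c₂ i + s * C.c₃ i := by simp [Y]
theorem X_apply (t : ℝ) (i : Fin 2) : C.X t i = C.c₁ i + t * C.c₃ i := by simp [X]

theorem hasDerivAt_Y (s : ℝ) (i : Fin 2) : HasDerivAt (fun s => C.Y s i) (C.c₃ i) s := by
  simp only [Y_apply]
  simpa using ((hasDerivAt_id s).mul_const (C.c₃ i)).const_add (C.c₂ i)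

theorem hasDerivAt_X (s : ℝ) (i : Fin 2) : HasDerivAt (fun s => C.X s i) (C.c₃ i) s := by
  simp only [X_apply]
  simpa using ((hasDerivAt_id s).mul_const (C.c₃ i)).const_add (C.c₁ i)

/-- The divergence of a vector field in the coordinates of the chart. -/
theorem deriv_flux {u w : Plane → ℝ} {s t a b : ℝ} (hu : DifferentiableAt ℝ u (C.map s t))
    (hw : DifferentiableAt ℝ w (C.map s t)) (ha : HasDerivAt (fun s => C.fluxX u w s t) a s)
    (hb : HasDerivAt (fun t => C.fluxY u w s t) b t) :
    a + b = C.κ * C.ρ s t * (pd 0 u (C.map s t) + pd 1 w (C.map s t)) := by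
  have h1 := ((C.hasDerivAt_Y s 1).mul (C.hasDerivAt_comp_map_left hu)).sub
    ((C.hasDerivAt_Y s 0).mul (C.hasDerivAt_comp_map_left hw))
  have h2 := ((C.hasDerivAt_X t 0).mul (C.hasDerivAt_comp_map_right hw)).sub
    ((C.hasDerivAt_X t 1).mul (C.hasDerivAt_comp_map_right hu))
  rw [ha.unique h1, hb.unique h2, ← det_eq]
  simp only [fderiv_apply_eq_pd, det2]
  ring

theorem form_mat (a b s t : ℝ) (v w : Plane) : form (C.mat a b s t) v w =
    (1 / C.ρ s t) * (a * (inner ℝ v (C.X t) * inner ℝ (C.X t) w) +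
      b * (inner ℝ v (C.Y s) * inner ℝ (C.Y s) w)) := by
  simp [form_eq, mat, sq, inner_eq]; ring

end Grid

namespace BilinearChart

variable {Q : LabeledQuadrilateral} (C : BilinearChart Q)

theorem matH_map (A B : Polynomial ℝ) {s t : ℝ} (h : 0 < C.ρ s t) :
    C.matH A B (C.map s t) = C.mat (A.eval s) (B.eval t) s t := by
  unfold matH
  rw [C.x_map s t h, C.y_map s t h]

theorem eventually_ρ_pos_left {s t : ℝ} (h : 0 < C.ρ s t) : ∀ᶠ s' in nhds s, 0 < C.ρ s' t :=
  (C.continuous_ρ.comp (Continuous.prodMk_left t)).continuousAt.eventually_const_lt h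

theorem eventually_ρ_pos_right {s t : ℝ} (h : 0 < C.ρ s t) : ∀ᶠ t' in nhds t, 0 < C.ρ s t' :=
  (C.continuous_ρ.comp (Continuous.prodMk_right s)).continuousAt.eventually_const_lt h

theorem contDiffOn_polynomial_x (A : Polynomial ℝ) : ContDiffOn ℝ ∞ (fun p => A.eval (C.x p)) C.U :=
  (contDiff_polynomial A).comp_contDiffOn C.contDiffOn_x

theorem contDiffOn_polynomial_y (A : Polynomial ℝ) : ContDiffOn ℝ ∞ (fun p => A.eval (C.y p)) C.U :=
  (contDiff_polynomial A).comp_contDiffOn C.contDiffOn_y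

theorem contDiffOn_ρ : ContDiffOn ℝ ∞ (fun p => C.ρ (C.x p) (C.y p)) C.U := by
  have h : ContDiff ℝ ∞ fun q : ℝ × ℝ => C.ρ q.1 q.2 := by
    unfold Grid.ρ det2; simp only [Grid.X_apply, Grid.Y_apply]; fun_prop
  exact h.comp_contDiffOn (C.contDiffOn_x.prodMk C.contDiffOn_y)

theorem contDiffOn_matH (A B : Polynomial ℝ) (i j : Fin 2) :
    ContDiffOn ℝ ∞ (fun p => C.matH A B p i j) C.U := by
  have e : (fun p => C.matH A B p i j) = fun p => (1 / C.ρ (C.x p) (C.y p)) *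
      (A.eval (C.x p) * ((C.c₁ i + C.y p * C.c₃ i) * (C.c₁ j + C.y p * C.c₃ j)) +
        B.eval (C.y p) * ((C.c₂ i + C.x p * C.c₃ i) * (C.c₂ j + C.x p * C.c₃ j))) := by
    funext p
    simp [matH, Grid.mat, Grid.sq, Grid.X_apply, Grid.Y_apply]
  rw [e]
  have hx : ∀ k : Fin 2, ContDiffOn ℝ ∞ (fun p => C.c₁ k + C.y p * C.c₃ k) C.U := fun k =>
    contDiffOn_const.add (C.contDiffOn_y.mul contDiffOn_const)
  have hy : ∀ k : Fin 2, ContDiffOn ℝ ∞ (fun p => C.c₂ k + C.x p * C.c₃ k) C.U := fun k =>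
    contDiffOn_const.add (C.contDiffOn_x.mul contDiffOn_const)
  exact (contDiffOn_const.div C.contDiffOn_ρ fun p hp => (C.ρ_coord_pos p hp).ne').mul
    (((C.contDiffOn_polynomial_x A).mul ((hx i).mul (hx j))).add
      ((C.contDiffOn_polynomial_y B).mul ((hy i).mul (hy j))))

theorem matH_symm (A B : Polynomial ℝ) (p : Plane) : (C.matH A B p).IsSymm := by
  ext i j
  simp [matH, Grid.mat, Grid.sq, Matrix.transpose_apply]
  ring

theorem isSmoothSymm_matH (A B : Polynomial ℝ) : Q.IsSmoothSymm (C.matH A B) :=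
  ⟨fun i j => (C.contDiffOn_matH A B i j).mono C.polytope_subset, fun p _ => C.matH_symm A B p⟩

/-- The divergence of the rows of `H_{A,B}`. -/
theorem div_row_matH (A B : Polynomial ℝ) (i : Fin 2) {s t : ℝ} (h : 0 < C.ρ s t) :
    pd 0 (fun q => C.matH A B q i 0) (C.map s t) + pd 1 (fun q => C.matH A B q i 1) (C.map s t) =
      (A.derivative.eval s * C.X t i + B.derivative.eval t * C.Y s i) / C.ρ s t := by
  have hU := C.map_mem_U s t h
  have hd := fun j => differentiableAt_of_contDiffOn C.isOpen_U (C.contDiffOn_matH A B i j) hU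
  have hκ := C.hκ
  -- The flux across the curves x = const is the determinant with Y. It kills the term with B, and
  -- the factor det(X, Y) left in the other term cancels the denominator ρ. As X depends on y only,
  -- differentiating in x hits A alone.
  have e1 : ∀ s t, 0 < C.ρ s t → C.fluxX (fun q => C.matH A B q i 0) (fun q => C.matH A B q i 1) s t =
      C.κ * (A.eval s * C.X t i) := by
    intro s t h
    have := C.det_eq s t
    simp only [Grid.fluxX, C.matH_map A B h, Grid.mat, Grid.sq, Matrix.smul_apply, Matrix.add_apply,
      Matrix.of_apply, smul_eq_mul]
    field_simp
    unfold det2 at this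
    linear_combination (A.eval s * C.X t i) * this
  have e2 : ∀ s t, 0 < C.ρ s t → C.fluxY (fun q => C.matH A B q i 0) (fun q => C.matH A B q i 1) s t =
      C.κ * (B.eval t * C.Y s i) := by
    intro s t h
    have := C.det_eq s t
    simp only [Grid.fluxY, C.matH_map A B h, Grid.mat, Grid.sq, Matrix.smul_apply, Matrix.add_apply,
      Matrix.of_apply, smul_eq_mul]
    field_simp
    unfold det2 at this
    linear_combination (B.eval t * C.Y s i) * this
  have h1 : HasDerivAt (fun s => C.fluxX (fun q => C.matH A B q i 0) (fun q => C.matH A B q i 1) s t)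
      (C.κ * (A.derivative.eval s * C.X t i)) s :=
    (((A.hasDerivAt s).mul_const _).const_mul _).congr_of_eventuallyEq
      ((C.eventually_ρ_pos_left h).mono fun s' h' => e1 s' t h')
  have h2 : HasDerivAt (fun t => C.fluxY (fun q => C.matH A B q i 0) (fun q => C.matH A B q i 1) s t)
      (C.κ * (B.derivative.eval t * C.Y s i)) t :=
    (((B.hasDerivAt t).mul_const _).const_mul _).congr_of_eventuallyEq
      ((C.eventually_ρ_pos_right h).mono fun t' h' => e2 s t' h')
  have := C.deriv_flux (hd 0) (hd 1) h1 h2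
  rw [eq_div_iff h.ne']
  apply mul_left_cancel₀ hκ
  linear_combination -this

/-- The divergence of the rows is the vector field (A'X + B'Y)/ρ. Its fluxes are κA' and κB', so the
flux computation applies a second time. -/
theorem abreu_matH (A B : Polynomial ℝ) {s t : ℝ} (h : 0 < C.ρ s t) :
    abreu (C.matH A B) (C.map s t) =
      -((A.derivative.derivative.eval s + B.derivative.derivative.eval t) / C.ρ s t) := by
  have hU := C.map_mem_U s t h
  have hκ := C.hκ
  rw [abreu_eq C.isOpen_U (C.contDiffOn_matH A B) hU]
  set u := fun q => pd 0 (fun q => C.matH A B q 0 0) q + pd 1 (fun q => C.matH A B q 0 1) q with hu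
  set w := fun q => pd 0 (fun q => C.matH A B q 1 0) q + pd 1 (fun q => C.matH A B q 1 1) q with hw
  have hp : ∀ i j k, DifferentiableAt ℝ (pd k fun q => C.matH A B q i j) (C.map s t) :=
    fun i j k => differentiableAt_of_contDiffOn C.isOpen_U
      (contDiffOn_pd C.isOpen_U (C.contDiffOn_matH A B i j) k) hU
  have e1 : ∀ s t, 0 < C.ρ s t → C.fluxX u w s t = C.κ * A.derivative.eval s := by
    intro s t h
    have := C.det_eq s t
    simp only [Grid.fluxX, hu, hw, C.div_row_matH A B _ h]
    field_simp
    unfold det2 at this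
    linear_combination A.derivative.eval s * this
  have e2 : ∀ s t, 0 < C.ρ s t → C.fluxY u w s t = C.κ * B.derivative.eval t := by
    intro s t h
    have := C.det_eq s t
    simp only [Grid.fluxY, hu, hw, C.div_row_matH A B _ h]
    field_simp
    unfold det2 at this
    linear_combination B.derivative.eval t * this
  have h1 : HasDerivAt (fun s => C.fluxX u w s t) (C.κ * A.derivative.derivative.eval s) s :=
    ((A.derivative.hasDerivAt s).const_mul _).congr_of_eventuallyEq
      ((C.eventually_ρ_pos_left h).mono fun s' h' => e1 s' t h')
  have h2 : HasDerivAt (fun t => C.fluxY u w s t) (C.κ * B.derivative.derivative.eval t) t :=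
    ((B.derivative.hasDerivAt t).const_mul _).congr_of_eventuallyEq
      ((C.eventually_ρ_pos_right h).mono fun t' h' => e2 s t' h')
  have := C.deriv_flux ((hp _ _ _).add (hp _ _ _)) ((hp _ _ _).add (hp _ _ _)) h1 h2
  congr 1
  rw [eq_div_iff h.ne']
  apply mul_left_cancel₀ hκ
  linear_combination -this

theorem extremalEquation_matH {A B : Polynomial ℝ} (hAB : C.Solves A B) :
    Q.ExtremalEquation (C.matH A B) := by
  intro p hp
  obtain ⟨s, hs, t, ht, rfl⟩ := (C.mem_polytope_iff p).1 (interior_subset hp)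
  have h := C.ρ_pos s hs t ht
  rw [C.abreu_matH A B h, hAB.eq]
  field_simp

/-! ### Boundary conditions for H_{A,B} -/

theorem contDiffOn_form_matH (A B : Polynomial ℝ) (v w : Plane) :
    ContDiffOn ℝ ∞ (fun p => form (C.matH A B p) v w) C.U := by
  simp only [form_eq]
  have h := C.contDiffOn_matH A B
  exact (contDiffOn_const.mul (((h 0 0).mul contDiffOn_const).add ((h 0 1).mul contDiffOn_const))).add
    (contDiffOn_const.mul (((h 1 0).mul contDiffOn_const).add ((h 1 1).mul contDiffOn_const)))

theorem fderivWithin_polytope_eq {f : Plane → ℝ} (hf : ContDiffOn ℝ ∞ f C.U) {p : Plane}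
    (hp : p ∈ Q.polytope) : fderivWithin ℝ f Q.polytope p = fderiv ℝ f p :=
  (differentiableAt_of_contDiffOn C.isOpen_U hf (C.polytope_subset hp)).fderivWithin
    (Q.uniqueDiffOn_polytope p hp)

/-- At a zero of A only the term B YYᵀ survives, and it annihilates the conormal. For the
differential two directions suffice: along the edge the form is identically zero, and across it the
B-term vanishes to second order, so only A' contributes. -/
theorem boundary_x {A B : Polynomial ℝ} {a t k : ℝ} {n : Plane} (h : 0 < C.ρ a t)
    (hp : C.map a t ∈ Q.polytope) (hn : n = k • perp (C.Y a)) (hA : A.eval a = 0)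
    (hA' : A.derivative.eval a * (k * C.κ) = 2) :
    (∀ v, form (C.matH A B (C.map a t)) n v = 0) ∧
    ∀ v, fderivWithin ℝ (fun z => form (C.matH A B z) n n) Q.polytope (C.map a t) v =
      2 * inner ℝ n v := by
  have hY : inner ℝ n (C.Y a) = 0 := by
    rw [hn, inner_smul_left, Grid.inner_perp_Y_Y, mul_zero]
  have hX : ∀ t, inner ℝ n (C.X t) = k * (C.κ * C.ρ a t) := by
    intro t; rw [hn, inner_smul_left, Grid.inner_perp_Y_X]; rfl
  constructor
  · intro v
    rw [C.matH_map A B h, Grid.form_mat, hA, hY]; ring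
  · have hsm := C.contDiffOn_form_matH A B n n
    rw [C.fderivWithin_polytope_eq hsm hp]
    have hd := differentiableAt_of_contDiffOn C.isOpen_U hsm (C.polytope_subset hp)
    have d1 : fderiv ℝ (fun z => form (C.matH A B z) n n) (C.map a t) (C.X t) =
        2 * inner ℝ n (C.X t) := by
      refine (C.hasDerivAt_comp_map_left hd).unique ?_
      have hY' : HasDerivAt (fun s => inner ℝ n (C.Y s)) (inner ℝ n C.c₃) a := by
        have : (fun s => inner ℝ n (C.Y s)) = fun s => inner ℝ n C.c₂ + s * inner ℝ n C.c₃ := by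
          funext s; rw [Grid.Y, inner_add_right, inner_smul_right]
        rw [this]
        simpa using ((hasDerivAt_id a).mul_const (inner ℝ n C.c₃)).const_add (inner ℝ n C.c₂)
      have hN : HasDerivAt (fun s => A.eval s * (inner ℝ n (C.X t) * inner ℝ (C.X t) n) +
          B.eval t * (inner ℝ n (C.Y s) * inner ℝ n (C.Y s)))
          (A.derivative.eval a * (inner ℝ n (C.X t) * inner ℝ (C.X t) n)) a := by
        refine (((A.hasDerivAt a).mul_const _).add ((hY'.mul hY').const_mul _)).congr_deriv ?_
        rw [hY]; ring
      have hρ : DifferentiableAt ℝ (fun s => C.ρ s t) a := by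
        unfold Grid.ρ det2; simp only [Grid.X_apply, Grid.Y_apply]; fun_prop
      have hq := hN.div hρ.hasDerivAt h.ne'
      refine (hq.congr_of_eventuallyEq ((C.eventually_ρ_pos_left h).mono fun s h' => ?_)).congr_deriv
        ?_
      · simp only [C.matH_map A B h', Grid.form_mat, real_inner_comm (C.Y s) n, Pi.div_apply]
        ring
      · rw [hA, hY, real_inner_comm n (C.X t), hX]
        field_simp
        linear_combination (C.ρ a t ^ 3 * k * C.κ) * hA'
    have d2 : fderiv ℝ (fun z => form (C.matH A B z) n n) (C.map a t) (C.Y a) = 0 := by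
      refine (C.hasDerivAt_comp_map_right hd).unique ?_
      refine (hasDerivAt_const t (0 : ℝ)).congr_of_eventuallyEq
        ((C.eventually_ρ_pos_right h).mono fun t' h' => ?_)
      simp only [C.matH_map A B h', Grid.form_mat, hA, hY]
      ring
    intro v
    have hne : det2 (C.X t) (C.Y a) ≠ 0 := by rw [Grid.det_eq]; exact mul_ne_zero C.hκ h.ne'
    rw [exists_combination hne v, map_add, map_smul, map_smul, d1, d2, inner_add_right,
      inner_smul_right, inner_smul_right, hY]
    simp; ring

theorem boundary_y {A B : Polynomial ℝ} {s b k : ℝ} {n : Plane} (h : 0 < C.ρ s b)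
    (hp : C.map s b ∈ Q.polytope) (hn : n = k • perp (C.X b)) (hB : B.eval b = 0)
    (hB' : B.derivative.eval b * (k * C.κ) = -2) :
    (∀ v, form (C.matH A B (C.map s b)) n v = 0) ∧
    ∀ v, fderivWithin ℝ (fun z => form (C.matH A B z) n n) Q.polytope (C.map s b) v =
      2 * inner ℝ n v := by
  have hX : inner ℝ n (C.X b) = 0 := by
    rw [hn, inner_smul_left, Grid.inner_perp_X_X, mul_zero]
  have hY : ∀ s, inner ℝ n (C.Y s) = -(k * (C.κ * C.ρ s b)) := by
    intro s; rw [hn, inner_smul_left, Grid.inner_perp_X_Y]; simp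
  constructor
  · intro v
    rw [C.matH_map A B h, Grid.form_mat, hB, hX]; ring
  · have hsm := C.contDiffOn_form_matH A B n n
    rw [C.fderivWithin_polytope_eq hsm hp]
    have hd := differentiableAt_of_contDiffOn C.isOpen_U hsm (C.polytope_subset hp)
    have d1 : fderiv ℝ (fun z => form (C.matH A B z) n n) (C.map s b) (C.Y s) =
        2 * inner ℝ n (C.Y s) := by
      refine (C.hasDerivAt_comp_map_right hd).unique ?_
      have hX' : HasDerivAt (fun s => inner ℝ n (C.X s)) (inner ℝ n C.c₃) b := by
        have : (fun s => inner ℝ n (C.X s)) = fun s => inner ℝ n C.c₁ + s * inner ℝ n C.c₃ := by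
          funext s; rw [Grid.X, inner_add_right, inner_smul_right]
        rw [this]
        simpa using ((hasDerivAt_id b).mul_const (inner ℝ n C.c₃)).const_add (inner ℝ n C.c₁)
      have hN : HasDerivAt (fun t => A.eval s * (inner ℝ n (C.X t) * inner ℝ n (C.X t)) +
          B.eval t * (inner ℝ n (C.Y s) * inner ℝ (C.Y s) n))
          (B.derivative.eval b * (inner ℝ n (C.Y s) * inner ℝ (C.Y s) n)) b := by
        refine (((hX'.mul hX').const_mul _).add ((B.hasDerivAt b).mul_const _)).congr_deriv ?_
        rw [hX]; ring
      have hρ : DifferentiableAt ℝ (fun t => C.ρ s t) b := by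
        unfold Grid.ρ det2; simp only [Grid.X_apply, Grid.Y_apply]; fun_prop
      have hq := hN.div hρ.hasDerivAt h.ne'
      refine (hq.congr_of_eventuallyEq ((C.eventually_ρ_pos_right h).mono fun t h' => ?_)).congr_deriv
        ?_
      · simp only [C.matH_map A B h', Grid.form_mat, real_inner_comm (C.X t) n, Pi.div_apply]
        ring
      · rw [hB, hX, real_inner_comm n (C.Y s), hY]
        field_simp
        linear_combination (C.ρ s b ^ 3 * k * C.κ) * hB'
    have d2 : fderiv ℝ (fun z => form (C.matH A B z) n n) (C.map s b) (C.X b) = 0 := by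
      refine (C.hasDerivAt_comp_map_left hd).unique ?_
      refine (hasDerivAt_const s (0 : ℝ)).congr_of_eventuallyEq
        ((C.eventually_ρ_pos_left h).mono fun t' h' => ?_)
      simp only [C.matH_map A B h', Grid.form_mat, hB, hX]
      ring
    intro v
    have hne : det2 (C.X b) (C.Y s) ≠ 0 := by rw [Grid.det_eq]; exact mul_ne_zero C.hκ h.ne'
    rw [exists_combination hne v, map_add, map_smul, map_smul, d1, d2, inner_add_right,
      inner_smul_right, inner_smul_right, hX]
    simp; ring

theorem boundaryConditions_matH {A B : Polynomial ℝ} (hAB : C.Solves A B) :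
    Q.BoundaryConditions (C.matH A B) := by
  have hν := fun i => (C.ν_pos i).ne'
  have hκ := C.hκ
  have key : ∀ i, C.ν i * (C.ν i)⁻¹ = 1 := fun i => mul_inv_cancel₀ (hν i)
  intro i y hy
  have hyp := Q.openFacet_subset i hy
  fin_cases i
  · obtain ⟨s, hs, rfl⟩ := C.mem_openFacet_zero.1 hy
    refine C.boundary_y (C.ρ_pos s (Set.Ioo_subset_Icc_self hs) _ C.bot_mem) hyp C.normal_zero
      hAB.B_left ?_
    rw [hAB.B'_left, div_mul_cancel₀ _ hκ]; linear_combination (-2) * key 0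
  · obtain ⟨t, ht, rfl⟩ := C.mem_openFacet_one.1 hy
    refine C.boundary_x (C.ρ_pos _ C.right_mem t (Set.Ioo_subset_Icc_self ht)) hyp C.normal_one
      hAB.A_right ?_
    rw [hAB.A'_right, div_mul_cancel₀ _ hκ]; linear_combination 2 * key 1
  · obtain ⟨s, hs, rfl⟩ := C.mem_openFacet_two.1 hy
    refine C.boundary_y (C.ρ_pos s (Set.Ioo_subset_Icc_self hs) _ C.top_mem) hyp C.normal_two
      hAB.B_right ?_
    rw [hAB.B'_right, div_mul_cancel₀ _ hκ]; linear_combination (-2) * key 2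
  · obtain ⟨t, ht, rfl⟩ := C.mem_openFacet_three.1 hy
    refine C.boundary_x (C.ρ_pos _ C.left_mem t (Set.Ioo_subset_Icc_self ht)) hyp C.normal_three
      hAB.A_left ?_
    rw [hAB.A'_left, div_mul_cancel₀ _ hκ]; linear_combination 2 * key 3

end BilinearChart

/-! ### Positivity -/

theorem posDef_iff_form {H : Matrix (Fin 2) (Fin 2) ℝ} (hH : H.IsSymm) :
    H.PosDef ↔ ∀ v : Plane, v ≠ 0 → 0 < form H v v := by
  rw [Matrix.posDef_iff_dotProduct_mulVec]
  have h1 : H.IsHermitian := by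
    rw [Matrix.IsHermitian, Matrix.conjTranspose_eq_transpose_of_trivial]; exact hH
  constructor
  · rintro ⟨-, h⟩ v hv
    have : v.ofLp ≠ 0 := fun h => hv (by ext i; exact congrFun h i)
    simpa [form] using h this
  · intro h
    refine ⟨h1, fun v hv => ?_⟩
    have : (WithLp.toLp 2 v : Plane) ≠ 0 := fun h => hv (by
      have := congrArg WithLp.ofLp h; simpa using this)
    simpa [form] using h _ this

namespace BilinearChart

variable {Q : LabeledQuadrilateral} (C : BilinearChart Q)

theorem eq_zero_of_inner_eq_zero {s t : ℝ} (h : 0 < C.ρ s t) {v : Plane}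
    (h1 : inner ℝ v (C.X t) = 0) (h2 : inner ℝ v (C.Y s) = 0) : v = 0 := by
  have hne : det2 (C.X t) (C.Y s) ≠ 0 := by rw [Grid.det_eq]; exact mul_ne_zero C.hκ h.ne'
  have : inner ℝ v v = 0 := by
    nth_rw 2 [exists_combination hne v]
    rw [inner_add_right, inner_smul_right, inner_smul_right, h1, h2]; ring
  exact inner_self_eq_zero.1 this

/-- The conormals `perp Y` and `perp X` each annihilate one of the two rank-one terms, so as test
vectors they isolate A and B. -/
theorem posDef_matH_iff (A B : Polynomial ℝ) {s t : ℝ} (h : 0 < C.ρ s t) :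
    (C.matH A B (C.map s t)).PosDef ↔ 0 < A.eval s ∧ 0 < B.eval t := by
  rw [posDef_iff_form (C.matH_symm A B _), C.matH_map A B h]
  simp only [Grid.form_mat]
  have hκ := C.hκ
  have hκ2 : 0 < C.κ ^ 2 := by positivity
  constructor
  · intro hv
    constructor
    · have h1 : perp (C.Y s) ≠ 0 := by
        intro h0
        have := C.inner_perp_Y_X s t
        rw [h0, inner_zero_left] at this
        exact mul_ne_zero hκ h.ne' this.symm
      have := hv _ h1
      rw [Grid.inner_perp_Y_Y, real_inner_comm _ (C.X t), Grid.inner_perp_Y_X] at this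
      have e : 1 / C.ρ s t * (A.eval s * (C.κ * C.ρ s t * (C.κ * C.ρ s t)) +
        B.eval t * (0 * inner ℝ (C.Y s) (perp (C.Y s)))) = A.eval s * (C.κ ^ 2 * C.ρ s t) := by
        field_simp; ring
      rw [e] at this
      exact (mul_pos_iff_of_pos_right (by positivity)).1 this
    · have h1 : perp (C.X t) ≠ 0 := by
        intro h0
        have := C.inner_perp_X_Y s t
        rw [h0, inner_zero_left] at this
        exact neg_ne_zero.2 (mul_ne_zero hκ h.ne') this.symm
      have := hv _ h1
      rw [Grid.inner_perp_X_X, real_inner_comm _ (C.Y s), Grid.inner_perp_X_Y] at this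
      have e : 1 / C.ρ s t * (A.eval s * (0 * inner ℝ (C.X t) (perp (C.X t))) +
        B.eval t * (-(C.κ * C.ρ s t) * -(C.κ * C.ρ s t))) = B.eval t * (C.κ ^ 2 * C.ρ s t) := by
        field_simp; ring
      rw [e] at this
      exact (mul_pos_iff_of_pos_right (by positivity)).1 this
  · rintro ⟨hA, hB⟩ v hv
    rw [real_inner_comm v (C.X t), real_inner_comm v (C.Y s)]
    refine mul_pos (one_div_pos.2 h) ?_
    by_cases h1 : inner ℝ v (C.X t) = 0
    · have h2 : inner ℝ v (C.Y s) ≠ 0 := fun h2 => hv (C.eq_zero_of_inner_eq_zero h h1 h2)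
      have := mul_self_pos.2 h2
      have := mul_self_nonneg (inner ℝ v (C.X t))
      positivity
    · have := mul_self_pos.2 h1
      have := mul_self_nonneg (inner ℝ v (C.Y s))
      positivity

theorem isPosDef_matH_iff (A B : Polynomial ℝ) : Q.IsPosDef (C.matH A B) ↔
    (∀ x ∈ Set.Ioo C.α₁ C.α₂, 0 < A.eval x) ∧ ∀ y ∈ Set.Ioo C.β₁ C.β₂, 0 < B.eval y := by
  have hρ : ∀ s ∈ Set.Ioo C.α₁ C.α₂, ∀ t ∈ Set.Ioo C.β₁ C.β₂, 0 < C.ρ s t := fun s hs t ht =>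
    C.ρ_pos s (Set.Ioo_subset_Icc_self hs) t (Set.Ioo_subset_Icc_self ht)
  constructor
  · intro h
    obtain ⟨s₀, hs₀⟩ := Set.nonempty_Ioo.2 C.hα
    obtain ⟨t₀, ht₀⟩ := Set.nonempty_Ioo.2 C.hβ
    exact ⟨fun s hs => ((C.posDef_matH_iff A B (hρ s hs t₀ ht₀)).1
      (h _ (C.map_mem_interior hs ht₀))).1, fun t ht => ((C.posDef_matH_iff A B
        (hρ s₀ hs₀ t ht)).1 (h _ (C.map_mem_interior hs₀ ht))).2⟩
  · rintro ⟨hA, hB⟩ p hp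
    obtain ⟨s, hs, t, ht, rfl⟩ := C.mem_interior_iff.1 hp
    exact (C.posDef_matH_iff A B (hρ s hs t ht)).2 ⟨hA s hs, hB t ht⟩

/-- On an open edge one of A, B is zero and the other positive. The form is then a positive multiple
of the squared pairing with the edge direction, and the kernel of this pairing is the line of the
normal. -/
theorem isPosDefOnFacets_matH {A B : Polynomial ℝ}
    (hA : ∀ x ∈ Set.Ioo C.α₁ C.α₂, 0 < A.eval x) (hB : ∀ y ∈ Set.Ioo C.β₁ C.β₂, 0 < B.eval y)
    (hAB : C.Solves A B) : Q.IsPosDefOnFacets (C.matH A B) := by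
  have hκ := C.hκ
  have hν := fun i => (C.ν_pos i).ne'
  have spanX : ∀ {s t k : ℝ} {n v : Plane}, 0 < C.ρ s t → k ≠ 0 → n = k • perp (C.X t) →
      v ∉ Submodule.span ℝ {n} → inner ℝ v (C.X t) ≠ 0 := by
    intro s t k n v h hk hn hv h0
    apply hv
    have hd : det2 (C.Y s) (C.X t) ≠ 0 := by
      have := C.det_eq s t
      have e : det2 (C.Y s) (C.X t) = -det2 (C.X t) (C.Y s) := by simp only [det2]; ring
      rw [e, this]; exact neg_ne_zero.2 (mul_ne_zero hκ h.ne')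
    rw [Submodule.mem_span_singleton]
    refine ⟨inner ℝ v (C.Y s) / det2 (C.Y s) (C.X t) / k, ?_⟩
    rw [hn, smul_smul, div_mul_cancel₀ _ hk]
    exact (eq_smul_perp h0 hd).symm
  have spanY : ∀ {s t k : ℝ} {n v : Plane}, 0 < C.ρ s t → k ≠ 0 → n = k • perp (C.Y s) →
      v ∉ Submodule.span ℝ {n} → inner ℝ v (C.Y s) ≠ 0 := by
    intro s t k n v h hk hn hv h0
    apply hv
    have hd : det2 (C.X t) (C.Y s) ≠ 0 := by
      rw [C.det_eq]; exact mul_ne_zero hκ h.ne'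
    rw [Submodule.mem_span_singleton]
    refine ⟨inner ℝ v (C.X t) / det2 (C.X t) (C.Y s) / k, ?_⟩
    rw [hn, smul_smul, div_mul_cancel₀ _ hk]
    exact (eq_smul_perp h0 hd).symm
  have posX : ∀ {s t : ℝ} {v : Plane}, 0 < C.ρ s t → 0 < A.eval s → B.eval t = 0 →
      inner ℝ v (C.X t) ≠ 0 → 0 < form (C.matH A B (C.map s t)) v v := by
    intro s t v h hA hB hv
    rw [C.matH_map A B h, Grid.form_mat, hB, real_inner_comm v (C.X t), zero_mul, add_zero]
    have := mul_self_pos.2 hv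
    positivity
  have posY : ∀ {s t : ℝ} {v : Plane}, 0 < C.ρ s t → A.eval s = 0 → 0 < B.eval t →
      inner ℝ v (C.Y s) ≠ 0 → 0 < form (C.matH A B (C.map s t)) v v := by
    intro s t v h hA hB hv
    rw [C.matH_map A B h, Grid.form_mat, hA, real_inner_comm v (C.Y s), zero_mul, zero_add]
    have := mul_self_pos.2 hv
    positivity
  intro i y hy v hv
  fin_cases i
  · obtain ⟨s, hs, rfl⟩ := C.mem_openFacet_zero.1 hy
    have h := C.ρ_pos s (Set.Ioo_subset_Icc_self hs) _ C.bot_mem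
    exact posX h (hA s hs) hAB.B_left
      (spanX h (div_ne_zero (neg_ne_zero.2 (hν 0)) hκ) C.normal_zero hv)
  · obtain ⟨t, ht, rfl⟩ := C.mem_openFacet_one.1 hy
    have h := C.ρ_pos _ C.right_mem t (Set.Ioo_subset_Icc_self ht)
    exact posY h hAB.A_right (hB t ht)
      (spanY h (div_ne_zero (neg_ne_zero.2 (hν 1)) hκ) C.normal_one hv)
  · obtain ⟨s, hs, rfl⟩ := C.mem_openFacet_two.1 hy
    have h := C.ρ_pos s (Set.Ioo_subset_Icc_self hs) _ C.top_mem
    exact posX h (hA s hs) hAB.B_right (spanX h (div_ne_zero (hν 2) hκ) C.normal_two hv)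
  · obtain ⟨t, ht, rfl⟩ := C.mem_openFacet_three.1 hy
    have h := C.ρ_pos _ C.left_mem t (Set.Ioo_subset_Icc_self ht)
    exact posY h hAB.A_left (hB t ht) (spanY h (div_ne_zero (hν 3) hκ) C.normal_three hv)

end BilinearChart

/-! ### The chart with the coordinates exchanged -/

theorem perp_ne_zero {v : Plane} (hv : v ≠ 0) : perp v ≠ 0 := by
  intro h
  apply hv
  have := norm_perp v
  rw [h, norm_zero] at this
  exact norm_eq_zero.1 this.symm

namespace Grid

/-- The bilinear map with exchanged variables. -/
def swap (C : Grid) : Grid where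
  α₁ := C.β₁
  α₂ := C.β₂
  β₁ := C.α₁
  β₂ := C.α₂
  c₀ := C.c₀
  c₁ := C.c₂
  c₂ := C.c₁
  c₃ := C.c₃
  κ := -C.κ
  hα := C.hβ
  hβ := C.hα
  hκ := neg_ne_zero.2 C.hκ

variable (C : Grid)

theorem swap_map (s t : ℝ) : C.swap.map s t = C.map t s := by
  unfold map swap; rw [mul_comm t s]; module

theorem swap_ρ (s t : ℝ) : C.swap.ρ s t = C.ρ t s := by
  unfold ρ
  rw [show C.swap.κ = -C.κ from rfl, div_neg, ← neg_div]
  congr 1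
  simp only [det2, X, Y, swap]; ring

end Grid

namespace BilinearChart

variable {Q : LabeledQuadrilateral} (C : BilinearChart Q)

/-- The chart with exchanged coordinates. -/
def swap : BilinearChart Q.reflect where
  toGrid := C.toGrid.swap
  x := C.y
  y := C.x
  U := C.U
  isOpen_U := C.isOpen_U
  contDiffOn_x := C.contDiffOn_y
  contDiffOn_y := C.contDiffOn_x
  ρ_pos s hs t ht := by rw [Grid.swap_ρ]; exact C.ρ_pos t ht s hs
  map_mem_U s t h := by rw [Grid.swap_ρ] at h; rw [Grid.swap_map]; exact C.map_mem_U t s h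
  x_map s t h := by rw [Grid.swap_ρ] at h; rw [Grid.swap_map]; exact C.y_map t s h
  y_map s t h := by rw [Grid.swap_ρ] at h; rw [Grid.swap_map]; exact C.x_map t s h
  map_coord p hp := by rw [Grid.swap_map]; exact C.map_coord p hp
  ρ_coord_pos p hp := by rw [Grid.swap_ρ]; exact C.ρ_coord_pos p hp
  mem_polytope_iff p := by
    rw [Q.polytope_reflect, C.mem_polytope_iff]
    simp only [Grid.swap_map]
    constructor
    · rintro ⟨s, hs, t, ht, h⟩; exact ⟨t, ht, s, hs, h⟩
    · rintro ⟨s, hs, t, ht, h⟩; exact ⟨t, ht, s, hs, h⟩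
  vertex_eq i := by
    fin_cases i <;> simp [LabeledQuadrilateral.reflect, Grid.corner, Grid.swap_map]
    · exact C.vertex_zero
    · exact C.vertex_three
    · exact C.vertex_two
    · exact C.vertex_one

theorem ν_swap (i : Fin 4) : C.swap.ν i = C.ν (-i - 1) := by
  have hκ := C.hκ
  have key : ∀ {a b : ℝ} {v n : Plane}, v ≠ 0 → n = (a / C.κ) • perp v → n = (b / C.κ) • perp v →
      a = b := by
    intro a b v n hv h1 h2
    rw [h1, ← sub_eq_zero, ← sub_smul, smul_eq_zero, sub_eq_zero] at h2
    have := h2.resolve_right (perp_ne_zero hv)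
    field_simp at this
    exact this
  have n0 := C.swap.normal_zero
  have n1 := C.swap.normal_one
  have n2 := C.swap.normal_two
  have n3 := C.swap.normal_three
  rw [show C.swap.κ = -C.κ from rfl] at n0 n1 n2 n3
  simp only [neg_div_neg_eq] at n0 n1 
  rw [div_neg, ← neg_div] at n2 n3
  fin_cases i
  · exact key (C.Y_ne_zero C.left_mem) n0 C.normal_three
  · exact key (C.X_ne_zero C.top_mem) n1 C.normal_two
  · exact neg_injective (key (C.Y_ne_zero C.right_mem) n2 C.normal_one)
  · exact neg_injective (key (C.X_ne_zero C.bot_mem) n3 C.normal_zero)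

theorem Solves.swap {A B : Polynomial ℝ} (h : C.Solves A B) : C.swap.Solves B A where
  A_left := h.B_left
  A_right := h.B_right
  B_left := h.A_left
  B_right := h.A_right
  A'_left := by rw [ν_swap]; exact h.B'_left
  A'_right := by rw [ν_swap]; exact h.B'_right
  B'_left := by rw [ν_swap]; exact h.A'_left
  B'_right := by rw [ν_swap]; exact h.A'_right
  eq s t := by
    rw [add_comm, h.eq t s, Q.sameAs_reflect.extremalAffine_eq]
    change _ = -(C.toGrid.swap.ρ s t * Q.extremalAffine (C.toGrid.swap.map s t))
    rw [Grid.swap_ρ, Grid.swap_map]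

end BilinearChart

/-! ### Convex functions of one variable -/

/-- A monotone function integrated against the derivative of a function which vanishes at the end
points and is nonnegative. -/
theorem integral_monotone_mul_deriv_le {r A A' : ℝ → ℝ} {a b x₁ x₂ ε : ℝ} (hab : a < b)
    (hr : Monotone r) (hA : ∀ x, HasDerivAt A (A' x) x) (hA' : Continuous A') (ha : A a = 0)
    (hb : A b = 0) (hpos : ∀ x ∈ Set.Icc a b, 0 ≤ A x) (hx₁ : a ≤ x₁) (hx₂ : x₂ ≤ b) (h12 : x₁ ≤ x₂)
    (hε : ∀ x ∈ Set.Icc x₁ x₂, ε ≤ A x) :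
    ∫ x in a..b, r x * A' x ≤ -(ε * (r x₂ - r x₁)) := by
  have hrab := hr hab.le
  -- Layer cake: `r x` is `r a` plus the length of the set of levels between `r a` and `r x`. By
  -- Fubini the integral becomes an integral over levels τ of the integrals of A' over the
  -- superlevel sets of r.
  set ind : ℝ → ℝ → ℝ := fun x τ => (Set.Iio (r x)).indicator 1 τ with hind
  have hlayer : ∀ x ∈ Set.Icc a b, r x = r a + ∫ τ in r a..r b, ind x τ := by
    intro x hx
    have h1 := hr hx.1
    have h2 := hr hx.2
    rw [intervalIntegral.integral_of_le hrab]
    have : ∫ τ in Set.Ioc (r a) (r b), ind x τ = r x - r a := by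
      simp only [hind]
      rw [setIntegral_indicator measurableSet_Iio]
      simp only [Pi.one_apply, setIntegral_const, smul_eq_mul, mul_one]
      have e : (Set.Ioc (r a) (r b) ∩ Set.Iio (r x) : Set ℝ) =ᵐ[volume] (Set.Ioc (r a) (r x) : Set ℝ) := by
        have : Set.Ioc (r a) (r b) ∩ Set.Iio (r x) = Set.Ioo (r a) (r x) := by
          ext τ; simp only [Set.mem_inter_iff, Set.mem_Ioc, Set.mem_Iio, Set.mem_Ioo]
          constructor
          · rintro ⟨⟨h, -⟩, h'⟩; exact ⟨h, h'⟩
          · rintro ⟨h, h'⟩; exact ⟨⟨h, by linarith⟩, h'⟩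
        rw [this]; exact Ioo_ae_eq_Ioc
      rw [measureReal_congr e]
      simp [h1]
    rw [this]; ring
  have hmeas : Measurable fun q : ℝ × ℝ => ind q.1 q.2 := by
    have : (fun q : ℝ × ℝ => ind q.1 q.2) = {q : ℝ × ℝ | q.2 < r q.1}.indicator 1 := by
      funext q; simp only [hind, Set.indicator_apply]; rfl
    rw [this]
    exact measurable_one.indicator
      (measurableSet_lt measurable_snd (hr.measurable.comp measurable_fst))
  have hbd : ∀ x τ, ‖ind x τ‖ ≤ 1 := by
    intro x τ
    simp only [hind, Set.indicator_apply]
    split_ifs <;> simp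
  obtain ⟨K, hK⟩ := (isCompact_Icc (a := a) (b := b)).exists_bound_of_continuousOn hA'.continuousOn
  have hfin : ∀ u v : ℝ, IsFiniteMeasure (volume.restrict (Set.uIoc u v)) := fun u v =>
    ⟨by rw [Measure.restrict_apply_univ, Set.uIoc]; exact measure_Ioc_lt_top⟩
  have := hfin a b
  have := hfin (r a) (r b)
  have hint : Integrable (Function.uncurry fun x τ => ind x τ * A' x)
      ((volume.restrict (Set.uIoc a b)).prod (volume.restrict (Set.uIoc (r a) (r b)))) := by
    refine Integrable.mono' (integrable_const K) ?_ ?_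
    · exact (hmeas.mul (hA'.measurable.comp measurable_fst)).aestronglyMeasurable
    · rw [Measure.prod_restrict]
      refine (ae_restrict_iff' (measurableSet_uIoc.prod measurableSet_uIoc)).2
        (Filter.Eventually.of_forall ?_)
      rintro ⟨x, τ⟩ ⟨hx, -⟩
      rw [Set.uIoc_of_le hab.le] at hx
      have := hK x (Set.Ioc_subset_Icc_self hx)
      simp only [Function.uncurry_apply_pair, norm_mul]
      calc _ ≤ 1 * K := mul_le_mul (hbd _ _) this (norm_nonneg _) zero_le_one
        _ = K := one_mul K
  have hint' : IntegrableOn (Function.uncurry fun x τ => ind x τ * A' x)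
      (Set.uIoc a b ×ˢ Set.uIoc (r a) (r b)) := by
    rwa [IntegrableOn, Measure.volume_eq_prod, ← Measure.prod_restrict]
  have hswap := intervalIntegral_intervalIntegral_swap hint'
  set F : ℝ → ℝ := fun τ => ∫ x in a..b, ind x τ * A' x with hF
  -- A superlevel set of the monotone function r is, up to one point, an interval from its infimum c
  -- to b. The integral of A' over it is A b - A c = -A c.
  have hFval : ∀ τ ∈ Set.Ico (r a) (r b), ∃ c ∈ Set.Icc a b, F τ = -A c ∧
      ∀ x, (τ < r x → c ≤ x) ∧ (c < x → τ < r x) := by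
    intro τ hτ
    set c := sInf {x | τ < r x} with hc
    have hbdd : BddBelow {x | τ < r x} := ⟨a, fun x hx => by
      by_contra h
      exact absurd (lt_of_lt_of_le hx (hr (not_le.1 h).le)) (not_lt.2 hτ.1)⟩
    have hne : {x | τ < r x}.Nonempty := ⟨b, hτ.2⟩
    have hc1 : ∀ x, τ < r x → c ≤ x := fun x hx => csInf_le hbdd hx
    have hc2 : ∀ x, c < x → τ < r x := by
      intro x hx
      obtain ⟨y, hy, hyx⟩ := (csInf_lt_iff hbdd hne).1 hx
      exact lt_of_lt_of_le hy (hr hyx.le)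
    have hca : a ≤ c := le_csInf hne fun x hx => by
      by_contra h
      exact absurd (lt_of_lt_of_le hx (hr (not_le.1 h).le)) (not_lt.2 hτ.1)
    have hcb : c ≤ b := hc1 b hτ.2
    refine ⟨c, ⟨hca, hcb⟩, ?_, fun x => ⟨hc1 x, hc2 x⟩⟩
    simp only [hF]
    have hii : ∀ u v, IntervalIntegrable (fun x => ind x τ * A' x) volume u v := by
      intro u v
      have h1 : IntervalIntegrable A' volume u v := hA'.intervalIntegrable _ _
      refine h1.norm.mono_fun' ?_ ?_
      · exact ((hmeas.comp measurable_prodMk_right).mul hA'.measurable).aestronglyMeasurable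
      · refine Filter.Eventually.of_forall fun x => ?_
        simp only [norm_mul]
        exact mul_le_of_le_one_left (norm_nonneg _) (hbd _ _)
    rw [← intervalIntegral.integral_add_adjacent_intervals (hii a c) (hii c b)]
    have z1 : ∫ x in a..c, ind x τ * A' x = 0 := by
      rw [intervalIntegral.integral_of_le hca, integral_Ioc_eq_integral_Ioo]
      refine setIntegral_eq_zero_of_forall_eq_zero fun x hx => ?_
      have : ¬ τ < r x := fun h => absurd (hc1 x h) (not_le.2 hx.2)
      simp only [hind, Set.indicator_apply, Set.mem_Iio, this, if_false, zero_mul]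
    have z2 : ∫ x in c..b, ind x τ * A' x = ∫ x in c..b, A' x := by
      rw [intervalIntegral.integral_of_le hcb, intervalIntegral.integral_of_le hcb]
      refine setIntegral_congr_fun measurableSet_Ioc fun x hx => ?_
      simp only [hind, Set.indicator_apply, Set.mem_Iio, hc2 x hx.1, if_true, Pi.one_apply, one_mul]
    rw [z1, z2, intervalIntegral.integral_eq_sub_of_hasDerivAt (fun x _ => hA x)
      (hA'.intervalIntegrable _ _), hb]
    ring
  have hx₁b : x₁ ∈ Set.Icc a b := ⟨hx₁, h12.trans hx₂⟩
  have hx₂b : x₂ ∈ Set.Icc a b := ⟨hx₁.trans h12, hx₂⟩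
  have e1 : ∫ x in a..b, r x * A' x = ∫ τ in r a..r b, F τ := by
    simp only [hF]
    rw [← hswap]
    have : ∀ x ∈ Set.uIcc a b, r x * A' x = r a * A' x + ∫ τ in r a..r b, ind x τ * A' x := by
      intro x hx
      rw [Set.uIcc_of_le hab.le] at hx
      rw [intervalIntegral.integral_mul_const, hlayer x hx]
      ring
    rw [intervalIntegral.integral_congr this, intervalIntegral.integral_add,
      intervalIntegral.integral_const_mul, intervalIntegral.integral_eq_sub_of_hasDerivAt
      (fun x _ => hA x) (hA'.intervalIntegrable _ _), ha, hb]
    · ring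
    · exact (hA'.intervalIntegrable _ _).const_mul _
    · have := hint.integral_prod_left
      rw [intervalIntegrable_iff]
      refine this.congr (Filter.Eventually.of_forall fun x => ?_)
      simp only [Function.uncurry_apply_pair]
      rw [intervalIntegral.integral_of_le hrab, Set.uIoc_of_le hrab]
  have hFi : IntervalIntegrable F volume (r a) (r b) := by
    have := hint.integral_prod_right
    rw [intervalIntegrable_iff]
    refine this.congr (Filter.Eventually.of_forall fun x => ?_)
    simp only [Function.uncurry_apply_pair, hF]
    rw [intervalIntegral.integral_of_le hab.le, Set.uIoc_of_le hab.le]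
  rw [e1]
  -- A level strictly between `r x₁` and `r x₂` has its threshold c in [x₁, x₂], where A is at least
  -- ε. All other levels contribute at most zero.
  have hG : ∫ τ in r a..r b, (Set.Ioo (r x₁) (r x₂)).indicator (fun _ => -ε) τ =
      -(ε * (r x₂ - r x₁)) := by
    rw [intervalIntegral.integral_of_le hrab, setIntegral_indicator measurableSet_Ioo,
      Set.inter_eq_self_of_subset_right ((Set.Ioo_subset_Ioo (hr hx₁) (hr hx₂)).trans Set.Ioo_subset_Ioc_self)]
    simp [hr h12]; ring
  rw [← hG]
  refine intervalIntegral.integral_mono_on_of_le_Ioo hrab hFi ?_ ?_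
  · rw [intervalIntegrable_iff]
    exact (integrable_const _).indicator measurableSet_Ioo
  · intro τ hτ
    obtain ⟨c, hc, hFc, hcx⟩ := hFval τ ⟨hτ.1.le, hτ.2⟩
    rw [hFc]
    by_cases h : τ ∈ Set.Ioo (r x₁) (r x₂)
    · rw [Set.indicator_of_mem h]
      have h1 : x₁ ≤ c := by
        by_contra h'
        exact absurd ((hcx x₁).2 (not_le.1 h')) (not_lt.2 h.1.le)
      exact neg_le_neg (hε c ⟨h1, (hcx x₂).1 h.2⟩)
    · rw [Set.indicator_of_notMem h]
      exact neg_nonpos.2 (hpos c hc)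

/-- `g` is convex, continuous and piecewise affine on `[a, b]`. -/
structure ConvexPL (a b : ℝ) (g : ℝ → ℝ) : Prop where
  convexOn : ConvexOn ℝ (Set.Icc a b) g
  continuousOn : ContinuousOn g (Set.Icc a b)
  piecewise : ∃ s : Finset (ℝ × ℝ), ∀ x ∈ Set.Icc a b, ∃ q ∈ s, g x = q.1 + q.2 * x

/-- Finitely many pieces have finitely many slopes. So the right derivative, monotone by convexity,
is bounded and extends monotonically across the end points, which fails for general convex
functions. -/
theorem ConvexPL.exists_monotone_rightDeriv {a b : ℝ} {g : ℝ → ℝ} (hg : ConvexPL a b g) :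
    ∃ r : ℝ → ℝ, Monotone r ∧ ∀ x ∈ Set.Ioo a b, HasDerivWithinAt g (r x) (Set.Ioi x) x := by
  obtain ⟨s, hs⟩ := hg.piecewise
  set r₀ : ℝ → ℝ := fun x => derivWithin g (Set.Ioi x) x with hr₀
  have hd : ∀ x ∈ Set.Ioo a b, HasDerivWithinAt g (r₀ x) (Set.Ioi x) x := fun x hx =>
    hg.convexOn.hasDerivWithinAt_rightDeriv_of_mem_interior (by rwa [interior_Icc])
  have hmono : MonotoneOn r₀ (Set.Ioo a b) := by
    have := hg.convexOn.monotoneOn_rightDeriv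
    rwa [interior_Icc] at this
  have hslope : ∀ x ∈ Set.Ioo a b, ∃ q ∈ s, r₀ x = q.2 := by
    intro x hx
    have hev : ∀ᶠ y in nhdsWithin x (Set.Ioi x), ∃ q ∈ s, g y = q.1 + q.2 * y := by
      have : Set.Ioo x b ∈ nhdsWithin x (Set.Ioi x) := Ioo_mem_nhdsGT hx.2
      filter_upwards [this] with y hy
      exact hs y ⟨hx.1.le.trans hy.1.le, hy.2.le⟩
    -- Some single piece agrees with g at points accumulating at x from the right. By continuity it
    -- agrees at x too, so its slope is a limit of difference quotients.
    obtain ⟨q, hq, hfr⟩ : ∃ q ∈ s, ∃ᶠ y in nhdsWithin x (Set.Ioi x), g y = q.1 + q.2 * y := by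
      by_contra! h
      have h' : ∀ᶠ y in nhdsWithin x (Set.Ioi x), ∀ q ∈ s, ¬ g y = q.1 + q.2 * y :=
        (Filter.eventually_all_finset s).2 fun q hq => by
          simpa using h q hq
      obtain ⟨y, h1, h2⟩ := (hev.and h').exists
      obtain ⟨q, hq, e⟩ := h1
      exact h2 q hq e
    refine ⟨q, hq, ?_⟩
    have hcont : Filter.Tendsto g (nhdsWithin x (Set.Ioi x)) (nhds (g x)) :=
      (hd x hx).continuousWithinAt
    have hgx : g x = q.1 + q.2 * x := by
      have ht : Filter.Tendsto (fun y => g y - (q.1 + q.2 * y)) (nhdsWithin x (Set.Ioi x))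
          (nhds (g x - (q.1 + q.2 * x))) := by
        refine hcont.sub ?_
        exact ((by fun_prop : Continuous fun y : ℝ => q.1 + q.2 * y).tendsto x).mono_left
          nhdsWithin_le_nhds
      have := isClosed_singleton (x := (0 : ℝ)) |>.mem_of_frequently_of_tendsto
        (hfr.mono fun y hy => by simp [hy]) ht
      simpa [sub_eq_zero] using this
    have hsl := (hasDerivWithinAt_iff_tendsto_slope' (by simp)).1 (hd x hx)
    have := isClosed_singleton (x := q.2) |>.mem_of_frequently_of_tendsto
      ((hfr.and_eventually self_mem_nhdsWithin).mono ?_) hsl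
    · simpa using this
    · rintro y ⟨hy, hxy⟩
      have : y - x ≠ 0 := sub_ne_zero.2 (ne_of_gt hxy)
      simp only [Set.mem_singleton_iff, slope_def_field, hy, hgx]
      field_simp; ring
  have hsub : r₀ '' Set.Ioo a b ⊆ Prod.snd '' (s : Set (ℝ × ℝ)) := by
    rintro _ ⟨x, hx, rfl⟩
    obtain ⟨q, hq, e⟩ := hslope x hx
    exact ⟨q, hq, e.symm⟩
  have hfin := s.finite_toSet.image Prod.snd
  obtain ⟨r, hr, he⟩ := hmono.exists_monotone_extension (hfin.bddBelow.mono hsub)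
    (hfin.bddAbove.mono hsub)
  exact ⟨r, hr, fun x hx => he hx ▸ hd x hx⟩

/-- The pairing of `g` with the second derivative of `A`, with the boundary terms of the first
integration by parts. -/
def secondVariation (A : Polynomial ℝ) (a b : ℝ) (g : ℝ → ℝ) : ℝ :=
  (∫ s in a..b, A.derivative.derivative.eval s * g s) -
    (g b * A.derivative.eval b - g a * A.derivative.eval a)

theorem secondVariation_eq {A : Polynomial ℝ} {a b : ℝ} (hab : a < b) {g r : ℝ → ℝ}
    (hg : ContinuousOn g (Set.Icc a b)) (hr : Monotone r)
    (hd : ∀ x ∈ Set.Ioo a b, HasDerivWithinAt g (r x) (Set.Ioi x) x) :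
    secondVariation A a b g = -∫ x in a..b, r x * A.derivative.eval x := by
  have hi1 : IntervalIntegrable (fun x => r x * A.derivative.eval x) volume a b :=
    (hr.intervalIntegrable).mul_continuousOn (by fun_prop)
  have hi2 : IntervalIntegrable (fun x => A.derivative.derivative.eval x * g x) volume a b := by
    refine ContinuousOn.intervalIntegrable_of_Icc hab.le ?_
    exact (by fun_prop : Continuous fun x => A.derivative.derivative.eval x).continuousOn.mul hg
  have := intervalIntegral.integral_eq_sub_of_hasDeriv_right_of_le
    (f := fun x => g x * A.derivative.eval x)
    (f' := fun x => r x * A.derivative.eval x + A.derivative.derivative.eval x * g x) hab.le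
    (hg.mul (by fun_prop)) (fun x hx => by
      refine ((hd x hx).mul (A.derivative.hasDerivAt x).hasDerivWithinAt).congr_deriv ?_
      ring) (hi1.add hi2)
  rw [intervalIntegral.integral_add hi1 hi2] at this
  unfold secondVariation
  linarith

/-- By parts the pairing is -∫ r A', that is, A integrated against the increase of the slope r. It
dominates the minimum of A on a compact subinterval times the increase of r there, so if it vanishes
the slope is constant. -/
theorem ConvexPL.secondVariation_nonneg {A : Polynomial ℝ} {a b : ℝ} {g : ℝ → ℝ} (hab : a < b)
    (hg : ConvexPL a b g) (ha : A.eval a = 0) (hb : A.eval b = 0)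
    (hA : ∀ x ∈ Set.Ioo a b, 0 < A.eval x) :
    0 ≤ secondVariation A a b g ∧ (secondVariation A a b g = 0 →
      ∃ p q : ℝ, ∀ x ∈ Set.Icc a b, g x = p + q * x) := by
  obtain ⟨r, hr, hd⟩ := hg.exists_monotone_rightDeriv
  have hA0 : ∀ x ∈ Set.Icc a b, 0 ≤ A.eval x := by
    intro x hx
    rcases eq_or_lt_of_le hx.1 with h | h
    · rw [← h, ha]
    rcases eq_or_lt_of_le hx.2 with h' | h'
    · rw [h', hb]
    · exact (hA x ⟨h, h'⟩).le
  have key : ∀ x₁ x₂ ε, a ≤ x₁ → x₂ ≤ b → x₁ ≤ x₂ → (∀ x ∈ Set.Icc x₁ x₂, ε ≤ A.eval x) →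
      ε * (r x₂ - r x₁) ≤ secondVariation A a b g := by
    intro x₁ x₂ ε h1 h2 h12 hε
    rw [secondVariation_eq hab hg.continuousOn hr hd]
    have := integral_monotone_mul_deriv_le (A := fun x => A.eval x) hab hr
      (fun x => A.hasDerivAt x) (by fun_prop) ha hb hA0 h1 h2 h12 hε
    linarith
  refine ⟨?_, fun h0 => ?_⟩
  · simpa using key a b 0 le_rfl le_rfl hab.le hA0
  -- Between two interior points A has a positive minimum, so a vanishing pairing leaves no room for
  -- r to grow.
  have hconst : ∀ x₁ ∈ Set.Ioo a b, ∀ x₂ ∈ Set.Ioo a b, x₁ ≤ x₂ → r x₂ = r x₁ := by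
    intro x₁ h1 x₂ h2 h12
    obtain ⟨z, hz, hmin⟩ := isCompact_Icc.exists_isMinOn (Set.nonempty_Icc.2 h12)
      (by fun_prop : ContinuousOn (fun x => A.eval x) (Set.Icc x₁ x₂))
    have hpos := hA z ⟨h1.1.trans_le hz.1, hz.2.trans_lt h2.2⟩
    have := key x₁ x₂ _ h1.1.le h2.2.le h12 (fun x hx => hmin hx)
    rw [h0] at this
    have := nonpos_of_mul_nonpos_right this hpos
    linarith [hr h12]
  set m := (a + b) / 2 with hm
  have hmm : m ∈ Set.Ioo a b := ⟨by rw [hm]; linarith, by rw [hm]; linarith⟩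
  have hrm : ∀ x ∈ Set.Ioo a b, r x = r m := by
    intro x hx
    rcases le_total x m with h | h
    · exact (hconst x hx m hmm h).symm
    · exact hconst m hmm x hx h
  refine ⟨g a - r m * a, r m, fun x hx => ?_⟩
  have := intervalIntegral.integral_eq_sub_of_hasDeriv_right_of_le (f := g)
    (f' := fun _ => r m) hx.1 (hg.continuousOn.mono (Set.Icc_subset_Icc_right hx.2))
    (fun y hy => by
      have hy' : y ∈ Set.Ioo a b := ⟨hy.1, hy.2.trans_le hx.2⟩
      rw [← hrm y hy']; exact hd y hy') (by simp)
  simp at this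
  linarith

theorem secondVariation_linear (A : Polynomial ℝ) {a b p q : ℝ} {g : ℝ → ℝ} (hab : a ≤ b)
    (ha : A.eval a = 0) (hb : A.eval b = 0) (hg : ∀ x ∈ Set.Icc a b, g x = p + q * x) :
    secondVariation A a b g = 0 := by
  have h : ∫ s in a..b, A.derivative.derivative.eval s * g s =
      ∫ s in a..b, A.derivative.derivative.eval s * (p + q * s) := by
    refine intervalIntegral.integral_congr fun s hs => ?_
    rw [Set.uIcc_of_le hab] at hs
    simp only [hg s hs]
  unfold secondVariation
  rw [h, integral_deriv2_mul_linear, ha, hb, hg a ⟨le_rfl, hab⟩, hg b ⟨hab, le_rfl⟩]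
  ring

/-- The second variation of a crease is the value of `A` at the crease. -/
theorem secondVariation_crease (A : Polynomial ℝ) {a b x₀ c : ℝ} (hx : x₀ ∈ Set.Ioo a b)
    (hb : A.eval b = 0) :
    secondVariation A a b (fun s => c * max 0 (s - x₀)) = c * A.eval x₀ := by
  have hint : ∀ u v, IntervalIntegrable
      (fun s => A.derivative.derivative.eval s * (c * max 0 (s - x₀))) volume u v := fun u v =>
    Continuous.intervalIntegrable (by fun_prop) _ _
  unfold secondVariation
  rw [← intervalIntegral.integral_add_adjacent_intervals (hint a x₀) (hint x₀ b)]
  have z1 : ∫ s in a..x₀, A.derivative.derivative.eval s * (c * max 0 (s - x₀)) = 0 := by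
    rw [intervalIntegral.integral_congr (g := fun _ => 0), intervalIntegral.integral_zero]
    intro s hs
    rw [Set.uIcc_of_le hx.1.le] at hs
    simp [max_eq_left (sub_nonpos.2 hs.2)]
  have z2 : ∫ s in x₀..b, A.derivative.derivative.eval s * (c * max 0 (s - x₀)) =
      ∫ s in x₀..b, A.derivative.derivative.eval s * (-c * x₀ + c * s) := by
    refine intervalIntegral.integral_congr fun s hs => ?_
    rw [Set.uIcc_of_le hx.2.le] at hs
    simp only [max_eq_right (sub_nonneg.2 hs.1)]
    ring
  beta_reduce
  rw [z1, z2, integral_deriv2_mul_linear, hb, max_eq_left (sub_nonpos.2 hx.1.le),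
    max_eq_right (sub_nonneg.2 hx.2.le)]
  ring

/-! ### The Futaki functional in the chart -/

theorem Grid.map_eq_lineMap_left (C : Grid) (s t : ℝ) :
    C.map s t = AffineMap.lineMap (C.map 0 t) (C.map 1 t) s := by
  rw [AffineMap.lineMap_apply_module']; unfold Grid.map; module

theorem Grid.map_eq_lineMap_right (C : Grid) (s t : ℝ) :
    C.map s t = AffineMap.lineMap (C.map s 0) (C.map s 1) t := by
  rw [AffineMap.lineMap_apply_module']; unfold Grid.map; module

theorem affineMap_lineMap_eq (a : Plane →ᵃ[ℝ] ℝ) (v w : Plane) (s : ℝ) :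
    a (AffineMap.lineMap v w s) = a v + (a w - a v) * s := by
  rw [AffineMap.apply_lineMap, AffineMap.lineMap_apply_module']
  simp; ring

/-- Coordinate lines of the chart are straight, so this reduces convex piecewise affine functions on
Δ to functions of one variable. -/
theorem ConvexPL.of_lineMap {Q : LabeledQuadrilateral} {f : Plane → ℝ} (hf : Q.IsConvexPL f)
    {a b : ℝ} {v w : Plane} (h : ∀ s ∈ Set.Icc a b, AffineMap.lineMap v w s ∈ Q.polytope) :
    ConvexPL a b fun s => f (AffineMap.lineMap v w s) := by
  obtain ⟨h1, h2, S, hS⟩ := hf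
  refine ⟨?_, ?_, ?_⟩
  · exact (h1.comp_affineMap (AffineMap.lineMap v w)).subset (fun s hs => h s hs) (convex_Icc a b)
  · exact h2.comp (AffineMap.lineMap_continuous).continuousOn h
  · classical
    refine ⟨S.image fun φ => (φ v, φ w - φ v), fun s hs => ?_⟩
    obtain ⟨φ, hφ, e⟩ := hS _ (h s hs)
    exact ⟨_, Finset.mem_image_of_mem _ hφ, by rw [e, affineMap_lineMap_eq]⟩

theorem intervalIntegral_swap_of_continuous {F : ℝ → ℝ → ℝ} (hF : Continuous (Function.uncurry F))
    (a b c d : ℝ) :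
    ∫ s in a..b, ∫ t in c..d, F s t = ∫ t in c..d, ∫ s in a..b, F s t := by
  refine intervalIntegral_intervalIntegral_swap ?_
  refine (hF.continuousOn.integrableOn_compact
    (isCompact_uIcc.prod isCompact_uIcc : IsCompact (Set.uIcc a b ×ˢ Set.uIcc c d))).mono_set ?_
  exact Set.prod_mono Set.uIoc_subset_uIcc Set.uIoc_subset_uIcc

theorem secondVariation_congr (A : Polynomial ℝ) {a b : ℝ} {g h : ℝ → ℝ} (hab : a ≤ b)
    (hgh : ∀ x ∈ Set.Icc a b, g x = h x) : secondVariation A a b g = secondVariation A a b h := by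
  unfold secondVariation
  rw [hgh a ⟨le_rfl, hab⟩, hgh b ⟨hab, le_rfl⟩]
  congr 1
  refine intervalIntegral.integral_congr fun s hs => ?_
  rw [Set.uIcc_of_le hab] at hs
  simp only [hgh s hs]

theorem continuous_secondVariation (A : Polynomial ℝ) {a b : ℝ} {F : ℝ → ℝ → ℝ}
    (hF : Continuous (Function.uncurry F)) :
    Continuous fun t => secondVariation A a b fun s => F s t := by
  unfold secondVariation
  have h1 : ∀ c, Continuous fun t => F c t := fun c => hF.comp (by fun_prop : Continuous fun t : ℝ => (c, t))
  refine Continuous.sub ?_ (((h1 b).mul_const _).sub ((h1 a).mul_const _))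
  refine intervalIntegral.continuous_parametric_intervalIntegral_of_continuous' ?_ a b
  have h2 : Continuous fun q : ℝ × ℝ => F q.2 q.1 := hF.comp continuous_swap
  exact (by fun_prop : Continuous fun q : ℝ × ℝ => A.derivative.derivative.eval q.2).mul h2

theorem eq_of_linear_of_two {a b : ℝ} {g h : ℝ → ℝ}
    (hg : ∃ p q : ℝ, ∀ x ∈ Set.Icc a b, g x = p + q * x)
    (hh : ∃ p q : ℝ, ∀ x ∈ Set.Icc a b, h x = p + q * x) {x₁ x₂ : ℝ} (h1 : x₁ ∈ Set.Icc a b)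
    (h2 : x₂ ∈ Set.Icc a b) (hne : x₁ ≠ x₂) (e1 : g x₁ = h x₁) (e2 : g x₂ = h x₂) :
    ∀ x ∈ Set.Icc a b, g x = h x := by
  obtain ⟨p, q, hg⟩ := hg
  obtain ⟨p', q', hh⟩ := hh
  rw [hg _ h1, hh _ h1] at e1
  rw [hg _ h2, hh _ h2] at e2
  have hq : q = q' := by
    have : (q - q') * (x₁ - x₂) = 0 := by linear_combination e1 - e2
    exact sub_eq_zero.1 ((mul_eq_zero.1 this).resolve_right (sub_ne_zero.2 hne))
  intro x hx
  rw [hg x hx, hh x hx]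
  subst hq; linarith

namespace BilinearChart

variable {Q : LabeledQuadrilateral} (C : BilinearChart Q)

/-- The function `f` in the coordinates of the chart, extended to a function on the plane. -/
def pull (f : Plane → ℝ) (s t : ℝ) : ℝ :=
  f (C.map (Set.projIcc C.α₁ C.α₂ C.hα.le s) (Set.projIcc C.β₁ C.β₂ C.hβ.le t))

theorem pull_eq (f : Plane → ℝ) {s t : ℝ} (hs : s ∈ Set.Icc C.α₁ C.α₂)
    (ht : t ∈ Set.Icc C.β₁ C.β₂) : C.pull f s t = f (C.map s t) := by
  unfold pull
  rw [Set.projIcc_of_mem _ hs, Set.projIcc_of_mem _ ht]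

theorem continuous_pull {f : Plane → ℝ} (hf : ContinuousOn f Q.polytope) :
    Continuous (Function.uncurry (C.pull f)) := by
  have h1 : Continuous fun q : ℝ × ℝ => ((Set.projIcc C.α₁ C.α₂ C.hα.le q.1 : Set.Icc C.α₁ C.α₂) : ℝ) :=
    continuous_subtype_val.comp (continuous_projIcc.comp continuous_fst)
  have h2 : Continuous fun q : ℝ × ℝ => ((Set.projIcc C.β₁ C.β₂ C.hβ.le q.2 : Set.Icc C.β₁ C.β₂) : ℝ) :=
    continuous_subtype_val.comp (continuous_projIcc.comp continuous_snd)
  have key : ∀ u v : ℝ × ℝ → ℝ, Continuous u → Continuous v → (∀ q, u q ∈ Set.Icc C.α₁ C.α₂) →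
      (∀ q, v q ∈ Set.Icc C.β₁ C.β₂) → Continuous fun q => f (C.map (u q) (v q)) := by
    intro u v hu hv hu' hv'
    exact hf.comp_continuous (C.continuous_map.comp (hu.prodMk hv)) fun q =>
      C.map_mem_polytope (hu' q) (hv' q)
  exact key _ _ h1 h2 (fun q => Subtype.mem _) (fun q => Subtype.mem _)

variable {C} {A B : Polynomial ℝ}

/-- In the interior integral ρζ is replaced by -(A'' + B''). On the boundary the weights of dν are,
up to sign and a factor 2, the end slopes of A and B, so each edge integral supplies one boundary
term of the one-dimensional pairings. -/
theorem two_mul_futaki_eq (hAB : C.Solves A B) {f : Plane → ℝ} (hf : ContinuousOn f Q.polytope) :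
    2 * Q.futaki f = |C.κ| *
      ((∫ t in C.β₁..C.β₂, secondVariation A C.α₁ C.α₂ fun s => C.pull f s t) +
        ∫ s in C.α₁..C.α₂, secondVariation B C.β₁ C.β₂ fun t => C.pull f s t) := by
  have hF := C.continuous_pull hf
  obtain ⟨F, hFdef⟩ : ∃ F, F = C.pull f := ⟨_, rfl⟩
  rw [← hFdef] at hF ⊢
  have hF1 : ∀ s, Continuous fun t => F s t := fun s =>
    hF.comp (by fun_prop : Continuous fun t : ℝ => (s, t))
  have hF2 : ∀ t, Continuous fun s => F s t := fun t =>
    hF.comp (by fun_prop : Continuous fun s : ℝ => (s, t))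
  have cA : Continuous fun q : ℝ × ℝ => A.derivative.derivative.eval q.1 := by fun_prop
  have cB : Continuous fun q : ℝ × ℝ => B.derivative.derivative.eval q.2 := by fun_prop
  have hA2 : Continuous (Function.uncurry fun s t => A.derivative.derivative.eval s * F s t) :=
    cA.mul hF
  have hB2 : Continuous (Function.uncurry fun s t => B.derivative.derivative.eval t * F s t) :=
    cB.mul hF
  have inner_cont : ∀ {K : ℝ → ℝ → ℝ}, Continuous (Function.uncurry K) → ∀ u v,
      Continuous fun s => ∫ t in u..v, K s t := fun hK u v =>
    intervalIntegral.continuous_parametric_intervalIntegral_of_continuous' hK u v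
  have inner_cont' : ∀ {K : ℝ → ℝ → ℝ}, Continuous (Function.uncurry K) → ∀ u v,
      Continuous fun t => ∫ s in u..v, K s t := fun {K} hK u v =>
    intervalIntegral.continuous_parametric_intervalIntegral_of_continuous'
      (f := fun t s => K s t) (hK.comp continuous_swap) u v
  have e1 : ∫ p in Q.polytope, f p * Q.extremalAffine p =
      -(|C.κ| * ((∫ s in C.α₁..C.α₂, ∫ t in C.β₁..C.β₂, A.derivative.derivative.eval s * F s t) +
        ∫ s in C.α₁..C.α₂, ∫ t in C.β₁..C.β₂, B.derivative.derivative.eval t * F s t)) := by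
    rw [C.integral_polytope_eq (fun p => f p * Q.extremalAffine p) (hf.mul Q.continuous_extremalAffine.continuousOn),
      ← intervalIntegral.integral_add ((inner_cont hA2 _ _).intervalIntegrable _ _)
        ((inner_cont hB2 _ _).intervalIntegrable _ _), ← intervalIntegral.integral_const_mul,
      ← intervalIntegral.integral_neg]
    refine intervalIntegral.integral_congr fun s hs => ?_
    rw [Set.uIcc_of_le C.hα.le] at hs
    rw [← intervalIntegral.integral_add, ← intervalIntegral.integral_const_mul,
      ← intervalIntegral.integral_neg]
    · refine intervalIntegral.integral_congr fun t ht => ?_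
      rw [Set.uIcc_of_le C.hβ.le] at ht
      rw [hFdef, C.pull_eq f hs ht]
      linear_combination |C.κ| * f (C.map s t) * hAB.eq s t
    · exact Continuous.intervalIntegrable (hA2.comp (by fun_prop : Continuous fun t : ℝ => (s, t))) _ _
    · exact Continuous.intervalIntegrable (hB2.comp (by fun_prop : Continuous fun t : ℝ => (s, t))) _ _
  have eA : ∀ s ∈ Set.Icc C.α₁ C.α₂, ∫ t in C.β₁..C.β₂, f (C.map s t) = ∫ t in C.β₁..C.β₂, F s t := by
    intro s hs
    refine intervalIntegral.integral_congr fun t ht => ?_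
    rw [Set.uIcc_of_le C.hβ.le] at ht
    rw [hFdef, C.pull_eq f hs ht]
  have eB : ∀ t ∈ Set.Icc C.β₁ C.β₂, ∫ s in C.α₁..C.α₂, f (C.map s t) = ∫ s in C.α₁..C.α₂, F s t := by
    intro t ht
    refine intervalIntegral.integral_congr fun s hs => ?_
    rw [Set.uIcc_of_le C.hα.le] at hs
    rw [hFdef, C.pull_eq f hs ht]
  have hi1 : ∀ s u v, IntervalIntegrable (fun t => F s t) volume u v := fun s u v =>
    (hF1 s).intervalIntegrable _ _
  have hi2 : ∀ t u v, IntervalIntegrable (fun s => F s t) volume u v := fun t u v =>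
    (hF2 t).intervalIntegrable _ _
  unfold LabeledQuadrilateral.futaki
  rw [e1, C.boundaryIntegral_eq, eA _ C.left_mem, eA _ C.right_mem, eB _ C.bot_mem, eB _ C.top_mem]
  unfold secondVariation
  rw [intervalIntegral.integral_sub ((inner_cont' hA2 _ _).intervalIntegrable _ _)
      (((hi1 _ _ _).mul_const _).sub ((hi1 _ _ _).mul_const _)),
    intervalIntegral.integral_sub ((inner_cont hB2 _ _).intervalIntegrable _ _)
      (((hi2 _ _ _).mul_const _).sub ((hi2 _ _ _).mul_const _)),
    intervalIntegral.integral_sub ((hi1 _ _ _).mul_const _) ((hi1 _ _ _).mul_const _),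
    intervalIntegral.integral_sub ((hi2 _ _ _).mul_const _) ((hi2 _ _ _).mul_const _),
    ← intervalIntegral_swap_of_continuous hA2]
  simp only [intervalIntegral.integral_mul_const]
  rw [hAB.A'_left, hAB.A'_right, hAB.B'_left, hAB.B'_right]
  ring

theorem futaki_eq_zero_of_isAffineOn (hAB : C.Solves A B) {f : Plane → ℝ} (hf : Q.IsAffineOn f) :
    Q.futaki f = 0 := by
  obtain ⟨φ, hφ⟩ := hf
  have hc : ContinuousOn f Q.polytope :=
    (AffineMap.continuous_of_finiteDimensional φ).continuousOn.congr hφ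
  have h1 : ∫ t in C.β₁..C.β₂, secondVariation A C.α₁ C.α₂ (fun s => C.pull f s t) = 0 := by
    rw [intervalIntegral.integral_congr (g := fun _ => 0), intervalIntegral.integral_zero]
    intro t ht
    rw [Set.uIcc_of_le C.hβ.le] at ht
    refine secondVariation_linear A C.hα.le hAB.A_left hAB.A_right (p := φ (C.map 0 t))
      (q := φ (C.map 1 t) - φ (C.map 0 t)) fun s hs => ?_
    rw [C.pull_eq f hs ht, hφ _ (C.map_mem_polytope hs ht), C.map_eq_lineMap_left,
      affineMap_lineMap_eq]
  have h2 : ∫ s in C.α₁..C.α₂, secondVariation B C.β₁ C.β₂ (fun t => C.pull f s t) = 0 := by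
    rw [intervalIntegral.integral_congr (g := fun _ => 0), intervalIntegral.integral_zero]
    intro s hs
    rw [Set.uIcc_of_le C.hα.le] at hs
    refine secondVariation_linear B C.hβ.le hAB.B_left hAB.B_right (p := φ (C.map s 0))
      (q := φ (C.map s 1) - φ (C.map s 0)) fun t ht => ?_
    rw [C.pull_eq f hs ht, hφ _ (C.map_mem_polytope hs ht), C.map_eq_lineMap_right,
      affineMap_lineMap_eq]
  have := two_mul_futaki_eq hAB hc
  rw [h1, h2] at this
  linarith

end BilinearChart

/-! ### K-stability and positivity of A and B -/

theorem integral_eq_zero_of_nonneg {a b : ℝ} {g : ℝ → ℝ} (hab : a < b) (hg : Continuous g)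
    (hpos : ∀ x ∈ Set.Icc a b, 0 ≤ g x) :
    0 ≤ ∫ x in a..b, g x ∧ ((∫ x in a..b, g x) = 0 → ∀ x ∈ Set.Icc a b, g x = 0) := by
  refine ⟨intervalIntegral.integral_nonneg hab.le hpos, fun h x hx => ?_⟩
  by_contra hne
  have := intervalIntegral.integral_pos hab hg.continuousOn
    (fun y hy => hpos y (Set.Ioc_subset_Icc_self hy))
    ⟨x, hx, lt_of_le_of_ne (hpos x hx) (Ne.symm hne)⟩
  linarith

/-- Pigeonhole for an infinite interval and a finite index set. It is applied once along a line, to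
find two points in one affine piece, and once to the family of lines. -/
theorem infinite_agree {a b : ℝ} (hab : a < b) {ι : Type*} (S : Finset ι) {P : ℝ → ι → Prop}
    (h : ∀ x ∈ Set.Icc a b, ∃ i ∈ S, P x i) :
    ∃ i ∈ S, ∃ x ∈ Set.Icc a b, ∃ y ∈ Set.Icc a b, x ≠ y ∧ P x i ∧ P y i := by
  choose φ hφ hP using h
  have := (Set.Icc_infinite hab).to_subtype
  obtain ⟨x, y, hxy, e⟩ := Finite.exists_ne_map_eq_of_infinite
    (fun x : Set.Icc a b => (⟨φ x x.2, hφ x x.2⟩ : S))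
  have e' : φ x x.2 = φ y y.2 := congrArg Subtype.val e
  exact ⟨φ x x.2, hφ x x.2, x, x.2, y, y.2, fun h => hxy (Subtype.ext h), hP x x.2,
    e' ▸ hP y y.2⟩

namespace BilinearChart

variable {Q : LabeledQuadrilateral} {C : BilinearChart Q} {A B : Polynomial ℝ}

theorem exists_linear_left (φ : Plane →ᵃ[ℝ] ℝ) (t : ℝ) (I : Set ℝ) :
    ∃ p q : ℝ, ∀ s ∈ I, φ (C.map s t) = p + q * s :=
  ⟨_, _, fun s _ => by rw [C.map_eq_lineMap_left, affineMap_lineMap_eq]⟩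

theorem exists_linear_right (φ : Plane →ᵃ[ℝ] ℝ) (s : ℝ) (I : Set ℝ) :
    ∃ p q : ℝ, ∀ t ∈ I, φ (C.map s t) = p + q * t :=
  ⟨_, _, fun t _ => by rw [C.map_eq_lineMap_right, affineMap_lineMap_eq]⟩

/-- A piecewise affine function which is affine along the coordinate lines is affine. -/
theorem isAffineOn_of_biaffine {f : Plane → ℝ} {S : Finset (Plane →ᵃ[ℝ] ℝ)}
    (hS : ∀ p ∈ Q.polytope, ∃ φ ∈ S, f p = φ p)
    (h1 : ∀ t ∈ Set.Icc C.β₁ C.β₂, ∃ p q : ℝ, ∀ s ∈ Set.Icc C.α₁ C.α₂, f (C.map s t) = p + q * s)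
    (h2 : ∀ s ∈ Set.Icc C.α₁ C.α₂, ∃ p q : ℝ, ∀ t ∈ Set.Icc C.β₁ C.β₂, f (C.map s t) = p + q * t) :
    Q.IsAffineOn f := by
  -- A row contains two points that share a piece, and an affine function of one variable is
  -- determined by two values.
  have hrow : ∀ t ∈ Set.Icc C.β₁ C.β₂, ∃ φ ∈ S, ∀ s ∈ Set.Icc C.α₁ C.α₂,
      f (C.map s t) = φ (C.map s t) := by
    intro t ht
    obtain ⟨φ, hφ, x, hx, y, hy, hxy, ex, ey⟩ := infinite_agree C.hα S
      (P := fun s φ => f (C.map s t) = φ (C.map s t)) (fun s hs => hS _ (C.map_mem_polytope hs ht))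
    exact ⟨φ, hφ, eq_of_linear_of_two (h := fun s => φ (C.map s t)) (h1 t ht)
      (exists_linear_left φ t _) hx hy hxy ex ey⟩
  -- Two rows share their piece φ. Every column meets both rows, and f is affine along it, so f = φ
  -- on the whole column.
  obtain ⟨φ, -, x, hx, y, hy, hxy, ex, ey⟩ := infinite_agree C.hβ S hrow
  refine ⟨φ, fun p hp => ?_⟩
  obtain ⟨s, hs, t, ht, rfl⟩ := (C.mem_polytope_iff p).1 hp
  exact eq_of_linear_of_two (h := fun t => φ (C.map s t)) (h2 s hs) (exists_linear_right φ s _)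
    hx hy hxy (ex s hs) (ey s hs) t ht

/-- All one-dimensional pairings are nonnegative and depend continuously on the line. If the
functional vanishes, so does each of them, hence f is affine along every coordinate line, and being
piecewise affine it is affine. -/
theorem isRelativelyKStable_of_pos (hAB : C.Solves A B)
    (hA : ∀ x ∈ Set.Ioo C.α₁ C.α₂, 0 < A.eval x) (hB : ∀ y ∈ Set.Ioo C.β₁ C.β₂, 0 < B.eval y) :
    Q.IsRelativelyKStable := by
  intro f hf
  have hc := hf.2.1
  have h2 := two_mul_futaki_eq hAB hc
  obtain ⟨F, hF, hFeq, h2⟩ : ∃ F : ℝ → ℝ → ℝ, Continuous (Function.uncurry F) ∧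
      (∀ s ∈ Set.Icc C.α₁ C.α₂, ∀ t ∈ Set.Icc C.β₁ C.β₂, F s t = f (C.map s t)) ∧
      2 * Q.futaki f = |C.κ| * ((∫ t in C.β₁..C.β₂, secondVariation A C.α₁ C.α₂ fun s => F s t) +
        ∫ s in C.α₁..C.α₂, secondVariation B C.β₁ C.β₂ fun t => F s t) :=
    ⟨_, C.continuous_pull hc, fun s hs t ht => C.pull_eq f hs ht, h2⟩
  have hκ := abs_pos.2 C.hκ
  have hcA := continuous_secondVariation A (a := C.α₁) (b := C.α₂) hF
  have hF' : Continuous (Function.uncurry fun t s => F s t) := hF.comp continuous_swap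
  have hcB := continuous_secondVariation B (a := C.β₁) (b := C.β₂) hF'
  have hPA : ∀ t ∈ Set.Icc C.β₁ C.β₂, ConvexPL C.α₁ C.α₂ fun s => f (C.map s t) := by
    intro t ht
    rw [show (fun s => f (C.map s t)) = fun s => f (AffineMap.lineMap (C.map 0 t) (C.map 1 t) s) from
      funext fun s => by rw [← C.map_eq_lineMap_left]]
    exact ConvexPL.of_lineMap hf fun s hs => by
      rw [← C.map_eq_lineMap_left]; exact C.map_mem_polytope hs ht
  have hPB : ∀ s ∈ Set.Icc C.α₁ C.α₂, ConvexPL C.β₁ C.β₂ fun t => f (C.map s t) := by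
    intro s hs
    rw [show (fun t => f (C.map s t)) = fun t => f (AffineMap.lineMap (C.map s 0) (C.map s 1) t) from
      funext fun t => by rw [← C.map_eq_lineMap_right]]
    exact ConvexPL.of_lineMap hf fun t ht => by
      rw [← C.map_eq_lineMap_right]; exact C.map_mem_polytope hs ht
  have hsA : ∀ t ∈ Set.Icc C.β₁ C.β₂, secondVariation A C.α₁ C.α₂ (fun s => F s t) =
      secondVariation A C.α₁ C.α₂ fun s => f (C.map s t) := fun t ht =>
    secondVariation_congr A C.hα.le fun s hs => hFeq s hs t ht
  have hsB : ∀ s ∈ Set.Icc C.α₁ C.α₂, secondVariation B C.β₁ C.β₂ (fun t => F s t) =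
      secondVariation B C.β₁ C.β₂ fun t => f (C.map s t) := fun s hs =>
    secondVariation_congr B C.hβ.le fun t ht => hFeq s hs t ht
  have hA0 := integral_eq_zero_of_nonneg C.hβ hcA fun t ht => by
    rw [hsA t ht]
    exact ((hPA t ht).secondVariation_nonneg C.hα hAB.A_left hAB.A_right hA).1
  have hB0 := integral_eq_zero_of_nonneg C.hα hcB fun s hs => by
    rw [hsB s hs]
    exact ((hPB s hs).secondVariation_nonneg C.hβ hAB.B_left hAB.B_right hB).1
  refine ⟨?_, fun h0 => ?_, futaki_eq_zero_of_isAffineOn hAB⟩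
  · have := mul_nonneg hκ.le (add_nonneg hA0.1 hB0.1)
    linarith
  · rw [h0, mul_zero, eq_comm] at h2
    have hsum := (mul_eq_zero.1 h2).resolve_left hκ.ne'
    have zA := hA0.2 (by linarith [hA0.1, hB0.1])
    have zB := hB0.2 (by linarith [hA0.1, hB0.1])
    obtain ⟨S, hS⟩ := hf.2.2
    refine isAffineOn_of_biaffine (C := C) hS (fun t ht => ?_) (fun s hs => ?_)
    · refine ((hPA t ht).secondVariation_nonneg C.hα hAB.A_left hAB.A_right hA).2 ?_
      rw [← hsA t ht]; exact zA t ht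
    · refine ((hPB s hs).secondVariation_nonneg C.hβ hAB.B_left hAB.B_right hB).2 ?_
      rw [← hsB s hs]; exact zB s hs

variable (C) in
theorem inner_perp_Y_sub (x₀ s t : ℝ) :
    inner ℝ (perp (C.Y x₀)) (C.map s t - C.map x₀ C.β₁) = C.κ * ((s - x₀) * C.ρ x₀ t) := by
  rw [show C.map s t - C.map x₀ C.β₁ = (s - x₀) • C.X t + (t - C.β₁) • C.Y x₀ by
    rw [← C.map_sub_map_left, ← C.map_sub_map_right]; abel]
  rw [inner_add_right, inner_smul_right, inner_smul_right, C.inner_perp_Y_X, C.inner_perp_Y_Y]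
  ring

variable (C) in
/-- The affine function which vanishes on the coordinate line through `x₀`. -/
def creaseAffine (x₀ : ℝ) : Plane →ᵃ[ℝ] ℝ :=
  (C.κ⁻¹ • (innerSL ℝ (perp (C.Y x₀))).toLinearMap).toAffineMap.comp
    (AffineMap.id ℝ Plane - AffineMap.const ℝ Plane (C.map x₀ C.β₁))

theorem creaseAffine_map (x₀ s t : ℝ) :
    C.creaseAffine x₀ (C.map s t) = (s - x₀) * C.ρ x₀ t := by
  have h := C.inner_perp_Y_sub x₀ s t
  have hκ := C.hκ
  simp only [creaseAffine, AffineMap.comp_apply, LinearMap.coe_toAffineMap, LinearMap.smul_apply,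
    smul_eq_mul, AffineMap.coe_sub, Pi.sub_apply, AffineMap.id_apply, AffineMap.const_apply,
    ContinuousLinearMap.coe_coe, innerSL_apply_apply]
  rw [h]
  field_simp

theorem exists_linear_ρ (x₀ : ℝ) : ∃ p q : ℝ, ∀ t, C.ρ x₀ t = p + q * t :=
  ⟨C.ρ x₀ 0, C.ρ x₀ 1 - C.ρ x₀ 0, fun t => by unfold Grid.ρ det2 Grid.X Grid.Y; simp; ring⟩

variable (C) in
/-- The crease along the coordinate line through `x₀`. -/
def crease (x₀ : ℝ) (p : Plane) : ℝ := max 0 (C.creaseAffine x₀ p)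

/-- Positivity of ρ(x₀, t) lets it be pulled out of the maximum. The crease becomes affine in t for
fixed s, and a multiple of the elementary crease at x₀ in s for fixed t. -/
theorem crease_map {x₀ : ℝ} (hx : x₀ ∈ Set.Icc C.α₁ C.α₂) (s : ℝ) {t : ℝ}
    (ht : t ∈ Set.Icc C.β₁ C.β₂) : C.crease x₀ (C.map s t) = C.ρ x₀ t * max 0 (s - x₀) := by
  unfold crease
  rw [creaseAffine_map, mul_max_of_nonneg _ _ (C.ρ_pos x₀ hx t ht).le, mul_zero, mul_comm]

theorem continuous_crease (x₀ : ℝ) : Continuous (C.crease x₀) :=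
  continuous_const.max (AffineMap.continuous_of_finiteDimensional _)

theorem convexOn_crease (x₀ : ℝ) (K : Set Plane) (hK : Convex ℝ K) : ConvexOn ℝ K (C.crease x₀) := by
  refine (convexOn_const 0 hK).sup ⟨hK, fun p _ q _ a b _ _ hab => le_of_eq ?_⟩
  exact Convex.combo_affine_apply hab

theorem isConvexPL_crease (x₀ : ℝ) : Q.IsConvexPL (C.crease x₀) := by
  classical
  refine ⟨convexOn_crease x₀ _ Q.convex_polytope, (continuous_crease x₀).continuousOn,
    {AffineMap.const ℝ Plane 0, C.creaseAffine x₀}, fun p _ => ?_⟩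
  unfold crease
  rcases max_choice 0 (C.creaseAffine x₀ p) with h | h
  · exact ⟨AffineMap.const ℝ Plane 0, by simp, by simp [h]⟩
  · exact ⟨C.creaseAffine x₀, by simp, h⟩

theorem not_isAffineOn_crease {x₀ : ℝ} (hx : x₀ ∈ Set.Ioo C.α₁ C.α₂) :
    ¬ Q.IsAffineOn (C.crease x₀) := by
  rintro ⟨φ, hφ⟩
  have hx' := Set.Ioo_subset_Icc_self hx
  have hm : (C.α₁ + x₀) / 2 ∈ Set.Icc C.α₁ C.α₂ := ⟨by linarith [hx.1], by linarith [hx.1, hx.2]⟩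
  have hval : ∀ s ∈ Set.Icc C.α₁ C.α₂, φ (C.map s C.β₁) = C.ρ x₀ C.β₁ * max 0 (s - x₀) := by
    intro s hs
    rw [← hφ _ (C.map_mem_polytope hs C.bot_mem), crease_map hx' s C.bot_mem]
  have := eq_of_linear_of_two (h := fun _ => (0 : ℝ)) (exists_linear_left φ C.β₁ _)
    ⟨0, 0, fun _ _ => by simp⟩ C.left_mem hm (by linarith [hx.1] : C.α₁ ≠ (C.α₁ + x₀) / 2)
    (by rw [hval _ C.left_mem, max_eq_left (by linarith [hx.1]), mul_zero])
    (by rw [hval _ hm, max_eq_left (by linarith [hx.1]), mul_zero]) C.α₂ C.right_mem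
  rw [hval _ C.right_mem, max_eq_right (by linarith [hx.2])] at this
  exact (mul_pos (C.ρ_pos x₀ hx' _ C.bot_mem) (sub_pos.2 hx.2)).ne' this

theorem integral_ρ_pos {x₀ : ℝ} (hx : x₀ ∈ Set.Icc C.α₁ C.α₂) :
    0 < ∫ t in C.β₁..C.β₂, C.ρ x₀ t := by
  have hc : Continuous fun t => C.ρ x₀ t := by
    obtain ⟨p, q, h⟩ := exists_linear_ρ (C := C) x₀
    simp only [h]; fun_prop
  exact intervalIntegral.intervalIntegral_pos_of_pos_on (hc.intervalIntegrable _ _)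
    (fun t ht => C.ρ_pos x₀ hx t (Set.Ioo_subset_Icc_self ht)) C.hβ

/-- The crease is affine along the lines x = const, so the B-part drops out. In the other direction
pairing A'' with a crease at x₀ evaluates A there. -/
theorem two_mul_futaki_crease (hAB : C.Solves A B) {x₀ : ℝ} (hx : x₀ ∈ Set.Ioo C.α₁ C.α₂) :
    2 * Q.futaki (C.crease x₀) = |C.κ| * ((∫ t in C.β₁..C.β₂, C.ρ x₀ t) * A.eval x₀) := by
  have hx' := Set.Ioo_subset_Icc_self hx
  rw [two_mul_futaki_eq hAB (continuous_crease x₀).continuousOn]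
  have h1 : ∫ t in C.β₁..C.β₂, secondVariation A C.α₁ C.α₂ (fun s => C.pull (C.crease x₀) s t) =
      ∫ t in C.β₁..C.β₂, C.ρ x₀ t * A.eval x₀ := by
    refine intervalIntegral.integral_congr fun t ht => ?_
    rw [Set.uIcc_of_le C.hβ.le] at ht
    rw [← secondVariation_crease A hx hAB.A_right]
    refine secondVariation_congr A C.hα.le fun s hs => ?_
    rw [C.pull_eq _ hs ht, crease_map hx' s ht]
  have h2 : ∫ s in C.α₁..C.α₂, secondVariation B C.β₁ C.β₂ (fun t => C.pull (C.crease x₀) s t) = 0 := by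
    rw [intervalIntegral.integral_congr (g := fun _ => 0), intervalIntegral.integral_zero]
    intro s hs
    rw [Set.uIcc_of_le C.hα.le] at hs
    obtain ⟨p, q, h⟩ := exists_linear_ρ (C := C) x₀
    refine secondVariation_linear B C.hβ.le hAB.B_left hAB.B_right (p := p * max 0 (s - x₀))
      (q := q * max 0 (s - x₀)) fun t ht => ?_
    rw [C.pull_eq _ hs ht, crease_map hx' s ht, h]
    ring
  rw [h1, h2, intervalIntegral.integral_mul_const, add_zero]

theorem eval_pos_of_isRelativelyKStable (hAB : C.Solves A B) (hQ : Q.IsRelativelyKStable) :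
    ∀ x ∈ Set.Ioo C.α₁ C.α₂, 0 < A.eval x := by
  intro x₀ hx
  have h := hQ _ (isConvexPL_crease (C := C) x₀)
  have hne : Q.futaki (C.crease x₀) ≠ 0 := fun h0 => not_isAffineOn_crease hx (h.2.1 h0)
  have hpos := lt_of_le_of_ne h.1 hne.symm
  have h2 := two_mul_futaki_crease hAB hx
  have hρ := integral_ρ_pos (C := C) (Set.Ioo_subset_Icc_self hx)
  have : 0 < |C.κ| * ((∫ t in C.β₁..C.β₂, C.ρ x₀ t) * A.eval x₀) := by linarith
  exact pos_of_mul_pos_right (pos_of_mul_pos_right this (abs_nonneg _)) hρ.le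

theorem isRelativelyKStable_iff (hAB : C.Solves A B) : Q.IsRelativelyKStable ↔
    (∀ x ∈ Set.Ioo C.α₁ C.α₂, 0 < A.eval x) ∧ ∀ y ∈ Set.Ioo C.β₁ C.β₂, 0 < B.eval y := by
  refine ⟨fun h => ⟨eval_pos_of_isRelativelyKStable hAB h, ?_⟩,
    fun h => isRelativelyKStable_of_pos hAB h.1 h.2⟩
  exact eval_pos_of_isRelativelyKStable (C := C.swap) (Solves.swap C hAB)
    (Q.sameAs_reflect.kStable_iff.2 h)

end BilinearChart

/-! ### Hessians -/

theorem eventually_pd_eq {f g : Plane → ℝ} {p : Plane} (h : f =ᶠ[nhds p] g) (i : Fin 2) :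
    pd i f =ᶠ[nhds p] pd i g := by
  filter_upwards [h.eventuallyEq_nhds] with q hq using pd_congr hq i

theorem abreu_congr {H K : Plane → Matrix (Fin 2) (Fin 2) ℝ} {p : Plane} (h : H =ᶠ[nhds p] K) :
    abreu H p = abreu K p := by
  unfold abreu
  congr 1
  refine Finset.sum_congr rfl fun i _ => Finset.sum_congr rfl fun j _ => ?_
  exact pd_congr (eventually_pd_eq (h.mono fun q hq => by simp only [hq]) j) i

theorem hasDerivAt_line {f : Plane → ℝ} {p v : Plane} {t : ℝ}
    (hf : DifferentiableAt ℝ f (p + t • v)) :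
    HasDerivAt (fun t : ℝ => f (p + t • v))
      (pd 0 f (p + t • v) * v 0 + pd 1 f (p + t • v) * v 1) t := by
  have h1 : HasDerivAt (fun t : ℝ => p + t • v) v t := by
    simpa using ((hasDerivAt_id t).smul_const v).const_add p
  have := hf.hasFDerivAt.comp_hasDerivAt t h1
  rwa [fderiv_apply_eq_pd] at this

theorem hasDerivAt_line_deriv {G : Plane → ℝ} {U : Set Plane} (hU : IsOpen U)
    (hG : ContDiffOn ℝ ∞ G U) {p v : Plane} {t : ℝ} (h : p + t • v ∈ U) :
    HasDerivAt (fun t : ℝ => pd 0 G (p + t • v) * v 0 + pd 1 G (p + t • v) * v 1)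
      (form (hess G (p + t • v)) v v) t := by
  have hd := fun i => differentiableAt_of_contDiffOn hU (contDiffOn_pd hU hG i) h
  refine (((hasDerivAt_line (hd 0)).mul_const (v 0)).add
    ((hasDerivAt_line (hd 1)).mul_const (v 1))).congr_deriv ?_
  simp [form_eq, hess]; ring

theorem strictConvexOn_of_form_hess_pos {G : Plane → ℝ} {U : Set Plane} (hU : IsOpen U)
    (hconv : Convex ℝ U) (hG : ContDiffOn ℝ ∞ G U)
    (hpos : ∀ p ∈ U, ∀ v : Plane, v ≠ 0 → 0 < form (hess G p) v v) : StrictConvexOn ℝ U G := by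
  refine ⟨hconv, fun p hp q hq hpq a b ha hb hab => ?_⟩
  have hseg : ∀ t ∈ Set.Icc (0 : ℝ) 1, p + t • (q - p) ∈ U := fun t ht => by
    have := hconv hp hq (sub_nonneg.2 ht.2) ht.1 (by ring)
    convert this using 1; module
  have hd : ∀ t ∈ Set.Icc (0 : ℝ) 1, HasDerivAt (fun t : ℝ => G (p + t • (q - p))) _ t := fun t ht =>
    hasDerivAt_line (differentiableAt_of_contDiffOn hU hG (hseg t ht))
  have hs : StrictConvexOn ℝ (Set.Icc (0 : ℝ) 1) fun t : ℝ => G (p + t • (q - p)) := by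
    refine strictConvexOn_of_deriv2_pos (convex_Icc 0 1)
      (fun t ht => (hd t ht).continuousAt.continuousWithinAt) fun t ht => ?_
    rw [interior_Icc] at ht
    have e : deriv (fun t : ℝ => G (p + t • (q - p))) =ᶠ[nhds t] fun t : ℝ =>
        pd 0 G (p + t • (q - p)) * (q - p) 0 + pd 1 G (p + t • (q - p)) * (q - p) 1 := by
      filter_upwards [Ioo_mem_nhds ht.1 ht.2] with r hr
      exact (hd r (Set.Ioo_subset_Icc_self hr)).deriv
    have hm := hseg t (Set.Ioo_subset_Icc_self ht)
    simp only [Function.iterate_succ, Function.iterate_zero, Function.id_comp, Function.comp_apply]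
    rw [e.deriv_eq, (hasDerivAt_line_deriv hU hG hm).deriv]
    exact hpos _ hm _ (sub_ne_zero.2 hpq.symm)
  have := hs.2 (Set.left_mem_Icc.2 zero_le_one) (Set.right_mem_Icc.2 zero_le_one) zero_ne_one ha hb hab
  simp only [smul_eq_mul, mul_zero, mul_one, zero_add, zero_smul, add_zero, one_smul,
    add_sub_cancel] at this
  rw [smul_eq_mul, smul_eq_mul]
  convert this using 2
  rw [← eq_sub_iff_add_eq] at hab
  rw [hab]; module

theorem isSymm_hess {G : Plane → ℝ} {U : Set Plane} (hU : IsOpen U) (hG : ContDiffOn ℝ ∞ G U)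
    {p : Plane} (hp : p ∈ U) : (hess G p).IsSymm := by
  have h2 : ContDiffAt ℝ 2 G p := (hG.contDiffAt (hU.mem_nhds hp)).of_le (WithTop.coe_le_coe.2 (le_top : (2 : ℕ∞) ≤ ⊤))
  have hs := h2.isSymmSndFDerivAt (by simp)
  have hd : DifferentiableAt ℝ (fderiv ℝ G) p :=
    ((h2.fderiv_right (m := 1) (by norm_num)).differentiableAt (by simp))
  have e : ∀ i j, pd i (pd j G) p = fderiv ℝ (fderiv ℝ G) p (EuclideanSpace.single i 1)
      (EuclideanSpace.single j 1) := by
    intro i j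
    unfold pd
    rw [fderiv_clm_apply hd (by fun_prop)]
    simp
  ext i j
  simp only [hess, Matrix.transpose_apply, Matrix.of_apply]
  rw [e, e]
  exact hs _ _

theorem LabeledQuadrilateral.extremalEquation_inv_hess {Q : LabeledQuadrilateral}
    {H : Plane → Matrix (Fin 2) (Fin 2) ℝ} {G : Plane → ℝ} (h : Q.IsInverseHessian H G) :
    Q.ExtremalEquation (fun p => (hess G p)⁻¹) ↔ Q.ExtremalEquation H := by
  unfold LabeledQuadrilateral.ExtremalEquation
  refine forall₂_congr fun p hp => ?_
  rw [abreu_congr]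
  filter_upwards [isOpen_interior.mem_nhds hp] with q hq
  exact Matrix.inv_eq_left_inv (h q hq)

/-! ### Primitives on an open interval -/

theorem hasDerivAt_primitive {g : ℝ → ℝ} {a b s₀ s : ℝ} (hg : ContinuousOn g (Set.Ioo a b))
    (hs₀ : s₀ ∈ Set.Ioo a b) (hs : s ∈ Set.Ioo a b) :
    HasDerivAt (fun s => ∫ r in s₀..s, g r) (g s) s := by
  have hsub : Set.uIcc s₀ s ⊆ Set.Ioo a b := Set.OrdConnected.uIcc_subset Set.ordConnected_Ioo hs₀ hs
  refine intervalIntegral.integral_hasDerivAt_right ((hg.mono hsub).intervalIntegrable) ?_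
    (hg.continuousAt (Ioo_mem_nhds hs.1 hs.2))
  exact hg.stronglyMeasurableAtFilter isOpen_Ioo s hs

theorem contDiffOn_primitive {g : ℝ → ℝ} {a b s₀ : ℝ} (hg : ContDiffOn ℝ ∞ g (Set.Ioo a b))
    (hs₀ : s₀ ∈ Set.Ioo a b) : ContDiffOn ℝ ∞ (fun s => ∫ r in s₀..s, g r) (Set.Ioo a b) := by
  rw [contDiffOn_infty_iff_deriv_of_isOpen isOpen_Ioo]
  refine ⟨fun s hs => (hasDerivAt_primitive hg.continuousOn hs₀ hs).differentiableAt.differentiableWithinAt,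
    hg.congr fun s hs => (hasDerivAt_primitive hg.continuousOn hs₀ hs).deriv⟩

/-! ### The explicit symplectic potential -/

/-- The vectors `perp Y`/(κρ) and -`perp X`/(κρ) form the basis dual to X, Y; they represent dx and
dy. The inverse is therefore ρ(dx²/A + dy²/B), arranged here so that its columns can be integrated.
-/
theorem Grid.mat_mul_inverse (C : Grid) {a b s t : ℝ} (ha : a ≠ 0) (hb : b ≠ 0)
    (hρ : C.ρ s t ≠ 0) : C.mat a b s t * Matrix.of (fun i j =>
      (perp (C.Y s) j / (C.κ * a) * perp (C.Y s) i + perp (C.X t) j / (C.κ * b) * perp (C.X t) i) /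
        (C.κ * C.ρ s t)) = 1 := by
  have hκ := C.hκ
  have hd : C.X t 0 * C.Y s 1 - C.X t 1 * C.Y s 0 = C.κ * C.ρ s t := by
    rw [← C.det_eq]; simp [det2]
  unfold Grid.mat
  generalize C.ρ s t = r at *
  generalize C.X t = X at *
  generalize C.Y s = Y at *
  ext i j
  rw [Matrix.mul_apply, Fin.sum_univ_two]
  fin_cases i <;> fin_cases j <;> simp [Grid.sq] <;> field_simp
  · linear_combination (a * b) * (X 0 * Y 1 - X 1 * Y 0 + C.κ * r) * hd
  · ring
  · ring
  · linear_combination (a * b) * (X 0 * Y 1 - X 1 * Y 0 + C.κ * r) * hd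

namespace BilinearChart

variable {Q : LabeledQuadrilateral} (C : BilinearChart Q)

/-- Differentiate the identity map(x(p), y(p)) = p and pair with the conormals of the two coordinate
directions. -/
theorem fderiv_coord {p : Plane} (hp : p ∈ C.U) (v : Plane) :
    fderiv ℝ C.x p v * (C.κ * C.ρ (C.x p) (C.y p)) = inner ℝ (perp (C.Y (C.x p))) v ∧
    fderiv ℝ C.y p v * (C.κ * C.ρ (C.x p) (C.y p)) = -inner ℝ (perp (C.X (C.y p))) v := by
  have hx := (differentiableAt_of_contDiffOn C.isOpen_U C.contDiffOn_x hp).hasFDerivAt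
  have hy := (differentiableAt_of_contDiffOn C.isOpen_U C.contDiffOn_y hp).hasFDerivAt
  have h1 := (C.hasFDerivAt_map (C.x p, C.y p)).comp p (hx.prodMk hy)
  have h2 : HasFDerivAt (fun p : Plane => p) (ContinuousLinearMap.id ℝ Plane) p := hasFDerivAt_id p
  have h3 := h2.congr_of_eventuallyEq (f₁ := (fun q : ℝ × ℝ => C.map q.1 q.2) ∘ fun q => (C.x q, C.y q))
    (Filter.eventuallyEq_of_mem (C.isOpen_U.mem_nhds hp) fun q hq => C.map_coord q hq)
  have e : fderiv ℝ C.x p v • C.X (C.y p) + fderiv ℝ C.y p v • C.Y (C.x p) = v := by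
    have := congrArg (fun L : Plane →L[ℝ] Plane => L v) (h1.unique h3)
    simpa [Grid.mapDeriv] using this
  constructor
  · nth_rw 2 [← e]
    rw [inner_add_right, inner_smul_right, inner_smul_right, C.inner_perp_Y_X, C.inner_perp_Y_Y]
    ring
  · nth_rw 2 [← e]
    rw [inner_add_right, inner_smul_right, inner_smul_right, C.inner_perp_X_Y, C.inner_perp_X_X]
    ring

theorem coord_mem_Ioo {p : Plane} (hp : p ∈ interior Q.polytope) :
    p ∈ C.U ∧ C.x p ∈ Set.Ioo C.α₁ C.α₂ ∧ C.y p ∈ Set.Ioo C.β₁ C.β₂ ∧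
      C.map (C.x p) (C.y p) = p ∧ 0 < C.ρ (C.x p) (C.y p) := by
  have hU := C.polytope_subset (interior_subset hp)
  obtain ⟨s, hs, t, ht, rfl⟩ := C.mem_interior_iff.1 hp
  have hρ := C.ρ_pos s (Set.Ioo_subset_Icc_self hs) t (Set.Ioo_subset_Icc_self ht)
  rw [C.x_map s t hρ, C.y_map s t hρ]
  exact ⟨hU, hs, ht, rfl, hρ⟩

/-- The function with differential `f(x) dx + g(y) dy`. -/
def separated (f g : ℝ → ℝ) (p : Plane) : ℝ :=
  (∫ s in (C.α₁ + C.α₂) / 2..C.x p, f s) + ∫ t in (C.β₁ + C.β₂) / 2..C.y p, g t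

variable {f g : ℝ → ℝ}

theorem mid_mem {a b : ℝ} (h : a < b) : (a + b) / 2 ∈ Set.Ioo a b :=
  ⟨by linarith, by linarith⟩

theorem contDiffOn_separated (hf : ContDiffOn ℝ ∞ f (Set.Ioo C.α₁ C.α₂))
    (hg : ContDiffOn ℝ ∞ g (Set.Ioo C.β₁ C.β₂)) :
    ContDiffOn ℝ ∞ (C.separated f g) (interior Q.polytope) := by
  have hI : interior Q.polytope ⊆ C.U := fun p hp => (C.coord_mem_Ioo hp).1
  exact ((contDiffOn_primitive hf (mid_mem C.hα)).comp (C.contDiffOn_x.mono hI) fun p hp =>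
      (C.coord_mem_Ioo hp).2.1).add
    ((contDiffOn_primitive hg (mid_mem C.hβ)).comp (C.contDiffOn_y.mono hI) fun p hp =>
      (C.coord_mem_Ioo hp).2.2.1)

theorem pd_separated (hf : ContDiffOn ℝ ∞ f (Set.Ioo C.α₁ C.α₂))
    (hg : ContDiffOn ℝ ∞ g (Set.Ioo C.β₁ C.β₂)) {p : Plane} (hp : p ∈ interior Q.polytope)
    (i : Fin 2) : pd i (C.separated f g) p =
      (f (C.x p) * perp (C.Y (C.x p)) i - g (C.y p) * perp (C.X (C.y p)) i) /
        (C.κ * C.ρ (C.x p) (C.y p)) := by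
  obtain ⟨hU, hx, hy, -, hρ⟩ := C.coord_mem_Ioo hp
  have dx := (differentiableAt_of_contDiffOn C.isOpen_U C.contDiffOn_x hU).hasFDerivAt
  have dy := (differentiableAt_of_contDiffOn C.isOpen_U C.contDiffOn_y hU).hasFDerivAt
  have h := ((hasDerivAt_primitive hf.continuousOn (mid_mem C.hα) hx).comp_hasFDerivAt p dx).add
    ((hasDerivAt_primitive hg.continuousOn (mid_mem C.hβ) hy).comp_hasFDerivAt p dy)
  obtain ⟨ex, ey⟩ := C.fderiv_coord hU (EuclideanSpace.single i 1)
  have hne : C.κ * C.ρ (C.x p) (C.y p) ≠ 0 := mul_ne_zero C.hκ hρ.ne'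
  have e : pd i (C.separated f g) p = f (C.x p) * fderiv ℝ C.x p (EuclideanSpace.single i 1) +
      g (C.y p) * fderiv ℝ C.y p (EuclideanSpace.single i 1) := by
    unfold pd
    rw [show C.separated f g = (fun p => ∫ s in (C.α₁ + C.α₂) / 2..C.x p, f s) +
      fun p => ∫ t in (C.β₁ + C.β₂) / 2..C.y p, g t from rfl]
    exact (congrArg (fun L : Plane →L[ℝ] ℝ => L (EuclideanSpace.single i 1)) h.fderiv).trans
      (by simp)
  rw [e, eq_div_iff hne, add_mul, mul_assoc, mul_assoc, ex, ey]
  have hs : ∀ v : Plane, inner ℝ v (EuclideanSpace.single i 1) = v i := fun v => by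
    fin_cases i <;> simp [inner_eq]
  rw [hs, hs]; ring

/-- The components of the differential of the separated potential. -/
def potentialGrad (A B : Polynomial ℝ) (i : Fin 2) : Plane → ℝ :=
  C.separated (fun s => perp (C.Y s) i / (C.κ * A.eval s)) fun t => -(perp (C.X t) i / (C.κ * B.eval t))

/-- The Legendre dual of the separated potential, up to sign. -/
def potentialDual (A B : Polynomial ℝ) : Plane → ℝ :=
  C.separated (fun s => inner ℝ (perp (C.Y s)) (C.map s 0) / (C.κ * A.eval s))
    fun t => -(inner ℝ (perp (C.X t)) (C.map 0 t) / (C.κ * B.eval t))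

/-- The potential of `H_{A,B}`. -/
def potential (A B : Polynomial ℝ) (p : Plane) : ℝ :=
  p 0 * C.potentialGrad A B 0 p + p 1 * C.potentialGrad A B 1 p - C.potentialDual A B p

variable {A B : Polynomial ℝ}

theorem contDiffOn_div_polynomial {h : ℝ → ℝ} {a b k : ℝ} (hh : ContDiff ℝ ∞ h) (hk : k ≠ 0)
    (hA : ∀ x ∈ Set.Ioo a b, 0 < A.eval x) :
    ContDiffOn ℝ ∞ (fun s => h s / (k * A.eval s)) (Set.Ioo a b) :=
  hh.contDiffOn.div (contDiff_const.mul (contDiff_polynomial A)).contDiffOn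
    fun x hx => mul_ne_zero hk (hA x hx).ne'

theorem contDiff_perp_Y (i : Fin 2) : ContDiff ℝ ∞ fun s => perp (C.Y s) i := by
  fin_cases i
  · simp only [Fin.zero_eta, perp_zero_apply, C.Y_apply]; fun_prop
  · simp only [Fin.mk_one, perp_one_apply, C.Y_apply]; fun_prop

theorem contDiff_perp_X (i : Fin 2) : ContDiff ℝ ∞ fun s => perp (C.X s) i := by
  fin_cases i
  · simp only [Fin.zero_eta, perp_zero_apply, C.X_apply]; fun_prop
  · simp only [Fin.mk_one, perp_one_apply, C.X_apply]; fun_prop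

theorem contDiff_map_apply (i : Fin 2) :
    (ContDiff ℝ ∞ fun s => C.map s 0 i) ∧ ContDiff ℝ ∞ fun t => C.map 0 t i := by
  simp only [Grid.map]; constructor <;> simp <;> fun_prop

theorem contDiffOn_potentialGrad (hA : ∀ x ∈ Set.Ioo C.α₁ C.α₂, 0 < A.eval x)
    (hB : ∀ y ∈ Set.Ioo C.β₁ C.β₂, 0 < B.eval y) (i : Fin 2) :
    ContDiffOn ℝ ∞ (C.potentialGrad A B i) (interior Q.polytope) :=
  C.contDiffOn_separated (contDiffOn_div_polynomial (C.contDiff_perp_Y i) C.hκ hA)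
    (contDiffOn_div_polynomial (C.contDiff_perp_X i) C.hκ hB).neg

/-- Since Y depends only on x and X only on y, the j-th column of the desired Hessian is a one-form
f(x) dx + g(y) dy. It is exact, and `potentialGrad` is its primitive. -/
theorem pd_potentialGrad (hA : ∀ x ∈ Set.Ioo C.α₁ C.α₂, 0 < A.eval x)
    (hB : ∀ y ∈ Set.Ioo C.β₁ C.β₂, 0 < B.eval y) {p : Plane} (hp : p ∈ interior Q.polytope)
    (i j : Fin 2) : pd i (C.potentialGrad A B j) p =
      (perp (C.Y (C.x p)) j / (C.κ * A.eval (C.x p)) * perp (C.Y (C.x p)) i +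
        perp (C.X (C.y p)) j / (C.κ * B.eval (C.y p)) * perp (C.X (C.y p)) i) /
        (C.κ * C.ρ (C.x p) (C.y p)) := by
  unfold potentialGrad
  rw [C.pd_separated (contDiffOn_div_polynomial (C.contDiff_perp_Y j) C.hκ hA)
    (contDiffOn_div_polynomial (C.contDiff_perp_X j) C.hκ hB).neg hp i]
  ring

theorem contDiff_dual : (ContDiff ℝ ∞ fun s => inner ℝ (perp (C.Y s)) (C.map s 0)) ∧
    ContDiff ℝ ∞ fun t => inner ℝ (perp (C.X t)) (C.map 0 t) := by
  simp only [inner_eq]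
  exact ⟨((C.contDiff_perp_Y 0).mul (C.contDiff_map_apply 0).1).add
      ((C.contDiff_perp_Y 1).mul (C.contDiff_map_apply 1).1),
    ((C.contDiff_perp_X 0).mul (C.contDiff_map_apply 0).2).add
      ((C.contDiff_perp_X 1).mul (C.contDiff_map_apply 1).2)⟩

theorem contDiffOn_potentialDual (hA : ∀ x ∈ Set.Ioo C.α₁ C.α₂, 0 < A.eval x)
    (hB : ∀ y ∈ Set.Ioo C.β₁ C.β₂, 0 < B.eval y) :
    ContDiffOn ℝ ∞ (C.potentialDual A B) (interior Q.polytope) :=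
  C.contDiffOn_separated (contDiffOn_div_polynomial C.contDiff_dual.1 C.hκ hA)
    (contDiffOn_div_polynomial C.contDiff_dual.2 C.hκ hB).neg

/-- The point p moves along Y when y varies, so its pairing with `perp (Y x)` depends on x alone,
and likewise for y. Hence the sum of the p_j times the differentials of the gradient components is
again separated and has the explicit primitive `potentialDual`. -/
theorem pd_potentialDual (hA : ∀ x ∈ Set.Ioo C.α₁ C.α₂, 0 < A.eval x)
    (hB : ∀ y ∈ Set.Ioo C.β₁ C.β₂, 0 < B.eval y) {p : Plane} (hp : p ∈ interior Q.polytope)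
    (i : Fin 2) : pd i (C.potentialDual A B) p =
      p 0 * pd i (C.potentialGrad A B 0) p + p 1 * pd i (C.potentialGrad A B 1) p := by
  obtain ⟨hU, hx, hy, hm, hρ⟩ := C.coord_mem_Ioo hp
  rw [C.pd_potentialGrad hA hB hp, C.pd_potentialGrad hA hB hp]
  unfold potentialDual
  rw [C.pd_separated (contDiffOn_div_polynomial C.contDiff_dual.1 C.hκ hA)
    (contDiffOn_div_polynomial C.contDiff_dual.2 C.hκ hB).neg hp i]
  have e1 : inner ℝ (perp (C.Y (C.x p))) (C.map (C.x p) 0) = inner ℝ (perp (C.Y (C.x p))) p := by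
    have := C.map_sub_map_right (C.x p) (C.y p) 0
    rw [hm] at this
    rw [← sub_eq_zero, ← inner_sub_right, ← neg_sub, this, inner_neg_right, inner_smul_right,
      C.inner_perp_Y_Y]; simp
  have e2 : inner ℝ (perp (C.X (C.y p))) (C.map 0 (C.y p)) = inner ℝ (perp (C.X (C.y p))) p := by
    have := C.map_sub_map_left (C.x p) 0 (C.y p)
    rw [hm] at this
    rw [← sub_eq_zero, ← inner_sub_right, ← neg_sub, this, inner_neg_right, inner_smul_right,
      C.inner_perp_X_X]; simp
  rw [e1, e2, inner_eq, inner_eq]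
  ring

theorem contDiffOn_potential (hA : ∀ x ∈ Set.Ioo C.α₁ C.α₂, 0 < A.eval x)
    (hB : ∀ y ∈ Set.Ioo C.β₁ C.β₂, 0 < B.eval y) :
    ContDiffOn ℝ ∞ (C.potential A B) (interior Q.polytope) := by
  have h0 := C.contDiffOn_potentialGrad hA hB 0
  have h1 := C.contDiffOn_potentialGrad hA hB 1
  have c : ∀ i : Fin 2, ContDiffOn ℝ ∞ (fun p : Plane => p i) (interior Q.polytope) := fun i => by
    fun_prop
  exact (((c 0).mul h0).add ((c 1).mul h1)).sub (C.contDiffOn_potentialDual hA hB)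

theorem pd_coord (i j : Fin 2) (p : Plane) :
    pd i (fun q : Plane => q j) p = if j = i then 1 else 0 := by
  unfold pd
  have : fderiv ℝ (fun q : Plane => q j) p = EuclideanSpace.proj j :=
    (EuclideanSpace.proj (𝕜 := ℝ) j).hasFDerivAt.fderiv
  rw [this]
  simp

/-- The Legendre formula: the terms in which p multiplies a derivative of the gradient cancel
against the differential of the dual. -/
theorem pd_potential (hA : ∀ x ∈ Set.Ioo C.α₁ C.α₂, 0 < A.eval x)
    (hB : ∀ y ∈ Set.Ioo C.β₁ C.β₂, 0 < B.eval y) {p : Plane} (hp : p ∈ interior Q.polytope)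
    (i : Fin 2) : pd i (C.potential A B) p = C.potentialGrad A B i p := by
  have d := fun j => differentiableAt_of_contDiffOn isOpen_interior
    (C.contDiffOn_potentialGrad hA hB j) hp
  have dd := differentiableAt_of_contDiffOn isOpen_interior (C.contDiffOn_potentialDual hA hB) hp
  have c : ∀ j : Fin 2, DifferentiableAt ℝ (fun p : Plane => p j) p := fun j => by fun_prop
  have hs : DifferentiableAt ℝ (fun p : Plane => p 0 * C.potentialGrad A B 0 p +
      p 1 * C.potentialGrad A B 1 p) p := ((c 0).mul (d 0)).add ((c 1).mul (d 1))
  have hp0 : DifferentiableAt ℝ (fun p : Plane => p 0 * C.potentialGrad A B 0 p) p := (c 0).mul (d 0)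
  have hp1 : DifferentiableAt ℝ (fun p : Plane => p 1 * C.potentialGrad A B 1 p) p := (c 1).mul (d 1)
  unfold potential
  rw [pd_sub hs dd, pd_add (hp0) (hp1),
    pd_mul (c 0) (d 0), pd_mul (c 1) (d 1), C.pd_potentialDual hA hB hp, pd_coord, pd_coord]
  fin_cases i <;> simp

theorem isInverseHessian_potential (hA : ∀ x ∈ Set.Ioo C.α₁ C.α₂, 0 < A.eval x)
    (hB : ∀ y ∈ Set.Ioo C.β₁ C.β₂, 0 < B.eval y) :
    Q.IsInverseHessian (C.matH A B) (C.potential A B) := by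
  intro p hp
  obtain ⟨hU, hx, hy, hm, hρ⟩ := C.coord_mem_Ioo hp
  have hκ := C.hκ
  have hA0 := (hA _ hx).ne'
  have hB0 := (hB _ hy).ne'
  have hh : ∀ i j, hess (C.potential A B) p i j = pd i (C.potentialGrad A B j) p := by
    intro i j
    refine pd_congr ?_ i
    filter_upwards [isOpen_interior.mem_nhds hp] with q hq using C.pd_potential hA hB hq j
  have hmul := C.toGrid.mat_mul_inverse hA0 hB0 hρ.ne'
  rw [← hmul]
  unfold matH
  congr 1
  ext i j
  rw [hh, C.pd_potentialGrad hA hB hp]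
  rfl

theorem isExtremalPotential_potential (hAB : C.Solves A B)
    (hA : ∀ x ∈ Set.Ioo C.α₁ C.α₂, 0 < A.eval x) (hB : ∀ y ∈ Set.Ioo C.β₁ C.β₂, 0 < B.eval y) :
    Q.IsExtremalPotential (C.potential A B) := by
  have hinv := C.isInverseHessian_potential hA hB
  have hpd := (C.isPosDef_matH_iff A B).2 ⟨hA, hB⟩
  refine ⟨⟨C.contDiffOn_potential hA hB, ?_, C.matH A B, hinv, C.isSmoothSymm_matH A B, hpd,
    C.isPosDefOnFacets_matH hA hB hAB, C.boundaryConditions_matH hAB⟩,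
    (LabeledQuadrilateral.extremalEquation_inv_hess hinv).2 (C.extremalEquation_matH hAB)⟩
  refine strictConvexOn_of_form_hess_pos isOpen_interior Q.convex_polytope.interior
    (C.contDiffOn_potential hA hB) fun p hp v hv => ?_
  refine (posDef_iff_form (isSymm_hess isOpen_interior (C.contDiffOn_potential hA hB) hp)).1 ?_ v hv
  rw [← Matrix.inv_eq_right_inv (hinv p hp)]
  exact (hpd p hp).inv

end BilinearChart

/-! ### Smooth functions on a rectangle which vanish on its sides -/

theorem abs_le_mul_of_hasDerivWithinAt {φ φ' : ℝ → ℝ} {a b c x K : ℝ}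
    (hφ : ∀ y ∈ Set.Icc a b, HasDerivWithinAt φ (φ' y) (Set.Icc a b) y) (hc : c ∈ Set.Icc a b)
    (hx : x ∈ Set.Icc a b) (h0 : φ c = 0) (hK : ∀ y ∈ Set.uIcc c x, |φ' y| ≤ K) :
    |φ x| ≤ K * |x - c| := by
  have hsub : Set.uIcc c x ⊆ Set.Icc a b := Set.OrdConnected.uIcc_subset Set.ordConnected_Icc hc hx
  have := (convex_uIcc c x).norm_image_sub_le_of_norm_hasDerivWithin_le
    (fun y hy => (hφ y (hsub hy)).mono hsub) hK Set.left_mem_uIcc Set.right_mem_uIcc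
  simpa [h0] using this

/-- The partial derivative along `e` of a function on a closed rectangle. -/
def rectDeriv (R : Set (ℝ × ℝ)) (e : ℝ × ℝ) (φ : ℝ × ℝ → ℝ) (q : ℝ × ℝ) : ℝ :=
  fderivWithin ℝ φ R q e

theorem contDiffOn_rectDeriv {R : Set (ℝ × ℝ)} (hR : UniqueDiffOn ℝ R) {φ : ℝ × ℝ → ℝ}
    (hφ : ContDiffOn ℝ ∞ φ R) (e : ℝ × ℝ) : ContDiffOn ℝ ∞ (rectDeriv R e φ) R :=
  (hφ.fderivWithin hR (m := ∞) (by simp)).clm_apply contDiffOn_const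

section Rect

variable {a b c d : ℝ}

theorem uniqueDiffOn_rect (hab : a < b) (hcd : c < d) :
    UniqueDiffOn ℝ (Set.Icc a b ×ˢ Set.Icc c d) :=
  (uniqueDiffOn_Icc hab).prod (uniqueDiffOn_Icc hcd)

variable {φ : ℝ × ℝ → ℝ}

theorem hasDerivWithinAt_rect_left (hφ : ContDiffOn ℝ ∞ φ (Set.Icc a b ×ˢ Set.Icc c d))
    {s t : ℝ} (hs : s ∈ Set.Icc a b) (ht : t ∈ Set.Icc c d) :
    HasDerivWithinAt (fun s => φ (s, t)) (rectDeriv (Set.Icc a b ×ˢ Set.Icc c d) (1, 0) φ (s, t))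
      (Set.Icc a b) s := by
  have h1 := ((hφ.differentiableOn (by simp)) (s, t) ⟨hs, ht⟩).hasFDerivWithinAt
  exact h1.comp_hasDerivWithinAt s ((hasDerivWithinAt_id s (Set.Icc a b)).prodMk
    (hasDerivWithinAt_const s _ t)) fun r hr => Set.mk_mem_prod hr ht

theorem hasDerivWithinAt_rect_right (hφ : ContDiffOn ℝ ∞ φ (Set.Icc a b ×ˢ Set.Icc c d))
    {s t : ℝ} (hs : s ∈ Set.Icc a b) (ht : t ∈ Set.Icc c d) :
    HasDerivWithinAt (fun t => φ (s, t)) (rectDeriv (Set.Icc a b ×ˢ Set.Icc c d) (0, 1) φ (s, t))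
      (Set.Icc c d) t := by
  have h1 := ((hφ.differentiableOn (by simp)) (s, t) ⟨hs, ht⟩).hasFDerivWithinAt
  exact h1.comp_hasDerivWithinAt t ((hasDerivWithinAt_const t (Set.Icc c d) s).prodMk
    (hasDerivWithinAt_id t _)) fun r hr => Set.mk_mem_prod hs hr

theorem exists_bound_rect (hφ : ContDiffOn ℝ ∞ φ (Set.Icc a b ×ˢ Set.Icc c d))
    : ∃ K, 0 ≤ K ∧ ∀ s ∈ Set.Icc a b, ∀ t ∈ Set.Icc c d, |φ (s, t)| ≤ K := by
  obtain ⟨K, hK⟩ := (isCompact_Icc.prod isCompact_Icc : IsCompact (Set.Icc a b ×ˢ Set.Icc c d))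
    |>.exists_bound_of_continuousOn hφ.continuousOn
  exact ⟨max K 0, le_max_right _ _, fun s hs t ht => (hK (s, t) ⟨hs, ht⟩).trans (le_max_left _ _)⟩

theorem exists_bound_of_vanish (hφ : ContDiffOn ℝ ∞ φ (Set.Icc a b ×ˢ Set.Icc c d))
    (hab : a < b) (hcd : c < d) {x : ℝ} (hx : x ∈ Set.Icc a b)
    (h0 : ∀ t ∈ Set.Icc c d, φ (x, t) = 0) :
    ∃ K, 0 ≤ K ∧ ∀ s ∈ Set.Icc a b, ∀ t ∈ Set.Icc c d, |φ (s, t)| ≤ K * |s - x| := by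
  obtain ⟨K, hK, h⟩ := exists_bound_rect (contDiffOn_rectDeriv (uniqueDiffOn_rect hab hcd) hφ (1, 0))
  refine ⟨K, hK, fun s hs t ht => ?_⟩
  exact abs_le_mul_of_hasDerivWithinAt (φ := fun s => φ (s, t))
    (fun y hy => hasDerivWithinAt_rect_left hφ hy ht) hx hs (h0 t ht)
    fun y hy => h y (Set.OrdConnected.uIcc_subset Set.ordConnected_Icc hx hs hy) t ht

theorem exists_bound_of_vanish_right (hφ : ContDiffOn ℝ ∞ φ (Set.Icc a b ×ˢ Set.Icc c d))
    (hab : a < b) (hcd : c < d) {y : ℝ} (hy : y ∈ Set.Icc c d)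
    (h0 : ∀ s ∈ Set.Icc a b, φ (s, y) = 0) :
    ∃ K, 0 ≤ K ∧ ∀ s ∈ Set.Icc a b, ∀ t ∈ Set.Icc c d, |φ (s, t)| ≤ K * |t - y| := by
  obtain ⟨K, hK, h⟩ := exists_bound_rect (contDiffOn_rectDeriv (uniqueDiffOn_rect hab hcd) hφ (0, 1))
  refine ⟨K, hK, fun s hs t ht => ?_⟩
  exact abs_le_mul_of_hasDerivWithinAt (φ := fun t => φ (s, t))
    (fun z hz => hasDerivWithinAt_rect_right hφ hs hz) hy ht (h0 s hs)
    fun z hz => h s hs z (Set.OrdConnected.uIcc_subset Set.ordConnected_Icc hy ht hz)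

/-- The first-order bound holds for the derivative in the first variable, and the mean value
inequality then gains a second factor. -/
theorem exists_bound_of_vanish_sq (hφ : ContDiffOn ℝ ∞ φ (Set.Icc a b ×ˢ Set.Icc c d))
    (hab : a < b) (hcd : c < d) {x : ℝ} (hx : x ∈ Set.Icc a b)
    (h0 : ∀ t ∈ Set.Icc c d, φ (x, t) = 0)
    (h1 : ∀ t ∈ Set.Icc c d, HasDerivWithinAt (fun s => φ (s, t)) 0 (Set.Icc a b) x) :
    ∃ K, 0 ≤ K ∧ ∀ s ∈ Set.Icc a b, ∀ t ∈ Set.Icc c d, |φ (s, t)| ≤ K * |s - x| ^ 2 := by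
  obtain ⟨K, hK, h⟩ := exists_bound_of_vanish
    (contDiffOn_rectDeriv (uniqueDiffOn_rect hab hcd) hφ (1, 0)) hab hcd hx fun t ht =>
      (uniqueDiffOn_Icc hab x hx).eq_deriv _ (hasDerivWithinAt_rect_left hφ hx ht) (h1 t ht)
  refine ⟨K, hK, fun s hs t ht => ?_⟩
  have := abs_le_mul_of_hasDerivWithinAt (φ := fun s => φ (s, t)) (K := K * |s - x|)
    (fun y hy => hasDerivWithinAt_rect_left hφ hy ht) hx hs (h0 t ht)
    fun y hy => (h y (Set.OrdConnected.uIcc_subset Set.ordConnected_Icc hx hs hy) t ht).trans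
      (mul_le_mul_of_nonneg_left (Set.abs_sub_left_of_mem_uIcc hy) hK)
  calc _ ≤ _ := this
    _ = _ := by ring

/-- The derivative in the first variable still vanishes on the line t = y, which gives the factor |t
- y|; the mean value inequality adds |s - x|. -/
theorem exists_bound_of_vanish_mul (hφ : ContDiffOn ℝ ∞ φ (Set.Icc a b ×ˢ Set.Icc c d))
    (hab : a < b) (hcd : c < d) {x y : ℝ} (hx : x ∈ Set.Icc a b)
    (hy : y ∈ Set.Icc c d) (h0 : ∀ t ∈ Set.Icc c d, φ (x, t) = 0)
    (h1 : ∀ s ∈ Set.Icc a b, φ (s, y) = 0) :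
    ∃ K, 0 ≤ K ∧ ∀ s ∈ Set.Icc a b, ∀ t ∈ Set.Icc c d, |φ (s, t)| ≤ K * (|s - x| * |t - y|) := by
  obtain ⟨K, hK, h⟩ := exists_bound_of_vanish_right
    (contDiffOn_rectDeriv (uniqueDiffOn_rect hab hcd) hφ (1, 0)) hab hcd hy fun s hs =>
      (uniqueDiffOn_Icc hab s hs).eq_deriv _ (hasDerivWithinAt_rect_left hφ hs hy)
        ((hasDerivWithinAt_const s (Set.Icc a b) (0 : ℝ)).congr h1 (h1 s hs))
  refine ⟨K, hK, fun s hs t ht => ?_⟩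
  have := abs_le_mul_of_hasDerivWithinAt (φ := fun s => φ (s, t)) (K := K * |t - y|)
    (fun y hy => hasDerivWithinAt_rect_left hφ hy ht) hx hs (h0 t ht)
    fun z hz => h z (Set.OrdConnected.uIcc_subset Set.ordConnected_Icc hx hs hz) t ht
  calc _ ≤ _ := this
    _ = _ := by ring

end Rect

/-- The distance to the end points of an interval. -/
def endDist (a b s : ℝ) : ℝ := min (s - a) (b - s)

theorem endDist_pos {a b s : ℝ} (hs : s ∈ Set.Ioo a b) : 0 < endDist a b s :=
  lt_min (sub_pos.2 hs.1) (sub_pos.2 hs.2)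

/-- A bound in terms of the distances to both end points. -/
theorem le_mul_endDist {ι : Type*} {a b : ℝ} {P : ι → Prop} {f : ι → ℝ} {s : ι → ℝ} {g : ι → ℝ}
    {h : ℝ → ℝ} (hs : ∀ i, P i → s i ∈ Set.Icc a b) (hg : ∀ i, P i → 0 ≤ g i)
    (hh : ∀ x, 0 ≤ x → 0 ≤ h x)
    (h1 : ∀ x, (x = a ∨ x = b) → ∃ K, 0 ≤ K ∧ ∀ i, P i → f i ≤ K * (h |s i - x| * g i)) :
    ∃ K, 0 ≤ K ∧ ∀ i, P i → f i ≤ K * (h (endDist a b (s i)) * g i) := by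
  obtain ⟨K₁, hK₁, b₁⟩ := h1 a (Or.inl rfl)
  obtain ⟨K₂, hK₂, b₂⟩ := h1 b (Or.inr rfl)
  refine ⟨max K₁ K₂, hK₁.trans (le_max_left _ _), fun i hi => ?_⟩
  obtain ⟨ha, hb⟩ := hs i hi
  have e1 : |s i - a| = s i - a := abs_of_nonneg (sub_nonneg.2 ha)
  have e2 : |s i - b| = b - s i := by rw [abs_sub_comm, abs_of_nonneg (sub_nonneg.2 hb)]
  rcases le_total (s i - a) (b - s i) with hle | hle
  · rw [endDist, min_eq_left hle]
    refine (b₁ i hi).trans ?_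
    rw [e1]
    exact mul_le_mul_of_nonneg_right (le_max_left _ _)
      (mul_nonneg (hh _ (sub_nonneg.2 ha)) (hg i hi))
  · rw [endDist, min_eq_right hle]
    refine (b₂ i hi).trans ?_
    rw [e2]
    exact mul_le_mul_of_nonneg_right (le_max_right _ _)
      (mul_nonneg (hh _ (sub_nonneg.2 hb)) (hg i hi))

/-! ### Decay at the boundary of the difference of two solutions -/

namespace LabeledQuadrilateral

variable (Q : LabeledQuadrilateral)

/-- The partial derivative of a function on the closed quadrilateral. -/
def pdOn (i : Fin 2) (f : Plane → ℝ) (p : Plane) : ℝ :=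
  fderivWithin ℝ f Q.polytope p (EuclideanSpace.single i 1)

variable {Q}

theorem contDiffOn_pdOn {f : Plane → ℝ} (hf : ContDiffOn ℝ ∞ f Q.polytope) (i : Fin 2) :
    ContDiffOn ℝ ∞ (Q.pdOn i f) Q.polytope :=
  (hf.fderivWithin Q.uniqueDiffOn_polytope (m := ∞) (by simp)).clm_apply contDiffOn_const

theorem pdOn_eq_pd {p : Plane} (hp : p ∈ interior Q.polytope) (i : Fin 2) (f : Plane → ℝ) :
    Q.pdOn i f p = pd i f p := by
  unfold pdOn pd
  rw [fderivWithin_of_mem_nhds (mem_interior_iff_mem_nhds.1 hp)]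

theorem fderivWithin_apply_eq_pdOn (f : Plane → ℝ) (p v : Plane) :
    fderivWithin ℝ f Q.polytope p v = Q.pdOn 0 f p * v 0 + Q.pdOn 1 f p * v 1 := by
  have : v = v 0 • (EuclideanSpace.single 0 1 : Plane) + v 1 • EuclideanSpace.single 1 1 := by
    apply plane_ext <;> simp
  conv_lhs => rw [this]
  rw [map_add, map_smul, map_smul]
  simp [pdOn, mul_comm]

theorem contDiffOn_form {D : Plane → Matrix (Fin 2) (Fin 2) ℝ}
    (hD : ∀ i j, ContDiffOn ℝ ∞ (fun p => D p i j) Q.polytope) (v w : Plane) :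
    ContDiffOn ℝ ∞ (fun p => form (D p) v w) Q.polytope := by
  simp only [form_eq]
  exact (contDiffOn_const.mul (((hD 0 0).mul contDiffOn_const).add ((hD 0 1).mul contDiffOn_const))).add
    (contDiffOn_const.mul (((hD 1 0).mul contDiffOn_const).add ((hD 1 1).mul contDiffOn_const)))

theorem fderivWithin_form {D : Plane → Matrix (Fin 2) (Fin 2) ℝ}
    (hD : ∀ i j, ContDiffOn ℝ ∞ (fun p => D p i j) Q.polytope) {p : Plane} (hp : p ∈ Q.polytope)
    (v w e : Plane) : fderivWithin ℝ (fun p => form (D p) v w) Q.polytope p e =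
      form (Matrix.of fun i j => fderivWithin ℝ (fun p => D p i j) Q.polytope p e) v w := by
  have d := fun i j => ((hD i j).differentiableOn (by simp) p hp).hasFDerivWithinAt
  have h : HasFDerivWithinAt (fun p => form (D p) v w) (
      v 0 • (w 0 • fderivWithin ℝ (fun p => D p 0 0) Q.polytope p +
        w 1 • fderivWithin ℝ (fun p => D p 0 1) Q.polytope p) +
      v 1 • (w 0 • fderivWithin ℝ (fun p => D p 1 0) Q.polytope p +
        w 1 • fderivWithin ℝ (fun p => D p 1 1) Q.polytope p)) Q.polytope p := by
    simp only [form_eq]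
    exact ((((d 0 0).mul_const (w 0)).add ((d 0 1).mul_const (w 1))).const_mul (v 0)).add
      ((((d 1 0).mul_const (w 0)).add ((d 1 1).mul_const (w 1))).const_mul (v 1))
  rw [h.fderivWithin (Q.uniqueDiffOn_polytope p hp)]
  simp [form_eq]; ring

end LabeledQuadrilateral

namespace BilinearChart

variable {Q : LabeledQuadrilateral} (C : BilinearChart Q)

/-- A smooth symmetric matrix function which vanishes on the boundary like the difference of two
solutions of the boundary conditions. -/
structure VanishesOnBoundary (D : Plane → Matrix (Fin 2) (Fin 2) ℝ) : Prop where
  smooth : ∀ i j, ContDiffOn ℝ ∞ (fun p => D p i j) Q.polytope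
  symm : ∀ p ∈ Q.polytope, (D p).IsSymm
  left : ∀ a, a = C.α₁ ∨ a = C.α₂ → ∀ t ∈ Set.Icc C.β₁ C.β₂,
    (∀ v, form (D (C.map a t)) (perp (C.Y a)) v = 0) ∧
    ∀ v, fderivWithin ℝ (fun z => form (D z) (perp (C.Y a)) (perp (C.Y a))) Q.polytope
      (C.map a t) v = 0
  right : ∀ b, b = C.β₁ ∨ b = C.β₂ → ∀ s ∈ Set.Icc C.α₁ C.α₂,
    (∀ v, form (D (C.map s b)) (perp (C.X b)) v = 0) ∧
    ∀ v, fderivWithin ℝ (fun z => form (D z) (perp (C.X b)) (perp (C.X b))) Q.polytope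
      (C.map s b) v = 0

theorem eq_zero_of_continuousOn_Icc {φ : ℝ → ℝ} {a b : ℝ} (hab : a < b)
    (hφ : ContinuousOn φ (Set.Icc a b)) (h0 : ∀ x ∈ Set.Ioo a b, φ x = 0) :
    ∀ x ∈ Set.Icc a b, φ x = 0 := by
  have h : Set.EqOn φ (fun _ => 0) (Set.Icc a b) :=
    Set.EqOn.of_subset_closure (s := Set.Ioo a b) (fun x hx => h0 x hx) hφ continuousOn_const
      Set.Ioo_subset_Icc_self (by rw [closure_Ioo hab.ne])
  exact h

/-- Continuity carries both conditions from the open edge to its end points, and rescaling the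
conormal does not affect them. -/
theorem vanishes_of_openFacet {D : Plane → Matrix (Fin 2) (Fin 2) ℝ}
    (hD : ∀ i j, ContDiffOn ℝ ∞ (fun p => D p i j) Q.polytope) {a b : ℝ} (hab : a < b)
    {γ : ℝ → Plane} (hγ : Continuous γ) (hm : ∀ t ∈ Set.Icc a b, γ t ∈ Q.polytope) {n n' : Plane}
    {k : ℝ} (hk : k ≠ 0) (hn : n' = k • n)
    (h : ∀ t ∈ Set.Ioo a b, (∀ v, form (D (γ t)) n' v = 0) ∧
      ∀ v, fderivWithin ℝ (fun z => form (D z) n' n') Q.polytope (γ t) v = 0) :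
    ∀ t ∈ Set.Icc a b, (∀ v, form (D (γ t)) n v = 0) ∧
      ∀ v, fderivWithin ℝ (fun z => form (D z) n n) Q.polytope (γ t) v = 0 := by
  have hn' : n = k⁻¹ • n' := by rw [hn, smul_smul, inv_mul_cancel₀ hk, one_smul]
  have e1 : ∀ p v, form (D p) n v = k⁻¹ * form (D p) n' v := by
    intro p v; rw [hn']; simp [form_eq]; ring
  have e2 : ∀ M : Matrix (Fin 2) (Fin 2) ℝ, form M n n = k⁻¹ ^ 2 * form M n' n' := by
    intro p; rw [hn']; simp [form_eq]; ring
  have c1 := fun v => (LabeledQuadrilateral.contDiffOn_form hD n' v).continuousOn.comp hγ.continuousOn hm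
  have c2 : ∀ v, ContinuousOn (fun p => fderivWithin ℝ (fun z => form (D z) n' n') Q.polytope p v)
      Q.polytope := fun v =>
    (((LabeledQuadrilateral.contDiffOn_form hD n' n').fderivWithin Q.uniqueDiffOn_polytope (m := ∞)
      (by simp)).clm_apply contDiffOn_const).continuousOn
  intro t ht
  refine ⟨fun v => ?_, fun v => ?_⟩
  · rw [e1, show form (D (γ t)) n' v = 0 from
      eq_zero_of_continuousOn_Icc hab (c1 v) (fun t ht => (h t ht).1 v) t ht, mul_zero]
  · have := eq_zero_of_continuousOn_Icc hab ((c2 v).comp hγ.continuousOn hm)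
      (fun t ht => (h t ht).2 v) t ht
    simp only [Function.comp_apply] at this
    rw [LabeledQuadrilateral.fderivWithin_form hD (hm t ht)] at this ⊢
    rw [e2, this, mul_zero]

theorem continuous_map_left (t : ℝ) : Continuous fun s => C.map s t :=
  C.continuous_map.comp (Continuous.prodMk_left t)

theorem continuous_map_right (s : ℝ) : Continuous fun t => C.map s t :=
  C.continuous_map.comp (Continuous.prodMk_right s)

/-- The difference of two solutions of the boundary conditions. -/
theorem vanishesOnBoundary_sub {H K : Plane → Matrix (Fin 2) (Fin 2) ℝ} (hH : Q.IsSmoothSymm H)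
    (hK : Q.IsSmoothSymm K) (hbH : Q.BoundaryConditions H) (hbK : Q.BoundaryConditions K) :
    C.VanishesOnBoundary fun p => H p - K p := by
  have smooth : ∀ i j, ContDiffOn ℝ ∞ (fun p => (H p - K p) i j) Q.polytope := fun i j =>
    (hH.1 i j).sub (hK.1 i j)
  have hfac : ∀ i, ∀ y ∈ Q.openFacet i, (∀ v, form (H y - K y) (Q.normal i) v = 0) ∧
      ∀ v, fderivWithin ℝ (fun z => form (H z - K z) (Q.normal i) (Q.normal i)) Q.polytope y v = 0 := by
    intro i y hy
    have e : ∀ (M N : Matrix (Fin 2) (Fin 2) ℝ) v w, form (M - N) v w = form M v w - form N v w := by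
      intro M N v w; simp [form_eq]; ring
    have hyp := Q.openFacet_subset i hy
    refine ⟨fun v => by rw [e, (hbH i y hy).1, (hbK i y hy).1, sub_zero], fun v => ?_⟩
    simp only [e]
    rw [fderivWithin_fun_sub (Q.uniqueDiffOn_polytope y hyp)
      ((LabeledQuadrilateral.contDiffOn_form hH.1 _ _).differentiableOn (by simp) y hyp)
      ((LabeledQuadrilateral.contDiffOn_form hK.1 _ _).differentiableOn (by simp) y hyp)]
    simp [(hbH i y hy).2 v, (hbK i y hy).2 v]
  have hκ := C.hκ
  have hν := fun i => (C.ν_pos i).ne'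
  refine ⟨smooth, fun p hp => (hH.2 p hp).sub (hK.2 p hp), ?_, ?_⟩
  · rintro a (rfl | rfl)
    · exact vanishes_of_openFacet smooth C.hβ (C.continuous_map_right _)
        (fun t ht => C.map_mem_polytope C.left_mem ht) (div_ne_zero (hν 3) hκ) C.normal_three
        fun t ht => hfac 3 _ (C.mem_openFacet_three.2 ⟨t, ht, rfl⟩)
    · exact vanishes_of_openFacet smooth C.hβ (C.continuous_map_right _)
        (fun t ht => C.map_mem_polytope C.right_mem ht) (div_ne_zero (neg_ne_zero.2 (hν 1)) hκ)
        C.normal_one fun t ht => hfac 1 _ (C.mem_openFacet_one.2 ⟨t, ht, rfl⟩)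
  · rintro b (rfl | rfl)
    · exact vanishes_of_openFacet smooth C.hα (C.continuous_map_left _)
        (fun t ht => C.map_mem_polytope ht C.bot_mem) (div_ne_zero (neg_ne_zero.2 (hν 0)) hκ)
        C.normal_zero fun t ht => hfac 0 _ (C.mem_openFacet_zero.2 ⟨t, ht, rfl⟩)
    · exact vanishes_of_openFacet smooth C.hα (C.continuous_map_left _)
        (fun t ht => C.map_mem_polytope ht C.top_mem) (div_ne_zero (hν 2) hκ) C.normal_two
        fun t ht => hfac 2 _ (C.mem_openFacet_two.2 ⟨t, ht, rfl⟩)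

variable {C} {D : Plane → Matrix (Fin 2) (Fin 2) ℝ}

theorem VanishesOnBoundary.swap (h : C.VanishesOnBoundary D) : C.swap.VanishesOnBoundary D := by
  have e : Q.reflect.polytope = Q.polytope := Q.polytope_reflect
  have em : ∀ s t, C.swap.map s t = C.map t s := C.toGrid.swap_map
  constructor
  · rw [e]; exact h.smooth
  · rw [e]; exact h.symm
  · rw [e]; intro a ha t ht; rw [em]; exact h.right a ha t ht
  · rw [e]; intro a ha t ht; rw [em]; exact h.left a ha t ht

variable (C) in
/-- The closed coordinate rectangle. -/
def box : Set (ℝ × ℝ) := Set.Icc C.α₁ C.α₂ ×ˢ Set.Icc C.β₁ C.β₂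

theorem contDiffOn_box {f : Plane → ℝ} (hf : ContDiffOn ℝ ∞ f Q.polytope) :
    ContDiffOn ℝ ∞ (fun q : ℝ × ℝ => f (C.map q.1 q.2)) C.box :=
  hf.comp C.contDiff_map.contDiffOn fun _ hq => C.map_mem_polytope hq.1 hq.2

variable (D) in
/-- The divergence of the `i`-th row of `D`. -/
def _root_.ToricQuad.LabeledQuadrilateral.divRow (Q : LabeledQuadrilateral)
    (i : Fin 2) (p : Plane) : ℝ :=
  Q.pdOn 0 (fun q => D q i 0) p + Q.pdOn 1 (fun q => D q i 1) p

theorem contDiffOn_perp_Y_fst (i : Fin 2) (S : Set (ℝ × ℝ)) :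
    ContDiffOn ℝ ∞ (fun q : ℝ × ℝ => perp (C.Y q.1) i) S :=
  ((C.contDiff_perp_Y i).comp contDiff_fst).contDiffOn

theorem contDiffOn_perp_X_snd (i : Fin 2) (S : Set (ℝ × ℝ)) :
    ContDiffOn ℝ ∞ (fun q : ℝ × ℝ => perp (C.X q.2) i) S :=
  ((C.contDiff_perp_X i).comp contDiff_snd).contDiffOn

/-- On a side x = a the conormal n = `perp (Y a)` lies in the kernel of D, and D(n, n) also has zero
derivative there. The moving conormal is n + (s - a) `perp c₃`; its correction terms carry a factor
s - a and either a second one or the value D(n, ·), which vanishes on the side. So the decay is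
quadratic. -/
theorem VanishesOnBoundary.exists_bound_YY (h : C.VanishesOnBoundary D) :
    ∃ K, 0 ≤ K ∧ ∀ q : ℝ × ℝ, q ∈ C.box →
      |form (D (C.map q.1 q.2)) (perp (C.Y q.1)) (perp (C.Y q.1))| ≤
        K * (endDist C.α₁ C.α₂ q.1 ^ 2 * 1) := by
  have hsm : ContDiffOn ℝ ∞ (fun q : ℝ × ℝ =>
      form (D (C.map q.1 q.2)) (perp (C.Y q.1)) (perp (C.Y q.1))) C.box := by
    simp only [form_eq]
    have hd := fun i j => contDiffOn_box (C := C) (h.smooth i j)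
    have hy := fun i => contDiffOn_perp_Y_fst (C := C) i C.box
    exact ((hy 0).mul (((hd 0 0).mul (hy 0)).add ((hd 0 1).mul (hy 1)))).add
      ((hy 1).mul (((hd 1 0).mul (hy 0)).add ((hd 1 1).mul (hy 1))))
  refine le_mul_endDist (s := Prod.fst) (g := fun _ => 1) (h := fun x => x ^ 2) (fun q hq => hq.1)
    (fun _ _ => zero_le_one) (fun x _ => sq_nonneg x) fun a ha => ?_
  have ham : a ∈ Set.Icc C.α₁ C.α₂ := by
    rcases ha with rfl | rfl
    · exact C.left_mem
    · exact C.right_mem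
  obtain ⟨K, hK, hb⟩ := exists_bound_of_vanish_sq hsm C.hα C.hβ ham
    (fun t ht => (h.left a ha t ht).1 _) fun t ht => by
      set n := perp (C.Y a) with hn
      set m := perp C.c₃ with hm
      have hp := C.map_mem_polytope ham ht
      have comp_deriv : ∀ v w : Plane, HasDerivWithinAt (fun s => form (D (C.map s t)) v w)
          (fderivWithin ℝ (fun z => form (D z) v w) Q.polytope (C.map a t) (C.X t))
          (Set.Icc C.α₁ C.α₂) a := fun v w =>
        HasFDerivWithinAt.comp_hasDerivWithinAt (f := fun s => C.map s t) (l := fun z => form (D z) v w)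
          a ((LabeledQuadrilateral.contDiffOn_form h.smooth v w).differentiableOn (by simp) _
            hp).hasFDerivWithinAt (C.hasDerivAt_map_left a t).hasDerivWithinAt
          fun s hs => C.map_mem_polytope hs ht
      have hid : HasDerivWithinAt (fun s : ℝ => s - a) 1 (Set.Icc C.α₁ C.α₂) a :=
        (hasDerivWithinAt_id a _).sub_const a
      have h1 := (comp_deriv n n).add (hid.mul (((comp_deriv n m).const_mul 2).add
        (hid.mul (comp_deriv m m))))
      have e : (fun s => form (D (C.map s t)) (perp (C.Y s)) (perp (C.Y s))) =
          fun s => form (D (C.map s t)) n n + (s - a) * (form (D (C.map s t)) n m +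
            form (D (C.map s t)) m n + (s - a) * form (D (C.map s t)) m m) := by
        funext s
        simp only [form_eq, hn, hm, perp_zero_apply, perp_one_apply, C.Y_apply]
        ring
      refine (h1.congr_of_mem (f₁ := fun s => form (D (C.map s t)) (perp (C.Y s)) (perp (C.Y s)))
        (fun s hs => ?_) ham).congr_deriv ?_
      · have hsy : D (C.map s t) 0 1 = D (C.map s t) 1 0 :=
          (h.symm _ (C.map_mem_polytope hs ht)).apply 1 0
        rw [congrFun e s]
        simp only [Pi.add_apply, Pi.mul_apply, form_eq, hsy]
        ring
      · have z := (h.left a ha t ht).1 m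
        rw [hn, (h.left a ha t ht).2]
        simp [z]
  exact ⟨K, hK, fun q hq => by rw [mul_one]; exact hb q.1 hq.1 q.2 hq.2⟩

/-- This entry vanishes on all four sides, because `perp Y` is conormal to the sides x = const and
`perp X` to the sides y = const. The bound is therefore a product of both distances. -/
theorem VanishesOnBoundary.exists_bound_YX (h : C.VanishesOnBoundary D) :
    ∃ K, 0 ≤ K ∧ ∀ q : ℝ × ℝ, q ∈ C.box →
      |form (D (C.map q.1 q.2)) (perp (C.Y q.1)) (perp (C.X q.2))| ≤
        K * (endDist C.α₁ C.α₂ q.1 * endDist C.β₁ C.β₂ q.2) := by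
  have hsm : ContDiffOn ℝ ∞ (fun q : ℝ × ℝ =>
      form (D (C.map q.1 q.2)) (perp (C.Y q.1)) (perp (C.X q.2))) C.box := by
    simp only [form_eq]
    have hd := fun i j => contDiffOn_box (C := C) (h.smooth i j)
    have hy := fun i => contDiffOn_perp_Y_fst (C := C) i C.box
    have hx := fun i => contDiffOn_perp_X_snd (C := C) i C.box
    exact ((hy 0).mul (((hd 0 0).mul (hx 0)).add ((hd 0 1).mul (hx 1)))).add
      ((hy 1).mul (((hd 1 0).mul (hx 0)).add ((hd 1 1).mul (hx 1))))
  have hnn : ∀ q : ℝ × ℝ, q ∈ C.box → 0 ≤ endDist C.β₁ C.β₂ q.2 := fun q hq =>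
    le_min (sub_nonneg.2 hq.2.1) (sub_nonneg.2 hq.2.2)
  refine le_mul_endDist (s := Prod.fst) (g := fun q => endDist C.β₁ C.β₂ q.2) (h := fun x => x)
    (fun q hq => hq.1) hnn (fun x hx => hx) fun a ha => ?_
  have ham : a ∈ Set.Icc C.α₁ C.α₂ := by
    rcases ha with rfl | rfl
    · exact C.left_mem
    · exact C.right_mem
  have := le_mul_endDist (P := fun q : ℝ × ℝ => q ∈ C.box) (s := Prod.snd)
    (f := fun q : ℝ × ℝ => |form (D (C.map q.1 q.2)) (perp (C.Y q.1)) (perp (C.X q.2))|)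
    (g := fun q => |q.1 - a|) (h := fun x => x)
    (fun q hq => hq.2) (fun q _ => abs_nonneg _) (fun x hx => hx) fun b hb => by
      have hbm : b ∈ Set.Icc C.β₁ C.β₂ := by
        rcases hb with rfl | rfl
        · exact C.bot_mem
        · exact C.top_mem
      obtain ⟨K, hK, hb⟩ := exists_bound_of_vanish_mul hsm C.hα C.hβ ham hbm
        (fun t ht => (h.left a ha t ht).1 _) fun s hs => by
          have := (h.right b hb s hs).1 (perp (C.Y s))
          have hsy : D (C.map s b) 0 1 = D (C.map s b) 1 0 :=
            (h.symm _ (C.map_mem_polytope hs hbm)).apply 1 0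
          rw [← this]
          simp only [form_eq, hsy]; ring
      exact ⟨K, hK, fun q hq => by rw [mul_comm |q.2 - b|]; exact hb q.1 hq.1 q.2 hq.2⟩
  obtain ⟨K, hK, hb⟩ := this
  exact ⟨K, hK, fun q hq => by rw [mul_comm |q.1 - a|]; exact hb q hq⟩

end BilinearChart

/-! ### The flux of D∇f - f div D near the boundary -/

namespace BilinearChart

variable {Q : LabeledQuadrilateral} {C : BilinearChart Q} {D : Plane → Matrix (Fin 2) (Fin 2) ℝ}

theorem VanishesOnBoundary.contDiffOn_divRow (h : C.VanishesOnBoundary D) (i : Fin 2) :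
    ContDiffOn ℝ ∞ (Q.divRow D i) Q.polytope :=
  (LabeledQuadrilateral.contDiffOn_pdOn (h.smooth i 0) 0).add
    (LabeledQuadrilateral.contDiffOn_pdOn (h.smooth i 1) 1)

/-- The divergence of `D` is tangent to the boundary. -/
theorem VanishesOnBoundary.perp_divRow (h : C.VanishesOnBoundary D) {a t : ℝ}
    (ha : a = C.α₁ ∨ a = C.α₂) (ht : t ∈ Set.Icc C.β₁ C.β₂) :
    perp (C.Y a) 0 * Q.divRow D 0 (C.map a t) + perp (C.Y a) 1 * Q.divRow D 1 (C.map a t) = 0 := by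
  have ham : a ∈ Set.Icc C.α₁ C.α₂ := by
    rcases ha with rfl | rfl
    · exact C.left_mem
    · exact C.right_mem
  have hp := C.map_mem_polytope ham ht
  -- D(n, ·) is zero along the edge, so its tangential derivatives vanish. With the vanishing
  -- transverse derivative of D(n, n) they determine the pairing of n with div D, up to the factor
  -- det(X, Y).
  have h1 : ∀ v, fderivWithin ℝ (fun z => form (D z) (perp (C.Y a)) v) Q.polytope (C.map a t)
      (C.Y a) = 0 := by
    intro v
    have hd := HasFDerivWithinAt.comp_hasDerivWithinAt (f := fun t => C.map a t)
      (l := fun z => form (D z) (perp (C.Y a)) v) t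
      ((LabeledQuadrilateral.contDiffOn_form h.smooth _ v).differentiableOn (by simp) _
        hp).hasFDerivWithinAt (C.hasDerivAt_map_right a t).hasDerivWithinAt
      (s := Set.Icc C.β₁ C.β₂) fun t ht => C.map_mem_polytope ham ht
    exact (uniqueDiffOn_Icc C.hβ t ht).eq_deriv _ hd
      ((hasDerivWithinAt_const t (Set.Icc C.β₁ C.β₂) (0 : ℝ)).congr
        (fun t ht => (h.left a ha t ht).1 v) ((h.left a ha t ht).1 v))
  have h2 := (h.left a ha t ht).2 (C.X t)
  have h10 := h1 (EuclideanSpace.single 0 1)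
  have h11 := h1 (EuclideanSpace.single 1 1)
  rw [LabeledQuadrilateral.fderivWithin_form h.smooth hp] at h10 h11 h2
  have hdet : C.X t 0 * C.Y a 1 - C.X t 1 * C.Y a 0 ≠ 0 := by
    rw [show C.X t 0 * C.Y a 1 - C.X t 1 * C.Y a 0 = C.κ * C.ρ a t by rw [← C.det_eq]; simp [det2]]
    exact mul_ne_zero C.hκ (C.ρ_pos a ham t ht).ne'
  simp only [form_eq, Matrix.of_apply, LabeledQuadrilateral.fderivWithin_apply_eq_pdOn,
    perp_zero_apply, perp_one_apply] at h10 h11 h2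
  simp only [PiLp.single_apply] at h10 h11
  simp only [LabeledQuadrilateral.divRow, perp_zero_apply, perp_one_apply]
  refine (mul_eq_zero.1 ?_).resolve_left hdet
  simp at h10 h11
  linear_combination h2 - C.X t 1 * h10 + C.X t 0 * h11

theorem VanishesOnBoundary.exists_bound_div (h : C.VanishesOnBoundary D) :
    ∃ K, 0 ≤ K ∧ ∀ q : ℝ × ℝ, q ∈ C.box →
      |perp (C.Y q.1) 0 * Q.divRow D 0 (C.map q.1 q.2) +
        perp (C.Y q.1) 1 * Q.divRow D 1 (C.map q.1 q.2)| ≤ K * (endDist C.α₁ C.α₂ q.1 * 1) := by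
  have hsm : ContDiffOn ℝ ∞ (fun q : ℝ × ℝ => perp (C.Y q.1) 0 * Q.divRow D 0 (C.map q.1 q.2) +
        perp (C.Y q.1) 1 * Q.divRow D 1 (C.map q.1 q.2)) C.box := by
    have hd := fun i => contDiffOn_box (C := C) (h.contDiffOn_divRow i)
    have hy := fun i => contDiffOn_perp_Y_fst (C := C) i C.box
    exact ((hy 0).mul (hd 0)).add ((hy 1).mul (hd 1))
  refine le_mul_endDist (s := Prod.fst) (g := fun _ => 1) (h := fun x => x) (fun q hq => hq.1)
    (fun _ _ => zero_le_one) (fun x hx => hx) fun a ha => ?_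
  have ham : a ∈ Set.Icc C.α₁ C.α₂ := by
    rcases ha with rfl | rfl
    · exact C.left_mem
    · exact C.right_mem
  obtain ⟨K, hK, hb⟩ := exists_bound_of_vanish hsm C.hα C.hβ ham fun t ht => h.perp_divRow ha ht
  exact ⟨K, hK, fun q hq => by rw [mul_one]; exact hb q.1 hq.1 q.2 hq.2⟩

variable (C) in
/-- A function whose values are bounded and whose derivatives along the coordinate lines grow at
most like the inverse distance to the boundary. -/
def ModerateGrowth (f : Plane → ℝ) (M : ℝ) : Prop :=
  ∀ s ∈ Set.Ioo C.α₁ C.α₂, ∀ t ∈ Set.Ioo C.β₁ C.β₂, |f (C.map s t)| ≤ M ∧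
    |fderiv ℝ f (C.map s t) (C.X t)| * endDist C.α₁ C.α₂ s ≤ M ∧
    |fderiv ℝ f (C.map s t) (C.Y s)| * endDist C.β₁ C.β₂ t ≤ M

theorem ModerateGrowth.swap {f : Plane → ℝ} {M : ℝ} (h : C.ModerateGrowth f M) :
    C.swap.ModerateGrowth f M := by
  intro s hs t ht
  obtain ⟨h1, h2, h3⟩ := h t ht s hs
  rw [show C.swap.map s t = C.map t s from C.toGrid.swap_map s t]
  exact ⟨h1, h3, h2⟩

variable (D) in
/-- The components of the vector field `D ∇f - f div D`. -/
def _root_.ToricQuad.greenField (f : Plane → ℝ) (i : Fin 2) (p : Plane) : ℝ :=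
  D p i 0 * pd 0 f p + D p i 1 * pd 1 f p -
    f p * (pd 0 (fun q => D q i 0) p + pd 1 (fun q => D q i 1) p)

/-- The flux is the pairing with `perp Y`, and the gradient expands as κρ∇f = (Xf) `perp Y` - (Yf)
`perp X`, where Xf and Yf are the derivatives along X and Y. -/
theorem fluxX_greenField (D : Plane → Matrix (Fin 2) (Fin 2) ℝ) (f : Plane → ℝ) {s t : ℝ}
    (hs : s ∈ Set.Ioo C.α₁ C.α₂) (ht : t ∈ Set.Ioo C.β₁ C.β₂) :
    C.κ * C.ρ s t * C.fluxX (greenField D f 0) (greenField D f 1) s t =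
      form (D (C.map s t)) (perp (C.Y s)) (perp (C.Y s)) * fderiv ℝ f (C.map s t) (C.X t) -
      form (D (C.map s t)) (perp (C.Y s)) (perp (C.X t)) * fderiv ℝ f (C.map s t) (C.Y s) -
      C.κ * C.ρ s t * (f (C.map s t) * (perp (C.Y s) 0 * Q.divRow D 0 (C.map s t) +
        perp (C.Y s) 1 * Q.divRow D 1 (C.map s t))) := by
  have hp := C.map_mem_interior hs ht
  rw [show C.κ * C.ρ s t = C.X t 0 * C.Y s 1 - C.X t 1 * C.Y s 0 by rw [← C.det_eq]; simp [det2]]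
  simp only [Grid.fluxX, greenField, fderiv_apply_eq_pd, form_eq, LabeledQuadrilateral.divRow,
    LabeledQuadrilateral.pdOn_eq_pd hp, perp_zero_apply, perp_one_apply]
  ring

/-- Let δ, δ' be the distances in x and y. The three terms are of size δ² · 1/δ, δδ' · 1/δ' and 1 ·
δ, so the boundary behaviour of D exactly compensates the growth of the derivatives of f. -/
theorem exists_bound_fluxX (h : C.VanishesOnBoundary D) {f : Plane → ℝ} {M : ℝ}
    (hf : C.ModerateGrowth f M) : ∃ K, 0 ≤ K ∧ ∀ s ∈ Set.Ioo C.α₁ C.α₂, ∀ t ∈ Set.Ioo C.β₁ C.β₂,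
      |C.fluxX (greenField D f 0) (greenField D f 1) s t| ≤ K * endDist C.α₁ C.α₂ s := by
  obtain ⟨K₁, hK₁, h₁⟩ := h.exists_bound_YY
  obtain ⟨K₂, hK₂, h₂⟩ := h.exists_bound_YX
  obtain ⟨K₃, hK₃, h₃⟩ := h.exists_bound_div
  obtain ⟨z, hz, hmin⟩ := (isCompact_Icc.prod isCompact_Icc : IsCompact C.box).exists_isMinOn
    ⟨(C.α₁, C.β₁), C.left_mem, C.bot_mem⟩ C.continuous_ρ.continuousOn
  have hm := C.ρ_pos _ hz.1 _ hz.2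
  have hM : 0 ≤ M := (abs_nonneg _).trans (hf _ (mid_mem C.hα) _ (mid_mem C.hβ)).1
  set m := |C.κ| * C.ρ z.1 z.2 with hmdef
  have hm0 : 0 < m := mul_pos (abs_pos.2 C.hκ) hm
  refine ⟨((K₁ + K₂) * M) / m + M * K₃, by positivity, fun s hs t ht => ?_⟩
  have hst : (s, t) ∈ C.box := ⟨Set.Ioo_subset_Icc_self hs, Set.Ioo_subset_Icc_self ht⟩
  have b1 := h₁ _ hst
  have b2 := h₂ _ hst
  have b3 := h₃ _ hst
  obtain ⟨g0, g1, g2⟩ := hf s hs t ht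
  have hδ := endDist_pos hs
  have hδ' := endDist_pos ht
  have hρm : m ≤ |C.κ * C.ρ s t| := by
    rw [abs_mul, abs_of_pos (C.ρ_pos s hst.1 t hst.2)]
    exact mul_le_mul_of_nonneg_left (hmin hst) (abs_nonneg _)
  have hρ0 : C.κ * C.ρ s t ≠ 0 := fun h0 => by rw [h0, abs_zero] at hρm; linarith
  have key := fluxX_greenField D f hs ht
  simp only at b1 b2 b3
  generalize form (D (C.map s t)) (perp (C.Y s)) (perp (C.Y s)) = E at *
  generalize form (D (C.map s t)) (perp (C.Y s)) (perp (C.X t)) = F at *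
  generalize perp (C.Y s) 0 * Q.divRow D 0 (C.map s t) +
        perp (C.Y s) 1 * Q.divRow D 1 (C.map s t) = P at *
  generalize fderiv ℝ f (C.map s t) (C.X t) = u at *
  generalize fderiv ℝ f (C.map s t) (C.Y s) = w at *
  generalize C.fluxX (greenField D f 0) (greenField D f 1) s t = Φ at *
  generalize C.κ * C.ρ s t = r at *
  generalize endDist C.α₁ C.α₂ s = δ at *
  generalize endDist C.β₁ C.β₂ t = δ' at *
  generalize f (C.map s t) = f₀ at *
  have e1 : |E * u| ≤ K₁ * M * δ := by
    rw [abs_mul]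
    calc |E| * |u| ≤ K₁ * (δ ^ 2 * 1) * |u| := mul_le_mul_of_nonneg_right b1 (abs_nonneg _)
      _ = K₁ * (|u| * δ) * δ := by ring
      _ ≤ K₁ * M * δ := by gcongr
  have e2 : |F * w| ≤ K₂ * M * δ := by
    rw [abs_mul]
    calc |F| * |w| ≤ K₂ * (δ * δ') * |w| := mul_le_mul_of_nonneg_right b2 (abs_nonneg _)
      _ = K₂ * (|w| * δ') * δ := by ring
      _ ≤ K₂ * M * δ := by gcongr
  have e3 : |f₀ * P| ≤ M * K₃ * δ := by
    rw [abs_mul]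
    calc |f₀| * |P| ≤ M * (K₃ * (δ * 1)) := mul_le_mul g0 b3 (abs_nonneg _) hM
      _ = _ := by ring
  have eΦ : Φ = (E * u - F * w) / r - f₀ * P := by
    field_simp; linear_combination key
  rw [eΦ]
  have hr0 : 0 < |r| := abs_pos.2 hρ0
  calc |(E * u - F * w) / r - f₀ * P| ≤ |(E * u - F * w) / r| + |f₀ * P| := abs_sub _ _
    _ ≤ ((K₁ + K₂) * M * δ) / m + M * K₃ * δ := by
        refine add_le_add ?_ e3
        rw [abs_div]
        refine div_le_div₀ (by positivity) ?_ hm0 hρm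
        calc |E * u - F * w| ≤ |E * u| + |F * w| := abs_sub _ _
          _ ≤ _ := by linarith
    _ = _ := by ring

theorem exists_bound_fluxY (h : C.VanishesOnBoundary D) {f : Plane → ℝ} {M : ℝ}
    (hf : C.ModerateGrowth f M) : ∃ K, 0 ≤ K ∧ ∀ s ∈ Set.Ioo C.α₁ C.α₂, ∀ t ∈ Set.Ioo C.β₁ C.β₂,
      |C.fluxY (greenField D f 0) (greenField D f 1) s t| ≤ K * endDist C.β₁ C.β₂ t := by
  obtain ⟨K, hK, hb⟩ := exists_bound_fluxX h.swap hf.swap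
  refine ⟨K, hK, fun s hs t ht => ?_⟩
  have e : C.fluxY (greenField D f 0) (greenField D f 1) s t =
      -C.swap.fluxX (greenField D f 0) (greenField D f 1) t s := by
    have em : C.swap.map t s = C.map s t := C.toGrid.swap_map t s
    unfold Grid.fluxX Grid.fluxY
    rw [em]
    change _ = -(C.X t 1 * _ - C.X t 0 * _)
    ring
  rw [e, abs_neg]
  exact hb t ht s hs

end BilinearChart

/-! ### The divergence theorem for D∇f - f div D -/

theorem contDiffOn_greenField {D : Plane → Matrix (Fin 2) (Fin 2) ℝ} {f : Plane → ℝ} {U : Set Plane}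
    (hU : IsOpen U) (hD : ∀ i j, ContDiffOn ℝ ∞ (fun p => D p i j) U) (hf : ContDiffOn ℝ ∞ f U)
    (i : Fin 2) : ContDiffOn ℝ ∞ (greenField D f i) U :=
  (((hD i 0).mul (contDiffOn_pd hU hf 0)).add ((hD i 1).mul (contDiffOn_pd hU hf 1))).sub
    (hf.mul ((contDiffOn_pd hU (hD i 0) 0).add (contDiffOn_pd hU (hD i 1) 1)))

/-- The divergence of `D ∇f - f div D`. -/
theorem div_greenField {D : Plane → Matrix (Fin 2) (Fin 2) ℝ} {f : Plane → ℝ} {U : Set Plane}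
    (hU : IsOpen U) (hD : ∀ i j, ContDiffOn ℝ ∞ (fun p => D p i j) U) (hf : ContDiffOn ℝ ∞ f U)
    (hsymm : ∀ p ∈ U, (D p).IsSymm) {p : Plane} (hp : p ∈ U) :
    pd 0 (greenField D f 0) p + pd 1 (greenField D f 1) p =
      (D p * hess f p).trace + f p * abreu D p := by
  have dD := fun i j => differentiableAt_of_contDiffOn hU (hD i j) hp
  have ddD := fun k i j => differentiableAt_of_contDiffOn hU (contDiffOn_pd hU (hD i j) k) hp
  have df := differentiableAt_of_contDiffOn hU hf hp
  have ddf := fun k => differentiableAt_of_contDiffOn hU (contDiffOn_pd hU hf k) hp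
  have key : ∀ i k, pd k (greenField D f i) p =
      (pd k (fun q => D q i 0) p * pd 0 f p + D p i 0 * pd k (pd 0 f) p +
        (pd k (fun q => D q i 1) p * pd 1 f p + D p i 1 * pd k (pd 1 f) p)) -
      (pd k f p * (pd 0 (fun q => D q i 0) p + pd 1 (fun q => D q i 1) p) +
        f p * pd k (fun q => pd 0 (fun q => D q i 0) q + pd 1 (fun q => D q i 1) q) p) := by
    intro i k
    have m0 : DifferentiableAt ℝ (fun q => D q i 0 * pd 0 f q) p := (dD i 0).mul (ddf 0)
    have m1 : DifferentiableAt ℝ (fun q => D q i 1 * pd 1 f q) p := (dD i 1).mul (ddf 1)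
    have ms : DifferentiableAt ℝ (fun q => D q i 0 * pd 0 f q + D q i 1 * pd 1 f q) p := m0.add m1
    have md : DifferentiableAt ℝ (fun q => pd 0 (fun q => D q i 0) q + pd 1 (fun q => D q i 1) q) p :=
      (ddD 0 i 0).add (ddD 1 i 1)
    have mf : DifferentiableAt ℝ (fun q => f q *
        (pd 0 (fun q => D q i 0) q + pd 1 (fun q => D q i 1) q)) p := df.mul md
    unfold greenField
    rw [pd_sub ms mf, pd_add m0 m1, pd_mul (dD i 0) (ddf 0), pd_mul (dD i 1) (ddf 1), pd_mul df md]
  have hs : ∀ᶠ q in nhds p, D q 0 1 = D q 1 0 := by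
    filter_upwards [hU.mem_nhds hp] with q hq using (hsymm q hq).apply 1 0
  have hs0 := pd_congr hs 0
  have hs1 := pd_congr hs 1
  have hsp := hs.self_of_nhds
  rw [key, key, abreu_eq hU hD hp, Matrix.trace_fin_two, Matrix.mul_apply, Matrix.mul_apply]
  simp only [Fin.sum_univ_two, hess, Matrix.of_apply, hs0, hs1, hsp]
  ring

namespace BilinearChart

variable {Q : LabeledQuadrilateral} {C : BilinearChart Q} {D : Plane → Matrix (Fin 2) (Fin 2) ℝ}
  {f : Plane → ℝ}

theorem contDiffOn_comp_map {g : Plane → ℝ} (hg : ContDiffOn ℝ ∞ g (interior Q.polytope)) :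
    ContDiffOn ℝ ∞ (fun q : ℝ × ℝ => g (C.map q.1 q.2))
      (Set.Ioo C.α₁ C.α₂ ×ˢ Set.Ioo C.β₁ C.β₂) :=
  hg.comp C.contDiff_map.contDiffOn fun _ hq => C.map_mem_interior hq.1 hq.2

theorem contDiffOn_flux {u w : Plane → ℝ} (hu : ContDiffOn ℝ ∞ u (interior Q.polytope))
    (hw : ContDiffOn ℝ ∞ w (interior Q.polytope)) :
    ContDiffOn ℝ ∞ (fun q : ℝ × ℝ => C.fluxX u w q.1 q.2)
      (Set.Ioo C.α₁ C.α₂ ×ˢ Set.Ioo C.β₁ C.β₂) ∧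
    ContDiffOn ℝ ∞ (fun q : ℝ × ℝ => C.fluxY u w q.1 q.2)
      (Set.Ioo C.α₁ C.α₂ ×ˢ Set.Ioo C.β₁ C.β₂) := by
  have h1 := contDiffOn_comp_map (C := C) hu
  have h2 := contDiffOn_comp_map (C := C) hw
  have hy : ∀ i, ContDiff ℝ ∞ fun q : ℝ × ℝ => C.Y q.1 i := fun i => by
    simp only [C.Y_apply]; fun_prop
  have hx : ∀ i, ContDiff ℝ ∞ fun q : ℝ × ℝ => C.X q.2 i := fun i => by
    simp only [C.X_apply]; fun_prop
  exact ⟨((hy 1).contDiffOn.mul h1).sub ((hy 0).contDiffOn.mul h2),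
    ((hx 0).contDiffOn.mul h2).sub ((hx 1).contDiffOn.mul h1)⟩

/-- The divergence theorem on a coordinate rectangle in the interior. -/
theorem integral_div_eq_flux {u w : Plane → ℝ} (hu : ContDiffOn ℝ ∞ u (interior Q.polytope))
    (hw : ContDiffOn ℝ ∞ w (interior Q.polytope)) {a b : ℝ × ℝ} (hab : a ≤ b)
    (ha : a ∈ Set.Ioo C.α₁ C.α₂ ×ˢ Set.Ioo C.β₁ C.β₂)
    (hb : b ∈ Set.Ioo C.α₁ C.α₂ ×ˢ Set.Ioo C.β₁ C.β₂) :
    ∫ q in Set.Icc a b, C.κ * C.ρ q.1 q.2 *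
      (pd 0 u (C.map q.1 q.2) + pd 1 w (C.map q.1 q.2)) =
    (((∫ s in a.1..b.1, C.fluxY u w s b.2) - ∫ s in a.1..b.1, C.fluxY u w s a.2) +
      ∫ t in a.2..b.2, C.fluxX u w b.1 t) - ∫ t in a.2..b.2, C.fluxX u w a.1 t := by
  set S := Set.Ioo C.α₁ C.α₂ ×ˢ Set.Ioo C.β₁ C.β₂ with hS
  have hSo : IsOpen S := isOpen_Ioo.prod isOpen_Ioo
  obtain ⟨hfx, hfy⟩ := contDiffOn_flux (C := C) hu hw
  set Φ := fun q : ℝ × ℝ => C.fluxX u w q.1 q.2 with hΦ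
  set Ψ := fun q : ℝ × ℝ => C.fluxY u w q.1 q.2 with hΨ
  have hsub : Set.Icc a b ⊆ S := by
    rintro q ⟨⟨h1, h2⟩, h3, h4⟩
    exact ⟨⟨ha.1.1.trans_le h1, h3.trans_lt hb.1.2⟩, ⟨ha.2.1.trans_le h2, h4.trans_lt hb.2.2⟩⟩
  have dΦ : ∀ q ∈ S, HasFDerivAt Φ (fderiv ℝ Φ q) q := fun q hq =>
    ((hfx.contDiffAt (hSo.mem_nhds hq)).differentiableAt (by simp)).hasFDerivAt
  have dΨ : ∀ q ∈ S, HasFDerivAt Ψ (fderiv ℝ Ψ q) q := fun q hq =>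
    ((hfy.contDiffAt (hSo.mem_nhds hq)).differentiableAt (by simp)).hasFDerivAt
  have cΦ := (((hfx.fderiv_of_isOpen hSo (m := ∞) (by simp)).clm_apply
    (contDiffOn_const (c := ((1 : ℝ), (0 : ℝ))))).continuousOn)
  have cΨ := (((hfy.fderiv_of_isOpen hSo (m := ∞) (by simp)).clm_apply
    (contDiffOn_const (c := ((0 : ℝ), (1 : ℝ))))).continuousOn)
  have hpt : ∀ q ∈ S, fderiv ℝ Φ q (1, 0) + fderiv ℝ Ψ q (0, 1) = C.κ * C.ρ q.1 q.2 *
      (pd 0 u (C.map q.1 q.2) + pd 1 w (C.map q.1 q.2)) := by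
    rintro ⟨s, t⟩ hq
    have hp := C.map_mem_interior hq.1 hq.2
    refine C.deriv_flux (differentiableAt_of_contDiffOn isOpen_interior hu hp)
      (differentiableAt_of_contDiffOn isOpen_interior hw hp) ?_ ?_
    · exact HasFDerivAt.comp_hasDerivAt (l := Φ) (f := fun s => (s, t)) s (dΦ _ hq)
        ((hasDerivAt_id s).prodMk (hasDerivAt_const s t))
    · exact HasFDerivAt.comp_hasDerivAt (l := Ψ) (f := fun t => (s, t)) t (dΨ _ hq)
        ((hasDerivAt_const t s).prodMk (hasDerivAt_id t))
  rw [setIntegral_congr_fun (g := fun q => fderiv ℝ Φ q (1, 0) + fderiv ℝ Ψ q (0, 1))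
    measurableSet_Icc fun q hq => (hpt q (hsub hq)).symm]
  refine integral_divergence_prod_Icc_of_hasFDerivAt_off_countable_of_le Φ Ψ (fderiv ℝ Φ) (fderiv ℝ Ψ)
    a b hab ∅ Set.countable_empty (hfx.continuousOn.mono hsub) (hfy.continuousOn.mono hsub) ?_ ?_ ?_
  · rintro q ⟨hq, -⟩
    exact dΦ q (hsub ⟨⟨hq.1.1.le, hq.2.1.le⟩, ⟨hq.1.2.le, hq.2.2.le⟩⟩)
  · rintro q ⟨hq, -⟩
    exact dΨ q (hsub ⟨⟨hq.1.1.le, hq.2.1.le⟩, ⟨hq.1.2.le, hq.2.2.le⟩⟩)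
  · exact ((cΦ.add cΨ).mono hsub).integrableOn_compact isCompact_Icc

/-- With zero double divergence, div(D∇f - f div D) reduces to tr(D Hess f). The rectangle stays in
the interior because f need not extend to the boundary. -/
theorem integral_trace_eq_flux (h : C.VanishesOnBoundary D)
    (hab : ∀ p ∈ interior Q.polytope, abreu D p = 0)
    (hf : ContDiffOn ℝ ∞ f (interior Q.polytope)) {a b : ℝ × ℝ} (hle : a ≤ b)
    (ha : a ∈ Set.Ioo C.α₁ C.α₂ ×ˢ Set.Ioo C.β₁ C.β₂)
    (hb : b ∈ Set.Ioo C.α₁ C.α₂ ×ˢ Set.Ioo C.β₁ C.β₂) :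
    ∫ q in Set.Icc a b, C.κ * C.ρ q.1 q.2 * (D (C.map q.1 q.2) * hess f (C.map q.1 q.2)).trace =
    (((∫ s in a.1..b.1, C.fluxY (greenField D f 0) (greenField D f 1) s b.2) -
      ∫ s in a.1..b.1, C.fluxY (greenField D f 0) (greenField D f 1) s a.2) +
      ∫ t in a.2..b.2, C.fluxX (greenField D f 0) (greenField D f 1) b.1 t) -
      ∫ t in a.2..b.2, C.fluxX (greenField D f 0) (greenField D f 1) a.1 t := by
  have hD := fun i j => (h.smooth i j).mono interior_subset
  rw [← integral_div_eq_flux (contDiffOn_greenField isOpen_interior hD hf 0)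
    (contDiffOn_greenField isOpen_interior hD hf 1) hle ha hb]
  refine setIntegral_congr_fun measurableSet_Icc fun q hq => ?_
  have hp : C.map q.1 q.2 ∈ interior Q.polytope := C.map_mem_interior
    ⟨ha.1.1.trans_le hq.1.1, hq.2.1.trans_lt hb.1.2⟩ ⟨ha.2.1.trans_le hq.1.2, hq.2.2.trans_lt hb.2.2⟩
  simp only [div_greenField isOpen_interior hD hf (fun p hp => h.symm p (interior_subset hp)) hp,
    hab _ hp, mul_zero, add_zero]

end BilinearChart

/-! ### A solution forces A and B to be positive -/

theorem exists_small {c K ε₀ : ℝ} (hc : 0 < c) (hK : 0 ≤ K) (hε : 0 < ε₀) :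
    ∃ ε, 0 < ε ∧ ε ≤ ε₀ ∧ K * ε < c := by
  refine ⟨min ε₀ (c / (K + 1)), lt_min hε (by positivity), min_le_left _ _, ?_⟩
  calc K * min ε₀ (c / (K + 1)) ≤ K * (c / (K + 1)) := mul_le_mul_of_nonneg_left (min_le_right _ _) hK
    _ < c := by rw [← mul_div_assoc, div_lt_iff₀ (by linarith)]; nlinarith

theorem exists_eq_affineMap (φ : Plane →ᵃ[ℝ] ℝ) :
    ∃ (L : Plane →L[ℝ] ℝ) (c : ℝ), ⇑φ = fun p => L p + c := by
  refine ⟨φ.linear.toContinuousLinearMap, φ 0, funext fun p => ?_⟩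
  simpa using φ.map_vadd 0 p

theorem contDiff_affineMap (φ : Plane →ᵃ[ℝ] ℝ) : ContDiff ℝ ∞ φ := by
  obtain ⟨L, c, h⟩ := exists_eq_affineMap φ
  rw [h]
  exact L.contDiff.add contDiff_const

theorem hess_affineMap (φ : Plane →ᵃ[ℝ] ℝ) (p : Plane) : hess φ p = 0 := by
  obtain ⟨L, c, h⟩ := exists_eq_affineMap φ
  have hcst : ∀ j, pd j φ = fun _ => L (EuclideanSpace.single j 1) := by
    intro j
    funext p
    unfold pd
    rw [h, fderiv_add_const, ContinuousLinearMap.fderiv]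
  ext i j
  simp only [hess, Matrix.of_apply, Matrix.zero_apply]
  rw [hcst j]; simp [pd]

/-- Compare the slope with the chord to the midpoint between s and an end point. That chord spans at
least half of `endDist` and its values differ by at most 2M, hence the factor 4. -/
theorem abs_deriv_mul_endDist_le {φ : ℝ → ℝ} {a b s φ' M : ℝ} (hφ : ConvexOn ℝ (Set.Ioo a b) φ)
    (hM : ∀ x ∈ Set.Ioo a b, |φ x| ≤ M) (hs : s ∈ Set.Ioo a b) (hd : HasDerivAt φ φ' s) :
    |φ'| * endDist a b s ≤ 4 * M := by
  have hr : (s + b) / 2 ∈ Set.Ioo a b := ⟨by linarith [hs.1, hs.2], by linarith [hs.2]⟩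
  have hl : (a + s) / 2 ∈ Set.Ioo a b := ⟨by linarith [hs.1], by linarith [hs.1, hs.2]⟩
  have h1 := hφ.le_slope_of_hasDerivAt hs hr (by linarith [hs.2]) hd
  have h2 := hφ.slope_le_of_hasDerivAt hl hs (by linarith [hs.1]) hd
  rw [slope_def_field] at h1 h2
  rw [le_div_iff₀ (by linarith [hs.2])] at h1
  rw [div_le_iff₀ (by linarith [hs.1])] at h2
  have b0 := abs_le.1 (hM s hs)
  have b1 := abs_le.1 (hM _ hr)
  have b2 := abs_le.1 (hM _ hl)
  have hδ := endDist_pos hs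
  have e1 : endDist a b s ≤ s - a := min_le_left _ _
  have e2 : endDist a b s ≤ b - s := min_le_right _ _
  rcases abs_cases φ' with ⟨h, h'⟩ | ⟨h, h'⟩ <;> rw [h]
  · nlinarith
  · nlinarith

namespace BilinearChart

variable {Q : LabeledQuadrilateral} {C : BilinearChart Q} {D : Plane → Matrix (Fin 2) (Fin 2) ℝ}
  {f g : Plane → ℝ}

theorem moderateGrowth_of_convexOn {M : ℝ} (hf : ContDiffOn ℝ ∞ f (interior Q.polytope))
    (hc : ConvexOn ℝ (interior Q.polytope) f) (hM : ∀ p ∈ interior Q.polytope, |f p| ≤ M) :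
    C.ModerateGrowth f (4 * M) := by
  intro s hs t ht
  have hp := C.map_mem_interior hs ht
  have hd := differentiableAt_of_contDiffOn isOpen_interior hf hp
  have h0 := hM _ hp
  refine ⟨by linarith [abs_nonneg (f (C.map s t))], ?_, ?_⟩
  · refine abs_deriv_mul_endDist_le (φ := fun s => f (C.map s t)) ?_
      (fun x hx => hM _ (C.map_mem_interior hx ht)) hs (C.hasDerivAt_comp_map_left hd)
    rw [show (fun s => f (C.map s t)) = fun s => f (AffineMap.lineMap (C.map 0 t) (C.map 1 t) s) from
      funext fun s => by rw [← C.map_eq_lineMap_left]]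
    refine (hc.comp_affineMap (AffineMap.lineMap (C.map 0 t) (C.map 1 t))).subset (fun s hs => ?_)
      (convex_Ioo _ _)
    rw [Set.mem_preimage, ← C.map_eq_lineMap_left]
    exact C.map_mem_interior hs ht
  · refine abs_deriv_mul_endDist_le (φ := fun t => f (C.map s t)) ?_
      (fun x hx => hM _ (C.map_mem_interior hs hx)) ht (C.hasDerivAt_comp_map_right hd)
    rw [show (fun t => f (C.map s t)) = fun t => f (AffineMap.lineMap (C.map s 0) (C.map s 1) t) from
      funext fun t => by rw [← C.map_eq_lineMap_right]]
    refine (hc.comp_affineMap (AffineMap.lineMap (C.map s 0) (C.map s 1))).subset (fun t ht => ?_)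
      (convex_Ioo _ _)
    rw [Set.mem_preimage, ← C.map_eq_lineMap_right]
    exact C.map_mem_interior hs ht

theorem ModerateGrowth.sub {M N : ℝ} (hf : C.ModerateGrowth f M) (hg : C.ModerateGrowth g N)
    (hfd : ContDiffOn ℝ ∞ f (interior Q.polytope)) (hgd : ContDiffOn ℝ ∞ g (interior Q.polytope)) :
    C.ModerateGrowth (fun p => f p - g p) (M + N) := by
  intro s hs t ht
  have hp := C.map_mem_interior hs ht
  obtain ⟨f0, f1, f2⟩ := hf s hs t ht
  obtain ⟨g0, g1, g2⟩ := hg s hs t ht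
  have hδ := (endDist_pos hs).le
  have hδ' := (endDist_pos ht).le
  rw [fderiv_fun_sub (differentiableAt_of_contDiffOn isOpen_interior hfd hp)
    (differentiableAt_of_contDiffOn isOpen_interior hgd hp)]
  simp only [sub_apply]
  refine ⟨(abs_sub _ _).trans (add_le_add f0 g0), ?_, ?_⟩
  · calc _ ≤ (|fderiv ℝ f (C.map s t) (C.X t)| + |fderiv ℝ g (C.map s t) (C.X t)|) *
        endDist C.α₁ C.α₂ s := mul_le_mul_of_nonneg_right (abs_sub _ _) hδ
      _ ≤ _ := by rw [add_mul]; exact add_le_add f1 g1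
  · calc _ ≤ (|fderiv ℝ f (C.map s t) (C.Y s)| + |fderiv ℝ g (C.map s t) (C.Y s)|) *
        endDist C.β₁ C.β₂ t := mul_le_mul_of_nonneg_right (abs_sub _ _) hδ'
      _ ≤ _ := by rw [add_mul]; exact add_le_add f2 g2

theorem abs_integral_fluxX_le {K s ε : ℝ} {u w : Plane → ℝ} {c d : ℝ}
    (hb : ∀ s ∈ Set.Ioo C.α₁ C.α₂, ∀ t ∈ Set.Ioo C.β₁ C.β₂, |C.fluxX u w s t| ≤ K * endDist C.α₁ C.α₂ s)
    (hK : 0 ≤ K) (hs : s ∈ Set.Ioo C.α₁ C.α₂) (hε : endDist C.α₁ C.α₂ s ≤ ε)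
    (hc : c ∈ Set.Ioo C.β₁ C.β₂) (hd : d ∈ Set.Ioo C.β₁ C.β₂) :
    |∫ t in c..d, C.fluxX u w s t| ≤ K * (C.β₂ - C.β₁) * ε := by
  have hε0 := (endDist_pos hs).le.trans hε
  have := intervalIntegral.norm_integral_le_of_norm_le_const (C := K * ε) (a := c) (b := d)
    (f := fun t => C.fluxX u w s t) fun t ht => by
      have htm := Set.OrdConnected.uIcc_subset Set.ordConnected_Ioo hc hd (Set.uIoc_subset_uIcc ht)
      exact (hb s hs t htm).trans (mul_le_mul_of_nonneg_left hε hK)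
  refine this.trans ?_
  have hcd : |d - c| ≤ C.β₂ - C.β₁ := abs_le.2 ⟨by linarith [hc.1, hc.2, hd.1, hd.2],
    by linarith [hc.1, hc.2, hd.1, hd.2]⟩
  calc K * ε * |d - c| ≤ K * ε * (C.β₂ - C.β₁) := mul_le_mul_of_nonneg_left hcd (mul_nonneg hK hε0)
    _ = _ := by ring

theorem abs_integral_fluxY_le {K t ε : ℝ} {u w : Plane → ℝ} {c d : ℝ}
    (hb : ∀ s ∈ Set.Ioo C.α₁ C.α₂, ∀ t ∈ Set.Ioo C.β₁ C.β₂, |C.fluxY u w s t| ≤ K * endDist C.β₁ C.β₂ t)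
    (hK : 0 ≤ K) (ht : t ∈ Set.Ioo C.β₁ C.β₂) (hε : endDist C.β₁ C.β₂ t ≤ ε)
    (hc : c ∈ Set.Ioo C.α₁ C.α₂) (hd : d ∈ Set.Ioo C.α₁ C.α₂) :
    |∫ s in c..d, C.fluxY u w s t| ≤ K * (C.α₂ - C.α₁) * ε := by
  have hε0 := (endDist_pos ht).le.trans hε
  have := intervalIntegral.norm_integral_le_of_norm_le_const (C := K * ε) (a := c) (b := d)
    (f := fun s => C.fluxY u w s t) fun s hs => by
      have htm := Set.OrdConnected.uIcc_subset Set.ordConnected_Ioo hc hd (Set.uIoc_subset_uIcc hs)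
      exact (hb s htm t ht).trans (mul_le_mul_of_nonneg_left hε hK)
  refine this.trans ?_
  have hcd : |d - c| ≤ C.α₂ - C.α₁ := abs_le.2 ⟨by linarith [hc.1, hc.2, hd.1, hd.2],
    by linarith [hc.1, hc.2, hd.1, hd.2]⟩
  calc K * ε * |d - c| ≤ K * ε * (C.α₂ - C.α₁) := mul_le_mul_of_nonneg_left hcd (mul_nonneg hK hε0)
    _ = _ := by ring

theorem endDist_add_le (a b ε : ℝ) : endDist a b (a + ε) ≤ ε := by
  unfold endDist; exact (min_le_left _ _).trans (by linarith)

theorem endDist_sub_le (a b ε : ℝ) : endDist a b (b - ε) ≤ ε := by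
  unfold endDist; exact (min_le_right _ _).trans (by linarith)

/-- If `D` is positive on the conormal along a coordinate line, the equation `div div D = 0` cannot
hold: integrate it against the crease along this line. -/
theorem not_form_pos_of_abreu_eq_zero (h : C.VanishesOnBoundary D)
    (hab : ∀ p ∈ interior Q.polytope, abreu D p = 0) {x₀ : ℝ} (hx : x₀ ∈ Set.Ioo C.α₁ C.α₂) :
    ¬ ∀ t ∈ Set.Ioo C.β₁ C.β₂, 0 < form (D (C.map x₀ t)) (perp (C.Y x₀)) (perp (C.Y x₀)) := by
  intro hpos
  -- Only one side of the crease is integrated, where it is an affine function. Its Hessian vanishes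
  -- there, and the jump of its gradient appears as flux through the line x = x₀.
  set f : Plane → ℝ := fun p => C.creaseAffine x₀ p with hf
  have hfc : Continuous f := AffineMap.continuous_of_finiteDimensional _
  have hfs : ContDiff ℝ ∞ f := contDiff_affineMap _
  have hfconv : ConvexOn ℝ (interior Q.polytope) f :=
    ⟨Q.convex_polytope.interior, fun p _ q _ a b _ _ hab => le_of_eq (Convex.combo_affine_apply hab)⟩
  obtain ⟨M, hM⟩ := Q.isCompact_polytope.exists_bound_of_continuousOn hfc.continuousOn
  have hmg := moderateGrowth_of_convexOn (C := C) hfs.contDiffOn hfconv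
    fun p hp => hM p (interior_subset hp)
  obtain ⟨K₁, hK₁, b₁⟩ := exists_bound_fluxX h hmg
  obtain ⟨K₂, hK₂, b₂⟩ := exists_bound_fluxY h hmg
  have hhess : ∀ p, hess f p = 0 := hess_affineMap _
  set E : ℝ → ℝ := fun t => form (D (C.map x₀ t)) (perp (C.Y x₀)) (perp (C.Y x₀)) with hE
  have hEc : ContinuousOn E (Set.Icc C.β₁ C.β₂) :=
    (LabeledQuadrilateral.contDiffOn_form h.smooth _ _).continuousOn.comp
      (C.continuous_map_right x₀).continuousOn
      fun t ht => C.map_mem_polytope (Set.Ioo_subset_Icc_self hx) ht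
  -- On the line, f and its derivative along Y vanish, while its derivative along X is ρ. The flux
  -- density is thus the conormal value of D divided by κ.
  have hflux : ∀ t ∈ Set.Ioo C.β₁ C.β₂,
      E t = C.κ * C.fluxX (greenField D f 0) (greenField D f 1) x₀ t := by
    intro t ht
    have hp := C.map_mem_interior hx ht
    have hρ := (C.ρ_pos x₀ (Set.Ioo_subset_Icc_self hx) t (Set.Ioo_subset_Icc_self ht)).ne'
    have key := fluxX_greenField D f hx ht
    have hd : DifferentiableAt ℝ f (C.map x₀ t) := hfs.differentiable (by simp) _
    have d1 : fderiv ℝ f (C.map x₀ t) (C.X t) = C.ρ x₀ t := by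
      have h1 := C.hasDerivAt_comp_map_left hd
      have h2 : HasDerivAt (fun s => (s - x₀) * C.ρ x₀ t) (C.ρ x₀ t) x₀ := by
        simpa using ((hasDerivAt_id x₀).sub_const x₀).mul_const (C.ρ x₀ t)
      simp only [hf, creaseAffine_map] at h1
      exact h1.unique h2
    have d2 : fderiv ℝ f (C.map x₀ t) (C.Y x₀) = 0 := by
      have h1 := C.hasDerivAt_comp_map_right hd
      simp only [hf, creaseAffine_map, sub_self, zero_mul] at h1
      exact h1.unique (hasDerivAt_const t (0 : ℝ))
    have d3 : f (C.map x₀ t) = 0 := by simp [hf, creaseAffine_map]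
    rw [d1, d2, d3] at key
    refine mul_left_cancel₀ hρ ?_
    simp only [hE]
    linear_combination -key
  -- The middle half of the line gives a positive lower bound independent of the margin ε. The
  -- fluxes through the other three sides of the rectangle are O(ε), so a small ε yields the
  -- contradiction.
  set ε₀ := (C.β₂ - C.β₁) / 4 with hε₀
  have hβ := C.hβ
  have hε₀0 : 0 < ε₀ := by rw [hε₀]; linarith
  have hint : ∀ c ∈ Set.Icc C.β₁ C.β₂, ∀ d ∈ Set.Icc C.β₁ C.β₂, IntervalIntegrable E volume c d :=
    fun c hc d hd => (hEc.mono (Set.OrdConnected.uIcc_subset Set.ordConnected_Icc hc hd)).intervalIntegrable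
  have hc0 : 0 < ∫ t in (C.β₁ + ε₀)..(C.β₂ - ε₀), E t := by
    refine intervalIntegral.intervalIntegral_pos_of_pos_on
      (hint _ ⟨by linarith, by linarith⟩ _ ⟨by linarith, by linarith⟩)
      (fun t ht => hpos t ⟨by linarith [ht.1], by linarith [ht.2]⟩) (by linarith)
  set K := |C.κ| * (K₂ * (C.α₂ - C.α₁) + K₂ * (C.α₂ - C.α₁) + K₁ * (C.β₂ - C.β₁)) with hK
  have hα := C.hα
  have hK0 : 0 ≤ K := by
    have h1 := sub_pos.2 hα
    have h2 := sub_pos.2 hβ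
    positivity
  obtain ⟨ε, hε, hle, hlt⟩ := exists_small hc0 hK0
    (lt_min hε₀0 (show 0 < (C.α₂ - x₀) / 2 by linarith [hx.2]))
  have hle1 := hle.trans (min_le_left _ _)
  have hle2 := hle.trans (min_le_right _ _)
  have hmono : ∫ t in (C.β₁ + ε₀)..(C.β₂ - ε₀), E t ≤ ∫ t in (C.β₁ + ε)..(C.β₂ - ε), E t := by
    refine intervalIntegral.integral_mono_interval (by linarith) (by linarith) (by linarith) ?_
      (hint _ ⟨by linarith, by linarith⟩ _ ⟨by linarith, by linarith⟩)
    refine (ae_restrict_iff' measurableSet_Ioc).2 (Filter.Eventually.of_forall fun t ht => ?_)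
    exact (hpos t ⟨by linarith [ht.1], by linarith [ht.2]⟩).le
  have mb : C.β₁ + ε ∈ Set.Ioo C.β₁ C.β₂ := ⟨by linarith, by linarith⟩
  have mt : C.β₂ - ε ∈ Set.Ioo C.β₁ C.β₂ := ⟨by linarith, by linarith⟩
  have mr : C.α₂ - ε ∈ Set.Ioo C.α₁ C.α₂ := ⟨by linarith [hx.1], by linarith⟩
  have hid := integral_trace_eq_flux h hab hfs.contDiffOn (a := (x₀, C.β₁ + ε))
    (b := (C.α₂ - ε, C.β₂ - ε)) ⟨by simp only; linarith, by simp only; linarith⟩ ⟨hx, mb⟩ ⟨mr, mt⟩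
  simp only [hhess, mul_zero, Matrix.trace_zero, integral_zero] at hid
  have f1 := abs_integral_fluxY_le b₂ hK₂ mt (endDist_sub_le _ _ _) hx mr
  have f2 := abs_integral_fluxY_le b₂ hK₂ mb (endDist_add_le _ _ _) hx mr
  have f3 := abs_integral_fluxX_le b₁ hK₁ mr (endDist_sub_le _ _ _) mb mt
  have hEint : ∫ t in (C.β₁ + ε)..(C.β₂ - ε), E t = C.κ *
      ∫ t in (C.β₁ + ε)..(C.β₂ - ε), C.fluxX (greenField D f 0) (greenField D f 1) x₀ t := by
    rw [← intervalIntegral.integral_const_mul]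
    refine intervalIntegral.integral_congr fun t ht => ?_
    exact hflux t (Set.OrdConnected.uIcc_subset Set.ordConnected_Ioo mb mt ht)
  have hfin : ∫ t in (C.β₁ + ε)..(C.β₂ - ε), E t ≤ K * ε := by
    rw [hEint]
    refine (le_abs_self _).trans ?_
    rw [abs_mul, hK, mul_assoc]
    refine mul_le_mul_of_nonneg_left ?_ (abs_nonneg _)
    have e := eq_sub_iff_add_eq.1 hid
    rw [zero_add] at e
    rw [e]
    refine (abs_add_le _ _).trans ?_
    have := (abs_sub (∫ s in x₀..(C.α₂ - ε), C.fluxY (greenField D f 0) (greenField D f 1) s (C.β₂ - ε))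
      (∫ s in x₀..(C.α₂ - ε), C.fluxY (greenField D f 0) (greenField D f 1) s (C.β₁ + ε)))
    linarith
  linarith

end BilinearChart

/-! ### Uniqueness of the inverse Hessian -/

theorem abreu_sub {H K : Plane → Matrix (Fin 2) (Fin 2) ℝ} {U : Set Plane} (hU : IsOpen U)
    (hH : ∀ i j, ContDiffOn ℝ ∞ (fun q => H q i j) U) (hK : ∀ i j, ContDiffOn ℝ ∞ (fun q => K q i j) U)
    {p : Plane} (hp : p ∈ U) : abreu (fun p => H p - K p) p = abreu H p - abreu K p := by
  have key : ∀ i j, pd i (pd j fun q => (H q - K q) i j) p =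
      pd i (pd j fun q => H q i j) p - pd i (pd j fun q => K q i j) p := by
    intro i j
    rw [← pd_sub (differentiableAt_of_contDiffOn hU (contDiffOn_pd hU (hH i j) j) hp)
      (differentiableAt_of_contDiffOn hU (contDiffOn_pd hU (hK i j) j) hp)]
    refine pd_congr ?_ i
    filter_upwards [hU.mem_nhds hp] with q hq
    exact pd_sub (differentiableAt_of_contDiffOn hU (hH i j) hq)
      (differentiableAt_of_contDiffOn hU (hK i j) hq) j
  unfold abreu
  simp only [key, Fin.sum_univ_two]
  ring

theorem form_sub (M N : Matrix (Fin 2) (Fin 2) ℝ) (v w : Plane) :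
    form (M - N) v w = form M v w - form N v w := by
  simp [form_eq]; ring

/-- The pairing of the difference of two positive definite matrices with the difference of their
inverses. -/
theorem trace_sub_mul_sub_nonpos {P R P' R' : Matrix (Fin 2) (Fin 2) ℝ} (hP : P.PosDef)
    (hR : R.PosDef) (hPP : P * P' = 1) (hRR : R * R' = 1) :
    ((P - R) * (P' - R')).trace ≤ 0 ∧ (((P - R) * (P' - R')).trace = 0 → P = R) := by
  have hP' : P'.PosDef := by rw [← Matrix.inv_eq_right_inv hPP]; exact hP.inv
  have hR' : R'.PosDef := by rw [← Matrix.inv_eq_right_inv hRR]; exact hR.inv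
  have sym : ∀ {M : Matrix (Fin 2) (Fin 2) ℝ}, M.PosDef → M.IsSymm := fun h => by
    have := h.isHermitian
    rwa [Matrix.IsHermitian, Matrix.conjTranspose_eq_transpose_of_trivial] at this
  have hdet := hP'.det_pos
  have ha : 0 < P' 0 0 := by
    have := (posDef_iff_form (sym hP')).1 hP' (EuclideanSpace.single 0 1) (by simp)
    simpa [form_eq] using this
  have hform := (posDef_iff_form (sym hR')).1 hR'
  have hform0 : ∀ v : Plane, 0 ≤ form R' v v := fun v => by
    by_cases hv : v = 0
    · simp [hv, form_eq]
    · exact (hform v hv).le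
  -- The resolvent identity P' - R' = -P'(P - R)R' turns the product into minus an expression
  -- quadratic in P - R.
  have e1 : (P - R) * (P' - R') = -((P - R) * P' * (P - R) * R') := by
    have h1 : P' * P = 1 := mul_eq_one_comm.1 hPP
    calc (P - R) * (P' - R') = (P - R) * (P' * (R * R') - (P' * P) * R') := by rw [hRR, h1]; simp
      _ = _ := by noncomm_ring
  have hs := (sym hP).sub (sym hR)
  obtain ⟨D, hD⟩ : ∃ D, D = P - R := ⟨_, rfl⟩
  rw [e1, ← hD]
  rw [← hD] at hs
  have d1 := hs.apply 0 1
  have d2 := (sym hP').apply 0 1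
  have d3 := (sym hR').apply 0 1
  rw [Matrix.det_fin_two] at hdet
  set v : Plane := !₂[D 0 0 * P' 0 0 + D 0 1 * P' 0 1, D 0 1 * P' 0 0 + D 1 1 * P' 0 1] with hv
  set w : Plane := !₂[D 0 1, D 1 1] with hw
  -- Completing the square: P'₀₀ P' is the square of its first column plus det P' times the square
  -- of the second basis vector. Here v and w are the images of these two vectors under D.
  have e2 : P' 0 0 * (D * P' * D * R').trace = form R' v v +
      (P' 0 0 * P' 1 1 - P' 0 1 * P' 1 0) * form R' w w := by
    rw [Matrix.trace_fin_two]
    simp only [Matrix.mul_apply, Fin.sum_univ_two, form_eq, hv, hw, d1, d2, d3]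
    simp
    ring
  have hpos : 0 ≤ P' 0 0 * (D * P' * D * R').trace := by
    rw [e2]; exact add_nonneg (hform0 v) (mul_nonneg hdet.le (hform0 w))
  have hpos' := nonneg_of_mul_nonneg_right hpos ha
  rw [Matrix.trace_neg]
  refine ⟨neg_nonpos.2 hpos', fun h0 => ?_⟩
  rw [neg_eq_zero.1 h0, mul_zero] at e2
  have z1 := hform0 v
  have z2 := mul_nonneg hdet.le (hform0 w)
  have hv0 : v = 0 := by
    by_contra hne; have := hform v hne; linarith
  have hw0 : w = 0 := by
    by_contra hne; have := mul_pos hdet (hform w hne); linarith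
  have w0 : D 0 1 = 0 := by simpa [hw] using congrArg (fun u : Plane => u 0) hw0
  have w1 : D 1 1 = 0 := by simpa [hw] using congrArg (fun u : Plane => u 1) hw0
  have v0 : D 0 0 = 0 := by
    have : D 0 0 * P' 0 0 + D 0 1 * P' 0 1 = 0 := by
      simpa [hv] using congrArg (fun u : Plane => u 0) hv0
    rw [w0, zero_mul, add_zero] at this
    exact (mul_eq_zero.1 this).resolve_right ha.ne'
  rw [← sub_eq_zero, ← hD]
  ext i j
  fin_cases i <;> fin_cases j <;> simp [v0, w0, w1, d1]

namespace BilinearChart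

variable {Q : LabeledQuadrilateral} {C : BilinearChart Q} {A B : Polynomial ℝ}

/-- Where A(x) ≤ 0, the matrix H_{A,B} is nonpositive on the conormal along the whole line through
x, while the inverse Hessian of a solution is positive. Their difference would contradict
`not_form_pos_of_abreu_eq_zero`. -/
theorem eval_pos_left_of_isExtremalPotential (hAB : C.Solves A B) {G : Plane → ℝ}
    (hG : Q.IsExtremalPotential G) : ∀ x ∈ Set.Ioo C.α₁ C.α₂, 0 < A.eval x := by
  obtain ⟨⟨-, -, H, hinv, hsm, hpd, -, hbc⟩, heq⟩ := hG
  have heqH := (LabeledQuadrilateral.extremalEquation_inv_hess hinv).1 heq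
  intro x hx
  by_contra hneg
  rw [not_lt] at hneg
  refine not_form_pos_of_abreu_eq_zero (C.vanishesOnBoundary_sub hsm (C.isSmoothSymm_matH A B) hbc
    (C.boundaryConditions_matH hAB)) (fun p hp => ?_) hx fun t ht => ?_
  · rw [abreu_sub isOpen_interior (fun i j => (hsm.1 i j).mono interior_subset)
      (fun i j => ((C.isSmoothSymm_matH A B).1 i j).mono interior_subset) hp, heqH p hp,
      C.extremalEquation_matH hAB p hp, sub_self]
  · have hp := C.map_mem_interior hx ht
    have hρ := C.ρ_pos x (Set.Ioo_subset_Icc_self hx) t (Set.Ioo_subset_Icc_self ht)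
    have h1 := (posDef_iff_form (hsm.2 _ (interior_subset hp))).1 (hpd _ hp) (perp (C.Y x))
      (perp_ne_zero (C.Y_ne_zero (Set.Ioo_subset_Icc_self hx)))
    have h2 : form (C.matH A B (C.map x t)) (perp (C.Y x)) (perp (C.Y x)) ≤ 0 := by
      rw [C.matH_map A B hρ, Grid.form_mat, C.inner_perp_Y_Y, C.inner_perp_Y_X, real_inner_comm,
        C.inner_perp_Y_X]
      have : 0 ≤ 1 / C.ρ x t * (C.κ * C.ρ x t * (C.κ * C.ρ x t)) :=
        mul_nonneg (by positivity) (mul_self_nonneg _)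
      nlinarith
    rw [form_sub]
    linarith

theorem eval_pos_of_isExtremalPotential (hAB : C.Solves A B) {G : Plane → ℝ}
    (hG : Q.IsExtremalPotential G) :
    (∀ x ∈ Set.Ioo C.α₁ C.α₂, 0 < A.eval x) ∧ ∀ y ∈ Set.Ioo C.β₁ C.β₂, 0 < B.eval y :=
  ⟨eval_pos_left_of_isExtremalPotential hAB hG,
    eval_pos_left_of_isExtremalPotential (C := C.swap) (Solves.swap C hAB)
      ((Q.sameAs_reflect.extremalPotential_iff G).2 hG)⟩

/-- For nonnegative g the integral grows as the margin shrinks, yet it is bounded by Kε. Hence it is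
zero on every interior rectangle. -/
theorem eq_zero_of_integral_le {g : ℝ × ℝ → ℝ} {a b c d K ε₀ : ℝ} (hε₀ : 0 < ε₀)
    (hg : ContinuousOn g (Set.Ioo a b ×ˢ Set.Ioo c d))
    (hpos : ∀ q ∈ Set.Ioo a b ×ˢ Set.Ioo c d, 0 ≤ g q) (hK : 0 ≤ K)
    (hle : ∀ ε, 0 < ε → ε ≤ ε₀ → ∫ q in Set.Icc (a + ε, c + ε) (b - ε, d - ε), g q ≤ K * ε) :
    ∀ q ∈ Set.Ioo a b ×ˢ Set.Ioo c d, g q = 0 := by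
  have hsub : ∀ ε, 0 < ε → Set.Icc (a + ε, c + ε) (b - ε, d - ε) ⊆ Set.Ioo a b ×ˢ Set.Ioo c d := by
    rintro ε hε q ⟨⟨h1, h2⟩, h3, h4⟩
    simp only at h1 h2 h3 h4
    exact ⟨⟨by linarith, by linarith⟩, ⟨by linarith, by linarith⟩⟩
  have hi : ∀ ε, 0 < ε → IntegrableOn g (Set.Icc (a + ε, c + ε) (b - ε, d - ε)) := fun ε hε =>
    (hg.mono (hsub ε hε)).integrableOn_compact isCompact_Icc
  have hae : ∀ ε, 0 < ε → 0 ≤ᵐ[volume.restrict (Set.Icc (a + ε, c + ε) (b - ε, d - ε))] g :=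
    fun ε hε => (ae_restrict_iff' measurableSet_Icc).2
      (Filter.Eventually.of_forall fun q hq => hpos q (hsub ε hε hq))
  rintro ⟨x, y⟩ ⟨hx, hy⟩
  set δ := min (min ((x - a) / 2) ((b - x) / 2)) (min ((y - c) / 2) ((d - y) / 2)) with hδ
  have hδ0 : 0 < δ := by
    refine lt_min (lt_min ?_ ?_) (lt_min ?_ ?_) <;> linarith [hx.1, hx.2, hy.1, hy.2]
  have l1 : δ ≤ (x - a) / 2 := (min_le_left _ _).trans (min_le_left _ _)
  have l2 : δ ≤ (b - x) / 2 := (min_le_left _ _).trans (min_le_right _ _)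
  have l3 : δ ≤ (y - c) / 2 := (min_le_right _ _).trans (min_le_left _ _)
  have l4 : δ ≤ (d - y) / 2 := (min_le_right _ _).trans (min_le_right _ _)
  have hzero : ∫ q in Set.Icc (a + δ, c + δ) (b - δ, d - δ), g q = 0 := by
    refine le_antisymm ?_ (setIntegral_nonneg_of_ae_restrict (hae δ hδ0))
    by_contra hlt
    rw [not_le] at hlt
    obtain ⟨ε, hε, hle', hlt'⟩ := exists_small hlt hK (lt_min hε₀ hδ0)
    have h1 := hle ε hε (hle'.trans (min_le_left _ _))
    have hεδ := hle'.trans (min_le_right _ _)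
    have h2 := setIntegral_mono_set (hi ε hε) (hae ε hε)
      (Filter.Eventually.of_forall (Set.Icc_subset_Icc
        (show (a + ε, c + ε) ≤ (a + δ, c + δ) from ⟨by simp only; linarith, by simp only; linarith⟩)
        (show (b - δ, d - δ) ≤ (b - ε, d - ε) from ⟨by simp only; linarith, by simp only; linarith⟩)) :
        Set.Icc (a + δ, c + δ) (b - δ, d - δ) ≤ᵐ[volume] Set.Icc (a + ε, c + ε) (b - ε, d - ε))
    linarith
  rw [setIntegral_eq_zero_iff_of_nonneg_ae (hae δ hδ0) (hi δ hδ0)] at hzero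
  have hO : Set.Ioo (a + δ) (b - δ) ×ˢ Set.Ioo (c + δ) (d - δ) ⊆
      Set.Icc (a + δ, c + δ) (b - δ, d - δ) := fun q hq =>
    ⟨⟨hq.1.1.le, hq.2.1.le⟩, ⟨hq.1.2.le, hq.2.2.le⟩⟩
  have h3 := ae_restrict_of_ae_restrict_of_subset hO hzero
  exact Measure.eqOn_open_of_ae_eq h3 (isOpen_Ioo.prod isOpen_Ioo)
    (hg.mono (hO.trans (hsub δ hδ0))) continuousOn_const
    (show (x, y) ∈ _ from ⟨⟨by linarith [hx.1], by linarith [hx.2]⟩, ⟨by linarith [hy.1], by linarith [hy.2]⟩⟩)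

/-- Two bounded solutions with the same boundary conditions have the same inverse Hessian. -/
theorem eq_of_bounded {H K : Plane → Matrix (Fin 2) (Fin 2) ℝ} {G₁ G₂ : Plane → ℝ} {M₁ M₂ : ℝ}
    (hv : C.VanishesOnBoundary fun p => H p - K p)
    (hab : ∀ p ∈ interior Q.polytope, abreu (fun p => H p - K p) p = 0)
    (hH : Q.IsPosDef H) (hK : Q.IsPosDef K) (h₁ : Q.IsInverseHessian H G₁)
    (h₂ : Q.IsInverseHessian K G₂) (s₁ : ContDiffOn ℝ ∞ G₁ (interior Q.polytope))
    (s₂ : ContDiffOn ℝ ∞ G₂ (interior Q.polytope)) (m₁ : C.ModerateGrowth G₁ M₁)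
    (m₂ : C.ModerateGrowth G₂ M₂) : ∀ p ∈ interior Q.polytope, H p = K p := by
  set f : Plane → ℝ := fun p => G₁ p - G₂ p with hf
  have hfs : ContDiffOn ℝ ∞ f (interior Q.polytope) := s₁.sub s₂
  have hmg : C.ModerateGrowth f (M₁ + M₂) := m₁.sub m₂ s₁ s₂
  have hhess : ∀ p ∈ interior Q.polytope, hess f p = hess G₁ p - hess G₂ p := by
    intro p hp
    ext i j
    simp only [hess, Matrix.of_apply, Matrix.sub_apply]
    rw [← pd_sub (differentiableAt_of_contDiffOn isOpen_interior (contDiffOn_pd isOpen_interior s₁ j) hp)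
      (differentiableAt_of_contDiffOn isOpen_interior (contDiffOn_pd isOpen_interior s₂ j) hp)]
    refine pd_congr ?_ i
    filter_upwards [isOpen_interior.mem_nhds hp] with q hq
    exact pd_sub (differentiableAt_of_contDiffOn isOpen_interior s₁ hq)
      (differentiableAt_of_contDiffOn isOpen_interior s₂ hq) j
  have htr : ∀ p ∈ interior Q.polytope, ((H p - K p) * hess f p).trace ≤ 0 ∧
      (((H p - K p) * hess f p).trace = 0 → H p = K p) := by
    intro p hp
    rw [hhess p hp]
    exact trace_sub_mul_sub_nonpos (hH p hp) (hK p hp) (h₁ p hp) (h₂ p hp)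
  obtain ⟨K₁, hK₁, b₁⟩ := exists_bound_fluxX hv hmg
  obtain ⟨K₂, hK₂, b₂⟩ := exists_bound_fluxY hv hmg
  set T : Plane → ℝ := fun p => ((H p - K p) * hess f p).trace with hT
  have hTs : ContDiffOn ℝ ∞ T (interior Q.polytope) := by
    have hd := fun i j => (hv.smooth i j).mono (interior_subset (s := Q.polytope))
    have hh : ∀ i j, ContDiffOn ℝ ∞ (fun p => hess f p i j) (interior Q.polytope) := fun i j =>
      contDiffOn_pd isOpen_interior (contDiffOn_pd isOpen_interior hfs j) i
    have e : T = fun p => ((H p - K p) 0 0 * hess f p 0 0 + (H p - K p) 0 1 * hess f p 1 0) +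
        ((H p - K p) 1 0 * hess f p 0 1 + (H p - K p) 1 1 * hess f p 1 1) := by
      funext p
      simp only [hT, Matrix.trace_fin_two, Matrix.mul_apply, Fin.sum_univ_two]
    rw [e]
    exact (((hd 0 0).mul (hh 0 0)).add ((hd 0 1).mul (hh 1 0))).add
      (((hd 1 0).mul (hh 0 1)).add ((hd 1 1).mul (hh 1 1)))
  have hα := C.hα
  have hβ := C.hβ
  set S := Set.Ioo C.α₁ C.α₂ ×ˢ Set.Ioo C.β₁ C.β₂ with hS
  have hcont : ContinuousOn (fun q : ℝ × ℝ => |C.κ| * C.ρ q.1 q.2 * -T (C.map q.1 q.2)) S :=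
    ((continuous_const.mul C.continuous_ρ).continuousOn).mul
      (contDiffOn_comp_map hTs).continuousOn.neg
  have hρS : ∀ q ∈ S, 0 < C.ρ q.1 q.2 := fun q hq =>
    C.ρ_pos _ (Set.Ioo_subset_Icc_self hq.1) _ (Set.Ioo_subset_Icc_self hq.2)
  -- The integrand is nonnegative by the trace inequality. Its integral over the rectangle with
  -- margin ε is bounded by the fluxes through the four sides, each at most linear in ε.
  have hz := eq_zero_of_integral_le (K := K₂ * (C.α₂ - C.α₁) + K₂ * (C.α₂ - C.α₁) +
    (K₁ * (C.β₂ - C.β₁) + K₁ * (C.β₂ - C.β₁))) (ε₀ := min ((C.α₂ - C.α₁) / 3) ((C.β₂ - C.β₁) / 3))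
    (lt_min (by linarith) (by linarith)) hcont
    (fun q hq => mul_nonneg (mul_nonneg (abs_nonneg _) (hρS q hq).le)
      (neg_nonneg.2 (htr _ (C.map_mem_interior hq.1 hq.2)).1))
    (by have h1 := sub_pos.2 hα; have h2 := sub_pos.2 hβ; positivity) ?_
  · intro p hp
    obtain ⟨s, hs, t, ht, rfl⟩ := C.mem_interior_iff.1 hp
    have := hz (s, t) ⟨hs, ht⟩
    refine (htr _ hp).2 ?_
    have h1 := (mul_eq_zero.1 this).resolve_left
      (mul_pos (abs_pos.2 C.hκ) (hρS (s, t) ⟨hs, ht⟩)).ne'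
    exact neg_eq_zero.1 h1
  · intro ε hε hle
    have l1 := hle.trans (min_le_left _ _)
    have l2 := hle.trans (min_le_right _ _)
    have ml : C.α₁ + ε ∈ Set.Ioo C.α₁ C.α₂ := ⟨by linarith, by linarith⟩
    have mr : C.α₂ - ε ∈ Set.Ioo C.α₁ C.α₂ := ⟨by linarith, by linarith⟩
    have mb : C.β₁ + ε ∈ Set.Ioo C.β₁ C.β₂ := ⟨by linarith, by linarith⟩
    have mt : C.β₂ - ε ∈ Set.Ioo C.β₁ C.β₂ := ⟨by linarith, by linarith⟩
    have hid := integral_trace_eq_flux hv hab hfs (a := (C.α₁ + ε, C.β₁ + ε))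
      (b := (C.α₂ - ε, C.β₂ - ε)) ⟨by simp only; linarith, by simp only; linarith⟩ ⟨ml, mb⟩ ⟨mr, mt⟩
    have f1 := abs_integral_fluxY_le b₂ hK₂ mt (endDist_sub_le _ _ _) ml mr
    have f2 := abs_integral_fluxY_le b₂ hK₂ mb (endDist_add_le _ _ _) ml mr
    have f3 := abs_integral_fluxX_le b₁ hK₁ mr (endDist_sub_le _ _ _) mb mt
    have f4 := abs_integral_fluxX_le b₁ hK₁ ml (endDist_add_le _ _ _) mb mt
    have e1 : ∫ q in Set.Icc (C.α₁ + ε, C.β₁ + ε) (C.α₂ - ε, C.β₂ - ε),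
        |C.κ| * C.ρ q.1 q.2 * -T (C.map q.1 q.2) ≤
        |∫ q in Set.Icc (C.α₁ + ε, C.β₁ + ε) (C.α₂ - ε, C.β₂ - ε),
          C.κ * C.ρ q.1 q.2 * T (C.map q.1 q.2)| := by
      rcases abs_cases C.κ with ⟨h, -⟩ | ⟨h, -⟩
      · rw [h, ← abs_neg, ← integral_neg]
        refine le_trans (le_of_eq ?_) (le_abs_self _)
        congr 1; funext q; ring
      · rw [h]
        refine le_trans (le_of_eq ?_) (le_abs_self _)
        congr 1; funext q; ring
    refine e1.trans ?_
    rw [hid]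
    simp only
    rw [abs_le] at f1 f2 f3 f4 ⊢
    constructor <;> linarith

end BilinearChart

/-! ### Boundedness of symplectic potentials -/

/-- A function of one variable whose second derivative is at most `c / r` is bounded above. -/
theorem exists_bound_of_deriv2_le {k k' k'' : ℝ → ℝ} {r₀ c : ℝ} (h0 : 0 < r₀) (h1 : r₀ ≤ 1)
    (hc : 0 ≤ c) (hk : ∀ r ∈ Set.Ioo 0 r₀, HasDerivAt k (k' r) r)
    (hk' : ∀ r ∈ Set.Ioo 0 r₀, HasDerivAt k' (k'' r) r)
    (hle : ∀ r ∈ Set.Ioo 0 r₀, k'' r ≤ c / r) : ∃ M, ∀ r ∈ Set.Ioo 0 r₀, k r ≤ M := by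
  -- The function c r log r has second derivative c/r, so q is convex and lies above its tangent at
  -- the midpoint. Since r₀ ≤ 1, the term c r log r is nonpositive, and a lower bound for q is an
  -- upper bound for k.
  set q : ℝ → ℝ := fun r => c * (r * Real.log r) - k r with hq
  have hq1 : ∀ r ∈ Set.Ioo 0 r₀, HasDerivAt q (c * (Real.log r + 1) - k' r) r := fun r hr =>
    ((Real.hasDerivAt_mul_log hr.1.ne').const_mul c).sub (hk r hr)
  have hq2 : ∀ r ∈ Set.Ioo 0 r₀,
      HasDerivAt (fun r => c * (Real.log r + 1) - k' r) (c * r⁻¹ - k'' r) r := fun r hr =>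
    (((Real.hasDerivAt_log hr.1.ne').add_const 1).const_mul c).sub (hk' r hr)
  have hconv : ConvexOn ℝ (Set.Ioo 0 r₀) q := by
    refine convexOn_of_hasDerivWithinAt2_nonneg (convex_Ioo 0 r₀)
      (fun r hr => (hq1 r hr).continuousAt.continuousWithinAt)
      (f' := fun r => c * (Real.log r + 1) - k' r) (f'' := fun r => c * r⁻¹ - k'' r) ?_ ?_ ?_
    · rw [interior_Ioo]; exact fun r hr => (hq1 r hr).hasDerivWithinAt
    · rw [interior_Ioo]; exact fun r hr => (hq2 r hr).hasDerivWithinAt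
    · rw [interior_Ioo]
      intro r hr
      have := hle r hr
      rw [div_eq_mul_inv] at this
      exact sub_nonneg.2 this
  set m := r₀ / 2 with hm
  have hmm : m ∈ Set.Ioo 0 r₀ := ⟨by linarith, by linarith⟩
  obtain ⟨d, hd⟩ : ∃ d, HasDerivAt q d m := ⟨_, hq1 m hmm⟩
  refine ⟨-q m + |d| * r₀, fun r hr => ?_⟩
  have hlow : q m - |d| * r₀ ≤ q r := by
    rcases lt_trichotomy r m with hlt | heq | hgt
    · have := hconv.slope_le_of_hasDerivAt hr hmm hlt hd
      rw [slope_def_field, div_le_iff₀ (by linarith)] at this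
      have h3 : d * (m - r) ≤ |d| * r₀ :=
        mul_le_mul (le_abs_self d) (by linarith [hr.1, hmm.2]) (by linarith) (abs_nonneg d)
      linarith
    · rw [heq]
      have := mul_nonneg (abs_nonneg d) h0.le
      linarith
    · have := hconv.le_slope_of_hasDerivAt hmm hr hgt hd
      rw [slope_def_field, le_div_iff₀ (by linarith)] at this
      have h3 : -d * (r - m) ≤ |d| * r₀ :=
        mul_le_mul (neg_le_abs d) (by linarith [hr.2, hmm.1]) (by linarith) (abs_nonneg d)
      linarith
  have hlog : c * (r * Real.log r) ≤ 0 :=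
    mul_nonpos_of_nonneg_of_nonpos hc (mul_nonpos_of_nonneg_of_nonpos hr.1.le
      (Real.log_nonpos hr.1.le (hr.2.le.trans h1)))
  have : k r = c * (r * Real.log r) - q r := by simp [hq]
  linarith

namespace LabeledQuadrilateral

variable {Q : LabeledQuadrilateral}

theorem boundaryConditions_segment {H : Plane → Matrix (Fin 2) (Fin 2) ℝ}
    (hH : ∀ i j, ContDiffOn ℝ ∞ (fun p => H p i j) Q.polytope) (hb : Q.BoundaryConditions H)
    (i : Fin 4) {y : Plane} (hy : y ∈ segment ℝ (Q.vertex i) (Q.vertex (i + 1))) :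
    (∀ v, form (H y) (Q.normal i) v = 0) ∧
    ∀ v, fderivWithin ℝ (fun z => form (H z) (Q.normal i) (Q.normal i)) Q.polytope y v =
      2 * inner ℝ (Q.normal i) v := by
  set γ : ℝ → Plane := fun t => Q.vertex i + t • (Q.vertex (i + 1) - Q.vertex i) with hγ
  have hγc : Continuous γ := by fun_prop
  rw [segment_eq_image'] at hy
  obtain ⟨t, ht, rfl⟩ := hy
  have hopen : ∀ t ∈ Set.Ioo (0 : ℝ) 1, γ t ∈ Q.openFacet i := fun t ht => by
    rw [openFacet, openSegment_eq_image']; exact ⟨t, ht, rfl⟩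
  have hmem : ∀ t ∈ Set.Icc (0 : ℝ) 1, γ t ∈ Q.polytope := fun t ht =>
    Q.convex_polytope.segment_subset (Q.vertex_mem i) (Q.vertex_mem (i + 1))
      (by rw [segment_eq_image']; exact ⟨t, ht, rfl⟩)
  have c1 := fun v => (contDiffOn_form hH (Q.normal i) v).continuousOn.comp hγc.continuousOn hmem
  have c2 : ∀ v, ContinuousOn (fun p => fderivWithin ℝ
      (fun z => form (H z) (Q.normal i) (Q.normal i)) Q.polytope p v) Q.polytope := fun v =>
    (((contDiffOn_form hH _ _).fderivWithin Q.uniqueDiffOn_polytope (m := ∞)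
      (by simp)).clm_apply contDiffOn_const).continuousOn
  refine ⟨fun v => BilinearChart.eq_zero_of_continuousOn_Icc zero_lt_one (c1 v)
    (fun t ht => (hb i _ (hopen t ht)).1 v) t ht, fun v => ?_⟩
  have := BilinearChart.eq_zero_of_continuousOn_Icc zero_lt_one
    (((c2 v).comp hγc.continuousOn hmem).sub (continuousOn_const (c := 2 * inner ℝ (Q.normal i) v)))
    (fun t ht => sub_eq_zero.2 ((hb i _ (hopen t ht)).2 v)) t ht
  exact sub_eq_zero.1 this

theorem fderivWithin_eq_zero_of_segment {φ : Plane → ℝ} (hφ : ContDiffOn ℝ ∞ φ Q.polytope)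
    {v w : Plane} (hv : v ∈ Q.polytope) (hw : w ∈ Q.polytope)
    (h0 : ∀ y ∈ segment ℝ v w, φ y = 0) : fderivWithin ℝ φ Q.polytope v (w - v) = 0 := by
  have hseg : ∀ t ∈ Set.Icc (0 : ℝ) 1, v + t • (w - v) ∈ segment ℝ v w := fun t ht => by
    rw [segment_eq_image']; exact ⟨t, ht, rfl⟩
  have hl : HasDerivAt (fun t : ℝ => v + t • (w - v)) (w - v) 0 := by
    simpa using ((hasDerivAt_id (0 : ℝ)).smul_const (w - v)).const_add v
  have hd := HasFDerivWithinAt.comp_hasDerivWithinAt_of_eq (f := fun t : ℝ => v + t • (w - v))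
    (l := φ) (y := v) (0 : ℝ) (hφ.differentiableOn (by simp) v hv).hasFDerivWithinAt
    (hl.hasDerivWithinAt (s := Set.Icc (0 : ℝ) 1))
    (fun t ht => Q.convex_polytope.segment_subset hv hw (hseg t ht)) (by simp)
  exact (uniqueDiffOn_Icc zero_lt_one 0 (by simp)).eq_deriv _ hd
    ((hasDerivWithinAt_const 0 (Set.Icc (0 : ℝ) 1) (0 : ℝ)).congr
      (fun t ht => h0 _ (hseg t ht)) (h0 _ (hseg 0 (by simp))))

/-- The derivative of `H` at a vertex in the direction of an interior point is nondegenerate. -/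
theorem det_fderivWithin_vertex_pos {H : Plane → Matrix (Fin 2) (Fin 2) ℝ} (hH : Q.IsSmoothSymm H)
    (hb : Q.BoundaryConditions H) (i : Fin 4) {c : Plane} (hc : c ∈ interior Q.polytope) :
    H (Q.vertex i) = 0 ∧ 0 < (Matrix.of fun j k =>
      fderivWithin ℝ (fun p => H p j k) Q.polytope (Q.vertex i) (c - Q.vertex i)).det := by
  obtain ⟨j, hj⟩ : ∃ j : Fin 4, i = j + 1 := ⟨i - 1, by simp⟩
  have d : ∀ j : Fin 4, j ≠ j + 1 ∧ j ≠ j + 1 + 1 ∧ j + 1 + 1 ≠ j + 1 := by decide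
  have hji : j ≠ i := hj ▸ (d j).1
  have hji1 : j ≠ i + 1 := hj ▸ (d j).2.1
  have hij : i + 1 ≠ j + 1 := hj ▸ (d j).2.2
  set v := Q.vertex i with hv
  set n := Q.normal i with hn
  set n' := Q.normal j with hn'
  set e := Q.vertex (i + 1) - v with he
  set e' := Q.vertex j - v with he'
  set w := c - v with hw
  have n1 : inner ℝ n e = 0 := Q.normal_orthogonal i
  have n2 : 0 < inner ℝ n e' := Q.normal_inward i j hji hji1
  have n3 : inner ℝ n' e' = 0 := by
    have := Q.normal_orthogonal j
    rw [← hj, ← neg_sub, inner_neg_right, neg_eq_zero] at this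
    exact this
  have n4 : 0 < inner ℝ n' e := by
    have := Q.normal_inward j (i + 1) hji1.symm hij
    rw [show Q.vertex (i + 1) - Q.vertex j = e - e' by simp [he, he'], inner_sub_right, n3,
      sub_zero] at this
    exact this
  have n5 : 0 < inner ℝ n w := Q.normal_pos_of_mem_interior i hc
  have n6 : 0 < inner ℝ n' w := by
    have := Q.normal_pos_of_mem_interior j hc
    rw [show c - Q.vertex j = w - e' by simp [hw, he'], inner_sub_right, n3, sub_zero] at this
    exact this
  have hdet : det2 n n' * det2 e e' = -(inner ℝ n e' * inner ℝ n' e) := by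
    have : det2 n n' * det2 e e' = inner ℝ n e * inner ℝ n' e' - inner ℝ n e' * inner ℝ n' e := by
      simp only [inner_eq, det2]; ring
    rw [this, n1]; ring
  have hne : det2 n n' * det2 e e' ≠ 0 := by
    rw [hdet]; exact neg_ne_zero.2 (mul_pos n2 n4).ne'
  have hnn := left_ne_zero_of_mul hne
  have hee := right_ne_zero_of_mul hne
  have hvm : v ∈ Q.polytope := Q.vertex_mem i
  have b1 := boundaryConditions_segment hH.1 hb i (left_mem_segment ℝ _ _)
  have b2 := boundaryConditions_segment hH.1 hb j (right_mem_segment ℝ _ _)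
  rw [← hj] at b2
  rw [← hv, ← hn] at b1
  rw [← hv, ← hn'] at b2
  have hH0 : H v = 0 := by
    have key : ∀ k, n 0 * H v 0 k + n 1 * H v 1 k = 0 ∧ n' 0 * H v 0 k + n' 1 * H v 1 k = 0 := by
      intro k
      have h1 := b1.1 (EuclideanSpace.single k 1)
      have h2 := b2.1 (EuclideanSpace.single k 1)
      fin_cases k <;> simp [form_eq] at h1 h2 <;> exact ⟨by simpa using h1, by simpa using h2⟩
    have hz : ∀ k, H v 0 k = 0 ∧ H v 1 k = 0 := by
      intro k
      obtain ⟨h1, h2⟩ := key k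
      constructor
      · refine (mul_eq_zero.1 (?_ : det2 n n' * H v 0 k = 0)).resolve_left hnn
        simp only [det2]; linear_combination n' 1 * h1 - n 1 * h2
      · refine (mul_eq_zero.1 (?_ : det2 n n' * H v 1 k = 0)).resolve_left hnn
        simp only [det2]; linear_combination n 0 * h2 - n' 0 * h1
    ext a b
    fin_cases a
    · exact (hz b).1
    · exact (hz b).2
  refine ⟨hH0, ?_⟩
  have hsym : ∀ p ∈ Q.polytope, ∀ a b, form (H p) a b = form (H p) b a := by
    intro p hp a b
    have := (hH.2 p hp).apply 0 1
    simp only [form_eq, this]; ring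
  -- The mixed entry H(n, n') vanishes along both edges at the vertex, whose directions span the
  -- plane, so its differential there is zero.
  have dn : ∀ u, fderivWithin ℝ (fun p => form (H p) n n') Q.polytope v u = 0 := by
    intro u
    have hs := contDiffOn_form hH.1 n n'
    have z1 : fderivWithin ℝ (fun p => form (H p) n n') Q.polytope v e = 0 :=
      fderivWithin_eq_zero_of_segment hs hvm (Q.vertex_mem _) fun y hy =>
        (boundaryConditions_segment hH.1 hb i hy).1 n'
    have z2 : fderivWithin ℝ (fun p => form (H p) n n') Q.polytope v e' = 0 :=
      fderivWithin_eq_zero_of_segment hs hvm (Q.vertex_mem _) fun y hy => by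
        have hyp : y ∈ Q.polytope := Q.convex_polytope.segment_subset hvm (Q.vertex_mem _) hy
        rw [hsym y hyp]
        rw [segment_symm, hv, hj] at hy
        exact (boundaryConditions_segment hH.1 hb j hy).1 n
    rw [exists_combination hee u, map_add, map_smul, map_smul, z1, z2]
    simp
  set H₀ : Matrix (Fin 2) (Fin 2) ℝ := Matrix.of fun j k =>
      fderivWithin ℝ (fun p => H p j k) Q.polytope v w with hH₀
  have f1 : form H₀ n n = 2 * inner ℝ n w := by
    rw [← b1.2 w, fderivWithin_form hH.1 hvm]
  have f2 : form H₀ n' n' = 2 * inner ℝ n' w := by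
    rw [← b2.2 w, fderivWithin_form hH.1 hvm]
  have f3 : form H₀ n n' = 0 := by
    rw [← dn w, fderivWithin_form hH.1 hvm]
  have hs0 : H₀ 1 0 = H₀ 0 1 := by
    simp only [hH₀, Matrix.of_apply]
    congr 1
    exact fderivWithin_congr (fun p hp => (hH.2 p hp).apply 0 1) ((hH.2 v hvm).apply 0 1)
  -- In the basis n, n' the derivative is diagonal, and its two entries are positive by the boundary
  -- conditions because w points into the interior. The change of basis contributes det(n, n')².
  have hprod : H₀.det * det2 n n' ^ 2 = 2 * inner ℝ n w * (2 * inner ℝ n' w) := by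
    have : H₀.det * det2 n n' ^ 2 = form H₀ n n * form H₀ n' n' - form H₀ n n' ^ 2 := by
      rw [Matrix.det_fin_two]
      simp only [form_eq, det2, hs0]; ring
    rw [this, f1, f2, f3]; ring
  have hpos : 0 < H₀.det * det2 n n' ^ 2 := by rw [hprod]; positivity
  exact pos_of_mul_pos_left hpos (sq_nonneg _)

end LabeledQuadrilateral

namespace LabeledQuadrilateral

variable {Q : LabeledQuadrilateral}

theorem ray_mem_interior {c : Plane} (hc : c ∈ interior Q.polytope) (i : Fin 4) {r : ℝ}
    (hr : r ∈ Set.Ioc (0 : ℝ) 1) : Q.vertex i + r • (c - Q.vertex i) ∈ interior Q.polytope :=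
  Q.convex_polytope.add_smul_sub_mem_interior (Q.vertex_mem i) hc hr

theorem tendsto_ray_div {φ : Plane → ℝ} (hφ : ContDiffOn ℝ ∞ φ Q.polytope) {c : Plane}
    (hc : c ∈ interior Q.polytope) (i : Fin 4) (h0 : φ (Q.vertex i) = 0) :
    Filter.Tendsto (fun r : ℝ => φ (Q.vertex i + r • (c - Q.vertex i)) / r)
      (nhdsWithin 0 (Set.Ioi 0))
      (nhds (fderivWithin ℝ φ Q.polytope (Q.vertex i) (c - Q.vertex i))) := by
  set v := Q.vertex i
  have hv : v ∈ Q.polytope := Q.vertex_mem i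
  have hl : HasDerivAt (fun t : ℝ => v + t • (c - v)) (c - v) 0 := by
    simpa using ((hasDerivAt_id (0 : ℝ)).smul_const (c - v)).const_add v
  have hd : HasDerivWithinAt (fun t : ℝ => φ (v + t • (c - v)))
      (fderivWithin ℝ φ Q.polytope v (c - v)) (Set.Icc 0 1) 0 :=
    HasFDerivWithinAt.comp_hasDerivWithinAt_of_eq (f := fun t : ℝ => v + t • (c - v))
    (l := φ) (y := v) (0 : ℝ) (hφ.differentiableOn (by simp) v hv).hasFDerivWithinAt
    (hl.hasDerivWithinAt (s := Set.Icc (0 : ℝ) 1))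
    (fun t ht => Q.convex_polytope.segment_subset hv (interior_subset hc)
      (by rw [segment_eq_image']; exact ⟨t, ht, rfl⟩)) (by simp)
  have hd' : HasDerivWithinAt (fun t : ℝ => φ (v + t • (c - v)))
      (fderivWithin ℝ φ Q.polytope v (c - v)) (Set.Ioi 0) 0 :=
    hd.mono_of_mem_nhdsWithin (Icc_mem_nhdsGT zero_lt_one)
  have ht := (hasDerivWithinAt_iff_tendsto_slope' Set.self_notMem_Ioi).1 hd'
  refine Filter.Tendsto.congr (fun r => ?_) ht
  rw [slope_def_field, zero_smul, add_zero, h0, sub_zero, sub_zero]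

theorem form_eq_div_of_mul_eq_one {M N : Matrix (Fin 2) (Fin 2) ℝ} (h : M * N = 1) (w : Plane) :
    form N w w = (M 1 1 * w 0 ^ 2 - (M 0 1 + M 1 0) * w 0 * w 1 + M 0 0 * w 1 ^ 2) / M.det := by
  have hdet : M.det * N.det = 1 := by rw [← Matrix.det_mul, h, Matrix.det_one]
  have hne : M.det ≠ 0 := left_ne_zero_of_mul_eq_one hdet
  rw [eq_div_iff hne, form_eq, Matrix.det_fin_two]
  have e00 := congrFun (congrFun h 0) 0
  have e01 := congrFun (congrFun h 0) 1
  have e10 := congrFun (congrFun h 1) 0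
  have e11 := congrFun (congrFun h 1) 1
  simp [Matrix.mul_apply, Fin.sum_univ_two] at e00 e01 e10 e11
  linear_combination w 0 ^ 2 * (M 1 1 * e00 - M 0 1 * e10) + w 0 * w 1 * (M 1 1 * e01 - M 0 1 * e11
    + M 0 0 * e10 - M 1 0 * e00) + w 1 ^ 2 * (M 0 0 * e11 - M 1 0 * e01)

/-- Along the ray H is r H₀ + o(r) with H₀ invertible. Its inverse, the Hessian of G, is therefore
O(1/r), so the second derivative of G along the ray is at most a/r and G stays bounded above. -/
theorem exists_bound_on_ray {G : Plane → ℝ} (hG : Q.IsSymplecticPotential G) {c : Plane}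
    (hc : c ∈ interior Q.polytope) (i : Fin 4) :
    ∃ M, ∀ r ∈ Set.Ioc (0 : ℝ) 1, G (Q.vertex i + r • (c - Q.vertex i)) ≤ M := by
  obtain ⟨hs, -, H, hinv, hH, -, -, hb⟩ := hG
  set v := Q.vertex i with hv
  set w := c - v with hw
  obtain ⟨hH0, hdet⟩ := det_fderivWithin_vertex_pos hH hb i hc
  set H₀ : Matrix (Fin 2) (Fin 2) ℝ := Matrix.of fun j k =>
    fderivWithin ℝ (fun p => H p j k) Q.polytope v w with hH₀
  have hlim : ∀ j k, Filter.Tendsto (fun r : ℝ => H (v + r • w) j k / r)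
      (nhdsWithin 0 (Set.Ioi 0)) (nhds (H₀ j k)) := fun j k =>
    tendsto_ray_div (hH.1 j k) hc i (by rw [hH0]; rfl)
  have hmem := fun (r : ℝ) (hr : r ∈ Set.Ioc (0 : ℝ) 1) => ray_mem_interior hc i hr
  have hq : Filter.Tendsto (fun r : ℝ => r * form (hess G (v + r • w)) w w)
      (nhdsWithin 0 (Set.Ioi 0)) (nhds ((H₀ 1 1 * w 0 ^ 2 - (H₀ 0 1 + H₀ 1 0) * w 0 * w 1 +
        H₀ 0 0 * w 1 ^ 2) / H₀.det)) := by
    rw [Matrix.det_fin_two] at hdet ⊢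
    have hT := ((((hlim 1 1).mul_const (w 0 ^ 2)).sub
      ((((hlim 0 1).add (hlim 1 0)).mul_const (w 0)).mul_const (w 1))).add
      ((hlim 0 0).mul_const (w 1 ^ 2))).div
      (((hlim 0 0).mul (hlim 1 1)).sub ((hlim 0 1).mul (hlim 1 0))) hdet.ne'
    refine hT.congr' ?_
    filter_upwards [Ioc_mem_nhdsGT zero_lt_one] with r hr
    have hm := hinv _ (hmem r hr)
    have hne : (H (v + r • w)).det ≠ 0 := by
      refine left_ne_zero_of_mul_eq_one (b := (hess G (v + r • w)).det) ?_
      rw [← Matrix.det_mul, hm, Matrix.det_one]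
    rw [form_eq_div_of_mul_eq_one hm]
    rw [Matrix.det_fin_two] at hne ⊢
    have hr0 := hr.1.ne'
    have hne' : H (v + r • w) 0 0 / r * (H (v + r • w) 1 1 / r) -
        H (v + r • w) 0 1 / r * (H (v + r • w) 1 0 / r) ≠ 0 := by
      rw [show H (v + r • w) 0 0 / r * (H (v + r • w) 1 1 / r) -
        H (v + r • w) 0 1 / r * (H (v + r • w) 1 0 / r) = (H (v + r • w) 0 0 * H (v + r • w) 1 1 -
        H (v + r • w) 0 1 * H (v + r • w) 1 0) / r ^ 2 by field_simp]
      positivity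
    change (H (v + r • w) 1 1 / r * w 0 ^ 2 - (H (v + r • w) 0 1 / r + H (v + r • w) 1 0 / r) * w 0
      * w 1 + H (v + r • w) 0 0 / r * w 1 ^ 2) / (H (v + r • w) 0 0 / r * (H (v + r • w) 1 1 / r) -
        H (v + r • w) 0 1 / r * (H (v + r • w) 1 0 / r)) = r * ((H (v + r • w) 1 1 * w 0 ^ 2 -
        (H (v + r • w) 0 1 + H (v + r • w) 1 0) * w 0 * w 1 + H (v + r • w) 0 0 * w 1 ^ 2) /
        (H (v + r • w) 0 0 * H (v + r • w) 1 1 - H (v + r • w) 0 1 * H (v + r • w) 1 0))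
    rw [← mul_div_assoc r, div_eq_div_iff hne' hne]
    field_simp
  obtain ⟨a, ha, hle⟩ : ∃ a > 0, ∀ᶠ r in nhdsWithin (0 : ℝ) (Set.Ioi 0),
      r * form (hess G (v + r • w)) w w ≤ a :=
    ⟨_, lt_of_lt_of_le one_pos (le_max_right _ _),
      (hq.eventually_le_const ((lt_add_one _).trans_le (le_max_left _ 1)))⟩
  obtain ⟨ε, hε, hle⟩ := mem_nhdsGT_iff_exists_Ioo_subset.1 hle
  have hε : 0 < ε := hε
  set r₀ := min ε 1 with hr₀
  have hr0 : 0 < r₀ := lt_min hε one_pos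
  obtain ⟨M₁, hM₁⟩ := exists_bound_of_deriv2_le hr0 (min_le_right _ _) ha.le
    (k := fun r => G (v + r • w))
    (fun r hr => hasDerivAt_line <| differentiableAt_of_contDiffOn isOpen_interior hs (hmem r ⟨hr.1, hr.2.le.trans (min_le_right _ _)⟩))
    (fun r hr => hasDerivAt_line_deriv isOpen_interior hs
      (hmem r ⟨hr.1, hr.2.le.trans (min_le_right _ _)⟩))
    (fun r hr => by
      rw [le_div_iff₀ hr.1, mul_comm]
      exact hle ⟨hr.1, hr.2.trans_le (min_le_left _ _)⟩)
  have hcont : ContinuousOn (fun r : ℝ => G (v + r • w)) (Set.Icc r₀ 1) :=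
    hs.continuousOn.comp (by fun_prop) fun r hr => hmem r ⟨hr0.trans_le hr.1, hr.2⟩
  obtain ⟨M₂, hM₂⟩ := isCompact_Icc.bddAbove_image hcont
  refine ⟨max M₁ M₂, fun r hr => ?_⟩
  rcases lt_or_ge r r₀ with h | h
  · exact (hM₁ r ⟨hr.1, h⟩).trans (le_max_left _ _)
  · exact (hM₂ ⟨r, ⟨h, hr.2⟩, rfl⟩).trans (le_max_right _ _)

/-- From above: an interior point is a convex combination of points on the rays from the vertices to
c, where G is bounded above. From below: c lies between p and a point slightly beyond c, so
convexity bounds G(p) by G(c) and the upper bound. -/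
theorem exists_bound_of_isSymplecticPotential {G : Plane → ℝ} (hG : Q.IsSymplecticPotential G) :
    ∃ M, ∀ p ∈ interior Q.polytope, |G p| ≤ M := by
  obtain ⟨c, hc⟩ := Q.interior_polytope_nonempty
  choose M hM using exists_bound_on_ray hG hc
  have hconv := hG.2.1.convexOn
  have hup : ∀ p ∈ interior Q.polytope, G p ≤ ∑ i, |M i| := by
    intro p hp
    -- Stretching p away from c by 1/(1 - r) stays in Δ for small r. Barycentric weights of the
    -- stretched point then express p through the points at the same parameter r on the rays.
    obtain ⟨r, hr, hmem⟩ : ∃ r ∈ Set.Ioo (0 : ℝ) 1, c + (1 - r)⁻¹ • (p - c) ∈ Q.polytope := by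
      have hcont : ContinuousAt (fun r : ℝ => c + (1 - r)⁻¹ • (p - c)) 0 := by
        have h : ContinuousAt (fun r : ℝ => (1 - r)⁻¹) 0 :=
          ContinuousAt.inv₀ (by fun_prop) (by simp)
        fun_prop
      have := hcont.eventually_mem (isOpen_interior.mem_nhds (by simpa using hp))
      obtain ⟨r, h1, h2⟩ := ((this.filter_mono (nhdsWithin_le_nhds (s := Set.Ioi 0))).and
        (Ioo_mem_nhdsGT zero_lt_one)).exists
      exact ⟨r, h2, interior_subset h1⟩
    have h1r : 1 - r ≠ 0 := by linarith [hr.2]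
    obtain ⟨a, a0, a1, ha⟩ := Q.mem_polytope_iff.1 hmem
    have hp' : p = ∑ i, a i • (Q.vertex i + r • (c - Q.vertex i)) := by
      have : p = c + (1 - r) • (c + (1 - r)⁻¹ • (p - c) - c) := by
        rw [add_sub_cancel_left, smul_smul, mul_inv_cancel₀ h1r]; module
      rw [this, ← ha]
      have e : ∀ i, a i • (Q.vertex i + r • (c - Q.vertex i)) =
          (1 - r) • (a i • Q.vertex i) + a i • (r • c) := fun i => by module
      simp only [e, Finset.sum_add_distrib, ← Finset.smul_sum, ← Finset.sum_smul, a1]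
      module
    rw [hp']
    have hr' : r ∈ Set.Ioc (0 : ℝ) 1 := ⟨hr.1, hr.2.le⟩
    calc G (∑ i, a i • (Q.vertex i + r • (c - Q.vertex i)))
        ≤ ∑ i, a i • G (Q.vertex i + r • (c - Q.vertex i)) :=
          hconv.map_sum_le (fun i _ => a0 i) a1 fun i _ => ray_mem_interior hc i hr'
      _ ≤ ∑ i, |M i| := Finset.sum_le_sum fun i _ => by
          have h1 : a i ≤ 1 := a1 ▸ Finset.single_le_sum (fun j _ => a0 j) (Finset.mem_univ i)
          calc a i • G (Q.vertex i + r • (c - Q.vertex i)) ≤ a i * |M i| :=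
                mul_le_mul_of_nonneg_left ((hM i r hr').trans (le_abs_self _)) (a0 i)
            _ ≤ |M i| := mul_le_of_le_one_left (abs_nonneg _) h1
  obtain ⟨ε, hε, hball⟩ := Metric.isOpen_iff.1 isOpen_interior c hc
  obtain ⟨D, hD, hDb⟩ := Q.isCompact_polytope.isBounded.exists_pos_norm_le
  -- Points of Δ have distance at most 2D from c, so the reflected point is moved by at most ε/2 and
  -- remains in the ball around c.
  set δ := min 1 (ε / (4 * D)) with hδ
  have hδ0 : 0 < δ := lt_min one_pos (by positivity)
  set S := ∑ i, |M i| with hS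
  have hlow : ∀ p ∈ interior Q.polytope, -((|G c| + |G c| + S) / δ + S) ≤ G p := by
    intro p hp
    have hmem : c - δ • (p - c) ∈ interior Q.polytope := by
      refine hball ?_
      rw [Metric.mem_ball, dist_eq_norm, sub_sub_cancel_left, norm_neg, norm_smul, Real.norm_eq_abs,
        abs_of_pos hδ0]
      have h1 : ‖p - c‖ ≤ 2 * D := (norm_sub_le _ _).trans
        (by linarith [hDb p (interior_subset hp), hDb c (interior_subset hc)])
      calc δ * ‖p - c‖ ≤ ε / (4 * D) * (2 * D) :=
            mul_le_mul (min_le_right _ _) h1 (norm_nonneg _) (by positivity)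
        _ = ε / 2 := by field_simp; norm_num
        _ < ε := by linarith
    have h1 : 0 < 1 + δ := by linarith
    have := hconv.2 hp hmem (show 0 ≤ δ / (1 + δ) by positivity)
      (show 0 ≤ 1 / (1 + δ) by positivity)
      (by field_simp; ring)
    rw [show (δ / (1 + δ)) • p + (1 / (1 + δ)) • (c - δ • (p - c)) = c by
      have e : δ / (1 + δ) = δ * (1 / (1 + δ)) := by ring
      have e2 : (1 / (1 + δ)) * (1 + δ) = 1 := by field_simp
      rw [e]
      calc _ = ((1 / (1 + δ)) * (1 + δ)) • c := by module
        _ = c := by rw [e2, one_smul]] at this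
    simp only [smul_eq_mul] at this
    have h2 := hup _ hmem
    have h3 : (1 + δ) * G c ≤ δ * G p + S := by
      have := mul_le_mul_of_nonneg_left this h1.le
      rw [show (1 + δ) * (δ / (1 + δ) * G p + 1 / (1 + δ) * G (c - δ • (p - c))) =
        δ * G p + G (c - δ • (p - c)) by field_simp] at this
      linarith
    have h4 : -|G c| ≤ G c := neg_abs_le _
    have hS0 : 0 ≤ S := Finset.sum_nonneg fun i _ => abs_nonneg _
    have h5 : δ ≤ 1 := min_le_left _ _
    have h6 : (1 + δ) * -|G c| ≤ (1 + δ) * G c := mul_le_mul_of_nonneg_left h4 h1.le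
    have h7 : δ * |G c| ≤ |G c| := mul_le_of_le_one_left (abs_nonneg _) h5
    have h8 : -(|G c| + |G c| + S) ≤ δ * G p := by linarith
    have h9 : -((|G c| + |G c| + S) / δ) ≤ G p := by
      rw [← neg_div, div_le_iff₀ hδ0]; linarith
    linarith
  have hpos : 0 ≤ (|G c| + |G c| + S) / δ := by
    have hS0 : 0 ≤ S := Finset.sum_nonneg fun i _ => abs_nonneg _
    positivity
  exact ⟨_, fun p hp => abs_le.2 ⟨hlow p hp, (hup p hp).trans (by linarith)⟩⟩

end LabeledQuadrilateral

/-! ### Potentials with equal Hessians -/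

theorem eq_of_hasDerivAt_zero {k : ℝ → ℝ} (h : ∀ t ∈ Set.Icc (0 : ℝ) 1, HasDerivAt k 0 t) :
    ∀ t ∈ Set.Icc (0 : ℝ) 1, k t = k 0 :=
  constant_of_has_deriv_right_zero (fun t ht => (h t ht).continuousAt.continuousWithinAt)
    fun t ht => (h t (Set.Ico_subset_Icc_self ht)).hasDerivWithinAt

/-- A function with vanishing Hessian on an open convex set is affine there. -/
theorem exists_affineMap_of_hess_eq_zero {f : Plane → ℝ} {U : Set Plane} (hU : IsOpen U)
    (hconv : Convex ℝ U) (hne : U.Nonempty) (hf : ContDiffOn ℝ ∞ f U)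
    (hz : ∀ p ∈ U, hess f p = 0) : ∃ a : Plane →ᵃ[ℝ] ℝ, ∀ p ∈ U, f p = a p := by
  obtain ⟨c, hc⟩ := hne
  refine ⟨(fderiv ℝ f c : Plane →ₗ[ℝ] ℝ).toAffineMap +
    AffineMap.const ℝ Plane (f c - fderiv ℝ f c c), fun p hp => ?_⟩
  have hseg : ∀ t ∈ Set.Icc (0 : ℝ) 1, c + t • (p - c) ∈ U := fun t ht =>
    hconv.segment_subset hc hp (by rw [segment_eq_image']; exact ⟨t, ht, rfl⟩)
  have hd := fun t ht => hasDerivAt_line (differentiableAt_of_contDiffOn hU hf (hseg t ht))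
  have hconst := eq_of_hasDerivAt_zero fun t ht =>
    (hasDerivAt_line_deriv hU hf (hseg t ht)).congr_deriv (by simp [hz _ (hseg t ht), form_eq])
  simp only [zero_smul, add_zero] at hconst
  have h1 := eq_of_hasDerivAt_zero (k := fun t => f (c + t • (p - c)) -
      t * (pd 0 f c * (p - c) 0 + pd 1 f c * (p - c) 1)) (fun t ht => by
    have := (hd t ht).sub ((hasDerivAt_id t).mul_const
      (pd 0 f c * (p - c) 0 + pd 1 f c * (p - c) 1))
    exact this.congr_deriv (by rw [hconst t ht]; ring)) 1 (by simp)
  simp only [one_smul, add_sub_cancel, zero_smul, add_zero, one_mul, zero_mul, sub_zero,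
    ← fderiv_apply_eq_pd] at h1
  rw [map_sub] at h1
  simp
  linarith

theorem hess_congr {f g : Plane → ℝ} {p : Plane} (h : f =ᶠ[nhds p] g) : hess f p = hess g p := by
  ext i j
  exact pd_congr (eventually_pd_eq h j) i

theorem hess_add {f g : Plane → ℝ} {U : Set Plane} (hU : IsOpen U) (hf : ContDiffOn ℝ ∞ f U)
    (hg : ContDiffOn ℝ ∞ g U) {p : Plane} (hp : p ∈ U) :
    hess (fun q => f q + g q) p = hess f p + hess g p := by
  ext i j
  simp only [hess, Matrix.of_apply, Matrix.add_apply]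
  rw [← pd_add (differentiableAt_of_contDiffOn hU (contDiffOn_pd hU hf j) hp)
    (differentiableAt_of_contDiffOn hU (contDiffOn_pd hU hg j) hp)]
  refine pd_congr ?_ i
  filter_upwards [hU.mem_nhds hp] with q hq using pd_add (differentiableAt_of_contDiffOn hU hf hq)
    (differentiableAt_of_contDiffOn hU hg hq) j

namespace LabeledQuadrilateral

variable {Q : LabeledQuadrilateral}

theorem hess_eq_of_eq_add_affine {G G' : Plane → ℝ} (hG : ContDiffOn ℝ ∞ G (interior Q.polytope))
    (a : Plane →ᵃ[ℝ] ℝ) (h : ∀ p ∈ interior Q.polytope, G' p = G p + a p) {p : Plane}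
    (hp : p ∈ interior Q.polytope) : hess G' p = hess G p := by
  have he : G' =ᶠ[nhds p] fun q => G q + a q := by
    filter_upwards [isOpen_interior.mem_nhds hp] with q hq using h q hq
  rw [hess_congr he, hess_add isOpen_interior hG (contDiff_affineMap a).contDiffOn hp,
    hess_affineMap, add_zero]

theorem IsExtremalPotential.add_affine {G G' : Plane → ℝ} (hG : Q.IsExtremalPotential G)
    (a : Plane →ᵃ[ℝ] ℝ) (h : ∀ p ∈ interior Q.polytope, G' p = G p + a p) :
    Q.IsExtremalPotential G' := by
  obtain ⟨⟨hs, hc, H, hinv, hrest⟩, hext⟩ := hG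
  have hh := fun p hp => hess_eq_of_eq_add_affine hs a h (p := p) hp
  have hconv : ConvexOn ℝ (interior Q.polytope) a := by
    obtain ⟨L, c, e⟩ := exists_eq_affineMap a
    rw [e]
    exact ((L : Plane →ₗ[ℝ] ℝ).convexOn Q.convex_polytope.interior).add_const c
  refine ⟨⟨(hs.add (contDiff_affineMap a).contDiffOn).congr h,
    (hc.add_convexOn hconv).congr fun p hp => (h p hp).symm, H, fun p hp => ?_, hrest⟩,
    fun p hp => ?_⟩
  · rw [hh p hp]; exact hinv p hp
  · rw [← hext p hp]
    refine abreu_congr ?_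
    filter_upwards [isOpen_interior.mem_nhds hp] with q hq
    rw [hh q hq]

theorem exists_affine_of_isInverseHessian {H : Plane → Matrix (Fin 2) (Fin 2) ℝ} {G G' : Plane → ℝ}
    (hG : ContDiffOn ℝ ∞ G (interior Q.polytope)) (hG' : ContDiffOn ℝ ∞ G' (interior Q.polytope))
    (h : Q.IsInverseHessian H G) (h' : Q.IsInverseHessian H G') :
    ∃ a : Plane →ᵃ[ℝ] ℝ, ∀ p ∈ interior Q.polytope, G' p = G p + a p := by
  obtain ⟨a, ha⟩ := exists_affineMap_of_hess_eq_zero isOpen_interior Q.convex_polytope.interior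
    Q.interior_polytope_nonempty (hG'.sub hG) fun p hp => by
      have e : hess G' p = hess G p := by
        rw [← Matrix.inv_eq_right_inv (h p hp), ← Matrix.inv_eq_right_inv (h' p hp)]
      have e2 := hess_add isOpen_interior (hG'.sub hG) hG hp
      simp only [sub_add_cancel] at e2
      rw [e] at e2
      exact left_eq_add.1 (e2.trans (add_comm _ _))
  exact ⟨a, fun p hp => by rw [← ha p hp]; simp⟩

end LabeledQuadrilateral

namespace BilinearChart

variable {Q : LabeledQuadrilateral} {C : BilinearChart Q} {A B : Polynomial ℝ}

/-- The inverse Hessian of a solution is `H_{A,B}`. -/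
theorem isInverseHessian_of_isExtremalPotential (hAB : C.Solves A B) {G : Plane → ℝ}
    (hG : Q.IsExtremalPotential G) : Q.IsInverseHessian (C.matH A B) G := by
  obtain ⟨hA, hB⟩ := eval_pos_of_isExtremalPotential hAB hG
  -- Existence of any solution has already made A and B positive, so the explicit potential is
  -- available as the second solution in the uniqueness argument.
  have hP := C.isExtremalPotential_potential hAB hA hB
  obtain ⟨M₁, hM₁⟩ := LabeledQuadrilateral.exists_bound_of_isSymplecticPotential hG.1
  obtain ⟨M₂, hM₂⟩ := LabeledQuadrilateral.exists_bound_of_isSymplecticPotential hP.1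
  obtain ⟨⟨hs, hc, H, hinv, hH, hpd, -, hb⟩, hext⟩ := hG
  have hsm := C.isSmoothSymm_matH A B
  have hextH := (LabeledQuadrilateral.extremalEquation_inv_hess hinv).1 hext
  have key := eq_of_bounded (C := C) (C.vanishesOnBoundary_sub hH hsm hb (C.boundaryConditions_matH hAB))
    (fun p hp => by
      rw [abreu_sub isOpen_interior (fun i j => (hH.1 i j).mono interior_subset)
        (fun i j => (hsm.1 i j).mono interior_subset) hp, hextH p hp,
        C.extremalEquation_matH hAB p hp, sub_self])
    hpd ((C.isPosDef_matH_iff A B).2 ⟨hA, hB⟩) hinv (C.isInverseHessian_potential hA hB) hs hP.1.1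
    (moderateGrowth_of_convexOn hs hc.convexOn hM₁)
    (moderateGrowth_of_convexOn hP.1.1 hP.1.2.1.convexOn hM₂)
  intro p hp
  rw [← key p hp]
  exact hinv p hp

theorem isExtremalPotential_iff_exists_affine (hAB : C.Solves A B) {G : Plane → ℝ}
    (hG : Q.IsExtremalPotential G) (G' : Plane → ℝ) : Q.IsExtremalPotential G' ↔
      ∃ a : Plane →ᵃ[ℝ] ℝ, ∀ p ∈ interior Q.polytope, G' p = G p + a p :=
  ⟨fun hG' => LabeledQuadrilateral.exists_affine_of_isInverseHessian hG.1.1 hG'.1.1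
    (isInverseHessian_of_isExtremalPotential hAB hG)
    (isInverseHessian_of_isExtremalPotential hAB hG'), fun ⟨a, ha⟩ => hG.add_affine a ha⟩

theorem exists_isExtremalPotential_iff (hAB : C.Solves A B) :
    (∃ G, Q.IsExtremalPotential G ∧ Q.IsInverseHessian (C.matH A B) G) ↔
      (∀ x ∈ Set.Ioo C.α₁ C.α₂, 0 < A.eval x) ∧ ∀ y ∈ Set.Ioo C.β₁ C.β₂, 0 < B.eval y :=
  ⟨fun ⟨_, hG, _⟩ => eval_pos_of_isExtremalPotential hAB hG, fun ⟨hA, hB⟩ =>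
    ⟨_, C.isExtremalPotential_potential hAB hA hB, C.isInverseHessian_potential hA hB⟩⟩

end BilinearChart

/-! ### Existence of separating coordinates -/

theorem convex_affine_nonneg (a b c : ℝ) : Convex ℝ {p : Plane | 0 ≤ a + b * p 0 + c * p 1} := by
  intro p hp q hq s t hs ht hst
  simp only [Set.mem_ofPred_eq, PiLp.add_apply, PiLp.smul_apply, smul_eq_mul] at *
  have h1 := mul_nonneg hs hp
  have h2 := mul_nonneg ht hq
  rw [show a = s * a + t * a by rw [← add_mul, hst, one_mul]]
  linarith

namespace Shape

theorem sigma_image_product (α₁ α₂ β₁ β₂ : ℝ) :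
    {p | ∃ x ∈ Set.Icc α₁ α₂, ∃ y ∈ Set.Icc β₁ β₂, p = sigma product x y} =
      {p | 0 ≤ -α₁ + 1 * p 0 + 0 * p 1} ∩ {p | 0 ≤ α₂ + (-1) * p 0 + 0 * p 1} ∩
        {p | 0 ≤ -β₁ + 0 * p 0 + 1 * p 1} ∩ {p | 0 ≤ β₂ + 0 * p 0 + (-1) * p 1} := by
  ext p
  simp only [Set.mem_inter_iff, Set.mem_ofPred_eq]
  constructor
  · rintro ⟨x, hx, y, hy, rfl⟩
    simp [sigma]
    exact ⟨⟨⟨hx.1, hx.2⟩, hy.1⟩, hy.2⟩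
  · rintro ⟨⟨⟨h1, h2⟩, h3⟩, h4⟩
    exact ⟨p 0, ⟨by linarith, by linarith⟩, p 1, ⟨by linarith, by linarith⟩, plane_ext rfl rfl⟩

theorem sigma_image_calabi {α₁ : ℝ} (h : 0 < α₁) (α₂ β₁ β₂ : ℝ) :
    {p | ∃ x ∈ Set.Icc α₁ α₂, ∃ y ∈ Set.Icc β₁ β₂, p = sigma calabi x y} =
      {p | 0 ≤ -α₁ + 1 * p 0 + 0 * p 1} ∩ {p | 0 ≤ α₂ + (-1) * p 0 + 0 * p 1} ∩
        {p | 0 ≤ 0 + -β₁ * p 0 + 1 * p 1} ∩ {p | 0 ≤ 0 + β₂ * p 0 + (-1) * p 1} := by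
  ext p
  simp only [Set.mem_inter_iff, Set.mem_ofPred_eq]
  constructor
  · rintro ⟨x, hx, y, hy, rfl⟩
    have hx0 : 0 ≤ x := h.le.trans hx.1
    have h1 := mul_nonneg hx0 (sub_nonneg.2 hy.1)
    have h2 := mul_nonneg hx0 (sub_nonneg.2 hy.2)
    simp only [sigma]
    refine ⟨⟨⟨?_, ?_⟩, ?_⟩, ?_⟩ <;> simp <;> linarith [hx.1, hx.2]
  · rintro ⟨⟨⟨h1, h2⟩, h3⟩, h4⟩
    have hp : 0 < p 0 := by linarith
    refine ⟨p 0, ⟨by linarith, by linarith⟩, p 1 / p 0, ⟨?_, ?_⟩, plane_ext rfl ?_⟩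
    · rw [le_div_iff₀ hp]; linarith
    · rw [div_le_iff₀ hp]; linarith
    · simp [sigma]; field_simp

/-- The coordinates x and y are the roots of z² - p₀z + p₁. The four inequalities prescribe its sign
at α₁, α₂, β₁, β₂, and as β₂ < α₁ these signs place one root in each interval. -/
theorem sigma_image_orthotoric {α₁ α₂ β₁ β₂ : ℝ} (hα : α₁ < α₂) (hβ : β₁ < β₂) (h : β₂ < α₁) :
    {p | ∃ x ∈ Set.Icc α₁ α₂, ∃ y ∈ Set.Icc β₁ β₂, p = sigma orthotoric x y} =
      {p | 0 ≤ -α₁ ^ 2 + α₁ * p 0 + (-1) * p 1} ∩ {p | 0 ≤ α₂ ^ 2 + -α₂ * p 0 + 1 * p 1} ∩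
        {p | 0 ≤ β₁ ^ 2 + -β₁ * p 0 + 1 * p 1} ∩ {p | 0 ≤ -β₂ ^ 2 + β₂ * p 0 + (-1) * p 1} := by
  ext p
  simp only [Set.mem_inter_iff, Set.mem_ofPred_eq]
  constructor
  · rintro ⟨x, hx, y, hy, rfl⟩
    have h1 := mul_nonneg (sub_nonneg.2 hx.1) (show 0 ≤ α₁ - y by linarith [hy.2])
    have h2 := mul_nonneg (sub_nonneg.2 hx.2) (show 0 ≤ α₂ - y by linarith [hy.2])
    have h3 := mul_nonneg (sub_nonneg.2 hy.1) (show 0 ≤ x - β₁ by linarith [hx.1])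
    have h4 := mul_nonneg (sub_nonneg.2 hy.2) (show 0 ≤ x - β₂ by linarith [hx.1])
    simp only [sigma]
    refine ⟨⟨⟨?_, ?_⟩, ?_⟩, ?_⟩ <;> simp <;> linarith
  · rintro ⟨⟨⟨h1, h2⟩, h3⟩, h4⟩
    -- The quadratic is nonpositive at β₂, so its roots are real.
    have hD : 0 ≤ p 0 ^ 2 - 4 * p 1 := by linarith [sq_nonneg (2 * β₂ - p 0)]
    set r := √(p 0 ^ 2 - 4 * p 1) with hr
    have hr0 : 0 ≤ r := Real.sqrt_nonneg _
    have hr2 : r ^ 2 = p 0 ^ 2 - 4 * p 1 := Real.sq_sqrt hD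
    obtain ⟨x, hx⟩ : ∃ x, x = (p 0 + r) / 2 := ⟨_, rfl⟩
    obtain ⟨y, hy⟩ : ∃ y, y = (p 0 - r) / 2 := ⟨_, rfl⟩
    have e0 : p 0 = x + y := by rw [hx, hy]; ring
    have e1 : p 1 = x * y := by rw [hx, hy]; linear_combination hr2 / 4
    have hyx : y ≤ x := by rw [hx, hy]; linarith
    rw [e0, e1] at h1 h2 h3 h4
    have k1 : 0 ≤ (x - α₁) * (α₁ - y) := by linarith
    have k2 : 0 ≤ (α₂ - x) * (α₂ - y) := by linarith
    have k3 : 0 ≤ (x - β₁) * (y - β₁) := by linarith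
    have k4 : 0 ≤ (x - β₂) * (β₂ - y) := by linarith
    have l1 : α₁ ≤ x := by
      by_contra! hlt
      linarith [mul_pos (sub_pos.2 hlt) (show 0 < α₁ - y by linarith)]
    have l4 : y ≤ β₂ := by
      by_contra! hlt
      linarith [mul_pos (sub_pos.2 hlt) (show 0 < x - β₂ by linarith)]
    have l2 : x ≤ α₂ := by
      by_contra! hlt
      linarith [mul_pos (sub_pos.2 hlt) (show 0 < α₂ - y by linarith)]
    have l3 : β₁ ≤ y := by
      by_contra! hlt
      linarith [mul_pos (sub_pos.2 hlt) (show 0 < x - β₁ by linarith)]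
    exact ⟨x, ⟨l1, l2⟩, y, ⟨l3, l4⟩, plane_ext e0 e1⟩

theorem convex_sigma_image (s : Shape) {α₁ α₂ β₁ β₂ : ℝ} (h : s.Admissible α₁ α₂ β₁ β₂) :
    Convex ℝ {p | ∃ x ∈ Set.Icc α₁ α₂, ∃ y ∈ Set.Icc β₁ β₂, p = s.sigma x y} := by
  cases s
  · rw [sigma_image_product]
    exact (((convex_affine_nonneg _ _ _).inter (convex_affine_nonneg _ _ _)).inter
      (convex_affine_nonneg _ _ _)).inter (convex_affine_nonneg _ _ _)
  · rw [sigma_image_calabi h.2.2.1]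
    exact (((convex_affine_nonneg _ _ _).inter (convex_affine_nonneg _ _ _)).inter
      (convex_affine_nonneg _ _ _)).inter (convex_affine_nonneg _ _ _)
  · rw [sigma_image_orthotoric h.1 h.2.1 h.2.2]
    exact (((convex_affine_nonneg _ _ _).inter (convex_affine_nonneg _ _ _)).inter
      (convex_affine_nonneg _ _ _)).inter (convex_affine_nonneg _ _ _)

/-- The image of an admissible rectangle is the convex hull of the images of its corners. -/
theorem sigma_image_eq_convexHull (s : Shape) {α₁ α₂ β₁ β₂ : ℝ} (h : s.Admissible α₁ α₂ β₁ β₂) :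
    {p | ∃ x ∈ Set.Icc α₁ α₂, ∃ y ∈ Set.Icc β₁ β₂, p = s.sigma x y} =
      convexHull ℝ {s.sigma α₁ β₁, s.sigma α₂ β₁, s.sigma α₂ β₂, s.sigma α₁ β₂} := by
  have la := Set.left_mem_Icc.2 h.lt.1.le
  have lb := Set.right_mem_Icc.2 h.lt.1.le
  have lc := Set.left_mem_Icc.2 h.lt.2.le
  have ld := Set.right_mem_Icc.2 h.lt.2.le
  apply Set.Subset.antisymm
  · rintro _ ⟨x, hx, y, hy, rfl⟩
    -- With the identity as affine isomorphism, σ itself is the bilinear map of a chart.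
    set N : SeparatingChart := ⟨s, α₁, α₂, β₁, β₂, h, AffineEquiv.refl ℝ Plane⟩
    have hm : ∀ x y, s.sigma x y = N.grid.map x y := fun x y => by rw [N.grid_map]; rfl
    have hmem := N.grid.map_mem_convexHull (x := x) (y := y) hx hy
    rw [← hm] at hmem
    refine convexHull_mono ?_ hmem
    rintro _ ⟨i, rfl⟩
    simp only [hm]
    fin_cases i <;> simp [Grid.corner] <;> simp [N, SeparatingChart.grid]
  · refine convexHull_min ?_ (s.convex_sigma_image h)
    rintro p (rfl | rfl | rfl | rfl)
    exacts [⟨_, la, _, lc, rfl⟩, ⟨_, lb, _, lc, rfl⟩, ⟨_, lb, _, ld, rfl⟩, ⟨_, la, _, ld, rfl⟩]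

end Shape

/-- An affine isomorphism is prescribed by a point and the images of two independent vectors. -/
theorem exists_affineEquiv {e₁ e₂ f₁ f₂ : Plane} (he : det2 e₁ e₂ ≠ 0) (hf : det2 f₁ f₂ ≠ 0)
    (a w : Plane) : ∃ φ : Plane ≃ᵃ[ℝ] Plane, ∀ s t : ℝ, φ (a + s • e₁ + t • e₂) = w + s • f₁ + t • f₂ := by
  have hli : ∀ {v₁ v₂ : Plane}, det2 v₁ v₂ ≠ 0 → LinearIndependent ℝ ![v₁, v₂] := by
    intro v₁ v₂ h
    rw [LinearIndependent.pair_iff]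
    intro s t hst
    have h0 : s * v₁ 0 + t * v₂ 0 = 0 := by simpa using congrArg (fun p : Plane => p 0) hst
    have h1 : s * v₁ 1 + t * v₂ 1 = 0 := by simpa using congrArg (fun p : Plane => p 1) hst
    constructor
    · refine (mul_eq_zero.1 (?_ : s * det2 v₁ v₂ = 0)).resolve_right h
      simp only [det2]; linear_combination v₂ 1 * h0 - v₂ 0 * h1
    · refine (mul_eq_zero.1 (?_ : t * det2 v₁ v₂ = 0)).resolve_right h
      simp only [det2]; linear_combination v₁ 0 * h1 - v₁ 1 * h0
  set E := basisOfLinearIndependentOfCardEqFinrank (hli he) (by simp)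
  set F := basisOfLinearIndependentOfCardEqFinrank (hli hf) (by simp)
  set L : Plane ≃ₗ[ℝ] Plane := E.equiv F (Equiv.refl _)
  have hL1 : L e₁ = f₁ := by
    have := E.equiv_apply 0 F (Equiv.refl _)
    simpa [E, F] using this
  have hL2 : L e₂ = f₂ := by
    have := E.equiv_apply 1 F (Equiv.refl _)
    simpa [E, F] using this
  refine ⟨AffineEquiv.mk' (fun p => L (p - a) + w) L a (fun p => by simp), fun s t => ?_⟩
  change L (a + s • e₁ + t • e₂ - a) + w = _
  rw [show a + s • e₁ + t • e₂ - a = s • e₁ + t • e₂ by module, map_add,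
    map_smul, map_smul, hL1, hL2]
  module

/-- In the affine frame at the first corner, the coordinates of the opposite corner of a σ-image are
the Jacobians at the two adjacent corners divided by the Jacobian at the first. Quadrilaterals with
equal coordinates are affinely equivalent. -/
theorem exists_separatingChart_of_shape {a b c d : Plane} {p q : ℝ} (hdet : det2 (b - a) (d - a) ≠ 0)
    (hc : c = a + p • (b - a) + q • (d - a)) (s : Shape) {α₁ α₂ β₁ β₂ : ℝ}
    (h : s.Admissible α₁ α₂ β₁ β₂) (hp : p * s.density α₁ β₁ = s.density α₁ β₂)
    (hq : q * s.density α₁ β₁ = s.density α₂ β₁) :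
    ∃ N : SeparatingChart, N.toAffine '' convexHull ℝ {a, b, c, d} =
      {p | ∃ x ∈ Set.Icc N.α₁ N.α₂, ∃ y ∈ Set.Icc N.β₁ N.β₂, p = N.shape.sigma x y} := by
  have la := Set.left_mem_Icc.2 h.lt.1.le
  have lc := Set.left_mem_Icc.2 h.lt.2.le
  have hρ := s.density_pos h la lc
  have hdet' : det2 (s.sigma α₂ β₁ - s.sigma α₁ β₁) (s.sigma α₁ β₂ - s.sigma α₁ β₁) ≠ 0 := by
    have : det2 (s.sigma α₂ β₁ - s.sigma α₁ β₁) (s.sigma α₁ β₂ - s.sigma α₁ β₁) =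
        (α₂ - α₁) * (β₂ - β₁) * s.density α₁ β₁ := by
      rw [← s.det2_lin]
      simp only [s.sigma_eq, det2]
      simp
      ring
    rw [this]
    exact (mul_pos (mul_pos (sub_pos.2 h.lt.1) (sub_pos.2 h.lt.2)) hρ).ne'
  obtain ⟨φ, hφ⟩ := exists_affineEquiv hdet hdet' a (s.sigma α₁ β₁)
  refine ⟨⟨s, α₁, α₂, β₁, β₂, h, φ⟩, ?_⟩
  have h0 := hφ 0 0
  have h1 := hφ 1 0
  have h2 := hφ p q
  have h3 := hφ 0 1
  rw [← hc] at h2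
  simp only [zero_smul, one_smul, add_zero, add_sub_cancel] at h0 h1 h3
  have e2 : s.sigma α₁ β₁ + p • (s.sigma α₂ β₁ - s.sigma α₁ β₁) +
      q • (s.sigma α₁ β₂ - s.sigma α₁ β₁) = s.sigma α₂ β₂ := by
    apply plane_ext <;> refine mul_left_cancel₀ hρ.ne' ?_ <;>
      cases s <;> simp [Shape.sigma, Shape.density] at hp hq ⊢ <;> grind
  rw [e2] at h2
  change (φ : Plane →ᵃ[ℝ] Plane) '' _ = _
  rw [AffineMap.image_convexHull, s.sigma_image_eq_convexHull h]
  congr 1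
  simp only [Set.image_insert_eq, Set.image_singleton, AffineEquiv.coe_coe, h0, h1, h2, h3]

/-- A parallelogram is a product, a trapezoid with p = 1 < q is of Calabi type, and p < 1 < q is
orthotoric. The rectangles are normalised to have Jacobian 1 at the first corner, so in the last two
cases α₂ = q, and in the orthotoric case 1 - β₂ = p. -/
theorem exists_separatingChart_of_le {a b c d : Plane} {p q : ℝ} (hdet : det2 (b - a) (d - a) ≠ 0)
    (hc : c = a + p • (b - a) + q • (d - a)) (hp : 0 < p) (hpq : (p = 1 ∧ 1 ≤ q) ∨ (p < 1 ∧ 1 < q)) :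
    ∃ N : SeparatingChart, N.toAffine '' convexHull ℝ {a, b, c, d} =
      {p | ∃ x ∈ Set.Icc N.α₁ N.α₂, ∃ y ∈ Set.Icc N.β₁ N.β₂, p = N.shape.sigma x y} := by
  rcases hpq with ⟨rfl, hq⟩ | ⟨hp1, hq⟩
  · rcases hq.eq_or_lt with rfl | hq
    · exact exists_separatingChart_of_shape hdet hc .product (α₁ := 0) (α₂ := 1) (β₁ := 0) (β₂ := 1)
        ⟨one_pos, one_pos⟩ (one_mul _) (one_mul _)
    · exact exists_separatingChart_of_shape hdet hc .calabi (α₁ := 1) (α₂ := q) (β₁ := 0) (β₂ := 1)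
        ⟨hq, one_pos, one_pos, le_rfl⟩ (one_mul _) (mul_one _)
  · exact exists_separatingChart_of_shape hdet hc .orthotoric (α₁ := 1) (α₂ := q) (β₁ := 0)
      (β₂ := 1 - p) ⟨hq, by linarith, by linarith⟩ (by simp [Shape.density])
      (by simp [Shape.density])

theorem exists_separatingChart_of_le_or {a b c d : Plane} {p q : ℝ} (hdet : det2 (b - a) (d - a) ≠ 0)
    (hc : c = a + p • (b - a) + q • (d - a)) (hp : 0 < p) (hq : 0 < q)
    (hpq : (p = 1 ∧ 1 ≤ q) ∨ (p < 1 ∧ 1 < q) ∨ (q = 1 ∧ 1 ≤ p) ∨ (q < 1 ∧ 1 < p)) :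
    ∃ N : SeparatingChart, N.toAffine '' convexHull ℝ {a, b, c, d} =
      {p | ∃ x ∈ Set.Icc N.α₁ N.α₂, ∃ y ∈ Set.Icc N.β₁ N.β₂, p = N.shape.sigma x y} := by
  have hswap : ({a, b, c, d} : Set Plane) = {a, d, c, b} := by
    ext z; simp only [Set.mem_insert_iff, Set.mem_singleton_iff]; tauto
  have hdet' : det2 (d - a) (b - a) ≠ 0 := fun h0 => hdet (by simp only [det2] at *; linarith)
  have hc' : c = a + q • (d - a) + p • (b - a) := by rw [hc]; module
  rcases hpq with h | h | h | h
  · exact exists_separatingChart_of_le hdet hc hp (Or.inl h)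
  · exact exists_separatingChart_of_le hdet hc hp (Or.inr h)
  · rw [hswap]; exact exists_separatingChart_of_le hdet' hc' hq (Or.inl h)
  · rw [hswap]; exact exists_separatingChart_of_le hdet' hc' hq (Or.inr h)

/-- Moving the base vertex from a to b replaces (p, q) by (1/q, (p + q - 1)/q). This settles the
remaining cases: both below 1, both above 1, and p = 1 > q. The excluded case q = 1 > p becomes the
last of these when b and d are exchanged. -/
theorem exists_separatingChart_of_ne {a b c d : Plane} {p q : ℝ} (hdet : det2 (b - a) (d - a) ≠ 0)
    (hc : c = a + p • (b - a) + q • (d - a)) (hp : 0 < p) (hq : 0 < q) (hpq : 1 < p + q)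
    (hne : q = 1 → 1 ≤ p) :
    ∃ N : SeparatingChart, N.toAffine '' convexHull ℝ {a, b, c, d} =
      {p | ∃ x ∈ Set.Icc N.α₁ N.α₂, ∃ y ∈ Set.Icc N.β₁ N.β₂, p = N.shape.sigma x y} := by
  by_cases h : (p = 1 ∧ 1 ≤ q) ∨ (p < 1 ∧ 1 < q) ∨ (q = 1 ∧ 1 ≤ p) ∨ (q < 1 ∧ 1 < p)
  · exact exists_separatingChart_of_le_or hdet hc hp hq h
  have hrot : ({a, b, c, d} : Set Plane) = {b, c, d, a} := by
    ext z; simp only [Set.mem_insert_iff, Set.mem_singleton_iff]; tauto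
  have hdet' : det2 (c - b) (a - b) ≠ 0 := by
    have : det2 (c - b) (a - b) = q * det2 (b - a) (d - a) := by
      rw [hc]; simp [det2]; ring
    rw [this]
    exact mul_ne_zero hq.ne' hdet
  have hd : d = b + q⁻¹ • (c - b) + ((p + q - 1) / q) • (a - b) := by
    have e : d = q⁻¹ • (c - a - p • (b - a)) + a := by
      rw [hc, show a + p • (b - a) + q • (d - a) - a - p • (b - a) = q • (d - a) by module,
        smul_smul, inv_mul_cancel₀ hq.ne']
      module
    have e2 : (p + q - 1) / q = q⁻¹ * p + 1 - q⁻¹ := by field_simp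
    rw [e2]
    nth_rewrite 1 [e]
    module
  rw [hrot]
  refine exists_separatingChart_of_le_or hdet' hd (by positivity) (div_pos (by linarith) hq) ?_
  rcases lt_trichotomy q 1 with h1 | h1 | h1
  · rcases lt_trichotomy p 1 with h2 | h2 | h2
    · refine Or.inr (Or.inr (Or.inr ⟨?_, (one_lt_inv₀ hq).2 h1⟩))
      rw [div_lt_one hq]; linarith
    · exact Or.inr (Or.inr (Or.inl ⟨by rw [h2]; field_simp; ring, ((one_lt_inv₀ hq).2 h1).le⟩))
    · exact absurd (Or.inr (Or.inr (Or.inr ⟨h1, h2⟩))) h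
  · exact absurd (Or.inr (Or.inr (Or.inl ⟨h1, hne h1⟩))) h
  · rcases lt_trichotomy p 1 with h2 | h2 | h2
    · exact absurd (Or.inr (Or.inl ⟨h2, h1⟩)) h
    · exact absurd (Or.inl ⟨h2, h1.le⟩) h
    · refine Or.inr (Or.inl ⟨(inv_lt_one₀ hq).2 h1, ?_⟩)
      rw [lt_div_iff₀ hq]; linarith

/-- Every convex quadrilateral, given by a vertex, two edges and the coordinates of the opposite
vertex, is the image of an admissible rectangle in separating coordinates. -/
theorem exists_separatingChart {a b c d : Plane} {p q : ℝ} (hdet : det2 (b - a) (d - a) ≠ 0)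
    (hc : c = a + p • (b - a) + q • (d - a)) (hp : 0 < p) (hq : 0 < q) (hpq : 1 < p + q) :
    ∃ N : SeparatingChart, N.toAffine '' convexHull ℝ {a, b, c, d} =
      {p | ∃ x ∈ Set.Icc N.α₁ N.α₂, ∃ y ∈ Set.Icc N.β₁ N.β₂, p = N.shape.sigma x y} := by
  by_cases h : q = 1 → 1 ≤ p
  · exact exists_separatingChart_of_ne hdet hc hp hq hpq h
  · have hswap : ({a, b, c, d} : Set Plane) = {a, d, c, b} := by
      ext z; simp only [Set.mem_insert_iff, Set.mem_singleton_iff]; tauto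
    have hdet' : det2 (d - a) (b - a) ≠ 0 := fun h0 => hdet (by simp only [det2] at *; linarith)
    have hc' : c = a + q • (d - a) + p • (b - a) := by rw [hc]; module
    rw [hswap]
    exact exists_separatingChart_of_ne hdet' hc' hq hp (by linarith)
      fun _ => by push Not at h; exact h.1.ge

namespace LabeledQuadrilateral

/-- The conditions q > 0, p > 0 and p + q > 1 on the coordinates of the vertex opposite to the base
express inwardness of the normals 0, 3 and 1. -/
theorem exists_represents (Q : LabeledQuadrilateral) : ∃ N : SeparatingChart, N.Represents Q := by
  set e := Q.vertex 1 - Q.vertex 0 with he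
  set e' := Q.vertex 3 - Q.vertex 0 with he'
  have o0 : inner ℝ (Q.normal 0) e = 0 := Q.normal_orthogonal 0
  have i03 : 0 < inner ℝ (Q.normal 0) e' := Q.normal_inward 0 3 (by decide) (by decide)
  have i02 := Q.normal_inward 0 2 (by decide) (by decide)
  have o3 : inner ℝ (Q.normal 3) e' = 0 := by
    have : inner ℝ (Q.normal 3) (Q.vertex 0 - Q.vertex 3) = 0 := Q.normal_orthogonal 3
    rw [← neg_sub, inner_neg_right, neg_eq_zero] at this
    exact this
  have i31 : 0 < inner ℝ (Q.normal 3) e := by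
    have := Q.normal_inward 3 1 (by decide) (by decide)
    rwa [show Q.vertex 1 - Q.vertex 3 = e - e' by simp [he, he'], inner_sub_right, o3,
      sub_zero] at this
  have hdet : det2 e e' ≠ 0 := by
    intro h0
    have : inner ℝ (Q.normal 0) e' * inner ℝ (Q.normal 3) e = 0 := by
      have : inner ℝ (Q.normal 0) e' * inner ℝ (Q.normal 3) e =
          inner ℝ (Q.normal 0) e * inner ℝ (Q.normal 3) e' -
            det2 (Q.normal 0) (Q.normal 3) * det2 e e' := by
        simp only [inner_eq, det2]; ring
      rw [this, o0, h0]; ring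
    exact (mul_pos i03 i31).ne' this
  obtain ⟨p, q, hpq⟩ : ∃ p q : ℝ, Q.vertex 2 - Q.vertex 0 = p • e + q • e' :=
    ⟨_, _, exists_combination hdet _⟩
  have hq : 0 < q := by
    rw [hpq, inner_add_right, inner_smul_right, inner_smul_right, o0, mul_zero, zero_add] at i02
    exact pos_of_mul_pos_left i02 i03.le
  have hp : 0 < p := by
    have := Q.normal_inward 3 2 (by decide) (by decide)
    rw [show Q.vertex 2 - Q.vertex 3 = p • e + (q - 1) • e' by
      rw [← sub_add_sub_cancel _ (Q.vertex 0), hpq, he']; module, inner_add_right,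
      inner_smul_right, inner_smul_right, o3, mul_zero, add_zero] at this
    exact pos_of_mul_pos_left this i31.le
  have hsum : 1 < p + q := by
    have o1 : inner ℝ (Q.normal 1) (Q.vertex 2 - Q.vertex 1) = 0 := Q.normal_orthogonal 1
    have i10 := Q.normal_inward 1 0 (by decide) (by decide)
    have i13 := Q.normal_inward 1 3 (by decide) (by decide)
    rw [show Q.vertex 2 - Q.vertex 1 = (p - 1) • e + q • e' by
      rw [← sub_add_sub_cancel _ (Q.vertex 0), hpq, he]; module, inner_add_right,
      inner_smul_right, inner_smul_right] at o1
    rw [← neg_sub, ← he, inner_neg_right] at i10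
    rw [show Q.vertex 3 - Q.vertex 1 = e' - e by simp [he, he'], inner_sub_right] at i13
    nlinarith [mul_pos hq i13]
  obtain ⟨N, hN⟩ := exists_separatingChart hdet
    (show Q.vertex 2 = Q.vertex 0 + p • e + q • e' by rw [add_assoc, ← hpq]; simp) hp hq hsum
  refine ⟨N, ?_⟩
  rw [SeparatingChart.Represents, ← hN, polytope]
  congr 2
  ext z
  simp only [Set.mem_range, Fin.exists_fin_succ, Set.mem_insert_iff, Set.mem_singleton_iff]
  simp [eq_comm]

end LabeledQuadrilateral

end ToricQuad

end

/-! ### The theorem -/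

theorem theorem1 (Q : ToricQuad.LabeledQuadrilateral) (hQ : Q.IsEquipoised Q.extremalAffine) :
    (∃ N : ToricQuad.SeparatingChart, N.Represents Q) ∧
    ∀ N : ToricQuad.SeparatingChart, N.Represents Q →
      ∃ A B : Polynomial ℝ, A.natDegree ≤ 4 ∧ B.natDegree ≤ 4 ∧
        Q.IsSmoothSymm (N.matrixH A B) ∧
        Q.BoundaryConditions (N.matrixH A B) ∧
        Q.ExtremalEquation (N.matrixH A B) ∧
        (Q.IsRelativelyKStable ↔
          ∃ G, Q.IsExtremalPotential G ∧ Q.IsInverseHessian (N.matrixH A B) G) ∧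
        ((∃ G, Q.IsExtremalPotential G ∧ Q.IsInverseHessian (N.matrixH A B) G) ↔
          Q.IsPosDef (N.matrixH A B)) ∧
        (Q.IsPosDef (N.matrixH A B) ↔
          (∀ x ∈ Set.Ioo N.α₁ N.α₂, 0 < A.eval x) ∧ ∀ y ∈ Set.Ioo N.β₁ N.β₂, 0 < B.eval y) ∧
        (∀ G, Q.IsExtremalPotential G → Q.IsInverseHessian (N.matrixH A B) G ∧
          ∀ G', Q.IsExtremalPotential G' ↔
            ∃ a : ToricQuad.Plane →ᵃ[ℝ] ℝ, ∀ p ∈ interior Q.polytope, G' p = G p + a p) := by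
  refine ⟨Q.exists_represents, fun N hN => ?_⟩
  -- All statements are proved for the renumbered quadrilateral `Q'`, whose vertices are the corners
  -- of the chart, and carried back along `SameAs`.
  obtain ⟨Q', h, C, h₁, h₂, h₃, h₄, hH⟩ := N.exists_bilinearChart hN
  have hQ' : Q'.IsEquipoised Q'.extremalAffine := by
    rw [h.extremalAffine_eq]
    exact (h.equipoised_iff _).2 hQ
  obtain ⟨A, B, hA, hB, hAB⟩ := C.exists_solves hQ'
  have smooth := C.isSmoothSymm_matH A B
  have bdry := C.boundaryConditions_matH hAB
  have eqn := C.extremalEquation_matH hAB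
  have stable := C.isRelativelyKStable_iff hAB
  have exis := C.exists_isExtremalPotential_iff hAB
  have pos := C.isPosDef_matH_iff A B
  have uniq := fun G hG => And.intro
    (C.isInverseHessian_of_isExtremalPotential hAB (G := G) hG)
    (C.isExtremalPotential_iff_exists_affine hAB hG)
  refine ⟨A, B, hA, hB, ?_⟩
  rw [hH, ← h₁, ← h₂, ← h₃, ← h₄]
  simp only [ToricQuad.LabeledQuadrilateral.IsSmoothSymm,
    ToricQuad.LabeledQuadrilateral.ExtremalEquation, ToricQuad.LabeledQuadrilateral.IsPosDef,
    ToricQuad.LabeledQuadrilateral.IsInverseHessian, h.polytope_eq, h.extremalAffine_eq,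
    h.extremalPotential_iff, h.kStable_iff, h.boundaryConditions_iff] at *
  exact ⟨smooth, bdry, eqn, stable.trans exis.symm, exis.trans pos.symm, pos, uniq⟩
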